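/- Let $\mathcal A$ be the Hopf $*$-algebra of polynomial functions on a compact matrix quantum group $G$ (coproduct $a\mapsto\sum a^{(1)}\otimes a^{(2)}$, antipode $\kappa$), $\Gamma$ a bicovariant first-order $*$-calculus over $G$, $\Gamma^\wedge$ its universal differential envelope, $\Gamma^\wedge_{inv}$ the left-invariant part of $\Gamma^\wedge$, $\pi(a)=\sum\kappa(a^{(1)})\,da^{(2)}$ and $\Gamma_{inv}=\pi(\mathcal A)$. Let $P=(\mathcal B,i,F)$ be a quantum principal $G$-bundle over a quantum space $M$ (a free coaction $F:\mathcal B\to\mathcal B\otimes\mathcal A$ whose invariants are the functions on $M$), and let $\Omega(P)$ be a graded-differential $*$-algebra with $\Omega^0(P)=\mathcal B$, generated by $\mathcal B$ as a differential algebra, such that $F$ extends to a homomorphism $\widehat F:\Omega(P)\to\Omega(P)\,\widehat\otimes\,\Gamma^\wedge$ of graded-differential $*$-algebras. Put $F^\wedge=(\mathrm{id}\otimes p_*)\widehat F$, where $p_*:\Gamma^\wedge\to\mathcal A$ is the projection, $\mathrm{hor}(P)=\widehat F^{-1}(\Omega(P)\otimes\mathcal A)$, $\Omega(M)=\{w:\widehat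 F(w)=w\otimes1\}$ and $$\mathfrak h_M=\{\varphi\in\mathrm{hor}(P):(\mathrm{id}\otimes\pi)F^\wedge(\varphi)=0\}.$$ For $k\in\mathbb Z$ let $\Omega_k(P)=\widehat F^{-1}\bigl(\Omega(P)\otimes\bigoplus_{i\le k}\Gamma^{\wedge i}\bigr)$ be the forms of vertical order at most $k$; then $d\Omega_k(P)\subseteq\Omega_{k+1}(P)$. Let $E_r^{p,q}(P)$ be the associated spectral sequence ($q$ the vertical order, $p+q$ the total degree): $E_r^{p,q}=Z_r^q/B_r^q$ in total degree $p+q$, with $Z_r^k=\{x\in\Omega_k(P):dx\in\Omega_{k+1-r}(P)\}$, $B_r^k=Z_{r-1}^{k-1}+\Omega_k(P)\cap d\,\Omega_{k+r-2}(P)$, and $d_r:E_r^{p,q}\to E_r^{p+r,q+1-r}$ induced by $d$. Let $\mathrm{vh}(P)=\mathrm{hor}(P)\otimes\Gamma^\wedge_{inv}$, bigraded by the degrees of the two factors, with product and differential $$(\psi\otimes\eta)(\varphi\otimes\vartheta)=(-1)^{\partial\eta\,\partial\varphi}\sum_k\psi\varphi_k\otimes(\eta\circ c_k)\vartheta,\qquad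 d_{vh}(\varphi\otimes\vartheta)=(-1)^{\partial\varphi}\Bigl(\sum_k\varphi_k\otimes\pi(c_k)\vartheta+\varphi\otimes d\vartheta\Bigr),$$ where $F^\wedge(\varphi)=\sum_k\varphi_k\otimes c_k$ and $\eta\circ c=\sum\kappa(c^{(1)})\,\eta\,c^{(2)}$, and let $H_{vh}(P)$ be its cohomology. A connection is a hermitian linear map $\omega:\Gamma_{inv}\to\Omega^1(P)$ with $\widehat F\omega\pi(a)=\sum\omega\pi(a^{(2)})\otimes\kappa(a^{(1)})a^{(3)}+1\otimes\pi(a)$ for all $a\in\mathcal A$. Then connections exist, $\mathfrak h_M$ is closed under $d$, and the following hold. 1. There is an isomorphism of bigraded differential algebras between $\mathrm{vh}(P)$ and the graded algebra $\bigoplus_k\Omega_k(P)/\Omega_{k-1}(P)$ associated with the filtration, given, for every connection $\omega$, by $\varphi\otimes\vartheta_1\cdots\vartheta_q\leftrightarrow[\varphi\,\omega(\vartheta_1)\cdots\omega(\vartheta_q)]$ (for $\varphi\in\mathrm{hor}(P)$, $\vartheta_i\in\Gamma_{inv}$). It induces $E_1^{p,q}(P)\cong H^{p,q}_{vh}(P)$.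 2. The map $\varphi\otimes[\vartheta]\mapsto[\varphi\otimes\vartheta]$ is an isomorphism $\mathfrak h_M^p\otimes H^q(\Gamma^\wedge_{inv})\cong H_{vh}^{p,q}(P)$. 3. Under these identifications $d_1(\varphi\otimes c)=d\varphi\otimes c$ for $\varphi\in\mathfrak h_M^p$ and $c\in H^q(\Gamma^\wedge_{inv})$. 4. Hence $E_2^{p,q}(P)\cong H^p(\mathfrak h_M)\otimes H^q(\Gamma^\wedge_{inv})$: for a closed $\varphi\in\mathfrak h_M^p$ and $c\in H^q(\Gamma^\wedge_{inv})$, the element $[\varphi]\otimes c$ corresponds to the class in $E_2$ of a form $w\in Z_2^q$ whose class in $E_1$ is $\varphi\otimes c$. 5. If $G$ is connected, i.e. $da=0$ with $a\in\mathcal A$ only for $a\in\mathbb C1$, then $\mathfrak h_M=\Omega(M)$, the inclusion $\Gamma^\wedge_{inv}\subseteq\Gamma^\wedge$ induces an isomorphism $H(\Gamma^\wedge_{inv})\cong H(G):=H(\Gamma^\wedge)$, and the isomorphism of 4 becomes $E_2^{p,q}(P)\cong H^p(M)\otimes H^q(G)$, where $H(M)=H(\Omega(M))$. -/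

import Mathlib

open scoped TensorProduct

set_option linter.unusedSectionVars false

noncomputable section

namespace QPB

universe uA uG uV uB uW

/-! ### Compact matrix quantum groups -/

/-- A Hopf `*`-algebra `A` (polynomial functions on a compact matrix quantum group): the coproduct
is compatible with `*`, and `A` is generated, as an algebra, by the matrix elements of one
finite-dimensional unitary representation `u`. -/
structure IsCompactMatrixQuantumGroup (A : Type uA) [Ring A] [StarRing A] [HopfAlgebra ℂ A]
    [StarModule ℂ A] : Prop where
  comul_star : ∀ a : A, Coalgebra.comul (R := ℂ) (star a) = star (Coalgebra.comul (R := ℂ) a)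
  counit_star : ∀ a : A, Coalgebra.counit (R := ℂ) (star a) = star (Coalgebra.counit (R := ℂ) a)
  exists_fundamental : ∃ (n : ℕ) (u : Matrix (Fin n) (Fin n) A),
    (∀ i j, Coalgebra.comul (R := ℂ) (u i j) = ∑ k, u i k ⊗ₜ[ℂ] u k j) ∧
    u.conjTranspose * u = 1 ∧ u * u.conjTranspose = 1 ∧
    Algebra.adjoin ℂ {a : A | ∃ i j, u i j = a} = ⊤

/-! ### Bicovariant first order `*`-calculi -/

section Calculus

variable (A : Type uA) [Ring A] [StarRing A] [HopfAlgebra ℂ A]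
variable (Γ : Type uG) [AddCommGroup Γ] [Module ℂ Γ] [Module A Γ] [Module Aᵐᵒᵖ Γ]
  [IsScalarTower ℂ A Γ] [IsScalarTower ℂ Aᵐᵒᵖ Γ] [SMulCommClass A Aᵐᵒᵖ Γ]

variable {A Γ} in
/-- `a ⊗ b ↦ a db`. -/
def formMap (d : A →ₗ[ℂ] Γ) : A ⊗[ℂ] A →ₗ[ℂ] Γ :=
  TensorProduct.lift (LinearMap.mk₂ ℂ (fun a b => a • d b)
    (fun _ _ _ => add_smul _ _ _) (fun _ _ _ => smul_assoc _ _ _)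
    (fun _ _ _ => by rw [map_add, smul_add])
    (fun c a b => by rw [map_smul, ← algebraMap_smul A c (d b), ← algebraMap_smul A c (a • d b),
      smul_smul, smul_smul, Algebra.commutes]))

/-- `a ⊗ b ↦ ∑ a⁽¹⁾ b⁽¹⁾ ⊗ (a⁽²⁾ ⊗ b⁽²⁾)`. -/
def leftTwist : A ⊗[ℂ] A →ₗ[ℂ] A ⊗[ℂ] (A ⊗[ℂ] A) :=
  TensorProduct.map (LinearMap.mul' ℂ A) LinearMap.id ∘ₗ
    (TensorProduct.tensorTensorTensorComm ℂ A A A A).toLinearMap ∘ₗ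
    TensorProduct.map Coalgebra.comul Coalgebra.comul

/-- `a ⊗ b ↦ ∑ (a⁽¹⁾ ⊗ b⁽¹⁾) ⊗ a⁽²⁾ b⁽²⁾`. -/
def rightTwist : A ⊗[ℂ] A →ₗ[ℂ] (A ⊗[ℂ] A) ⊗[ℂ] A :=
  TensorProduct.map LinearMap.id (LinearMap.mul' ℂ A) ∘ₗ
    (TensorProduct.tensorTensorTensorComm ℂ A A A A).toLinearMap ∘ₗ
    TensorProduct.map Coalgebra.comul Coalgebra.comul

/-- A bicovariant first order `*`-calculus over `A`, with space of one-forms the `A`-bimodule `Γ`: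
whenever `∑ aₖ dbₖ = 0`, also `∑ aₖ⁽¹⁾ bₖ⁽¹⁾ ⊗ aₖ⁽²⁾ dbₖ⁽²⁾ = 0` (left covariance),
`∑ aₖ⁽¹⁾ dbₖ⁽¹⁾ ⊗ aₖ⁽²⁾ bₖ⁽²⁾ = 0` (right covariance) and `∑ d(bₖ*) aₖ* = 0` (so that `*`
descends to `Γ`). -/
structure BicovariantStarCalculus where
  /-- The differential. -/
  d : A →ₗ[ℂ] Γ
  leibniz : ∀ a b : A, d (a * b) = a • d b + MulOpposite.op b • d a
  span_eq_top : LinearMap.range (formMap d) = ⊤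
  left_covariant : ∀ x : A ⊗[ℂ] A, formMap d x = 0 →
    TensorProduct.map LinearMap.id (formMap d) (leftTwist A x) = 0
  right_covariant : ∀ x : A ⊗[ℂ] A, formMap d x = 0 →
    TensorProduct.map (formMap d) LinearMap.id (rightTwist A x) = 0
  star_covariant : ∀ (n : ℕ) (a b : Fin n → A), ∑ i, a i • d (b i) = 0 →
    ∑ i, MulOpposite.op (star (a i)) • d (star (b i)) = 0

end Calculus

namespace BicovariantStarCalculus

variable {A : Type uA} [Ring A] [StarRing A] [HopfAlgebra ℂ A]
variable {Γ : Type uG} [AddCommGroup Γ] [Module ℂ Γ] [Module A Γ] [Module Aᵐᵒᵖ Γ]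
  [IsScalarTower ℂ A Γ] [IsScalarTower ℂ Aᵐᵒᵖ Γ] [SMulCommClass A Aᵐᵒᵖ Γ]
variable (C : BicovariantStarCalculus A Γ)

/-! ### The universal differential envelope `Γ^∧` -/

/-- The defining relations of the universal differential envelope, on free generators
`a` (`Sum.inl a`) and `db` (`Sum.inr b`): `A` is a subalgebra, `d` is a derivation,
`∑ aₖ dbₖ = 0` if this holds in `Γ`, and `∑ daₖ dbₖ = 0` if `∑ aₖ dbₖ = 0` in `Γ`. -/
inductive Rel : FreeAlgebra ℂ (A ⊕ A) → FreeAlgebra ℂ (A ⊕ A) → Prop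
  | add (a b : A) : Rel (FreeAlgebra.ι ℂ (Sum.inl (a + b)))
      (FreeAlgebra.ι ℂ (Sum.inl a) + FreeAlgebra.ι ℂ (Sum.inl b))
  | scalar (c : ℂ) : Rel (FreeAlgebra.ι ℂ (Sum.inl (algebraMap ℂ A c)))
      (algebraMap ℂ (FreeAlgebra ℂ (A ⊕ A)) c)
  | mul (a b : A) : Rel (FreeAlgebra.ι ℂ (Sum.inl (a * b)))
      (FreeAlgebra.ι ℂ (Sum.inl a) * FreeAlgebra.ι ℂ (Sum.inl b))
  | leibniz (a b : A) : Rel (FreeAlgebra.ι ℂ (Sum.inr (a * b)))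
      (FreeAlgebra.ι ℂ (Sum.inl a) * FreeAlgebra.ι ℂ (Sum.inr b) +
        FreeAlgebra.ι ℂ (Sum.inr a) * FreeAlgebra.ι ℂ (Sum.inl b))
  | form (n : ℕ) (a b : Fin n → A) (h : ∑ i, a i • C.d (b i) = 0) :
      Rel (∑ i, FreeAlgebra.ι ℂ (Sum.inl (a i)) * FreeAlgebra.ι ℂ (Sum.inr (b i))) 0
  | dform (n : ℕ) (a b : Fin n → A) (h : ∑ i, a i • C.d (b i) = 0) :
      Rel (∑ i, FreeAlgebra.ι ℂ (Sum.inr (a i)) * FreeAlgebra.ι ℂ (Sum.inr (b i))) 0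

/-- The universal differential envelope `Γ^∧` of the calculus. -/
def Envelope : Type uA := RingQuot C.Rel

instance : Ring C.Envelope := inferInstanceAs (Ring (RingQuot C.Rel))

instance : Algebra ℂ C.Envelope := inferInstanceAs (Algebra ℂ (RingQuot C.Rel))

/-- The quotient map onto `Γ^∧`. -/
def quot : FreeAlgebra ℂ (A ⊕ A) →ₐ[ℂ] C.Envelope := RingQuot.mkAlgHom ℂ C.Rel

theorem quot_rel {x y : FreeAlgebra ℂ (A ⊕ A)} (h : C.Rel x y) : C.quot x = C.quot y :=
  RingQuot.mkAlgHom_rel ℂ h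

/-- The image in `Γ^∧` of a free generator. -/
def gen (s : A ⊕ A) : C.Envelope := C.quot (FreeAlgebra.ι ℂ s)

section lift

variable {X : Type*} [Ring X] [Algebra ℂ X]

/-- Compatibility of a pair of maps `A → X` with the relations of `Γ^∧`. -/
structure Compatible (f g : A → X) : Prop where
  add : ∀ a b, f (a + b) = f a + f b
  scalar : ∀ c : ℂ, f (algebraMap ℂ A c) = algebraMap ℂ X c
  mul : ∀ a b, f (a * b) = f a * f b
  leibniz : ∀ a b, g (a * b) = f a * g b + g a * f b
  form : ∀ (n : ℕ) (a b : Fin n → A), ∑ i, a i • C.d (b i) = 0 → ∑ i, f (a i) * g (b i) = 0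
  dform : ∀ (n : ℕ) (a b : Fin n → A), ∑ i, a i • C.d (b i) = 0 → ∑ i, g (a i) * g (b i) = 0

theorem lift_rel (f g : A → X) (h : C.Compatible f g) ⦃x y : FreeAlgebra ℂ (A ⊕ A)⦄
    (hxy : C.Rel x y) : FreeAlgebra.lift ℂ (Sum.elim f g) x =
      FreeAlgebra.lift ℂ (Sum.elim f g) y := by
  induction hxy with
  | add a b => simp [h.add]
  | scalar c => simp [h.scalar]
  | mul a b => simp [h.mul]
  | leibniz a b => simp [h.leibniz]
  | form n a b hab => simpa using h.form n a b hab
  | dform n a b hab => simpa using h.dform n a b hab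

/-- The algebra homomorphism out of `Γ^∧` with prescribed values on `a` and `db`. -/
def liftHom (f g : A → X) (h : C.Compatible f g) : C.Envelope →ₐ[ℂ] X :=
  RingQuot.liftAlgHom ℂ ⟨FreeAlgebra.lift ℂ (Sum.elim f g), C.lift_rel f g h⟩

theorem liftHom_gen (f g : A → X) (h : C.Compatible f g) (s : A ⊕ A) :
    C.liftHom f g h (C.gen s) = Sum.elim f g s := by
  have := RingQuot.liftAlgHom_mkAlgHom_apply (S := ℂ) (s := C.Rel)
    (FreeAlgebra.lift ℂ (Sum.elim f g)) (C.lift_rel f g h) (FreeAlgebra.ι ℂ s)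
  rw [FreeAlgebra.lift_ι_apply] at this
  exact this

theorem hom_ext {f g : C.Envelope →ₐ[ℂ] X} (h : ∀ s, f (C.gen s) = g (C.gen s)) : f = g := by
  apply RingQuot.ringQuot_ext'
  ext s
  exact h s

end lift

theorem compatible_gen :
    C.Compatible (fun a => C.gen (Sum.inl a)) (fun b => C.gen (Sum.inr b)) where
  add a b := by simpa [gen] using C.quot_rel (Rel.add (C := C) a b)
  scalar c := by
    have := C.quot_rel (Rel.scalar (C := C) c)
    rw [AlgHom.commutes] at this
    exact this
  mul a b := by simpa [gen] using C.quot_rel (Rel.mul (C := C) a b)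
  leibniz a b := by simpa [gen] using C.quot_rel (Rel.leibniz (C := C) a b)
  form n a b h := by simpa [gen] using C.quot_rel (Rel.form (C := C) n a b h)
  dform n a b h := by simpa [gen] using C.quot_rel (Rel.dform (C := C) n a b h)

/-- The inclusion `A → Γ^∧`. -/
def ofA : A →ₐ[ℂ] C.Envelope where
  toFun a := C.gen (Sum.inl a)
  map_add' := C.compatible_gen.add
  map_mul' := C.compatible_gen.mul
  map_zero' := by simpa using C.compatible_gen.scalar 0
  map_one' := by simpa using C.compatible_gen.scalar 1
  commutes' := C.compatible_gen.scalar

theorem gen_inl_neg_mul (a : A) (x : C.Envelope) :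
    C.gen (Sum.inl (-a)) * x = -(C.gen (Sum.inl a) * x) := by
  rw [← neg_mul]
  congr 1
  exact map_neg C.ofA a

theorem gen_inl_one_mul (x : C.Envelope) : C.gen (Sum.inl 1) * x = x := by
  have h2 : C.gen (Sum.inl 1) = 1 := map_one C.ofA
  rw [h2, one_mul]

/-- The differential `A → Γ ⊆ Γ^∧`. -/
def dA : A →ₗ[ℂ] C.Envelope where
  toFun b := C.gen (Sum.inr b)
  map_add' x y := by
    have h := C.compatible_gen.form 3 ![1, -1, -1] ![x + y, x, y]
      (by simp [Fin.sum_univ_three])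
    rw [Fin.sum_univ_three] at h
    change C.gen (Sum.inl 1) * C.gen (Sum.inr (x + y)) +
      C.gen (Sum.inl (-1)) * C.gen (Sum.inr x) + C.gen (Sum.inl (-1)) * C.gen (Sum.inr y) = 0 at h
    simp only [gen_inl_neg_mul, gen_inl_one_mul] at h
    rw [← sub_eq_zero, ← h]
    abel
  map_smul' c x := by
    have h := C.compatible_gen.form 2 ![1, -(algebraMap ℂ A c)] ![c • x, x]
      (by simp [Fin.sum_univ_two])
    rw [Fin.sum_univ_two] at h
    change C.gen (Sum.inl 1) * C.gen (Sum.inr (c • x)) +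
      C.gen (Sum.inl (-(algebraMap ℂ A c))) * C.gen (Sum.inr x) = 0 at h
    have h1 : C.gen (Sum.inl (algebraMap ℂ A c)) = algebraMap ℂ C.Envelope c := C.ofA.commutes c
    simp only [gen_inl_neg_mul, gen_inl_one_mul, h1] at h
    rw [← sub_eq_add_neg, sub_eq_zero, ← Algebra.smul_def] at h
    exact h

theorem dA_mul (a b : A) : C.dA (a * b) = C.ofA a * C.dA b + C.dA a * C.ofA b :=
  C.compatible_gen.leibniz a b

/-! Upper triangular matrices `(γ(x), d(x); 0, x)`, where `γ` is the grading involution, turn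
the differential of `Γ^∧` into an algebra homomorphism. -/

/-- The matrix `(x, y; 0, z)`. -/
def tri (x y z : C.Envelope) : Matrix (Fin 2) (Fin 2) C.Envelope := !![x, y; 0, z]

theorem tri_mul (x y z x' y' z' : C.Envelope) :
    C.tri x y z * C.tri x' y' z' = C.tri (x * x') (x * y' + y * z') (z * z') := by
  simp only [tri, Matrix.mul_fin_two, mul_zero, zero_mul, add_zero, zero_add]

theorem tri_add (x y z x' y' z' : C.Envelope) :
    C.tri x y z + C.tri x' y' z' = C.tri (x + x') (y + y') (z + z') := by
  ext i j
  fin_cases i <;> fin_cases j <;> simp [tri]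

theorem tri_zero : C.tri 0 0 0 = 0 := by
  ext i j
  fin_cases i <;> fin_cases j <;> rfl

theorem tri_sum {n : ℕ} (x y z : Fin n → C.Envelope) :
    ∑ i, C.tri (x i) (y i) (z i) = C.tri (∑ i, x i) (∑ i, y i) (∑ i, z i) := by
  induction n with
  | zero => simp [tri_zero]
  | succ n ih => simp only [Fin.sum_univ_succ, ih, tri_add]

theorem compatible_tri : C.Compatible
    (fun a => C.tri (C.ofA a) (C.dA a) (C.ofA a)) (fun b => C.tri (-C.dA b) 0 (C.dA b)) where
  add a b := by simp only [tri_add, map_add]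
  scalar c := by
    have h1 : C.dA (algebraMap ℂ A c) = 0 := by
      have h2 : C.dA 1 = 0 := by
        have := C.dA_mul 1 1
        rw [mul_one, map_one C.ofA, one_mul, mul_one] at this
        exact left_eq_add.1 this
      rw [Algebra.algebraMap_eq_smul_one, map_smul, h2, smul_zero]
    rw [h1, AlgHom.commutes]
    ext i j
    fin_cases i <;> fin_cases j <;> simp [tri, Matrix.algebraMap_matrix_apply]
  mul a b := by simp only [tri_mul, map_mul, C.dA_mul]
  leibniz a b := by
    simp only [tri_mul, tri_add, C.dA_mul]
    congr 1
    · rw [neg_add, mul_neg, neg_mul]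
    · rw [mul_zero, zero_add, zero_mul, add_zero, neg_mul, add_neg_cancel]
  form n a b h := by
    have h1 : ∑ i, C.ofA (a i) * C.dA (b i) = 0 := C.compatible_gen.form n a b h
    have h2 : ∑ i, C.dA (a i) * C.dA (b i) = 0 := C.compatible_gen.dform n a b h
    simp only [tri_mul, tri_sum, mul_neg, mul_zero, zero_add, Finset.sum_neg_distrib, h1, h2,
      neg_zero, tri_zero]
  dform n a b h := by
    have h2 : ∑ i, C.dA (a i) * C.dA (b i) = 0 := C.compatible_gen.dform n a b h
    simp only [tri_mul, tri_sum, neg_mul_neg, mul_zero, zero_mul, zero_add,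
      Finset.sum_const_zero, h2, tri_zero]

/-- The differential of `Γ^∧`. -/
def dΓ : C.Envelope →ₗ[ℂ] C.Envelope where
  toFun x := C.liftHom _ _ C.compatible_tri x 0 1
  map_add' x y := by simp
  map_smul' c x := by simp

theorem dΓ_ofA (a : A) : C.dΓ (C.ofA a) = C.dA a := by
  change C.liftHom _ _ C.compatible_tri (C.gen (Sum.inl a)) 0 1 = _
  rw [liftHom_gen]; rfl

theorem dΓ_dA (a : A) : C.dΓ (C.dA a) = 0 := by
  change C.liftHom _ _ C.compatible_tri (C.gen (Sum.inr a)) 0 1 = _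
  rw [liftHom_gen]; rfl

/-- The degree `n` part of `Γ^∧`: the span of the forms `a₀ da₁ ⋯ daₙ`. -/
def deg (n : ℕ) : Submodule ℂ C.Envelope :=
  LinearMap.range C.ofA.toLinearMap * LinearMap.range C.dA ^ n

theorem ofA_mem (a : A) : C.ofA a ∈ C.deg 0 := by
  rw [deg, pow_zero, mul_one]; exact ⟨a, rfl⟩

theorem dA_mem (a : A) : C.dA a ∈ C.deg 1 := by
  rw [deg, pow_one, ← one_mul (C.dA a)]
  exact Submodule.mul_mem_mul ⟨1, map_one C.ofA⟩ ⟨a, rfl⟩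

theorem range_ofA_mul : LinearMap.range C.ofA.toLinearMap * LinearMap.range C.ofA.toLinearMap =
    LinearMap.range C.ofA.toLinearMap := by
  apply le_antisymm
  · rw [Submodule.mul_le]
    rintro _ ⟨a, rfl⟩ _ ⟨b, rfl⟩
    exact ⟨a * b, map_mul C.ofA a b⟩
  · rintro _ ⟨a, rfl⟩
    rw [← one_mul (C.ofA.toLinearMap a)]
    exact Submodule.mul_mem_mul ⟨1, map_one C.ofA⟩ ⟨a, rfl⟩

theorem range_dA_pow_mul (n : ℕ) :
    LinearMap.range C.dA ^ n * LinearMap.range C.ofA.toLinearMap ≤ C.deg n := by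
  induction n with
  | zero => simp [deg]
  | succ n ih =>
    rw [pow_succ, mul_assoc]
    have h : LinearMap.range C.dA * LinearMap.range C.ofA.toLinearMap ≤
        LinearMap.range C.ofA.toLinearMap * LinearMap.range C.dA := by
      rw [Submodule.mul_le]
      rintro _ ⟨a, rfl⟩ _ ⟨b, rfl⟩
      have : C.dA a * C.ofA b = C.ofA 1 * C.dA (a * b) - C.ofA a * C.dA b := by
        rw [C.dA_mul, map_one, one_mul]; abel
      change C.dA a * C.ofA b ∈ _
      rw [this]
      exact sub_mem (Submodule.mul_mem_mul ⟨1, rfl⟩ ⟨_, rfl⟩)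
        (Submodule.mul_mem_mul ⟨a, rfl⟩ ⟨_, rfl⟩)
    calc _ ≤ LinearMap.range C.dA ^ n *
          (LinearMap.range C.ofA.toLinearMap * LinearMap.range C.dA) := by gcongr
      _ = LinearMap.range C.dA ^ n * LinearMap.range C.ofA.toLinearMap *
          LinearMap.range C.dA := by rw [mul_assoc]
      _ ≤ C.deg n * LinearMap.range C.dA := by gcongr
      _ = C.deg (n + 1) := by rw [deg, deg, mul_assoc, pow_succ]

instance gradedMonoid : SetLike.GradedMonoid C.deg where
  one_mem := by simpa using C.ofA_mem 1
  mul_mem i j x y hx hy := by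
    have : C.deg i * C.deg j ≤ C.deg (i + j) := by
      calc C.deg i * C.deg j = LinearMap.range C.ofA.toLinearMap *
            (LinearMap.range C.dA ^ i * LinearMap.range C.ofA.toLinearMap) *
            LinearMap.range C.dA ^ j := by simp only [deg, mul_assoc]
        _ ≤ LinearMap.range C.ofA.toLinearMap * C.deg i * LinearMap.range C.dA ^ j := by
            gcongr; exact C.range_dA_pow_mul i
        _ = C.deg (i + j) := by
            rw [deg, ← mul_assoc, C.range_ofA_mul, mul_assoc, ← pow_add, deg]
    exact this (Submodule.mul_mem_mul hx hy)

theorem sum_of_mul_of {n i j : ℕ} (x y : Fin n → C.Envelope) (hx : ∀ k, x k ∈ C.deg i)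
    (hy : ∀ k, y k ∈ C.deg j) (h : ∑ k, x k * y k = 0) :
    ∑ k, DirectSum.of (fun i => C.deg i) i ⟨x k, hx k⟩ *
      DirectSum.of (fun i => C.deg i) j ⟨y k, hy k⟩ = 0 := by
  have h1 : ∀ k, DirectSum.of (fun i => C.deg i) i ⟨x k, hx k⟩ *
      DirectSum.of (fun i => C.deg i) j ⟨y k, hy k⟩ =
      DirectSum.of (fun i => C.deg i) (i + j)
        ⟨x k * y k, SetLike.mul_mem_graded (hx k) (hy k)⟩ := fun k => by
    rw [DirectSum.of_mul_of]; rfl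
  simp only [h1]
  rw [← map_sum]
  have h2 : ∑ k, (⟨x k * y k, SetLike.mul_mem_graded (hx k) (hy k)⟩ : C.deg (i + j)) = 0 := by
    ext
    rw [AddSubmonoidClass.coe_finsetSum]
    exact h
  rw [h2, map_zero]

theorem compatible_grading : C.Compatible
    (fun a => DirectSum.of (fun i => C.deg i) 0 ⟨C.ofA a, C.ofA_mem a⟩)
    (fun b => DirectSum.of (fun i => C.deg i) 1 ⟨C.dA b, C.dA_mem b⟩) where
  add a b := by
    rw [← map_add]; congr 1; ext; simp
  scalar c := by
    rw [DirectSum.algebraMap_apply]; congr 1; ext; exact C.ofA.commutes c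
  mul a b := by
    rw [DirectSum.of_mul_of]
    exact DirectSum.of_eq_of_gradedMonoid_eq (Sigma.subtype_ext (zero_add 0).symm (map_mul _ _ _))
  leibniz a b := by
    rw [DirectSum.of_mul_of, DirectSum.of_mul_of]
    change _ = DirectSum.of (fun i => C.deg i) 1 _ + DirectSum.of (fun i => C.deg i) 1 _
    rw [← map_add]; congr 1; ext; exact C.dA_mul a b
  form n a b h := C.sum_of_mul_of _ _ _ _ (C.compatible_gen.form n a b h)
  dform n a b h := C.sum_of_mul_of _ _ _ _ (C.compatible_gen.dform n a b h)

/-- The decomposition of `Γ^∧` into homogeneous components. -/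
def gradingHom : C.Envelope →ₐ[ℂ] DirectSum ℕ fun i => C.deg i :=
  C.liftHom _ _ C.compatible_grading

theorem gradingHom_mem (n : ℕ) (x : C.Envelope) (hx : x ∈ C.deg n) :
    C.gradingHom x = DirectSum.of (fun i => C.deg i) n ⟨x, hx⟩ := by
  have hmul : ∀ (i j : ℕ) (x y : C.Envelope),
      (∃ h : x ∈ C.deg i, C.gradingHom x = DirectSum.of (fun i => C.deg i) i ⟨x, h⟩) →
      (∃ h : y ∈ C.deg j, C.gradingHom y = DirectSum.of (fun i => C.deg i) j ⟨y, h⟩) →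
      ∃ h : x * y ∈ C.deg (i + j),
        C.gradingHom (x * y) = DirectSum.of (fun i => C.deg i) (i + j) ⟨x * y, h⟩ := by
    rintro i j x y ⟨h, hx⟩ ⟨h', hy⟩
    refine ⟨SetLike.mul_mem_graded h h', ?_⟩
    rw [map_mul, hx, hy, DirectSum.of_mul_of]
    rfl
  have hadd : ∀ (i : ℕ) (x y : C.Envelope),
      (∃ h : x ∈ C.deg i, C.gradingHom x = DirectSum.of (fun i => C.deg i) i ⟨x, h⟩) →
      (∃ h : y ∈ C.deg i, C.gradingHom y = DirectSum.of (fun i => C.deg i) i ⟨y, h⟩) →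
      ∃ h : x + y ∈ C.deg i,
        C.gradingHom (x + y) = DirectSum.of (fun i => C.deg i) i ⟨x + y, h⟩ := by
    rintro i x y ⟨h, hx⟩ ⟨h', hy⟩
    refine ⟨add_mem h h', ?_⟩
    rw [map_add, hx, hy, ← map_add]
    rfl
  have h0 : ∀ a : A, ∃ h : C.ofA a ∈ C.deg 0,
      C.gradingHom (C.ofA a) = DirectSum.of (fun i => C.deg i) 0 ⟨C.ofA a, h⟩ := fun a =>
    ⟨C.ofA_mem a, C.liftHom_gen _ _ C.compatible_grading (Sum.inl a)⟩
  have h1 : ∀ a : A, ∃ h : C.dA a ∈ C.deg 1,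
      C.gradingHom (C.dA a) = DirectSum.of (fun i => C.deg i) 1 ⟨C.dA a, h⟩ := fun a =>
    ⟨C.dA_mem a, C.liftHom_gen _ _ C.compatible_grading (Sum.inr a)⟩
  have hpow : ∀ (n : ℕ) (x : C.Envelope), x ∈ LinearMap.range C.dA ^ n →
      ∃ h : x ∈ C.deg n, C.gradingHom x = DirectSum.of (fun i => C.deg i) n ⟨x, h⟩ := by
    intro n
    induction n with
    | zero =>
      intro x hx
      rw [pow_zero] at hx
      obtain ⟨c, rfl⟩ := Submodule.mem_one.1 hx
      simpa using h0 (algebraMap ℂ A c)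
    | succ n ih =>
      intro x hx
      rw [pow_succ] at hx
      induction hx using Submodule.mul_induction_on' with
      | mem_mul_mem y hy z hz =>
        obtain ⟨a, rfl⟩ := hz
        exact hmul n 1 _ _ (ih y hy) (h1 a)
      | add y _ z _ hy hz => exact hadd _ _ _ hy hz
  suffices h : ∃ h : x ∈ C.deg n,
      C.gradingHom x = DirectSum.of (fun i => C.deg i) n ⟨x, h⟩ from h.2
  rw [deg] at hx
  induction hx using Submodule.mul_induction_on' with
  | mem_mul_mem y hy z hz =>
    obtain ⟨a, rfl⟩ := hy
    have := hmul 0 n _ _ (h0 a) (hpow n z hz)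
    rwa [zero_add] at this
  | add y _ z _ hy hz => exact hadd _ _ _ hy hz

instance gradedAlgebra : GradedAlgebra C.deg :=
  GradedAlgebra.ofAlgHom _ C.gradingHom
    (by
      apply C.hom_ext
      intro s
      rw [AlgHom.comp_apply, gradingHom, liftHom_gen]
      cases s with
      | inl a => simp only [Sum.elim_inl, DirectSum.coeAlgHom_of]; rfl
      | inr a => simp only [Sum.elim_inr, DirectSum.coeAlgHom_of]; rfl)
    (fun i x => C.gradingHom_mem i x x.2)

/-- The projection `p_* : Γ^∧ → A`, identical on `A` and zero on forms of positive degree. -/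
def pA : C.Envelope →ₐ[ℂ] A :=
  C.liftHom (fun a => a) (fun _ => 0)
    { add := fun _ _ => rfl
      scalar := fun _ => rfl
      mul := fun _ _ => rfl
      leibniz := by simp
      form := by simp
      dform := by simp }

theorem exists_factor (T : A ⊗[ℂ] A →ₗ[ℂ] C.Envelope)
    (hT : ∀ (n : ℕ) (a b : Fin n → A), ∑ i, a i • C.d (b i) = 0 →
      ∑ i, T (a i ⊗ₜ b i) = 0) :
    ∃ g : Γ →ₗ[ℂ] C.Envelope, T = g ∘ₗ formMap C.d := by
  obtain ⟨s, hs⟩ := LinearMap.exists_rightInverse_of_surjective _ C.span_eq_top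
  refine ⟨T ∘ₗ s, ?_⟩
  have hker : ∀ x, formMap C.d x = 0 → T x = 0 := by
    intro x hx
    have hex : ∃ (n : ℕ) (a b : Fin n → A), x = ∑ i, a i ⊗ₜ[ℂ] b i := by
      clear hx
      induction x with
      | zero => exact ⟨0, 0, 0, by simp⟩
      | tmul a b => exact ⟨1, fun _ => a, fun _ => b, by simp⟩
      | add x y hx hy =>
        obtain ⟨n, a, b, rfl⟩ := hx
        obtain ⟨m, a', b', rfl⟩ := hy
        exact ⟨n + m, Fin.append a a', Fin.append b b', by simp [Fin.sum_univ_add]⟩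
    obtain ⟨n, a, b, rfl⟩ := hex
    rw [map_sum]
    apply hT
    simpa [formMap] using hx
  ext1
  ext a b
  have := hker (a ⊗ₜ b - s (formMap C.d (a ⊗ₜ b))) (by
    rw [map_sub, ← LinearMap.comp_apply, hs, LinearMap.id_apply, sub_self])
  simpa [sub_eq_zero] using this

theorem leftTwist_tmul_mul (T : A ⊗[ℂ] A →ₗ[ℂ] C.Envelope) (f g : A →ₗ[ℂ] C.Envelope)
    (hT : ∀ a b, T (a ⊗ₜ b) = f a * g b) (a b : A) :
    TensorProduct.map LinearMap.id f (Coalgebra.comul (R := ℂ) a) *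
      TensorProduct.map LinearMap.id g (Coalgebra.comul (R := ℂ) b) =
    TensorProduct.map LinearMap.id T (leftTwist A (a ⊗ₜ b)) := by
  simp only [leftTwist, LinearMap.comp_apply, TensorProduct.map_tmul]
  induction Coalgebra.comul (R := ℂ) a with
  | zero => simp
  | add x y hx hy => simp only [map_add, add_mul, TensorProduct.add_tmul, hx, hy]
  | tmul a1 a2 =>
    induction Coalgebra.comul (R := ℂ) b with
    | zero => simp
    | add x y hx hy => simp only [map_add, mul_add, TensorProduct.tmul_add, hx, hy]
    | tmul b1 b2 => simp [hT]

theorem leftTwist_zero (f g : A →ₗ[ℂ] C.Envelope)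
    (hfg : ∀ (n : ℕ) (a b : Fin n → A), ∑ i, a i • C.d (b i) = 0 →
      ∑ i, f (a i) * g (b i) = 0)
    (n : ℕ) (a b : Fin n → A) (h : ∑ i, a i • C.d (b i) = 0) :
    ∑ i, TensorProduct.map LinearMap.id f (Coalgebra.comul (R := ℂ) (a i)) *
      TensorProduct.map LinearMap.id g (Coalgebra.comul (R := ℂ) (b i)) = 0 := by
  set T : A ⊗[ℂ] A →ₗ[ℂ] C.Envelope := LinearMap.mul' ℂ C.Envelope ∘ₗ TensorProduct.map f g
  have hT : ∀ a b, T (a ⊗ₜ b) = f a * g b := fun a b => by simp [T]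
  obtain ⟨G, hG⟩ := C.exists_factor T (fun n a b h => by simpa [hT] using hfg n a b h)
  simp only [C.leftTwist_tmul_mul T f g hT]
  rw [← map_sum, ← map_sum, hG,
    show TensorProduct.map (LinearMap.id : A →ₗ[ℂ] A) (G ∘ₗ formMap C.d) =
      TensorProduct.map LinearMap.id G ∘ₗ TensorProduct.map LinearMap.id (formMap C.d) by
      rw [← TensorProduct.map_comp, LinearMap.id_comp],
    LinearMap.comp_apply, C.left_covariant _ (by simpa [formMap] using h), map_zero]

/-- The left action `ℓ^∧ : Γ^∧ → A ⊗ Γ^∧` of the quantum group on `Γ^∧`: the homomorphism with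
`a ↦ ∑ a⁽¹⁾ ⊗ a⁽²⁾` and `da ↦ ∑ a⁽¹⁾ ⊗ da⁽²⁾`. -/
def leftCoaction : C.Envelope →ₐ[ℂ] A ⊗[ℂ] C.Envelope :=
  C.liftHom
    (fun a => TensorProduct.map LinearMap.id C.ofA.toLinearMap (Coalgebra.comul (R := ℂ) a))
    (fun b => TensorProduct.map LinearMap.id C.dA (Coalgebra.comul (R := ℂ) b))
    { add := by simp
      scalar := fun c => by
        rw [Bialgebra.comul_algebraMap, Algebra.TensorProduct.algebraMap_apply,
          TensorProduct.map_tmul]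
        simp [Algebra.TensorProduct.algebraMap_apply]
      mul := fun a b => by
        rw [Bialgebra.comul_mul]
        exact map_mul (Algebra.TensorProduct.map (AlgHom.id ℂ A) C.ofA) _ _
      leibniz := fun a b => by
        rw [Bialgebra.comul_mul]
        induction Coalgebra.comul (R := ℂ) a with
        | zero => simp
        | add x y hx hy => simp only [add_mul, map_add, hx, hy]; abel
        | tmul a1 a2 =>
          induction Coalgebra.comul (R := ℂ) b with
          | zero => simp
          | add x y hx hy => simp only [mul_add, map_add, hx, hy]; abel
          | tmul b1 b2 => simp [C.dA_mul, TensorProduct.tmul_add]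
      form := C.leftTwist_zero _ _ C.compatible_gen.form
      dform := C.leftTwist_zero _ _ C.compatible_gen.dform }

/-- The left-invariant forms `Γ^∧_inv`. -/
def inv : Submodule ℂ C.Envelope :=
  LinearMap.eqLocus C.leftCoaction.toLinearMap (TensorProduct.mk ℂ A C.Envelope 1)

/-- Left-invariant forms of degree `q`. -/
def invDeg (q : ℕ) : Submodule ℂ C.Envelope := C.inv ⊓ C.deg q

/-- `π(a) = ∑ κ(a⁽¹⁾) da⁽²⁾`. -/
def π : A →ₗ[ℂ] C.Envelope :=
  LinearMap.mul' ℂ C.Envelope ∘ₗ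
    TensorProduct.map (C.ofA.toLinearMap ∘ₗ HopfAlgebra.antipode ℂ) C.dA ∘ₗ Coalgebra.comul

/-- The adjoint coaction `ad(a) = ∑ a⁽²⁾ ⊗ κ(a⁽¹⁾) a⁽³⁾`. -/
def ad (A : Type uA) [Ring A] [HopfAlgebra ℂ A] : A →ₗ[ℂ] A ⊗[ℂ] A :=
  TensorProduct.map LinearMap.id (LinearMap.mul' ℂ A) ∘ₗ
    (TensorProduct.leftComm ℂ A A A).toLinearMap ∘ₗ
    TensorProduct.map (HopfAlgebra.antipode ℂ) Coalgebra.comul ∘ₗ Coalgebra.comul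

/-- `η ⊗ c ↦ η ∘ c = ∑ κ(c⁽¹⁾) η c⁽²⁾`. -/
def circ : C.Envelope ⊗[ℂ] A →ₗ[ℂ] C.Envelope :=
  LinearMap.mul' ℂ C.Envelope ∘ₗ
    TensorProduct.map (C.ofA.toLinearMap ∘ₗ HopfAlgebra.antipode ℂ)
      (LinearMap.mul' ℂ C.Envelope ∘ₗ TensorProduct.map LinearMap.id C.ofA.toLinearMap) ∘ₗ
    (TensorProduct.leftComm ℂ C.Envelope A A).toLinearMap ∘ₗ
    TensorProduct.map LinearMap.id Coalgebra.comul

end BicovariantStarCalculus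

/-! ### Cohomology and spectral sequences -/

section Cohomology

variable {X : Type*} [AddCommGroup X] [Module ℂ X]

/-- Cohomology `(L ∩ ker d) / (L ∩ d(K))` of a subcomplex `K` in the degree whose homogeneous
part is `L ≤ K`. -/
abbrev Coh (d : X →ₗ[ℂ] X) (K L : Submodule ℂ X) : Type _ :=
  ↥(L ⊓ LinearMap.ker d) ⧸ (K.map d).submoduleOf (L ⊓ LinearMap.ker d)

/-- The cohomology class of a cocycle. -/
abbrev Coh.mk (d : X →ₗ[ℂ] X) (K L : Submodule ℂ X) :
    ↥(L ⊓ LinearMap.ker d) →ₗ[ℂ] Coh d K L :=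
  Submodule.mkQ _

variable (d : X →ₗ[ℂ] X) (𝒲 : ℕ → Submodule ℂ X) (Fil : ℤ → Submodule ℂ X)

/-- `Z_r` in filtration level `k` and total degree `n`, for an increasing filtration with
`d Fil_k ⊆ Fil_{k+1}`: the forms `x ∈ Fil_k` with `dx ∈ Fil_{k+1-r}`. -/
def Zr (r k : ℤ) (n : ℕ) : Submodule ℂ X := 𝒲 n ⊓ Fil k ⊓ (Fil (k + 1 - r)).comap d

/-- `B_r = Z_{r-1}(k-1) + Fil_k ∩ d(Fil_{k+r-2})` in total degree `n`. -/
def Br (r k : ℤ) (n : ℕ) : Submodule ℂ X :=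
  Zr d 𝒲 Fil (r - 1) (k - 1) n ⊔ 𝒲 n ⊓ Fil k ⊓ (Fil (k + r - 2)).map d

/-- The term `E_r` of the spectral sequence, in filtration level `k` and total degree `n`. -/
abbrev Er (r k : ℤ) (n : ℕ) : Type _ :=
  ↥(Zr d 𝒲 Fil r k n) ⧸ (Br d 𝒲 Fil r k n).submoduleOf (Zr d 𝒲 Fil r k n)

/-- The class in `E_r` of an element of `Z_r`. -/
abbrev Er.mk (r k : ℤ) (n : ℕ) : ↥(Zr d 𝒲 Fil r k n) →ₗ[ℂ] Er d 𝒲 Fil r k n :=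
  Submodule.mkQ _

/-- The associated graded space `Fil_k / Fil_{k-1}` in total degree `n`. -/
abbrev Gr (k : ℤ) (n : ℕ) : Type _ :=
  ↥(𝒲 n ⊓ Fil k) ⧸ (Fil (k - 1)).submoduleOf (𝒲 n ⊓ Fil k)

/-- The symbol of an element of `Fil_k`. -/
abbrev Gr.mk (k : ℤ) (n : ℕ) : ↥(𝒲 n ⊓ Fil k) →ₗ[ℂ] Gr 𝒲 Fil k n :=
  Submodule.mkQ _

variable {d 𝒲 Fil}

/-- The differential `d_r : E_r(k, n) → E_r(k + 1 - r, n + 1)`, induced by `d`. -/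
def dr (hd : ∀ x, d (d x) = 0) (hdeg : ∀ n, ∀ x ∈ 𝒲 n, d x ∈ 𝒲 (n + 1))
    {r k k' : ℤ} {n n' : ℕ} (hk : k' = k + 1 - r) (hn : n' = n + 1) :
    Er d 𝒲 Fil r k n →ₗ[ℂ] Er d 𝒲 Fil r k' n' :=
  Submodule.mapQ _ _
    (d.restrict (p := Zr d 𝒲 Fil r k n) (q := Zr d 𝒲 Fil r k' n') (by
      subst hk hn
      intro x hx
      obtain ⟨⟨h1, _⟩, h3⟩ := hx
      refine ⟨⟨hdeg n x h1, h3⟩, ?_⟩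
      simp [hd]))
    (by
      subst hk hn
      intro x hx
      have hx' : (x : X) ∈ Br d 𝒲 Fil r k n := hx
      change d (x : X) ∈ Br d 𝒲 Fil r (k + 1 - r) (n + 1)
      obtain ⟨y, hy, z, ⟨_, w, _, rfl⟩, hyz⟩ := Submodule.mem_sup.1 hx'
      rw [← hyz, map_add, hd, add_zero]
      obtain ⟨⟨h1, h2⟩, h3⟩ := hy
      refine Submodule.mem_sup_right ⟨⟨hdeg n y h1, ?_⟩, y, ?_, rfl⟩
      · have h3' : d y ∈ Fil (k - 1 + 1 - (r - 1)) := h3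
        rwa [show k - 1 + 1 - (r - 1) = k + 1 - r by ring] at h3'
      · have h2' : y ∈ Fil (k - 1) := h2
        rwa [show k - 1 = k + 1 - r + r - 2 by ring] at h2')

/-- The subspace of `X ⊗ Y` spanned by `x ⊗ y` with `x ∈ U`, `y ∈ W`. -/
def tens {Y : Type*} [AddCommGroup Y] [Module ℂ Y] (U : Submodule ℂ X) (W : Submodule ℂ Y) :
    Submodule ℂ (X ⊗[ℂ] Y) :=
  LinearMap.range (TensorProduct.map U.subtype W.subtype)

end Cohomology

/-- The linear map acting as `(-1)^n` on elements of degree `n`. -/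
def gradeInvolution {X : Type*} [Ring X] [Algebra ℂ X] (𝒜 : ℕ → Submodule ℂ X) [GradedAlgebra 𝒜] :
    X →ₗ[ℂ] X :=
  DirectSum.toModule ℂ ℕ X (fun i => ((-1 : ℂ) ^ i) • (𝒜 i).subtype) ∘ₗ
    (DirectSum.decomposeLinearEquiv 𝒜).toLinearMap

/-! ### Quantum principal bundles and their differential calculi -/

/-- A quantum principal bundle `P = (B, i, F)` over the quantum space `M` represented by `V`:
`i` identifies `V` with the `F`-invariant elements of `B`, `F` is a coaction, and the action is
free, i.e. `q ⊗ b ↦ q F(b)` is onto `B ⊗ A`. -/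
structure QuantumPrincipalBundle (V : Type uV) (B : Type uB) (A : Type uA)
    [Ring V] [StarRing V] [Algebra ℂ V] [StarModule ℂ V]
    [Ring B] [StarRing B] [Algebra ℂ B] [StarModule ℂ B]
    [Ring A] [StarRing A] [HopfAlgebra ℂ A] [StarModule ℂ A] where
  /-- The dualized projection. -/
  i : V →⋆ₐ[ℂ] B
  /-- The dualized right action. -/
  F : B →⋆ₐ[ℂ] B ⊗[ℂ] A
  i_injective : Function.Injective i
  mem_range_i : ∀ b : B, b ∈ Set.range i ↔ F b = b ⊗ₜ[ℂ] 1
  coassoc : ∀ b : B, TensorProduct.assoc ℂ B A A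
      (TensorProduct.map F.toAlgHom.toLinearMap LinearMap.id (F b)) =
    TensorProduct.map LinearMap.id Coalgebra.comul (F b)
  counit : ∀ b : B, TensorProduct.map LinearMap.id (Coalgebra.counit (R := ℂ)) (F b) =
    b ⊗ₜ[ℂ] (1 : ℂ)
  free : ∀ x : B ⊗[ℂ] A, x ∈ Submodule.span ℂ {y | ∃ q b : B, y = (q ⊗ₜ[ℂ] (1 : A)) * F b}

/-- A graded-differential `*`-algebra `Ω = Ω(P)` (with grading `𝒲`) representing the calculus on
the bundle `P`: `Ω⁰(P) = B`, `B` generates `Ω(P)` as a differential algebra, and `F` extends to a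
homomorphism `F̂ : Ω(P) → Ω(P) ⊗̂ Γ^∧` of differential algebras. (It is then automatically unique
and compatible with gradings and `*`-structures.) -/
structure BundleCalculus {V : Type uV} {B : Type uB} {A : Type uA}
    [Ring V] [StarRing V] [Algebra ℂ V] [StarModule ℂ V]
    [Ring B] [StarRing B] [Algebra ℂ B] [StarModule ℂ B]
    [Ring A] [StarRing A] [HopfAlgebra ℂ A] [StarModule ℂ A]
    {Γ : Type uG} [AddCommGroup Γ] [Module ℂ Γ] [Module A Γ] [Module Aᵐᵒᵖ Γ]
    [IsScalarTower ℂ A Γ] [IsScalarTower ℂ Aᵐᵒᵖ Γ] [SMulCommClass A Aᵐᵒᵖ Γ]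
    (P : QuantumPrincipalBundle V B A) (C : BicovariantStarCalculus A Γ)
    (Ω : Type uW) [Ring Ω] [Algebra ℂ Ω] (𝒲 : ℕ → Submodule ℂ Ω) [GradedAlgebra 𝒲] where
  /-- The differential. -/
  d : Ω →ₗ[ℂ] Ω
  d_mem : ∀ n, ∀ w ∈ 𝒲 n, d w ∈ 𝒲 (n + 1)
  d_mul : ∀ n, ∀ w ∈ 𝒲 n, ∀ w', d (w * w') = d w * w' + ((-1 : ℂ) ^ n) • (w * d w')
  d_d : ∀ w, d (d w) = 0
  /-- The `*`-structure (graded-antimultiplicative). -/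
  conj : Ω →ₛₗ[starRingEnd ℂ] Ω
  conj_conj : ∀ w, conj (conj w) = w
  conj_mem : ∀ n, ∀ w ∈ 𝒲 n, conj w ∈ 𝒲 n
  conj_mul : ∀ m n, ∀ w ∈ 𝒲 m, ∀ w' ∈ 𝒲 n,
    conj (w * w') = ((-1 : ℂ) ^ (m * n)) • (conj w' * conj w)
  conj_d : ∀ w, conj (d w) = d (conj w)
  /-- The identification of `B` with `Ω⁰(P)`. -/
  j : B →ₐ[ℂ] Ω
  j_injective : Function.Injective j
  range_j : LinearMap.range j.toLinearMap = 𝒲 0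
  conj_j : ∀ b, conj (j b) = j (star b)
  generates : Algebra.adjoin ℂ (Set.range j ∪ Set.range fun b => d (j b)) = ⊤
  /-- The pull back `F̂` of the right action. -/
  Fhat : Ω →ₐ[ℂ] 𝒲 ᵍ⊗[ℂ] C.deg
  Fhat_j : ∀ b, Fhat (j b) = GradedTensorProduct.of ℂ 𝒲 C.deg
    (TensorProduct.map j.toLinearMap C.ofA.toLinearMap (P.F b))
  Fhat_d : ∀ w, (GradedTensorProduct.of ℂ 𝒲 C.deg).symm (Fhat (d w)) =
    (TensorProduct.map d LinearMap.id + TensorProduct.map (gradeInvolution 𝒲) C.dΓ :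
        Ω ⊗[ℂ] C.Envelope →ₗ[ℂ] Ω ⊗[ℂ] C.Envelope)
      ((GradedTensorProduct.of ℂ 𝒲 C.deg).symm (Fhat w))

namespace BundleCalculus

variable {V : Type uV} {B : Type uB} {A : Type uA}
    [Ring V] [StarRing V] [Algebra ℂ V] [StarModule ℂ V]
    [Ring B] [StarRing B] [Algebra ℂ B] [StarModule ℂ B]
    [Ring A] [StarRing A] [HopfAlgebra ℂ A] [StarModule ℂ A]
    {Γ : Type uG} [AddCommGroup Γ] [Module ℂ Γ] [Module A Γ] [Module Aᵐᵒᵖ Γ]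
    [IsScalarTower ℂ A Γ] [IsScalarTower ℂ Aᵐᵒᵖ Γ] [SMulCommClass A Aᵐᵒᵖ Γ]
    {P : QuantumPrincipalBundle V B A} {C : BicovariantStarCalculus A Γ}
    {Ω : Type uW} [Ring Ω] [Algebra ℂ Ω] {𝒲 : ℕ → Submodule ℂ Ω} [GradedAlgebra 𝒲]
    (S : BundleCalculus P C Ω 𝒲)

/-- `F̂` with values in the underlying vector space `Ω(P) ⊗ Γ^∧`. -/
def Fl : Ω →ₗ[ℂ] Ω ⊗[ℂ] C.Envelope :=
  (GradedTensorProduct.of ℂ 𝒲 C.deg).symm.toLinearMap ∘ₗ S.Fhat.toLinearMap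

/-- The right action `F^∧ = (id ⊗ p_*) F̂ : Ω(P) → Ω(P) ⊗ A`. -/
def FA : Ω →ₗ[ℂ] Ω ⊗[ℂ] A := TensorProduct.map LinearMap.id C.pA.toLinearMap ∘ₗ S.Fl

/-- The forms of vertical order at most `k`: `Ω_k(P) = F̂⁻¹(Ω(P) ⊗ Γ^∧_k)`, where `Γ^∧_k` consists
of the forms of degree at most `k` (zero for negative `k`). -/
def fil (k : ℤ) : Submodule ℂ Ω :=
  (tens ⊤ (⨆ (i : ℕ) (_ : (i : ℤ) ≤ k), C.deg i)).comap S.Fl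

/-- Horizontal forms `hor(P) = F̂⁻¹(Ω(P) ⊗ A)`. -/
def hor : Submodule ℂ Ω := (tens ⊤ (LinearMap.range C.ofA.toLinearMap)).comap S.Fl

/-- Horizontal forms of degree `p`. -/
def horDeg (p : ℕ) : Submodule ℂ Ω := S.hor ⊓ 𝒲 p

/-- Forms on the base: `Ω(M)` consists of the `F̂`-invariant forms. -/
def base : Submodule ℂ Ω :=
  LinearMap.eqLocus S.Fl ((TensorProduct.mk ℂ Ω C.Envelope).flip 1)

/-- Forms on the base of degree `p`. -/
def baseDeg (p : ℕ) : Submodule ℂ Ω := S.base ⊓ 𝒲 p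

/-- `𝔥_M`: the horizontal forms `φ` with `(id ⊗ π) F^∧(φ) = 0`. -/
def hM : Submodule ℂ Ω :=
  S.hor ⊓ LinearMap.ker (TensorProduct.map LinearMap.id C.π ∘ₗ S.FA)

/-- Elements of `𝔥_M` of degree `p`. -/
def hMDeg (p : ℕ) : Submodule ℂ Ω := S.hM ⊓ 𝒲 p

/-- The bidegree `(p, q)` part of `vh(P) = hor(P) ⊗ Γ^∧_inv`, inside `Ω(P) ⊗ Γ^∧`. -/
def vhDeg (p q : ℕ) : Submodule ℂ (Ω ⊗[ℂ] C.Envelope) := tens (S.horDeg p) (C.invDeg q)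

/-- `vh(P) = hor(P) ⊗ Γ^∧_inv`. -/
def vh : Submodule ℂ (Ω ⊗[ℂ] C.Envelope) := tens S.hor C.inv

/-- `d_vh(φ ⊗ ϑ) = (-1)^∂φ ∑ φₖ ⊗ π(cₖ) ϑ + (-1)^∂φ φ ⊗ dϑ`, where `F^∧(φ) = ∑ φₖ ⊗ cₖ`. -/
def dvh : Ω ⊗[ℂ] C.Envelope →ₗ[ℂ] Ω ⊗[ℂ] C.Envelope :=
  TensorProduct.map (gradeInvolution 𝒲) LinearMap.id ∘ₗ
    (TensorProduct.map LinearMap.id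
        (LinearMap.mul' ℂ C.Envelope ∘ₗ TensorProduct.map C.π LinearMap.id) ∘ₗ
      (TensorProduct.assoc ℂ Ω A C.Envelope).toLinearMap ∘ₗ
      TensorProduct.map S.FA LinearMap.id +
    TensorProduct.map LinearMap.id C.dΓ)

/-- The product of `vh(P)` up to the sign `(-1)^(∂η ∂φ)`:
`(ψ ⊗ η) ⊗ (φ ⊗ ϑ) ↦ ∑ ψ φₖ ⊗ (η ∘ cₖ) ϑ`, where `F^∧(φ) = ∑ φₖ ⊗ cₖ`. -/
def vhMul : (Ω ⊗[ℂ] C.Envelope) ⊗[ℂ] (Ω ⊗[ℂ] C.Envelope) →ₗ[ℂ] Ω ⊗[ℂ] C.Envelope :=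
  TensorProduct.map (LinearMap.mul' ℂ Ω)
      (LinearMap.mul' ℂ C.Envelope ∘ₗ TensorProduct.map C.circ LinearMap.id ∘ₗ
        (TensorProduct.assoc ℂ C.Envelope A C.Envelope).symm.toLinearMap) ∘ₗ
    (TensorProduct.tensorTensorTensorComm ℂ Ω C.Envelope Ω (A ⊗[ℂ] C.Envelope)).toLinearMap ∘ₗ
    TensorProduct.map LinearMap.id
      ((TensorProduct.assoc ℂ Ω A C.Envelope).toLinearMap ∘ₗ TensorProduct.map S.FA LinearMap.id)

/-- A connection: a hermitian first order linear map `ω : Γ_inv → Ω(P)`, where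
`Γ_inv = π(A)`, with `F̂ω(ϑ) = ∑ ω(ϑₖ) ⊗ cₖ + 1 ⊗ ϑ` for `ϖ(ϑ) = ∑ ϑₖ ⊗ cₖ`. Here the adjoint
action is given by `ϖ π = (π ⊗ id) ad`, and the `*`-structure by `π(a)* = -π(κ(a)*)`. -/
structure IsConnection (ω : ↥(LinearMap.range C.π) →ₗ[ℂ] Ω) : Prop where
  mem : ∀ ϑ, ω ϑ ∈ 𝒲 1
  hermitian : ∀ a : A, S.conj (ω (C.π.rangeRestrict a)) =
    -ω (C.π.rangeRestrict (star (HopfAlgebra.antipode ℂ a)))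
  pullback : ∀ a : A, S.Fl (ω (C.π.rangeRestrict a)) =
    TensorProduct.map (ω ∘ₗ C.π.rangeRestrict) C.ofA.toLinearMap
      (BicovariantStarCalculus.ad A a) + 1 ⊗ₜ C.π a

/-- The associated graded space of the filtration by vertical order: vertical order `q` and total
degree `p + q`. -/
abbrev gr (p q : ℕ) : Type _ := Gr 𝒲 S.fil q (p + q)

/-- `H_vh(P)` in bidegree `(p, q)`. -/
abbrev Hvh (p q : ℕ) : Type _ := Coh S.dvh S.vh (S.vhDeg p q)

/-- `H^p(𝔥_M)`. -/
abbrev HhM (p : ℕ) : Type _ := Coh S.d S.hM (S.hMDeg p)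

/-- `H^p(M)`. -/
abbrev HM (p : ℕ) : Type _ := Coh S.d S.base (S.baseDeg p)

/-- The spectral sequence `E_r(P)` of the filtration by vertical order, in bidegree `(p, q)`
(vertical order `q` and total degree `p + q`). -/
abbrev E (r p q : ℕ) : Type _ := Er S.d 𝒲 S.fil r q (p + q)

/-- `d₁ : E_1^{p,q} → E_1^{p+1,q}`. -/
def d₁ (p q : ℕ) : S.E 1 p q →ₗ[ℂ] S.E 1 (p + 1) q :=
  dr S.d_d S.d_mem (by push_cast; ring) (by ring)

end BundleCalculus

/-- `H^q(Γ^∧_inv)`. -/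
abbrev Hinv {A : Type uA} [Ring A] [StarRing A] [HopfAlgebra ℂ A]
    {Γ : Type uG} [AddCommGroup Γ] [Module ℂ Γ] [Module A Γ] [Module Aᵐᵒᵖ Γ]
    [IsScalarTower ℂ A Γ] [IsScalarTower ℂ Aᵐᵒᵖ Γ] [SMulCommClass A Aᵐᵒᵖ Γ]
    (C : BicovariantStarCalculus A Γ) (q : ℕ) : Type _ :=
  Coh C.dΓ C.inv (C.invDeg q)

/-- `H^q(G)`, the cohomology of the whole algebra `Γ^∧` of forms on the quantum group. -/
abbrev HG {A : Type uA} [Ring A] [StarRing A] [HopfAlgebra ℂ A]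
    {Γ : Type uG} [AddCommGroup Γ] [Module ℂ Γ] [Module A Γ] [Module Aᵐᵒᵖ Γ]
    [IsScalarTower ℂ A Γ] [IsScalarTower ℂ Aᵐᵒᵖ Γ] [SMulCommClass A Aᵐᵒᵖ Γ]
    (C : BicovariantStarCalculus A Γ) (q : ℕ) : Type _ :=
  Coh C.dΓ ⊤ (C.deg q)

end QPB

end

/-! Everything is read off from symbols. The symbol of `w ∈ Ω_q(P)` is the component of `F̂(w)` of
vertical degree `q` in `Ω(P) ⊗ Γ^∧`. It vanishes exactly when `w ∈ Ω_{q-1}(P)`, and coassociativity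
of `F̂` puts it in the cotensor product of `hor(P)` and `Γ^∧` over `A`: the tensors for which the
right coaction on the first leg equals the left coaction on the second. The map `iota`, `φ ⊗ γ ↦ ∑
φ⁽⁰⁾ ⊗ φ⁽¹⁾γ`, is inverted by means of the antipode and carries `hor(P) ⊗ Γ^∧_inv` onto this
cotensor product. It untwists the product of `vh(P)` and turns `d_vh` into `id ⊗ d` up to sign
(`iota_vhMul`, `iota_dvh`). Every element of the cotensor product of vertical degree `q` is a
symbol, since `φ ω(ϑ₁)⋯ω(ϑ_q)` has symbol `iota (φ ⊗ ϑ₁⋯ϑ_q)` and `Γ^∧_inv` is spanned by products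
of elements of `π(A)` (`invDeg_eq`). This gives the associated graded algebra and `E₁`
(`exists_grEquiv`, `exists_E₁Equiv`).

Connections come from freeness, which makes each `1 ⊗ π(a)` the symbol of a one-form. A linear
choice of such forms is averaged over the adjoint action with the Haar functional and then replaced
by its hermitian part (`exists_isConnection`). The Haar functional is built from unitary matrix
corepresentations by orthogonal projection in spaces of matrix coefficients.

The cohomology of `vh(P)` rests on two further uses of the Haar functional. Averaging projects
tensors onto cotensors and commutes with `id ⊗ d`, so a cotensor that is a boundary is the boundary
of a cotensor (`exists_mem_cot`). Next, a functional `e` on `A` that equals the counit on `ker d`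
acts on `Γ^∧` homotopically to the identity (`exists_homotopy`); it can be chosen so that its
convolution maps `A` into `ker d` (`exists_functional`). On cotensors the action of `e` on `Γ^∧` can
be moved to `hor(P)`, where it maps into `𝔥_M`. So every class has a representative in `𝔥_M ⊗
Γ^∧_inv` (`exists_hM_rep`), and there `d_vh` is `id ⊗ d` up to sign.

For `d₁` and `E₂`, representatives are compared modulo the image `bnd` of `id ⊗ d`. Modulo `bnd` the
differential acts on symbols by `d ⊗ id` (`symb_d_sub_mem_bnd`), so `Z₂` and `B₂` are matched with
cocycles and coboundaries of `𝔥_M` tensored with those of `Γ^∧_inv`. If `ker d = ℂ1`, the Haar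
functional itself is an admissible `e`, which gives the comparison with `H(Γ^∧)`. -/

noncomputable section
namespace QPB

/-! ### Linear algebra of tensor products over a field -/

section LinearAlgebra

variable {X Y X' Y' : Type*} [AddCommGroup X] [Module ℂ X] [AddCommGroup Y] [Module ℂ Y]
  [AddCommGroup X'] [Module ℂ X'] [AddCommGroup Y'] [Module ℂ Y']

/-- Both targets are the quotient of `X` by the common kernel. The isomorphisms below are produced
in this form because it fixes their values on representatives. -/
theorem exists_equiv_of_ker_eq {f : X →ₗ[ℂ] Y} {g : X →ₗ[ℂ] Y'} (hf : Function.Surjective f)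
    (hg : Function.Surjective g) (h : ∀ x, f x = 0 ↔ g x = 0) :
    ∃ e : Y ≃ₗ[ℂ] Y', ∀ x, e (f x) = g x := by
  have hk : LinearMap.ker f = LinearMap.ker g := by ext x; exact h x
  refine ⟨(f.quotKerEquivOfSurjective hf).symm ≪≫ₗ Submodule.quotEquivOfEq _ _ hk ≪≫ₗ
    g.quotKerEquivOfSurjective hg, fun x => ?_⟩
  have h1 : (f.quotKerEquivOfSurjective hf).symm (f x) = Submodule.Quotient.mk x := by
    rw [LinearEquiv.symm_apply_eq]; rfl
  simp only [LinearEquiv.trans_apply, h1]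
  rfl

/-- Over a field every subspace has a complement. The projection turns membership in a subspace of a
tensor product into a fixed-point equation. -/
theorem exists_proj (U : Submodule ℂ X) :
    ∃ p : X →ₗ[ℂ] X, (∀ x, p x ∈ U) ∧ ∀ x ∈ U, p x = x := by
  obtain ⟨g, hg⟩ := LinearMap.exists_leftInverse_of_injective U.subtype U.ker_subtype
  exact ⟨U.subtype ∘ₗ g, fun x => (g x).2, fun x hx =>
    congrArg Subtype.val (LinearMap.congr_fun hg ⟨x, hx⟩)⟩

/-- Contraction of the second tensor factor with a functional. -/
def sliceR (l : Y →ₗ[ℂ] ℂ) : X ⊗[ℂ] Y →ₗ[ℂ] X :=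
  (TensorProduct.rid ℂ X).toLinearMap ∘ₗ TensorProduct.map LinearMap.id l

/-- Contraction of the first tensor factor with a functional. -/
def sliceL (l : X →ₗ[ℂ] ℂ) : X ⊗[ℂ] Y →ₗ[ℂ] Y :=
  (TensorProduct.lid ℂ Y).toLinearMap ∘ₗ TensorProduct.map l LinearMap.id

@[simp] theorem sliceR_tmul (l : Y →ₗ[ℂ] ℂ) (x : X) (y : Y) : sliceR l (x ⊗ₜ[ℂ] y) = l y • x := by
  simp [sliceR]

@[simp] theorem sliceL_tmul (l : X →ₗ[ℂ] ℂ) (x : X) (y : Y) : sliceL l (x ⊗ₜ[ℂ] y) = l x • y := by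
  simp [sliceL]

theorem sliceR_map (l : Y' →ₗ[ℂ] ℂ) (f : X →ₗ[ℂ] X') (g : Y →ₗ[ℂ] Y') (z : X ⊗[ℂ] Y) :
    sliceR l (TensorProduct.map f g z) = f (sliceR (l ∘ₗ g) z) := by
  induction z with
  | zero => simp
  | add x y hx hy => simp only [map_add, hx, hy]
  | tmul x y => simp

theorem sliceL_map (l : X' →ₗ[ℂ] ℂ) (f : X →ₗ[ℂ] X') (g : Y →ₗ[ℂ] Y') (z : X ⊗[ℂ] Y) :
    sliceL l (TensorProduct.map f g z) = g (sliceL (l ∘ₗ f) z) := by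
  induction z with
  | zero => simp
  | add x y hx hy => simp only [map_add, hx, hy]
  | tmul x y => simp

/-- The coordinates of `z` with respect to a basis of `Y` are contractions with coordinate
functionals. -/
theorem eq_zero_of_sliceR {z : X ⊗[ℂ] Y} (h : ∀ l, sliceR l z = 0) : z = 0 := by
  classical
  let b := Module.Basis.ofVectorSpace ℂ Y
  apply (TensorProduct.equivFinsuppOfBasisRight (M := X) b).injective
  rw [map_zero]
  ext i
  have : ∀ z : X ⊗[ℂ] Y, TensorProduct.equivFinsuppOfBasisRight b z i = sliceR (b.coord i) z := by
    intro z
    induction z with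
    | zero => simp
    | add x y hx hy => simp only [map_add, Finsupp.add_apply, hx, hy]
    | tmul x y => simp
  rw [this, h]; rfl

theorem eq_zero_of_sliceL {z : X ⊗[ℂ] Y} (h : ∀ l, sliceL l z = 0) : z = 0 := by
  apply (TensorProduct.comm ℂ X Y).injective
  rw [map_zero]
  apply eq_zero_of_sliceR
  intro l
  rw [← h l]
  clear h
  induction z with
  | zero => simp
  | add x y hx hy => simp only [map_add, hx, hy]
  | tmul x y => simp

theorem tmul_mem_tens {U : Submodule ℂ X} {W : Submodule ℂ Y} {x : X} {y : Y} (hx : x ∈ U)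
    (hy : y ∈ W) : x ⊗ₜ[ℂ] y ∈ tens U W :=
  ⟨(⟨x, hx⟩ : U) ⊗ₜ (⟨y, hy⟩ : W), rfl⟩

theorem map_mem_of_mem_tens {U : Submodule ℂ X} {W : Submodule ℂ Y} {S : Submodule ℂ X'}
    {f : X ⊗[ℂ] Y →ₗ[ℂ] X'} (h : ∀ x ∈ U, ∀ y ∈ W, f (x ⊗ₜ y) ∈ S) {z : X ⊗[ℂ] Y}
    (hz : z ∈ tens U W) : f z ∈ S := by
  obtain ⟨t, rfl⟩ := hz
  induction t with
  | zero => simp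
  | add x y hx hy => rw [map_add, map_add]; exact add_mem hx hy
  | tmul x y => exact h x x.2 y y.2

theorem eqOn_tens {U : Submodule ℂ X} {W : Submodule ℂ Y}
    {f g : X ⊗[ℂ] Y →ₗ[ℂ] X'} (h : ∀ x ∈ U, ∀ y ∈ W, f (x ⊗ₜ y) = g (x ⊗ₜ y)) {z : X ⊗[ℂ] Y}
    (hz : z ∈ tens U W) : f z = g z := by
  have : (f - g) z ∈ (⊥ : Submodule ℂ X') :=
    map_mem_of_mem_tens (fun x hx y hy => by simp [h x hx y hy]) hz
  simpa [sub_eq_zero] using this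

theorem map_mem_tens {U : Submodule ℂ X} {W : Submodule ℂ Y} {U' : Submodule ℂ X'}
    {W' : Submodule ℂ Y'} {f : X →ₗ[ℂ] X'} {g : Y →ₗ[ℂ] Y'} (hf : ∀ x ∈ U, f x ∈ U')
    (hg : ∀ y ∈ W, g y ∈ W') {z : X ⊗[ℂ] Y} (hz : z ∈ tens U W) :
    TensorProduct.map f g z ∈ tens U' W' :=
  map_mem_of_mem_tens (fun x hx y hy => tmul_mem_tens (hf x hx) (hg y hy)) hz

theorem map_eq_self_of_mem_tens {U : Submodule ℂ X} {W : Submodule ℂ Y} {f : X →ₗ[ℂ] X}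
    {g : Y →ₗ[ℂ] Y} (hf : ∀ x ∈ U, f x = x) (hg : ∀ y ∈ W, g y = y) {z : X ⊗[ℂ] Y}
    (hz : z ∈ tens U W) : TensorProduct.map f g z = z :=
  eqOn_tens (g := LinearMap.id) (fun x hx y hy => by simp [hf x hx, hg y hy]) hz

theorem mem_tens_top (z : X ⊗[ℂ] Y) : z ∈ tens (⊤ : Submodule ℂ X) (⊤ : Submodule ℂ Y) := by
  induction z with
  | zero => simp
  | add x y hx hy => exact add_mem hx hy
  | tmul x y => exact tmul_mem_tens trivial trivial

theorem tens_mono {U U' : Submodule ℂ X} {W W' : Submodule ℂ Y} (h : U ≤ U') (h' : W ≤ W') :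
    tens U W ≤ tens U' W' := fun z hz => by
  have := map_mem_tens (f := LinearMap.id) (g := LinearMap.id) h h' hz
  simpa using this

/-- If all contractions lie in `U`, a projection onto `U` applied to the first leg does not change
any contraction, hence fixes `z`. -/
theorem mem_tens_iff_sliceR {U : Submodule ℂ X} {z : X ⊗[ℂ] Y} :
    z ∈ tens U ⊤ ↔ ∀ l, sliceR l z ∈ U := by
  constructor
  · intro hz l
    exact map_mem_of_mem_tens (fun x hx y _ => by simpa using U.smul_mem _ hx) hz
  · intro h
    obtain ⟨p, hp, hp'⟩ := exists_proj U
    have h1 : TensorProduct.map p LinearMap.id z = z := by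
      rw [← sub_eq_zero]
      apply eq_zero_of_sliceR
      intro l
      rw [map_sub, sliceR_map, LinearMap.comp_id, hp' _ (h l), sub_self]
    rw [← h1]
    exact map_mem_tens (fun x _ => hp x) (fun _ _ => Submodule.mem_top) (mem_tens_top z)

theorem mem_tens_iff_sliceL {W : Submodule ℂ Y} {z : X ⊗[ℂ] Y} :
    z ∈ tens ⊤ W ↔ ∀ l, sliceL l z ∈ W := by
  constructor
  · intro hz l
    exact map_mem_of_mem_tens (fun x _ y hy => by simpa using W.smul_mem _ hy) hz
  · intro h
    obtain ⟨p, hp, hp'⟩ := exists_proj W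
    have h1 : TensorProduct.map LinearMap.id p z = z := by
      rw [← sub_eq_zero]
      apply eq_zero_of_sliceL
      intro l
      rw [map_sub, sliceL_map, LinearMap.comp_id, hp' _ (h l), sub_self]
    rw [← h1]
    exact map_mem_tens (fun _ _ => Submodule.mem_top) (fun x _ => hp x) (mem_tens_top z)

/-- Contractions handle each leg separately. Projections onto the two intersections then fix `z`,
and applying both shows membership in the smaller tensor product. -/
theorem mem_tens_inf {U₁ U₂ : Submodule ℂ X} {W₁ W₂ : Submodule ℂ Y} {z : X ⊗[ℂ] Y}
    (h₁ : z ∈ tens U₁ W₁) (h₂ : z ∈ tens U₂ W₂) : z ∈ tens (U₁ ⊓ U₂) (W₁ ⊓ W₂) := by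
  have hU : z ∈ tens (U₁ ⊓ U₂) ⊤ := mem_tens_iff_sliceR.2 fun l =>
    ⟨mem_tens_iff_sliceR.1 (tens_mono le_rfl le_top h₁) l,
      mem_tens_iff_sliceR.1 (tens_mono le_rfl le_top h₂) l⟩
  have hW : z ∈ tens ⊤ (W₁ ⊓ W₂) := mem_tens_iff_sliceL.2 fun l =>
    ⟨mem_tens_iff_sliceL.1 (tens_mono le_top le_rfl h₁) l,
      mem_tens_iff_sliceL.1 (tens_mono le_top le_rfl h₂) l⟩
  obtain ⟨p, hp, hp'⟩ := exists_proj (U₁ ⊓ U₂)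
  obtain ⟨r, hr, hr'⟩ := exists_proj (W₁ ⊓ W₂)
  have h1 : TensorProduct.map p LinearMap.id (TensorProduct.map LinearMap.id r z) = z := by
    rw [map_eq_self_of_mem_tens (U := ⊤) (fun _ _ => rfl) hr' hW,
      map_eq_self_of_mem_tens (W := ⊤) hp' (fun _ _ => rfl) hU]
  rw [← h1, ← LinearMap.comp_apply, ← TensorProduct.map_comp]
  exact map_mem_tens (fun x _ => hp _) (fun y _ => hr _) (mem_tens_top z)

theorem mem_tens {U : Submodule ℂ X} {W : Submodule ℂ Y} {z : X ⊗[ℂ] Y}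
    (h₁ : z ∈ tens U ⊤) (h₂ : z ∈ tens ⊤ W) : z ∈ tens U W := by
  simpa using mem_tens_inf h₁ h₂

/-- Exactness of the tensor product over a field, obtained from contractions. -/
theorem mem_tens_ker_left {f : X →ₗ[ℂ] X'} {z : X ⊗[ℂ] Y} :
    z ∈ tens (LinearMap.ker f) ⊤ ↔ TensorProduct.map f LinearMap.id z = 0 := by
  constructor
  · exact fun hz => eqOn_tens (g := 0) (fun x hx y _ => by
      simp [LinearMap.mem_ker.1 hx]) hz
  · intro h
    rw [mem_tens_iff_sliceR]
    intro l
    have := sliceR_map l f LinearMap.id z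
    rw [h, map_zero] at this
    exact this.symm

theorem mem_tens_ker_right {f : Y →ₗ[ℂ] Y'} {z : X ⊗[ℂ] Y} :
    z ∈ tens ⊤ (LinearMap.ker f) ↔ TensorProduct.map LinearMap.id f z = 0 := by
  constructor
  · exact fun hz => eqOn_tens (g := 0) (fun x _ y hy => by
      simp [LinearMap.mem_ker.1 hy]) hz
  · intro h
    rw [mem_tens_iff_sliceL]
    intro l
    have := sliceL_map l LinearMap.id f z
    rw [h, map_zero] at this
    exact this.symm

theorem map_map {X'' Y'' : Type*} [AddCommGroup X''] [Module ℂ X''] [AddCommGroup Y'']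
    [Module ℂ Y''] (f' : X' →ₗ[ℂ] X'') (g' : Y' →ₗ[ℂ] Y'') (f : X →ₗ[ℂ] X') (g : Y →ₗ[ℂ] Y')
    (z : X ⊗[ℂ] Y) : TensorProduct.map f' g' (TensorProduct.map f g z) =
      TensorProduct.map (f' ∘ₗ f) (g' ∘ₗ g) z := by
  rw [TensorProduct.map_comp]; rfl

end LinearAlgebra

/-! ### Diagonal operators on graded algebras -/

section Grading

variable {X : Type*} [Ring X] [Algebra ℂ X] (𝒜 : ℕ → Submodule ℂ X) [GradedAlgebra 𝒜]

/-- The operator acting as the scalar `c n` in degree `n`. -/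
def gradeMap (c : ℕ → ℂ) : X →ₗ[ℂ] X :=
  DirectSum.toModule ℂ ℕ X (fun i => c i • (𝒜 i).subtype) ∘ₗ
    (DirectSum.decomposeLinearEquiv 𝒜).toLinearMap

variable {𝒜}

theorem gradeMap_of_mem {c : ℕ → ℂ} {n : ℕ} {x : X} (hx : x ∈ 𝒜 n) :
    gradeMap 𝒜 c x = c n • x := by
  have : DirectSum.decompose 𝒜 x = DirectSum.of (fun i => 𝒜 i) n ⟨x, hx⟩ :=
    DirectSum.decompose_of_mem 𝒜 hx
  simp only [gradeMap, LinearMap.comp_apply, LinearEquiv.coe_coe,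
    DirectSum.decomposeLinearEquiv_apply, this]
  erw [DirectSum.toModule_lof]
  rfl

theorem gradeInvolution_eq : gradeInvolution 𝒜 = gradeMap 𝒜 fun i => (-1) ^ i := rfl

theorem grading_induction {p : X → Prop} (h0 : p 0) (hadd : ∀ x y, p x → p y → p (x + y))
    (h : ∀ n, ∀ x ∈ 𝒜 n, p x) (x : X) : p x := by
  have : x ∈ ⨆ n, 𝒜 n := by
    rw [(DirectSum.Decomposition.isInternal 𝒜).submodule_iSup_eq_top]; trivial
  exact Submodule.iSup_induction 𝒜 (motive := p) this (fun n x hx => h n x hx) h0 hadd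

theorem grading_ext {Y : Type*} [AddCommGroup Y] [Module ℂ Y] {f g : X →ₗ[ℂ] Y}
    (h : ∀ n, ∀ x ∈ 𝒜 n, f x = g x) : f = g := by
  ext x
  induction x using grading_induction (𝒜 := 𝒜) with
  | h0 => simp
  | hadd x y hx hy => simp [hx, hy]
  | h n x hx => exact h n x hx

theorem gradeMap_comp (c c' : ℕ → ℂ) : gradeMap 𝒜 c ∘ₗ gradeMap 𝒜 c' =
    gradeMap 𝒜 fun i => c i * c' i :=
  grading_ext (𝒜 := 𝒜) fun n x hx => by
    rw [LinearMap.comp_apply, gradeMap_of_mem hx, map_smul, gradeMap_of_mem hx,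
      gradeMap_of_mem hx, smul_smul, mul_comm]

variable (𝒜) in
/-- The projection to degree `n`. -/
abbrev gproj (n : ℕ) : X →ₗ[ℂ] X := GradedAlgebra.proj 𝒜 n

theorem gproj_mem (n : ℕ) (x : X) : gproj 𝒜 n x ∈ 𝒜 n := SetLike.coe_mem _

theorem gproj_of_mem {n : ℕ} {x : X} (hx : x ∈ 𝒜 n) : gproj 𝒜 n x = x := by
  simp [gproj, GradedAlgebra.proj_apply, DirectSum.decompose_of_mem_same 𝒜 hx]

theorem gproj_of_mem_ne {n m : ℕ} {x : X} (hx : x ∈ 𝒜 n) (h : n ≠ m) : gproj 𝒜 m x = 0 := by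
  simp [gproj, GradedAlgebra.proj_apply, DirectSum.decompose_of_mem_ne 𝒜 hx h]

theorem eq_zero_of_gproj {x : X} (h : ∀ n, gproj 𝒜 n x = 0) : x = 0 := by
  apply (DirectSum.decompose 𝒜).injective
  rw [DirectSum.decompose_zero]
  ext n
  exact h n

theorem mem_of_gproj {k : ℕ} {x : X} (h : ∀ n, n ≠ k → gproj 𝒜 n x = 0) : x ∈ 𝒜 k := by
  have : x - gproj 𝒜 k x = 0 := by
    apply eq_zero_of_gproj (𝒜 := 𝒜)
    intro n
    rw [map_sub]
    by_cases hn : n = k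
    · subst hn; rw [gproj_of_mem (gproj_mem n x), sub_self]
    · rw [h n hn, gproj_of_mem_ne (gproj_mem k x) (Ne.symm hn), sub_self]
  rw [sub_eq_zero.1 this]
  exact gproj_mem k x

theorem gproj_gradeMap (c : ℕ → ℂ) (n : ℕ) (x : X) :
    gproj 𝒜 n (gradeMap 𝒜 c x) = c n • gproj 𝒜 n x := by
  induction x using grading_induction (𝒜 := 𝒜) with
  | h0 => simp
  | hadd x y hx hy => simp only [map_add, hx, hy, smul_add]
  | h m x hx =>
    rw [gradeMap_of_mem hx, map_smul]
    by_cases h : m = n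
    · subst h; rfl
    · rw [gproj_of_mem_ne hx h, smul_zero, smul_zero]

/-- Eigenvectors of a diagonal operator are supported where the eigenvalue is attained. -/
theorem gproj_eq_zero_of_gradeMap {c : ℕ → ℂ} {t : ℂ} {x : X} (h : gradeMap 𝒜 c x = t • x) {n : ℕ}
    (hn : c n ≠ t) : gproj 𝒜 n x = 0 := by
  have := congrArg (gproj 𝒜 n) h
  rw [gproj_gradeMap, map_smul, ← sub_eq_zero, ← sub_smul] at this
  exact (smul_eq_zero.1 this).resolve_left (sub_ne_zero.2 hn)

theorem mem_of_gradeMap {c : ℕ → ℂ} {k : ℕ} {x : X} (hc : ∀ n, n ≠ k → c n ≠ c k)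
    (h : gradeMap 𝒜 c x = c k • x) : x ∈ 𝒜 k :=
  mem_of_gproj fun n hn => gproj_eq_zero_of_gradeMap h (hc n hn)

/-- This reformulates the filtration of `Γ^∧` by degree as vanishing of components, the form in
which vertical order is handled throughout. -/
theorem mem_iSup_deg_iff {k : ℤ} {x : X} :
    x ∈ (⨆ (i : ℕ) (_ : (i : ℤ) ≤ k), 𝒜 i) ↔ ∀ j : ℕ, k < j → gproj 𝒜 j x = 0 := by
  constructor
  · intro hx j hj
    have : (⨆ (i : ℕ) (_ : (i : ℤ) ≤ k), 𝒜 i) ≤ LinearMap.ker (gproj 𝒜 j) :=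
      iSup₂_le fun i hi x hx => gproj_of_mem_ne hx (by omega)
    exact this hx
  · intro h
    classical
    rw [← DirectSum.sum_support_decompose 𝒜 x]
    refine sum_mem fun i _ => ?_
    by_cases hi : (i : ℤ) ≤ k
    · exact Submodule.mem_iSup_of_mem i (Submodule.mem_iSup_of_mem hi (SetLike.coe_mem _))
    · have := h i (by omega)
      rw [GradedAlgebra.proj_apply] at this
      rw [this]; exact zero_mem _

end Grading

end QPB
end

noncomputable section
namespace QPB

/-! ### Derivations and signs on graded algebras, and signs in the graded tensor product. -/

section Grading

variable {X : Type*} [Ring X] [Algebra ℂ X] {𝒜 : ℕ → Submodule ℂ X} [GradedAlgebra 𝒜]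

theorem gradeInvolution_of_mem {n : ℕ} {x : X} (hx : x ∈ 𝒜 n) :
    gradeInvolution 𝒜 x = (-1 : ℂ) ^ n • x := by
  rw [gradeInvolution_eq, gradeMap_of_mem hx]

theorem gradeInvolution_mul (x y : X) :
    gradeInvolution 𝒜 (x * y) = gradeInvolution 𝒜 x * gradeInvolution 𝒜 y := by
  induction x using grading_induction (𝒜 := 𝒜) with
  | h0 => simp
  | hadd x x' hx hx' => simp only [add_mul, map_add, hx, hx']
  | h n x hx =>
    induction y using grading_induction (𝒜 := 𝒜) with
    | h0 => simp
    | hadd y y' hy hy' => simp only [mul_add, map_add, hy, hy']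
    | h m y hy =>
      rw [gradeInvolution_of_mem (SetLike.mul_mem_graded hx hy), gradeInvolution_of_mem hx,
        gradeInvolution_of_mem hy, smul_mul_smul_comm, pow_add]

variable (𝒜) in
/-- The operator multiplying by the degree. -/
abbrev degOp : X →ₗ[ℂ] X := gradeMap 𝒜 fun i => (i : ℂ)

theorem degOp_mul (x y : X) : degOp 𝒜 (x * y) = degOp 𝒜 x * y + x * degOp 𝒜 y := by
  induction x using grading_induction (𝒜 := 𝒜) with
  | h0 => simp
  | hadd x x' hx hx' => simp only [add_mul, map_add, hx, hx']; abel
  | h n x hx =>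
    induction y using grading_induction (𝒜 := 𝒜) with
    | h0 => simp
    | hadd y y' hy hy' => simp only [mul_add, map_add, hy, hy']; abel
    | h m y hy =>
      rw [degOp, gradeMap_of_mem (SetLike.mul_mem_graded hx hy), gradeMap_of_mem hx,
        gradeMap_of_mem hy, smul_mul_assoc, mul_smul_comm, ← add_smul, Nat.cast_add]

/-- In characteristic zero the degrees are distinct eigenvalues of the degree operator. Homogeneity
thus becomes a linear equation, which can be propagated from generators. -/
theorem mem_of_degOp {k : ℕ} {x : X} (h : degOp 𝒜 x = (k : ℂ) • x) : x ∈ 𝒜 k :=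
  mem_of_gradeMap (c := fun i => (i : ℂ)) (fun n hn => by simpa using hn) h

theorem degOp_comp_of_mem {d : X →ₗ[ℂ] X} (h : ∀ n, ∀ x ∈ 𝒜 n, d x ∈ 𝒜 (n + 1)) (x : X) :
    degOp 𝒜 (d x) = d (degOp 𝒜 x) + d x := by
  induction x using grading_induction (𝒜 := 𝒜) with
  | h0 => simp
  | hadd x x' hx hx' => simp only [map_add, hx, hx']; abel
  | h n x hx =>
    rw [degOp, gradeMap_of_mem (h n x hx), gradeMap_of_mem hx, map_smul, Nat.cast_add,
      Nat.cast_one, add_smul, one_smul]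

theorem gradeInvolution_comp_of_mem {d : X →ₗ[ℂ] X} (h : ∀ n, ∀ x ∈ 𝒜 n, d x ∈ 𝒜 (n + 1))
    (x : X) : gradeInvolution 𝒜 (d x) = -d (gradeInvolution 𝒜 x) := by
  induction x using grading_induction (𝒜 := 𝒜) with
  | h0 => simp
  | hadd x x' hx hx' => simp only [map_add, hx, hx', neg_add]
  | h n x hx =>
    rw [gradeInvolution_of_mem (h n x hx), gradeInvolution_of_mem hx, map_smul, pow_succ]
    simp

theorem gproj_succ_comp_of_mem {d : X →ₗ[ℂ] X} (h : ∀ n, ∀ x ∈ 𝒜 n, d x ∈ 𝒜 (n + 1)) (n : ℕ)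
    (x : X) : gproj 𝒜 (n + 1) (d x) = d (gproj 𝒜 n x) := by
  induction x using grading_induction (𝒜 := 𝒜) with
  | h0 => simp
  | hadd x x' hx hx' => simp only [map_add, hx, hx']
  | h m x hx =>
    by_cases hm : m = n
    · subst hm; rw [gproj_of_mem (h m x hx), gproj_of_mem hx]
    · rw [gproj_of_mem_ne (h m x hx) (by omega), gproj_of_mem_ne hx hm, map_zero]

theorem gproj_zero_comp_of_mem {d : X →ₗ[ℂ] X} (h : ∀ n, ∀ x ∈ 𝒜 n, d x ∈ 𝒜 (n + 1))
    (x : X) : gproj 𝒜 0 (d x) = 0 := by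
  induction x using grading_induction (𝒜 := 𝒜) with
  | h0 => simp
  | hadd x x' hx hx' => simp only [map_add, hx, hx', add_zero]
  | h m x hx => exact gproj_of_mem_ne (h m x hx) (by omega)

theorem gproj_mul_left {x : X} (hx : x ∈ 𝒜 0) (n : ℕ) (y : X) :
    gproj 𝒜 n (x * y) = x * gproj 𝒜 n y := by
  induction y using grading_induction (𝒜 := 𝒜) with
  | h0 => simp
  | hadd y y' hy hy' => simp only [mul_add, map_add, hy, hy']
  | h m y hy =>
    have hxy : x * y ∈ 𝒜 m := by simpa using SetLike.mul_mem_graded hx hy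
    by_cases hm : m = n
    · subst hm; rw [gproj_of_mem hxy, gproj_of_mem hy]
    · rw [gproj_of_mem_ne hxy hm, gproj_of_mem_ne hy hm, mul_zero]

variable {Y : Type*} [Ring Y] [Algebra ℂ Y] {ℬ : ℕ → Submodule ℂ Y} [GradedAlgebra ℬ]

/-- Only the degrees of the two inner legs enter the Koszul sign, so the outer legs are left
arbitrary. -/
theorem of_mul_of_of_mem {j i : ℕ} {z z' : X ⊗[ℂ] Y} (hz : z ∈ tens ⊤ (ℬ j))
    (hz' : z' ∈ tens (𝒜 i) ⊤) :
    GradedTensorProduct.of ℂ 𝒜 ℬ z * GradedTensorProduct.of ℂ 𝒜 ℬ z' =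
      ((-1 : ℂ) ^ (j * i)) • GradedTensorProduct.of ℂ 𝒜 ℬ (z * z') := by
  refine eqOn_tens (f := LinearMap.mulRight ℂ (GradedTensorProduct.of ℂ 𝒜 ℬ z') ∘ₗ
    (GradedTensorProduct.of ℂ 𝒜 ℬ).toLinearMap) (g := ((-1 : ℂ) ^ (j * i)) •
    (GradedTensorProduct.of ℂ 𝒜 ℬ).toLinearMap ∘ₗ LinearMap.mulRight ℂ z') ?_ hz
  intro x _ y hy
  refine eqOn_tens (f := LinearMap.mulLeft ℂ (GradedTensorProduct.of ℂ 𝒜 ℬ (x ⊗ₜ y)) ∘ₗ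
    (GradedTensorProduct.of ℂ 𝒜 ℬ).toLinearMap) (g := ((-1 : ℂ) ^ (j * i)) •
    (GradedTensorProduct.of ℂ 𝒜 ℬ).toLinearMap ∘ₗ LinearMap.mulLeft ℂ (x ⊗ₜ y)) ?_ hz'
  intro x' hx' y' _
  have := GradedTensorProduct.tmul_coe_mul_coe_tmul (R := ℂ) (𝒜 := 𝒜) (ℬ := ℬ) x ⟨y, hy⟩ ⟨x', hx'⟩ y'
  simp only [LinearMap.comp_apply, LinearMap.mulLeft_apply, LinearEquiv.coe_coe,
    LinearMap.smul_apply, Algebra.TensorProduct.tmul_mul_tmul]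
  refine this.trans ?_
  rw [Units.smul_def, ← Int.cast_smul_eq_zsmul ℂ]
  congr 1
  simp

theorem of_mul_of_left {z z' : X ⊗[ℂ] Y} (hz : z ∈ tens ⊤ (ℬ 0)) :
    GradedTensorProduct.of ℂ 𝒜 ℬ z * GradedTensorProduct.of ℂ 𝒜 ℬ z' =
      GradedTensorProduct.of ℂ 𝒜 ℬ (z * z') := by
  induction z' with
  | zero => simp
  | add x y hx hy => simp only [map_add, mul_add, hx, hy]
  | tmul x y =>
    induction x using grading_induction (𝒜 := 𝒜) with
    | h0 => simp
    | hadd x x' hx hx' => simp only [TensorProduct.add_tmul, map_add, mul_add, hx, hx']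
    | h n x hx =>
      rw [of_mul_of_of_mem hz (tmul_mem_tens hx Submodule.mem_top)]; simp

theorem of_mul_of_right {z z' : X ⊗[ℂ] Y} (hz : z' ∈ tens (𝒜 0) ⊤) :
    GradedTensorProduct.of ℂ 𝒜 ℬ z * GradedTensorProduct.of ℂ 𝒜 ℬ z' =
      GradedTensorProduct.of ℂ 𝒜 ℬ (z * z') := by
  induction z with
  | zero => simp
  | add x y hx hy => simp only [map_add, add_mul, hx, hy]
  | tmul x y =>
    induction y using grading_induction (𝒜 := ℬ) with
    | h0 => simp
    | hadd y y' hy hy' => simp only [TensorProduct.tmul_add, map_add, add_mul, hy, hy']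
    | h n y hy =>
      rw [of_mul_of_of_mem (tmul_mem_tens Submodule.mem_top hy) hz]; simp

end Grading

namespace BicovariantStarCalculus

universe uA uG

variable {A : Type uA} [Ring A] [StarRing A] [HopfAlgebra ℂ A]
variable {Γ : Type uG} [AddCommGroup Γ] [Module ℂ Γ] [Module A Γ] [Module Aᵐᵒᵖ Γ]
  [IsScalarTower ℂ A Γ] [IsScalarTower ℂ Aᵐᵒᵖ Γ] [SMulCommClass A Aᵐᵒᵖ Γ]
variable (C : BicovariantStarCalculus A Γ)

/-! ### The differential of `Γ^∧` -/

theorem gen_induction {p : C.Envelope → Prop} (halg : ∀ c, p (algebraMap ℂ _ c))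
    (hA : ∀ a, p (C.ofA a)) (hd : ∀ a, p (C.dA a)) (hadd : ∀ x y, p x → p y → p (x + y))
    (hmul : ∀ x y, p x → p y → p (x * y)) (x : C.Envelope) : p x := by
  obtain ⟨y, rfl⟩ := RingQuot.mkAlgHom_surjective ℂ C.Rel x
  change p (C.quot y)
  induction y using FreeAlgebra.induction with
  | grade0 c => rw [AlgHom.commutes]; exact halg c
  | grade1 s =>
    cases s with
    | inl a => exact hA a
    | inr a => exact hd a
  | mul x y hx hy => rw [map_mul]; exact hmul _ _ hx hy
  | add x y hx hy => rw [map_add]; exact hadd _ _ hx hy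

/-- The homomorphism `x ↦ (γ(x), dx; 0, x)`. -/
def triHom : C.Envelope →ₐ[ℂ] Matrix (Fin 2) (Fin 2) C.Envelope := C.liftHom _ _ C.compatible_tri

theorem triHom_ofA (a : A) : C.triHom (C.ofA a) = C.tri (C.ofA a) (C.dA a) (C.ofA a) :=
  C.liftHom_gen _ _ C.compatible_tri (Sum.inl a)

theorem triHom_dA (a : A) : C.triHom (C.dA a) = C.tri (-C.dA a) 0 (C.dA a) :=
  C.liftHom_gen _ _ C.compatible_tri (Sum.inr a)

/-- The diagonal entries are homomorphisms and are compared on generators; the upper right entry is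
`dΓ` by definition. Multiplicativity of `triHom` is then the graded Leibniz rule. -/
theorem triHom_eq (x : C.Envelope) :
    C.triHom x = C.tri (gradeInvolution C.deg x) (C.dΓ x) x := by
  have h : C.triHom x 0 0 = gradeInvolution C.deg x ∧ C.triHom x 1 0 = 0 ∧
      C.triHom x 1 1 = x := by
    induction x using C.gen_induction with
    | halg c =>
      have : algebraMap ℂ C.Envelope c ∈ C.deg 0 := SetLike.algebraMap_mem_graded C.deg c
      rw [AlgHom.commutes, gradeInvolution_of_mem this]
      simp [Matrix.algebraMap_matrix_apply]
    | hA a => rw [triHom_ofA, gradeInvolution_of_mem (C.ofA_mem a)]; simp [tri]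
    | hd a => rw [triHom_dA, gradeInvolution_of_mem (C.dA_mem a)]; simp [tri]
    | hadd x y hx hy => simp [hx, hy]
    | hmul x y hx hy =>
      simp [Matrix.mul_apply, Fin.sum_univ_two, hx, hy, gradeInvolution_mul]
  ext i j
  fin_cases i <;> fin_cases j
  · exact h.1
  · rfl
  · exact h.2.1
  · exact h.2.2

theorem dΓ_mul (x y : C.Envelope) :
    C.dΓ (x * y) = C.dΓ x * y + gradeInvolution C.deg x * C.dΓ y := by
  have h := C.triHom_eq (x * y)
  rw [map_mul, C.triHom_eq x, C.triHom_eq y, tri_mul] at h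
  have := congrArg (fun M => M 0 1) h
  simp only [tri] at this
  simpa [add_comm] using this.symm

theorem dΓ_ofA_mul (a : A) (x : C.Envelope) :
    C.dΓ (C.ofA a * x) = C.dA a * x + C.ofA a * C.dΓ x := by
  rw [dΓ_mul, dΓ_ofA, gradeInvolution_of_mem (C.ofA_mem a)]; simp

theorem dΓ_dA_mul (a : A) (x : C.Envelope) : C.dΓ (C.dA a * x) = -(C.dA a * C.dΓ x) := by
  rw [dΓ_mul, dΓ_dA, gradeInvolution_of_mem (C.dA_mem a)]; simp

theorem dΓ_one : C.dΓ 1 = 0 := by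
  have := C.dΓ_ofA_mul 1 1
  rw [map_one, one_mul, one_mul, mul_one, right_eq_add, ← dΓ_ofA, map_one] at this
  exact this

/-- A subspace of `Γ^∧` containing `1` and stable under `A` and the differential is everything. -/
theorem env_induction {T : Submodule ℂ C.Envelope} (h1 : 1 ∈ T)
    (hA : ∀ a, ∀ x ∈ T, C.ofA a * x ∈ T) (hd : ∀ x ∈ T, C.dΓ x ∈ T) (x : C.Envelope) : x ∈ T := by
  have h : ∀ x : C.Envelope, ∀ y ∈ T, x * y ∈ T := by
    intro x
    induction x using C.gen_induction with
    | halg c => intro y hy; rw [← Algebra.smul_def]; exact T.smul_mem c hy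
    | hA a => exact hA a
    | hd a =>
      intro y hy
      -- Multiplication by `da` is a combination of the two operations under which `T` is stable.
      rw [show C.dA a * y = C.dΓ (C.ofA a * y) - C.ofA a * C.dΓ y by rw [dΓ_ofA_mul]; abel]
      exact sub_mem (hd _ (hA _ _ hy)) (hA _ _ (hd _ hy))
    | hadd x y hx hy => intro z hz; rw [add_mul]; exact add_mem (hx z hz) (hy z hz)
    | hmul x y hx hy => intro z hz; rw [mul_assoc]; exact hx _ (hy z hz)
  simpa using h x 1 h1

theorem env_ext {Y : Type*} [AddCommGroup Y] [Module ℂ Y] {f g : C.Envelope →ₗ[ℂ] Y}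
    (h1 : f 1 = g 1) (hA : ∀ a x, f x = g x → f (C.ofA a * x) = g (C.ofA a * x))
    (hd : ∀ x, f x = g x → f (C.dΓ x) = g (C.dΓ x)) : f = g := by
  ext x
  exact C.env_induction (T := LinearMap.eqLocus f g) h1 hA hd x

theorem dΓ_dΓ (x : C.Envelope) : C.dΓ (C.dΓ x) = 0 := by
  refine LinearMap.congr_fun (C.env_ext (f := C.dΓ ∘ₗ C.dΓ) (g := 0) ?_ ?_ ?_) x
  · simp [dΓ_one]
  · intro a x hx
    simp only [LinearMap.comp_apply, LinearMap.zero_apply] at hx ⊢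
    rw [dΓ_ofA_mul, map_add, dΓ_dA_mul, dΓ_ofA_mul, hx, mul_zero, add_zero, neg_add_cancel]
  · intro x hx
    simp only [LinearMap.comp_apply, LinearMap.zero_apply] at hx ⊢
    rw [hx, map_zero]

/-- The commutator of the degree operator with `d` is `d`. As an identity of operators on the whole
algebra it can be verified by `env_ext`, and homogeneity follows. -/
theorem dΓ_mem (n : ℕ) : ∀ x ∈ C.deg n, C.dΓ x ∈ C.deg (n + 1) := by
  have key : degOp C.deg ∘ₗ C.dΓ = C.dΓ ∘ₗ degOp C.deg + C.dΓ := by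
    have hone : degOp C.deg 1 = 0 := by
      rw [degOp, gradeMap_of_mem (n := 0) (SetLike.one_mem_graded C.deg)]; simp
    refine C.env_ext ?_ ?_ ?_
    · simp [dΓ_one, hone]
    · intro a x hx
      simp only [LinearMap.comp_apply, LinearMap.add_apply] at hx ⊢
      have h1 : degOp C.deg (C.ofA a) = 0 := by
        rw [degOp, gradeMap_of_mem (C.ofA_mem a)]; simp
      have h2 : degOp C.deg (C.dA a) = C.dA a := by
        rw [degOp, gradeMap_of_mem (C.dA_mem a)]; simp
      rw [dΓ_ofA_mul, map_add, degOp_mul, degOp_mul, degOp_mul, h1, h2, hx, zero_mul, zero_mul,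
        zero_add, zero_add, dΓ_ofA_mul, mul_add]
      abel
    · intro x hx
      simp only [LinearMap.comp_apply, LinearMap.add_apply] at hx ⊢
      rw [dΓ_dΓ, hx, map_add, dΓ_dΓ, dΓ_dΓ]; simp
  intro x hx
  apply mem_of_degOp
  have := LinearMap.congr_fun key x
  simp only [LinearMap.comp_apply, LinearMap.add_apply] at this
  rw [this, degOp, gradeMap_of_mem hx, map_smul, Nat.cast_add, Nat.cast_one, add_smul, one_smul]

theorem pA_ofA (a : A) : C.pA (C.ofA a) = a := C.liftHom_gen _ _ _ (Sum.inl a)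

theorem pA_dA (a : A) : C.pA (C.dA a) = 0 := C.liftHom_gen _ _ _ (Sum.inr a)

theorem pA_dΓ (x : C.Envelope) : C.pA (C.dΓ x) = 0 := by
  refine LinearMap.congr_fun (C.env_ext (f := C.pA.toLinearMap ∘ₗ C.dΓ) (g := 0) ?_ ?_ ?_) x
  · simp [dΓ_one]
  · intro a x hx
    simp only [LinearMap.comp_apply, LinearMap.zero_apply, AlgHom.toLinearMap_apply] at hx ⊢
    rw [dΓ_ofA_mul, map_add, map_mul, map_mul, pA_dA, hx, zero_mul, mul_zero, add_zero]
  · intro x hx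
    simp [dΓ_dΓ]

theorem pA_of_mem {n : ℕ} (hn : n ≠ 0) {x : C.Envelope} (hx : x ∈ C.deg n) : C.pA x = 0 := by
  obtain ⟨n, rfl⟩ := Nat.exists_eq_succ_of_ne_zero hn
  have h : C.deg (n + 1) ≤ LinearMap.ker C.pA.toLinearMap := by
    rw [deg, pow_succ, ← mul_assoc, Submodule.mul_le]
    rintro x - _ ⟨b, rfl⟩
    simp [pA_dA]
  exact h hx

theorem deg_zero : C.deg 0 = LinearMap.range C.ofA.toLinearMap := by
  rw [deg, pow_zero, mul_one]

theorem ofA_pA (x : C.Envelope) : C.ofA (C.pA x) = gproj C.deg 0 x := by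
  induction x using grading_induction (𝒜 := C.deg) with
  | h0 => simp
  | hadd x y hx hy => simp only [map_add, hx, hy]
  | h n x hx =>
    by_cases hn : n = 0
    · subst hn
      rw [gproj_of_mem hx]
      rw [deg_zero] at hx
      obtain ⟨a, rfl⟩ := hx
      exact congrArg C.ofA (C.pA_ofA a)
    · rw [C.pA_of_mem hn hx, gproj_of_mem_ne hx hn, map_zero]

theorem pA_gradeInvolution (x : C.Envelope) : C.pA (gradeInvolution C.deg x) = C.pA x := by
  induction x using grading_induction (𝒜 := C.deg) with
  | h0 => simp
  | hadd x y hx hy => simp only [map_add, hx, hy]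
  | h n x hx =>
    rw [gradeInvolution_of_mem hx, map_smul]
    by_cases hn : n = 0
    · subst hn; simp
    · rw [C.pA_of_mem hn hx, smul_zero]

end BicovariantStarCalculus
end QPB
end

noncomputable section
namespace QPB

/-! ### Matrix corepresentations and the Haar functional -/

section Corep

universe uA

variable {A : Type uA} [Ring A] [HopfAlgebra ℂ A]

/-- Matrix corepresentations of a Hopf algebra. -/
structure IsCorep {ι : Type} [Fintype ι] [DecidableEq ι] (U : Matrix ι ι A) : Prop where
  comul : ∀ i j, Coalgebra.comul (R := ℂ) (U i j) = ∑ k, U i k ⊗ₜ[ℂ] U k j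
  counit : ∀ i j, Coalgebra.counit (R := ℂ) (U i j) = if i = j then 1 else 0

theorem IsCorep.antipode_mul {ι : Type} [Fintype ι] [DecidableEq ι] {U : Matrix ι ι A}
    (hU : IsCorep U) (i j : ι) :
    ∑ k, HopfAlgebra.antipode ℂ (U i k) * U k j = if i = j then 1 else 0 := by
  have := HopfAlgebra.mul_antipode_rTensor_comul_apply (R := ℂ) (U i j)
  rw [hU.comul, hU.counit] at this
  simpa [map_sum, apply_ite] using this

theorem IsCorep.mul_antipode {ι : Type} [Fintype ι] [DecidableEq ι] {U : Matrix ι ι A}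
    (hU : IsCorep U) (i j : ι) :
    ∑ k, U i k * HopfAlgebra.antipode ℂ (U k j) = if i = j then 1 else 0 := by
  have := HopfAlgebra.mul_antipode_lTensor_comul_apply (R := ℂ) (U i j)
  rw [hU.comul, hU.counit] at this
  simpa [map_sum, apply_ite] using this

variable [StarRing A] [StarModule ℂ A]

/-- Unitary matrix corepresentations. -/
structure IsUnitaryCorep {ι : Type} [Fintype ι] [DecidableEq ι] (U : Matrix ι ι A) : Prop where
  comul : ∀ i j, Coalgebra.comul (R := ℂ) (U i j) = ∑ k, U i k ⊗ₜ[ℂ] U k j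
  conjTranspose_mul : U.conjTranspose * U = 1
  mul_conjTranspose : U * U.conjTranspose = 1

namespace IsUnitaryCorep

variable {ι : Type} [Fintype ι] [DecidableEq ι] {U : Matrix ι ι A}

/-- The counit law gives `ε(U)U = U`, and unitarity allows `U` to be cancelled. -/
theorem isCorep (hU : IsUnitaryCorep U) : IsCorep U where
  comul := hU.comul
  counit i j := by
    have h : (Matrix.of fun i j => algebraMap ℂ A (Coalgebra.counit (R := ℂ) (U i j))) * U = U := by
      ext i j
      have := Coalgebra.rTensor_counit_comul (R := ℂ) (U i j)
      rw [hU.comul] at this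
      have := congrArg (TensorProduct.lid ℂ A) this
      simpa [map_sum, Matrix.mul_apply, Algebra.smul_def] using this
    have h1 := congrArg (· * U.conjTranspose) h
    simp only [mul_assoc, hU.mul_conjTranspose, mul_one] at h1
    have h2 := congrArg (Coalgebra.counit (R := ℂ)) (congrFun (congrFun h1 i) j)
    simp only [Matrix.of_apply, Matrix.one_apply] at h2
    rw [Bialgebra.counit_algebraMap] at h2
    rw [h2]
    split_ifs <;> simp

/-- The antipode of `U` is a left inverse of `U`, and the adjoint matrix is a right inverse; the two
agree. -/
theorem antipode_eq (hU : IsUnitaryCorep U) (i j : ι) :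
    HopfAlgebra.antipode ℂ (U i j) = star (U j i) := by
  have h : (Matrix.of fun i j => HopfAlgebra.antipode ℂ (U i j)) * U = 1 := by
    ext i j
    simp only [Matrix.mul_apply, Matrix.of_apply, Matrix.one_apply]
    exact hU.isCorep.antipode_mul i j
  have h1 := congrArg (· * U.conjTranspose) h
  simp only [mul_assoc, hU.mul_conjTranspose, mul_one, one_mul] at h1
  exact congrFun (congrFun h1 i) j

theorem sum_star_mul (hU : IsUnitaryCorep U) (i j : ι) :
    ∑ k, star (U k i) * U k j = if i = j then 1 else 0 := by
  have := congrFun (congrFun hU.conjTranspose_mul i) j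
  simpa [Matrix.mul_apply, Matrix.one_apply] using this

theorem sum_mul_star (hU : IsUnitaryCorep U) (i j : ι) :
    ∑ k, U i k * star (U j k) = if i = j then 1 else 0 := by
  have := congrFun (congrFun hU.mul_conjTranspose i) j
  simpa [Matrix.mul_apply, Matrix.one_apply] using this

theorem one : IsUnitaryCorep (1 : Matrix Unit Unit A) where
  comul i j := by simp [Algebra.TensorProduct.one_def]
  conjTranspose_mul := by simp
  mul_conjTranspose := by simp

variable {κ : Type} [Fintype κ] [DecidableEq κ] {V : Matrix κ κ A}

theorem fromBlocks (hU : IsUnitaryCorep U) (hV : IsUnitaryCorep V) :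
    IsUnitaryCorep (Matrix.fromBlocks U 0 0 V) where
  comul i j := by
    cases i <;> cases j <;> simp [hU.comul, hV.comul]
  conjTranspose_mul := by
    simp [Matrix.fromBlocks_conjTranspose, Matrix.fromBlocks_multiply, hU.conjTranspose_mul, hV.conjTranspose_mul]
  mul_conjTranspose := by
    simp [Matrix.fromBlocks_conjTranspose, Matrix.fromBlocks_multiply, hU.mul_conjTranspose, hV.mul_conjTranspose]

theorem tensor (hU : IsUnitaryCorep U) (hV : IsUnitaryCorep V) :
    IsUnitaryCorep (Matrix.of fun (i j : ι × κ) => U i.1 j.1 * V i.2 j.2) where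
  comul i j := by
    simp [Bialgebra.comul_mul, hU.comul, hV.comul, Finset.sum_mul_sum, Fintype.sum_prod_type]
  conjTranspose_mul := by
    ext ⟨i, k⟩ ⟨j, l⟩
    simp only [Matrix.mul_apply, Matrix.conjTranspose_apply, Matrix.of_apply, star_mul,
      Fintype.sum_prod_type]
    rw [Finset.sum_comm]
    have : ∀ y : κ, ∑ x, star (V y k) * star (U x i) * (U x j * V y l) =
        star (V y k) * (∑ x, star (U x i) * U x j) * V y l := fun y => by
      rw [Finset.mul_sum, Finset.sum_mul]
      exact Finset.sum_congr rfl fun x _ => by noncomm_ring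
    simp only [this, hU.sum_star_mul]
    by_cases h : i = j
    · subst h
      simp [hV.sum_star_mul, Matrix.one_apply]
    · simp [h]
  mul_conjTranspose := by
    ext ⟨i, k⟩ ⟨j, l⟩
    simp only [Matrix.mul_apply, Matrix.conjTranspose_apply, Matrix.of_apply, star_mul,
      Fintype.sum_prod_type]
    have : ∀ x : ι, ∑ y, U i x * V k y * (star (V l y) * star (U j x)) =
        U i x * (∑ y, V k y * star (V l y)) * star (U j x) := fun x => by
      rw [Finset.mul_sum, Finset.sum_mul]
      exact Finset.sum_congr rfl fun y _ => by noncomm_ring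
    simp only [this, hV.sum_mul_star]
    by_cases h : k = l
    · subst h
      simp [hU.sum_mul_star, Matrix.one_apply]
    · simp [h]

end IsUnitaryCorep

/-- The span of the matrix coefficients. -/
def coeffs {ι : Type} (U : Matrix ι ι A) : Submodule ℂ A :=
  Submodule.span ℂ {a | ∃ i j, U i j = a}

theorem coeff_mem {ι : Type} (U : Matrix ι ι A) (i j : ι) : U i j ∈ coeffs U :=
  Submodule.subset_span ⟨i, j, rfl⟩

theorem coeffs_fromBlocks_left {ι κ : Type} (U : Matrix ι ι A) (V : Matrix κ κ A) :
    coeffs U ≤ coeffs (Matrix.fromBlocks U 0 0 V) := by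
  refine Submodule.span_le.2 ?_
  rintro _ ⟨i, j, rfl⟩
  exact coeff_mem (Matrix.fromBlocks U 0 0 V) (Sum.inl i) (Sum.inl j)

theorem coeffs_fromBlocks_right {ι κ : Type} (U : Matrix ι ι A) (V : Matrix κ κ A) :
    coeffs V ≤ coeffs (Matrix.fromBlocks U 0 0 V) := by
  refine Submodule.span_le.2 ?_
  rintro _ ⟨i, j, rfl⟩
  exact coeff_mem (Matrix.fromBlocks U 0 0 V) (Sum.inr i) (Sum.inr j)

/-- Sums and products of coefficients are coefficients of block sums and tensor products. Conjugate
corepresentations are not needed, because the fundamental coefficients generate `A` as an algebra.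
-/
theorem exists_mem_coeffs (hA : IsCompactMatrixQuantumGroup A) (a : A) :
    ∃ (ι : Type) (_ : Fintype ι) (_ : DecidableEq ι) (U : Matrix ι ι A),
      IsUnitaryCorep U ∧ a ∈ coeffs U := by
  obtain ⟨n, u, hu1, hu2, hu3, hu4⟩ := hA.exists_fundamental
  have ha : a ∈ Algebra.adjoin ℂ {a : A | ∃ i j, u i j = a} := by rw [hu4]; trivial
  induction ha using Algebra.adjoin_induction with
  | mem x hx =>
    obtain ⟨i, j, rfl⟩ := hx
    exact ⟨Fin n, inferInstance, inferInstance, u, ⟨hu1, hu2, hu3⟩, coeff_mem u i j⟩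
  | algebraMap c =>
    refine ⟨Unit, inferInstance, inferInstance, 1, .one, ?_⟩
    rw [Algebra.algebraMap_eq_smul_one]
    exact Submodule.smul_mem _ _ (coeff_mem (1 : Matrix Unit Unit A) () ())
  | add x y _ _ hx hy =>
    obtain ⟨ι, _, _, U, hU, hx⟩ := hx
    obtain ⟨κ, _, _, V, hV, hy⟩ := hy
    exact ⟨ι ⊕ κ, inferInstance, inferInstance, _, hU.fromBlocks hV,
      add_mem (coeffs_fromBlocks_left U V hx) (coeffs_fromBlocks_right U V hy)⟩
  | mul x y _ _ hx hy =>
    obtain ⟨ι, _, _, U, hU, hx⟩ := hx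
    obtain ⟨κ, _, _, V, hV, hy⟩ := hy
    refine ⟨ι × κ, inferInstance, inferInstance, _, hU.tensor hV, ?_⟩
    have h : coeffs U * coeffs V ≤
        coeffs (Matrix.of fun (i j : ι × κ) => U i.1 j.1 * V i.2 j.2) := by
      rw [coeffs, coeffs, Submodule.span_mul_span]
      refine Submodule.span_le.2 ?_
      rintro _ ⟨_, ⟨i, j, rfl⟩, _, ⟨k, l, rfl⟩, rfl⟩
      exact coeff_mem (Matrix.of fun (i j : ι × κ) => U i.1 j.1 * V i.2 j.2) (i, k) (j, l)
    exact h (Submodule.mul_mem_mul hx hy)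

theorem corep_ext (hA : IsCompactMatrixQuantumGroup A) {X : Type*} [AddCommGroup X] [Module ℂ X]
    {f g : A →ₗ[ℂ] X} (h : ∀ (ι : Type) [Fintype ι] [DecidableEq ι] (U : Matrix ι ι A),
      IsUnitaryCorep U → ∀ i j, f (U i j) = g (U i j)) : f = g := by
  ext a
  obtain ⟨ι, _, _, U, hU, ha⟩ := exists_mem_coeffs hA a
  have : coeffs U ≤ LinearMap.eqLocus f g := by
    refine Submodule.span_le.2 ?_
    rintro _ ⟨i, j, rfl⟩
    exact h ι U hU i j
  exact this ha

/-- On unitary coefficients the antipode is `U i j ↦ star (U j i)`, so the claim reduces to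
compatibility of the coproduct with `*`. -/
theorem comul_antipode (hA : IsCompactMatrixQuantumGroup A) (a : A) :
    Coalgebra.comul (R := ℂ) (HopfAlgebra.antipode ℂ a) =
      TensorProduct.map (HopfAlgebra.antipode ℂ) (HopfAlgebra.antipode ℂ)
        (TensorProduct.comm ℂ A A (Coalgebra.comul (R := ℂ) a)) := by
  refine LinearMap.congr_fun (f := Coalgebra.comul ∘ₗ HopfAlgebra.antipode ℂ)
    (g := TensorProduct.map (HopfAlgebra.antipode ℂ) (HopfAlgebra.antipode ℂ) ∘ₗ
      (TensorProduct.comm ℂ A A).toLinearMap ∘ₗ Coalgebra.comul) (corep_ext hA ?_) a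
  intro ι _ _ U hU i j
  simp only [LinearMap.comp_apply, hU.antipode_eq, hA.comul_star, hU.comul, map_sum, star_sum,
    LinearEquiv.coe_coe, TensorProduct.comm_tmul, TensorProduct.map_tmul, TensorProduct.star_tmul]

/-- The convolution of functionals. -/
def conv (f g : A →ₗ[ℂ] ℂ) : A →ₗ[ℂ] ℂ :=
  LinearMap.mul' ℂ ℂ ∘ₗ TensorProduct.map f g ∘ₗ Coalgebra.comul

theorem conv_coeff {ι : Type} [Fintype ι] [DecidableEq ι] {U : Matrix ι ι A}
    (hU : IsUnitaryCorep U) (f g : A →ₗ[ℂ] ℂ) (i j : ι) :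
    conv f g (U i j) = ∑ k, f (U i k) * g (U k j) := by
  simp [conv, hU.comul]

theorem conv_one (f g : A →ₗ[ℂ] ℂ) : conv f g 1 = f 1 * g 1 := by
  simp [conv, Algebra.TensorProduct.one_def]

/-- The adjoint functional `a ↦ conj f(κ(a)*)`. -/
def adj (f : A →ₗ[ℂ] ℂ) : A →ₗ[ℂ] ℂ where
  toFun a := star (f (star (HopfAlgebra.antipode ℂ a)))
  map_add' a b := by simp
  map_smul' c a := by simp [star_smul]

theorem adj_coeff {ι : Type} [Fintype ι] [DecidableEq ι] {U : Matrix ι ι A}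
    (hU : IsUnitaryCorep U) (f : A →ₗ[ℂ] ℂ) (i j : ι) : adj f (U i j) = star (f (U j i)) := by
  change star (f (star (HopfAlgebra.antipode ℂ (U i j)))) = _
  rw [hU.antipode_eq, star_star]

/-- The values of a functional on the matrix coefficients. -/
def coeffVec {ι : Type} [Fintype ι] (U : Matrix ι ι A) :
    (A →ₗ[ℂ] ℂ) →ₗ[ℂ] EuclideanSpace ℂ (ι × ι) where
  toFun f := WithLp.toLp 2 fun p => f (U p.1 p.2)
  map_add' _ _ := rfl
  map_smul' _ _ := rfl

/-- Functionals are recorded by their values on the coefficients of `U`, in a Euclidean space. On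
coefficients `h` is the component of the counit orthogonal to the space `K` of value vectors of
functionals killing `1`. Invariance holds because convolution with a functional killing `1`
annihilates `h` there. -/
theorem exists_haar_coeffs {ι : Type} [Fintype ι] [DecidableEq ι] {U : Matrix ι ι A}
    (hU : IsUnitaryCorep U) : ∃ h : A →ₗ[ℂ] ℂ, h 1 = 1 ∧
      ∀ a ∈ coeffs U, ∀ f, conv f h a = f 1 * h a ∧ conv h f a = f 1 * h a := by
  let K : Submodule ℂ (EuclideanSpace ℂ (ι × ι)) :=
    (LinearMap.ker (LinearMap.applyₗ (1 : A) : (A →ₗ[ℂ] ℂ) →ₗ[ℂ] ℂ)).map (coeffVec U)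
  have hK : ∀ f : A →ₗ[ℂ] ℂ, f 1 = 0 → coeffVec U f ∈ K := fun f hf => ⟨f, hf, rfl⟩
  obtain ⟨k, hk, hk'⟩ : K.starProjection (coeffVec U Coalgebra.counit) ∈ K :=
    Submodule.starProjection_apply_mem _ _
  set h : A →ₗ[ℂ] ℂ := Coalgebra.counit - k with hh
  have horth : ∀ f : A →ₗ[ℂ] ℂ, f 1 = 0 → inner ℂ (coeffVec U h) (coeffVec U f) = 0 := by
    intro f hf
    rw [hh, map_sub, hk']
    exact (Submodule.mem_orthogonal' _ _).1 (Submodule.sub_starProjection_mem_orthogonal _) _ (hK f hf)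
  have hsum : ∀ f g : A →ₗ[ℂ] ℂ, inner ℂ (coeffVec U f) (coeffVec U g) =
      ∑ i, ∑ j, star (f (U i j)) * g (U i j) := by
    intro f g
    rw [PiLp.inner_apply, Fintype.sum_prod_type]
    refine Finset.sum_congr rfl fun i _ => Finset.sum_congr rfl fun j _ => ?_
    exact mul_comm _ _
  have hzero : ∀ f : A →ₗ[ℂ] ℂ, f 1 = 0 → coeffVec U (conv f h) = 0 ∧ coeffVec U (conv h f) = 0 := by
    intro f hf
    constructor
    -- With `f† = adj f` one has `‖f * h‖² = ⟨h, f† * f * h⟩`, and `f† * f * h` kills `1`, so it is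
    -- orthogonal to `h`.
    · rw [← inner_self_eq_zero (𝕜 := ℂ), ← horth (conv (adj f) (conv f h)) (by
        rw [conv_one, conv_one, hf]; simp), hsum, hsum]
      set g := conv f h with hg
      simp only [conv_coeff hU (adj f), adj_coeff hU]
      rw [Finset.sum_comm]
      conv_rhs => rw [Finset.sum_comm]
      refine Finset.sum_congr rfl fun j _ => ?_
      simp only [Finset.mul_sum]
      conv_rhs => rw [Finset.sum_comm]
      refine Finset.sum_congr rfl fun i _ => ?_
      rw [hg, conv_coeff hU, star_sum, Finset.sum_mul]
      refine Finset.sum_congr rfl fun k _ => ?_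
      rw [star_mul]; ring
    · rw [← inner_self_eq_zero (𝕜 := ℂ), ← horth (conv (conv h f) (adj f)) (by
        rw [conv_one, conv_one, hf]; simp), hsum, hsum]
      set g := conv h f with hg
      simp only [conv_coeff hU _ (adj f), adj_coeff hU]
      refine Finset.sum_congr rfl fun i _ => ?_
      simp only [Finset.mul_sum]
      conv_rhs => rw [Finset.sum_comm]
      refine Finset.sum_congr rfl fun j _ => ?_
      rw [hg, conv_coeff hU, star_sum, Finset.sum_mul]
      refine Finset.sum_congr rfl fun k _ => ?_
      rw [star_mul]; ring
  have h1 : h 1 = 1 := by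
    have : k 1 = 0 := hk
    simp [hh, this]
  refine ⟨h, h1, fun a ha f => ?_⟩
  -- The counit is the unit for convolution, so subtracting its multiple reduces to functionals
  -- killing `1`.
  have h2 := hzero (f - f 1 • Coalgebra.counit) (by simp)
  have h3 : ∀ i j, conv f h (U i j) = f 1 * h (U i j) ∧ conv h f (U i j) = f 1 * h (U i j) := by
    intro i j
    have h4 := congrFun (congrArg WithLp.ofLp h2.1) (i, j)
    have h5 := congrFun (congrArg WithLp.ofLp h2.2) (i, j)
    change conv _ h (U i j) = 0 at h4
    change conv h _ (U i j) = 0 at h5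
    rw [conv_coeff hU] at h4 h5
    rw [conv_coeff hU, conv_coeff hU]
    simp only [LinearMap.sub_apply, LinearMap.smul_apply, hU.isCorep.counit, sub_mul, mul_sub,
      Finset.sum_sub_distrib, smul_eq_mul, mul_ite, mul_one, mul_zero, ite_mul, zero_mul,
      Finset.sum_ite_eq, Finset.sum_ite_eq', Finset.mem_univ, if_true, sub_eq_zero] at h4 h5
    exact ⟨h4, by rw [h5, mul_comm]⟩
  constructor
  · have : coeffs U ≤ LinearMap.eqLocus (conv f h) (f 1 • h) :=
      Submodule.span_le.2 (by rintro _ ⟨i, j, rfl⟩; exact (h3 i j).1)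
    exact this ha
  · have : coeffs U ≤ LinearMap.eqLocus (conv h f) (f 1 • h) :=
      Submodule.span_le.2 (by rintro _ ⟨i, j, rfl⟩; exact (h3 i j).2)
    exact this ha

-- Invariance says that the functional kills the span `N ⊤` of all `(f ⊗ id)Δ(a) - f(1)a` and their
-- mirror images. If `1` were in this span, it would already be in the span for a single
-- corepresentation, where a functional with value `1` at `1` kills the span. Hence some functional
-- kills `N ⊤` but not `1`, and it only remains to normalize it.
variable (A) in
theorem exists_haar_conv (hA : IsCompactMatrixQuantumGroup A) : ∃ h : A →ₗ[ℂ] ℂ, h 1 = 1 ∧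
    ∀ a f, conv f h a = f 1 * h a ∧ conv h f a = f 1 * h a := by
  let N (S : Submodule ℂ A) : Submodule ℂ A := Submodule.span ℂ
    {x | ∃ a ∈ S, ∃ f : A →ₗ[ℂ] ℂ, x = sliceL f (Coalgebra.comul (R := ℂ) a) - f 1 • a ∨
      x = sliceR f (Coalgebra.comul (R := ℂ) a) - f 1 • a}
  have hN : ∀ S T, S ≤ T → N S ≤ N T := fun S T h => Submodule.span_mono
    fun x ⟨a, ha, f, hx⟩ => ⟨a, h ha, f, hx⟩
  have hL : ∀ (f g : A →ₗ[ℂ] ℂ) x, g (sliceL f x) = LinearMap.mul' ℂ ℂ (TensorProduct.map f g x) :=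
    fun f g x => by
      induction x with
      | zero => simp
      | add x y hx hy => simp only [map_add, hx, hy]
      | tmul x y => simp
  have hR : ∀ (f g : A →ₗ[ℂ] ℂ) x, g (sliceR f x) = LinearMap.mul' ℂ ℂ (TensorProduct.map g f x) :=
    fun f g x => by
      induction x with
      | zero => simp
      | add x y hx hy => simp only [map_add, hx, hy]
      | tmul x y => simp [mul_comm]
  have hmem : ∀ x ∈ N ⊤, ∃ (ι : Type) (_ : Fintype ι) (_ : DecidableEq ι) (U : Matrix ι ι A),
      IsUnitaryCorep U ∧ x ∈ N (coeffs U) := by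
    intro x hx
    induction hx using Submodule.span_induction with
    | mem x hx =>
      obtain ⟨a, -, f, hx⟩ := hx
      obtain ⟨ι, _, _, U, hU, ha⟩ := exists_mem_coeffs hA a
      exact ⟨ι, inferInstance, inferInstance, U, hU, Submodule.subset_span ⟨a, ha, f, hx⟩⟩
    | zero => exact ⟨Unit, inferInstance, inferInstance, 1, .one, zero_mem _⟩
    | add x y _ _ hx hy =>
      obtain ⟨ι, _, _, U, hU, hx⟩ := hx
      obtain ⟨κ, _, _, V, hV, hy⟩ := hy
      exact ⟨ι ⊕ κ, inferInstance, inferInstance, _, hU.fromBlocks hV,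
        add_mem (hN _ _ (coeffs_fromBlocks_left U V) hx)
          (hN _ _ (coeffs_fromBlocks_right U V) hy)⟩
    | smul c x _ hx =>
      obtain ⟨ι, _, _, U, hU, hx⟩ := hx
      exact ⟨ι, inferInstance, inferInstance, U, hU, Submodule.smul_mem _ c hx⟩
  have h1 : (1 : A) ∉ N ⊤ := by
    intro h1
    obtain ⟨ι, _, _, U, hU, h1⟩ := hmem 1 h1
    have hV := hU.fromBlocks (IsUnitaryCorep.one (A := A))
    obtain ⟨h, hh1, hh⟩ := exists_haar_coeffs hV
    have : N (coeffs (Matrix.fromBlocks U 0 0 (1 : Matrix Unit Unit A))) ≤ LinearMap.ker h := by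
      refine Submodule.span_le.2 ?_
      rintro _ ⟨a, ha, f, rfl | rfl⟩
      · change h _ = 0
        rw [map_sub, hL, map_smul, smul_eq_mul, ← (hh a ha f).1, sub_eq_zero]; rfl
      · change h _ = 0
        rw [map_sub, hR, map_smul, smul_eq_mul, ← (hh a ha f).2, sub_eq_zero]; rfl
    have := this (hN _ _ (coeffs_fromBlocks_left U _) h1)
    rw [LinearMap.mem_ker, hh1] at this
    exact one_ne_zero this
  obtain ⟨h, hh, hN⟩ := Submodule.exists_le_ker_of_notMem h1
  have h2 : ∀ a f, conv f h a = f 1 * h a ∧ conv h f a = f 1 * h a := by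
    intro a f
    have hl := hN (Submodule.subset_span ⟨a, trivial, f, Or.inl rfl⟩)
    have hr := hN (Submodule.subset_span ⟨a, trivial, f, Or.inr rfl⟩)
    rw [LinearMap.mem_ker, map_sub, hL, map_smul, smul_eq_mul, sub_eq_zero] at hl
    rw [LinearMap.mem_ker, map_sub, hR, map_smul, smul_eq_mul, sub_eq_zero] at hr
    exact ⟨hl, hr⟩
  have h3 : ∀ (c : ℂ) (f g : A →ₗ[ℂ] ℂ) a, conv f (c • g) a = c * conv f g a ∧
      conv (c • f) g a = c * conv f g a := by
    intro c f g a
    simp only [conv, LinearMap.comp_apply, TensorProduct.map_smul_left,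
      TensorProduct.map_smul_right, LinearMap.smul_apply, map_smul, smul_eq_mul, and_self]
  refine ⟨(h 1)⁻¹ • h, by simp [hh], fun a f => ?_⟩
  rw [(h3 _ _ _ _).1, (h3 _ _ _ _).2, (h2 a f).1, (h2 a f).2, LinearMap.smul_apply, smul_eq_mul]
  constructor <;> ring

/-- A normalized two-sided invariant functional. -/
structure IsHaar (h : A →ₗ[ℂ] ℂ) : Prop where
  one : h 1 = 1
  left : ∀ a, sliceL h (Coalgebra.comul (R := ℂ) a) = h a • 1
  right : ∀ a, sliceR h (Coalgebra.comul (R := ℂ) a) = h a • 1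

-- Functionals separate the points of `A`, so the scalar identities for all `f` give invariance as
-- identities in `A`.
variable (A) in
theorem exists_haar (hA : IsCompactMatrixQuantumGroup A) : ∃ h : A →ₗ[ℂ] ℂ, IsHaar h := by
  obtain ⟨h, h1, h2⟩ := exists_haar_conv A hA
  have hL : ∀ (f g : A →ₗ[ℂ] ℂ) x, g (sliceL f x) = LinearMap.mul' ℂ ℂ (TensorProduct.map f g x) :=
    fun f g x => by
      induction x with
      | zero => simp
      | add x y hx hy => simp only [map_add, hx, hy]
      | tmul x y => simp
  have hR : ∀ (f g : A →ₗ[ℂ] ℂ) x, g (sliceR f x) = LinearMap.mul' ℂ ℂ (TensorProduct.map g f x) :=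
    fun f g x => by
      induction x with
      | zero => simp
      | add x y hx hy => simp only [map_add, hx, hy]
      | tmul x y => simp [mul_comm]
  refine ⟨h, h1, fun a => ?_, fun a => ?_⟩ <;>
  · rw [← sub_eq_zero]
    refine (Module.forall_dual_apply_eq_zero_iff ℂ _).1 fun f => ?_
    rw [map_sub, map_smul, smul_eq_mul, sub_eq_zero, mul_comm]
    first | exact (hL h f _).trans (h2 a f).2 | exact (hR h f _).trans (h2 a f).1

theorem IsCorep.comul_antipode (hA : IsCompactMatrixQuantumGroup A) {ι : Type} [Fintype ι]
    [DecidableEq ι] {U : Matrix ι ι A} (hU : IsCorep U) (i j : ι) :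
    Coalgebra.comul (R := ℂ) (HopfAlgebra.antipode ℂ (U i j)) =
      ∑ k, HopfAlgebra.antipode ℂ (U k j) ⊗ₜ[ℂ] HopfAlgebra.antipode ℂ (U i k) := by
  rw [QPB.comul_antipode hA, hU.comul]
  simp

/-- `∑ h(κ(x) y⁽¹⁾) y⁽²⁾ = ∑ x⁽¹⁾ h(κ(x⁽²⁾) y)` for a matrix coefficient `x`. -/
theorem IsHaar.exchange_left (hA : IsCompactMatrixQuantumGroup A) {h : A →ₗ[ℂ] ℂ} (hh : IsHaar h)
    {ι : Type} [Fintype ι] [DecidableEq ι] {U : Matrix ι ι A} (hU : IsCorep U) (n i : ι) (y : A) :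
    sliceL (h ∘ₗ LinearMap.mulLeft ℂ (HopfAlgebra.antipode ℂ (U n i)))
      (Coalgebra.comul (R := ℂ) y) = ∑ l, h (HopfAlgebra.antipode ℂ (U l i) * y) • U n l := by
  set S : ι → A := fun k => sliceL (h ∘ₗ LinearMap.mulLeft ℂ (HopfAlgebra.antipode ℂ (U k i)))
      (Coalgebra.comul (R := ℂ) y) with hS
  -- Left invariance of `h` at `κ(U l i) y`. Multiplying by `U n l` and summing over `l` then
  -- cancels the antipode.
  have key : ∀ l, h (HopfAlgebra.antipode ℂ (U l i) * y) • (1 : A) =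
      ∑ k, HopfAlgebra.antipode ℂ (U l k) * S k := by
    intro l
    rw [← hh.left, Bialgebra.comul_mul, hU.comul_antipode hA, Finset.sum_mul, map_sum]
    refine Finset.sum_congr rfl fun k _ => ?_
    simp only [hS]
    induction Coalgebra.comul (R := ℂ) y with
    | zero => simp
    | add x y hx hy => simp only [map_add, mul_add, hx, hy]
    | tmul x y => simp
  have h2 : ∀ l, h (HopfAlgebra.antipode ℂ (U l i) * y) • U n l =
      ∑ k, U n l * HopfAlgebra.antipode ℂ (U l k) * S k := by
    intro l
    rw [← mul_one (U n l), ← mul_smul_comm, key, Finset.mul_sum, mul_one]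
    simp only [mul_assoc]
  simp only [h2]
  rw [Finset.sum_comm]
  simp only [← Finset.sum_mul, hU.mul_antipode, ite_mul, one_mul, zero_mul, Finset.sum_ite_eq,
    Finset.mem_univ, if_true]
  rfl

/-- `∑ w⁽¹⁾ h(w⁽²⁾ κ(x)) = ∑ h(w κ(x⁽¹⁾)) x⁽²⁾` for a matrix coefficient `x`. -/
theorem IsHaar.exchange_right (hA : IsCompactMatrixQuantumGroup A) {h : A →ₗ[ℂ] ℂ} (hh : IsHaar h)
    {ι : Type} [Fintype ι] [DecidableEq ι] {U : Matrix ι ι A} (hU : IsCorep U) (n i : ι) (w : A) :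
    sliceR (h ∘ₗ LinearMap.mulRight ℂ (HopfAlgebra.antipode ℂ (U n i)))
      (Coalgebra.comul (R := ℂ) w) = ∑ l, h (w * HopfAlgebra.antipode ℂ (U n l)) • U l i := by
  set S : ι → A := fun k => sliceR (h ∘ₗ LinearMap.mulRight ℂ (HopfAlgebra.antipode ℂ (U n k)))
      (Coalgebra.comul (R := ℂ) w) with hS
  -- Right invariance of `h` at `w κ(U n l)`. Multiplying by `U l i` on the right and summing over
  -- `l` then cancels the antipode.
  have key : ∀ l, h (w * HopfAlgebra.antipode ℂ (U n l)) • (1 : A) =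
      ∑ k, S k * HopfAlgebra.antipode ℂ (U k l) := by
    intro l
    rw [← hh.right, Bialgebra.comul_mul, hU.comul_antipode hA, Finset.mul_sum, map_sum]
    refine Finset.sum_congr rfl fun k _ => ?_
    simp only [hS]
    induction Coalgebra.comul (R := ℂ) w with
    | zero => simp
    | add x y hx hy => simp only [map_add, add_mul, hx, hy]
    | tmul x y => simp
  have h2 : ∀ l, h (w * HopfAlgebra.antipode ℂ (U n l)) • U l i =
      ∑ k, S k * (HopfAlgebra.antipode ℂ (U k l) * U l i) := by
    intro l
    rw [← one_mul (U l i), ← smul_mul_assoc, key, Finset.sum_mul, one_mul]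
    simp only [mul_assoc]
  simp only [h2]
  rw [Finset.sum_comm]
  simp only [← Finset.mul_sum, hU.antipode_mul, mul_ite, mul_one, mul_zero, Finset.sum_ite_eq',
    Finset.mem_univ, if_true]
  rfl

end Corep

/-! ### Frames in comodules -/

section Frames

universe uA

variable {A : Type uA} [Ring A] [HopfAlgebra ℂ A] {X : Type*} [AddCommGroup X] [Module ℂ X]

/-- Right coactions on a vector space. -/
structure IsCoaction (ρ : X →ₗ[ℂ] X ⊗[ℂ] A) : Prop where
  coassoc : ∀ x, TensorProduct.assoc ℂ X A A (TensorProduct.map ρ LinearMap.id (ρ x)) =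
    TensorProduct.map LinearMap.id Coalgebra.comul (ρ x)
  counit : ∀ x, sliceR Coalgebra.counit (ρ x) = x

/-- A family of vectors transforming by a matrix corepresentation. -/
structure IsFrame (ρ : X →ₗ[ℂ] X ⊗[ℂ] A) {n : ℕ} (e : Fin n → X)
    (U : Matrix (Fin n) (Fin n) A) : Prop where
  corep : IsCorep U
  apply : ∀ i, ρ (e i) = ∑ j, e j ⊗ₜ[ℂ] U j i

/-- The contractions of `ρ x` with all functionals form a finite-dimensional subcomodule of `W`,
which contains `x` by the counit law. A basis of it is a frame. This replaces Sweedler notation by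
finite matrix sums. -/
theorem IsCoaction.exists_frame {ρ : X →ₗ[ℂ] X ⊗[ℂ] A} (hρ : IsCoaction ρ) {W : Submodule ℂ X}
    (hW : ∀ x ∈ W, ρ x ∈ tens W ⊤) {x : X} (hx : x ∈ W) :
    ∃ (n : ℕ) (e : Fin n → X) (U : Matrix (Fin n) (Fin n) A), IsFrame ρ e U ∧ (∀ i, e i ∈ W) ∧
      x ∈ Submodule.span ℂ (Set.range e) := by
  let S : (A →ₗ[ℂ] ℂ) →ₗ[ℂ] X :=
    { toFun := fun f => sliceR f (ρ x)
      map_add' := fun f g => by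
        simp only [sliceR, TensorProduct.map_add_right, LinearMap.comp_apply, LinearMap.add_apply,
          map_add]
      map_smul' := fun c f => by
        simp only [sliceR, TensorProduct.map_smul_right, LinearMap.comp_apply,
          LinearMap.smul_apply, map_smul, RingHom.id_apply] }
  let V := LinearMap.range S
  have hVW : V ≤ W := by
    rintro _ ⟨f, rfl⟩
    exact mem_tens_iff_sliceR.1 (hW x hx) f
  have hxV : x ∈ V := ⟨Coalgebra.counit, hρ.counit x⟩
  have hVfin : FiniteDimensional ℂ V := by
    obtain ⟨s, hs⟩ : ∃ s : Finset X, ∀ f, sliceR f (ρ x) ∈ Submodule.span ℂ (s : Set X) := by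
      classical
      induction ρ x with
      | zero => exact ⟨∅, by simp⟩
      | tmul x a =>
        exact ⟨{x}, fun f => by
          rw [sliceR_tmul]; exact Submodule.smul_mem _ _ (Submodule.subset_span (by simp))⟩
      | add x y hx hy =>
        obtain ⟨s, hs⟩ := hx
        obtain ⟨t, ht⟩ := hy
        refine ⟨s ∪ t, fun f => ?_⟩
        rw [map_add]
        exact add_mem (Submodule.span_mono (by simp) (hs f)) (Submodule.span_mono (by simp) (ht f))
    have : V ≤ Submodule.span ℂ (s : Set X) := by
      rintro _ ⟨f, rfl⟩
      exact hs f
    exact Submodule.finiteDimensional_of_le this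
  -- By coassociativity, contracting `ρ` of a contraction is contracting `ρ x` with the convolution
  -- of the two functionals.
  have hVρ : ∀ v ∈ V, ρ v ∈ tens V ⊤ := by
    rintro _ ⟨f, rfl⟩
    rw [mem_tens_iff_sliceR]
    intro g
    refine ⟨LinearMap.mul' ℂ ℂ ∘ₗ TensorProduct.map g f ∘ₗ Coalgebra.comul, ?_⟩
    have h1 : ∀ z : X ⊗[ℂ] A, sliceR (LinearMap.mul' ℂ ℂ ∘ₗ TensorProduct.map g f)
        (TensorProduct.assoc ℂ X A A (TensorProduct.map ρ LinearMap.id z)) =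
        sliceR g (ρ (sliceR f z)) := by
      intro z
      induction z with
      | zero => simp
      | add x y hx hy => simp only [map_add, hx, hy]
      | tmul x a =>
        simp only [TensorProduct.map_tmul, LinearMap.id_apply, sliceR_tmul, map_smul]
        induction ρ x with
        | zero => simp
        | add x y hx hy => simp only [map_add, TensorProduct.add_tmul, hx, hy, smul_add]
        | tmul x b => simp [smul_smul, mul_comm]
    change sliceR _ (ρ x) = sliceR g (ρ (sliceR f (ρ x)))
    rw [← h1, hρ.coassoc, sliceR_map]
    rfl
  let b := Module.finBasis ℂ V
  obtain ⟨p, hp, hp'⟩ := exists_proj V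
  let co : Fin (Module.finrank ℂ V) → X →ₗ[ℂ] ℂ := fun i => b.coord i ∘ₗ p.codRestrict V hp
  have hco : ∀ v ∈ V, ∑ j, co j v • (b j : X) = v := by
    intro v hv
    have h1 : p.codRestrict V hp v = ⟨v, hv⟩ := Subtype.ext (hp' v hv)
    have h2 := congrArg Subtype.val (b.sum_repr ⟨v, hv⟩)
    simp only [AddSubmonoidClass.coe_finsetSum, Submodule.coe_smul] at h2
    conv_rhs => rw [← h2]
    simp only [co, LinearMap.comp_apply, h1, Module.Basis.coord_apply]
  have hcob : ∀ i j, co i (b j : X) = if i = j then 1 else 0 := by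
    intro i j
    have h1 : p.codRestrict V hp (b j : X) = b j := Subtype.ext (hp' _ (b j).2)
    simp only [co, LinearMap.comp_apply, h1, Module.Basis.coord_apply, Module.Basis.repr_self,
      Finsupp.single_apply, eq_comm]
  let U : Matrix (Fin (Module.finrank ℂ V)) (Fin (Module.finrank ℂ V)) A :=
    Matrix.of fun i j => sliceL (co i) (ρ (b j))
  have hexp : ∀ z ∈ tens V (⊤ : Submodule ℂ A), ∑ j, (b j : X) ⊗ₜ[ℂ] sliceL (co j) z = z := by
    intro z hz
    refine eqOn_tens (f := ∑ j, (TensorProduct.mk ℂ X A (b j : X)) ∘ₗ sliceL (co j))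
      (g := LinearMap.id) ?_ hz |> fun h => by simpa using h
    intro v hv a _
    simp only [LinearMap.sum_apply, LinearMap.comp_apply, TensorProduct.mk_apply, sliceL_tmul,
      TensorProduct.tmul_smul, LinearMap.id_apply, TensorProduct.smul_tmul']
    rw [← TensorProduct.sum_tmul, hco v hv]
  have happ : ∀ i, ρ (b i : X) = ∑ j, (b j : X) ⊗ₜ[ℂ] U j i := fun i =>
    (hexp _ (hVρ _ (b i).2)).symm
  refine ⟨_, fun i => b i, U, ⟨⟨fun i j => ?_, fun i j => ?_⟩, happ⟩, fun i => hVW (b i).2, ?_⟩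
  · have h1 := hρ.coassoc (b j : X)
    rw [happ] at h1
    simp only [map_sum, TensorProduct.map_tmul, happ, LinearMap.id_apply, TensorProduct.sum_tmul,
      TensorProduct.assoc_tmul] at h1
    have h2 := congrArg (sliceL (co i)) h1
    simp only [map_sum, sliceL_tmul, hcob, ite_smul, one_smul, zero_smul, Finset.sum_ite_eq,
      Finset.mem_univ, if_true] at h2
    exact h2.symm
  · have h1 := hρ.counit (b j : X)
    rw [happ] at h1
    have h2 := congrArg (co i) h1
    simp only [map_sum, sliceR_tmul, map_smul, hcob, smul_eq_mul, mul_ite, mul_one, mul_zero,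
      Finset.sum_ite_eq, Finset.mem_univ, if_true] at h2
    exact h2
  · rw [← hco x hxV]
    exact sum_mem fun j _ => Submodule.smul_mem _ _ (Submodule.subset_span ⟨j, rfl⟩)

/-- Linear maps agreeing on frames agree. -/
theorem IsCoaction.ext {ρ : X →ₗ[ℂ] X ⊗[ℂ] A} (hρ : IsCoaction ρ) {W : Submodule ℂ X}
    (hW : ∀ x ∈ W, ρ x ∈ tens W ⊤) {Y : Type*} [AddCommGroup Y] [Module ℂ Y] {f g : X →ₗ[ℂ] Y}
    (h : ∀ (n : ℕ) (e : Fin n → X) (U : Matrix (Fin n) (Fin n) A), IsFrame ρ e U →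
      (∀ i, e i ∈ W) → ∀ i, f (e i) = g (e i)) {x : X} (hx : x ∈ W) : f x = g x := by
  obtain ⟨n, e, U, he, heW, hx⟩ := hρ.exists_frame hW hx
  have : Submodule.span ℂ (Set.range e) ≤ LinearMap.eqLocus f g :=
    Submodule.span_le.2 (by rintro _ ⟨i, rfl⟩; exact h n e U he heW i)
  exact this hx

end Frames

end QPB
end

noncomputable section
namespace QPB

/-! ### Total differentials on tensor products -/

section Total

variable {X Y : Type*} [Ring X] [Algebra ℂ X] (𝒜 : ℕ → Submodule ℂ X) [GradedAlgebra 𝒜]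
  [Ring Y] [Algebra ℂ Y] (ℬ : ℕ → Submodule ℂ Y) [GradedAlgebra ℬ]

/-- The total differential `d ⊗ id + γ ⊗ d` on a tensor product. -/
def totD (d : X →ₗ[ℂ] X) (d' : Y →ₗ[ℂ] Y) : X ⊗[ℂ] Y →ₗ[ℂ] X ⊗[ℂ] Y :=
  TensorProduct.map d LinearMap.id + TensorProduct.map (gradeInvolution 𝒜) d'

@[simp] theorem totD_tmul (d : X →ₗ[ℂ] X) (d' : Y →ₗ[ℂ] Y) (x : X) (y : Y) :
    totD 𝒜 d d' (x ⊗ₜ y) = d x ⊗ₜ y + gradeInvolution 𝒜 x ⊗ₜ d' y := rfl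

/-- The total degree operator on a tensor product. -/
def totDeg : X ⊗[ℂ] Y →ₗ[ℂ] X ⊗[ℂ] Y :=
  TensorProduct.map (degOp 𝒜) LinearMap.id + TensorProduct.map LinearMap.id (degOp ℬ)

@[simp] theorem totDeg_tmul (x : X) (y : Y) :
    totDeg 𝒜 ℬ (x ⊗ₜ y) = degOp 𝒜 x ⊗ₜ y + x ⊗ₜ degOp ℬ y := rfl

variable {𝒜 ℬ}

theorem degOp_of_mem_zero {x : X} (hx : x ∈ 𝒜 0) : degOp 𝒜 x = 0 := by
  rw [degOp, gradeMap_of_mem hx]; simp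

theorem degOp_gradeInvolution (x : X) :
    degOp 𝒜 (gradeInvolution 𝒜 x) = gradeInvolution 𝒜 (degOp 𝒜 x) := by
  rw [degOp, gradeInvolution_eq, ← LinearMap.comp_apply, ← LinearMap.comp_apply, gradeMap_comp,
    gradeMap_comp]
  simp only [mul_comm]

theorem totDeg_totD {d : X →ₗ[ℂ] X} (h : ∀ n, ∀ x ∈ 𝒜 n, d x ∈ 𝒜 (n + 1)) {d' : Y →ₗ[ℂ] Y}
    (h' : ∀ n, ∀ x ∈ ℬ n, d' x ∈ ℬ (n + 1)) (z : X ⊗[ℂ] Y) :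
    totDeg 𝒜 ℬ (totD 𝒜 d d' z) = totD 𝒜 d d' (totDeg 𝒜 ℬ z) + totD 𝒜 d d' z := by
  induction z with
  | zero => simp
  | add x y hx hy => simp only [map_add, hx, hy]; abel
  | tmul x y =>
    simp only [totD_tmul, totDeg_tmul, map_add, degOp_comp_of_mem h, degOp_comp_of_mem h',
      TensorProduct.add_tmul, TensorProduct.tmul_add, degOp_gradeInvolution]
    abel

theorem totDeg_mul {u : X ⊗[ℂ] Y} (hu : u ∈ tens (𝒜 0) (ℬ 0)) (z : X ⊗[ℂ] Y) :
    totDeg 𝒜 ℬ (u * z) = u * totDeg 𝒜 ℬ z := by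
  refine eqOn_tens (f := totDeg 𝒜 ℬ ∘ₗ LinearMap.mulRight ℂ z)
    (g := LinearMap.mulRight ℂ (totDeg 𝒜 ℬ z)) (fun x hx y hy => ?_) hu
  simp only [LinearMap.comp_apply, LinearMap.mulRight_apply]
  induction z with
  | zero => simp
  | add z z' hz hz' => simp only [map_add, mul_add, hz, hz']
  | tmul x' y' =>
    simp only [Algebra.TensorProduct.tmul_mul_tmul, totDeg_tmul, degOp_mul, mul_add, degOp_of_mem_zero hx,
      degOp_of_mem_zero hy,
      zero_mul, zero_add]

/-- The component of degree `k` in the second factor. -/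
abbrev compR (ℬ : ℕ → Submodule ℂ Y) [GradedAlgebra ℬ] (k : ℕ) : X ⊗[ℂ] Y →ₗ[ℂ] X ⊗[ℂ] Y :=
  TensorProduct.map LinearMap.id (gproj ℬ k)

theorem compR_mem (k : ℕ) (z : X ⊗[ℂ] Y) : compR ℬ k z ∈ tens ⊤ (ℬ k) :=
  map_mem_tens (fun _ _ => Submodule.mem_top) (fun y _ => gproj_mem k y) (mem_tens_top z)

theorem compR_of_mem {k : ℕ} {z : X ⊗[ℂ] Y} (hz : z ∈ tens ⊤ (ℬ k)) : compR ℬ k z = z :=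
  map_eq_self_of_mem_tens (fun _ _ => rfl) (fun _ h => gproj_of_mem h) hz

theorem compR_of_mem_ne {k l : ℕ} (h : k ≠ l) {z : X ⊗[ℂ] Y} (hz : z ∈ tens ⊤ (ℬ k)) :
    compR ℬ l z = 0 :=
  eqOn_tens (g := 0) (fun x _ y hy => by simp [gproj_of_mem_ne hy h]) hz

theorem mem_tens_iSup_iff {k : ℤ} {z : X ⊗[ℂ] Y} :
    z ∈ tens ⊤ (⨆ (i : ℕ) (_ : (i : ℤ) ≤ k), ℬ i) ↔ ∀ j : ℕ, k < j → compR ℬ j z = 0 := by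
  rw [mem_tens_iff_sliceL]
  simp only [mem_iSup_deg_iff]
  constructor
  · intro h j hj
    apply eq_zero_of_sliceL
    intro l
    rw [sliceL_map, LinearMap.comp_id, h l j hj]
  · intro h l j hj
    have := sliceL_map l LinearMap.id (gproj ℬ j) z
    rw [LinearMap.comp_id] at this
    rw [← this, h j hj, map_zero]

/-- An eigenvector of the total degree operator of degree `k` in the second factor is homogeneous in
the first one. -/
theorem mem_tens_of_totDeg {p k : ℕ} {z : X ⊗[ℂ] Y} (hz : z ∈ tens ⊤ (ℬ k))
    (h : totDeg 𝒜 ℬ z = ((p + k : ℕ) : ℂ) • z) : z ∈ tens (𝒜 p) (ℬ k) := by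
  refine mem_tens ?_ hz
  rw [mem_tens_iff_sliceR]
  intro l
  apply mem_of_degOp
  have h1 : TensorProduct.map LinearMap.id (degOp ℬ) z = (k : ℂ) • z :=
    eqOn_tens (g := (k : ℂ) • LinearMap.id) (fun x _ y hy => by
      rw [TensorProduct.map_tmul, degOp, gradeMap_of_mem hy]; simp) hz
  have h2 : TensorProduct.map (degOp 𝒜) LinearMap.id z = (p : ℂ) • z := by
    rw [totDeg, LinearMap.add_apply, h1, Nat.cast_add, add_smul] at h
    exact add_right_cancel h
  have := sliceR_map l (degOp 𝒜) LinearMap.id z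
  rw [h2, map_smul, LinearMap.comp_id] at this
  exact this.symm

/-- The first leg of such a component would have the negative degree `n - k`. -/
theorem compR_eq_zero_of_totDeg {n k : ℕ} (hn : n < k) {z : X ⊗[ℂ] Y}
    (h : totDeg 𝒜 ℬ z = (n : ℂ) • z) : compR ℬ k z = 0 := by
  have hk := compR_mem (ℬ := ℬ) k z
  have hcomm : totDeg 𝒜 ℬ (compR ℬ k z) = (n : ℂ) • compR ℬ k z := by
    rw [← map_smul, ← h]
    clear h hk
    induction z with
    | zero => simp
    | add x y hx hy => simp only [map_add, hx, hy]
    | tmul x y =>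
      have : degOp ℬ (gproj ℬ k y) = gproj ℬ k (degOp ℬ y) := by
        rw [gproj_gradeMap, degOp, gradeMap_of_mem (gproj_mem k y)]
      simp only [totDeg_tmul, TensorProduct.map_tmul, map_add, LinearMap.id_apply, this]
  have h1 : TensorProduct.map LinearMap.id (degOp ℬ) (compR ℬ k z) = (k : ℂ) • compR ℬ k z :=
    eqOn_tens (g := (k : ℂ) • LinearMap.id) (fun x _ y hy => by
      rw [TensorProduct.map_tmul, degOp, gradeMap_of_mem hy]; simp) hk
  have h2 : TensorProduct.map (degOp 𝒜) LinearMap.id (compR ℬ k z) =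
      ((n : ℂ) - k) • compR ℬ k z := by
    rw [totDeg, LinearMap.add_apply, h1] at hcomm
    rw [sub_smul, ← hcomm, add_sub_cancel_right]
  apply eq_zero_of_sliceR
  intro l
  apply eq_zero_of_gproj (𝒜 := 𝒜)
  intro m
  have h3 := sliceR_map l (degOp 𝒜) LinearMap.id (compR ℬ k z)
  rw [h2, map_smul, LinearMap.comp_id] at h3
  refine gproj_eq_zero_of_gradeMap h3.symm fun h => ?_
  have : ((m + k : ℕ) : ℂ) = (n : ℂ) := by push_cast; rw [h]; ring
  have := Nat.cast_injective this
  omega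

theorem exists_sum_compR (z : X ⊗[ℂ] Y) :
    ∃ s : Finset ℕ, z = ∑ k ∈ s, compR ℬ k z ∧ ∀ k ∉ s, compR ℬ k z = 0 := by
  classical
  obtain ⟨s, hs⟩ : ∃ s : Finset ℕ, ∀ k ∉ s, compR ℬ k z = 0 := by
    induction z with
    | zero => exact ⟨∅, by simp⟩
    | add x y hx hy =>
      obtain ⟨s, hs⟩ := hx
      obtain ⟨t, ht⟩ := hy
      refine ⟨s ∪ t, fun k hk => ?_⟩
      rw [Finset.notMem_union] at hk
      rw [map_add, hs k hk.1, ht k hk.2, add_zero]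
    | tmul x y =>
      refine ⟨(DirectSum.decompose ℬ y).support, fun k hk => ?_⟩
      rw [DFinsupp.notMem_support_iff] at hk
      simp [GradedAlgebra.proj_apply, hk]
  refine ⟨s, ?_, hs⟩
  rw [← sub_eq_zero]
  have h0 : ∀ w : X ⊗[ℂ] Y, (∀ k, compR ℬ k w = 0) → w = 0 := by
    intro w hw
    apply eq_zero_of_sliceL
    intro l
    apply eq_zero_of_gproj (𝒜 := ℬ)
    intro k
    have := sliceL_map l LinearMap.id (gproj ℬ k) w
    rw [LinearMap.comp_id] at this
    rw [← this, hw k, map_zero]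
  apply h0
  intro k
  rw [map_sub, map_sum, sub_eq_zero]
  by_cases hk : k ∈ s
  · rw [Finset.sum_eq_single_of_mem k hk fun l _ hl => compR_of_mem_ne hl (compR_mem l z),
      compR_of_mem (compR_mem k z)]
  · rw [hs k hk, Finset.sum_eq_zero fun l hl => compR_of_mem_ne (ne_of_mem_of_not_mem hl hk)
      (compR_mem l z)]

variable (𝒜 ℬ) in
/-- The product of the graded tensor product, on the underlying vector space. -/
def gmul (z z' : X ⊗[ℂ] Y) : X ⊗[ℂ] Y :=
  (GradedTensorProduct.of ℂ 𝒜 ℬ).symm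
    (GradedTensorProduct.of ℂ 𝒜 ℬ z * GradedTensorProduct.of ℂ 𝒜 ℬ z')

theorem gmul_add_left (a b c : X ⊗[ℂ] Y) : gmul 𝒜 ℬ (a + b) c = gmul 𝒜 ℬ a c + gmul 𝒜 ℬ b c := by
  simp only [gmul, map_add, add_mul]

theorem gmul_add_right (a b c : X ⊗[ℂ] Y) : gmul 𝒜 ℬ a (b + c) = gmul 𝒜 ℬ a b + gmul 𝒜 ℬ a c := by
  simp only [gmul, map_add, mul_add]

variable (𝒜 ℬ) in
/-- The graded product as a bilinear map. -/
def gmulₗ : X ⊗[ℂ] Y →ₗ[ℂ] X ⊗[ℂ] Y →ₗ[ℂ] X ⊗[ℂ] Y :=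
  LinearMap.mk₂ ℂ (gmul 𝒜 ℬ) gmul_add_left (fun c a b => by simp [gmul]) gmul_add_right
    (fun c a b => by simp [gmul])

@[simp] theorem gmulₗ_apply (z z' : X ⊗[ℂ] Y) : gmulₗ 𝒜 ℬ z z' = gmul 𝒜 ℬ z z' := rfl

theorem gmul_tmul {j i : ℕ} (x : X) {y : Y} (hy : y ∈ ℬ j) {x' : X} (hx' : x' ∈ 𝒜 i) (y' : Y) :
    gmul 𝒜 ℬ (x ⊗ₜ y) (x' ⊗ₜ y') = ((-1 : ℂ) ^ (j * i)) • ((x * x') ⊗ₜ[ℂ] (y * y')) := by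
  rw [gmul, of_mul_of_of_mem (tmul_mem_tens Submodule.mem_top hy)
    (tmul_mem_tens hx' Submodule.mem_top), map_smul, GradedTensorProduct.of_symm_of,
    Algebra.TensorProduct.tmul_mul_tmul]

theorem gmul_of_left {z z' : X ⊗[ℂ] Y} (hz : z ∈ tens ⊤ (ℬ 0)) : gmul 𝒜 ℬ z z' = z * z' := by
  rw [gmul, of_mul_of_left hz, GradedTensorProduct.of_symm_of]

theorem gmul_of_right {z z' : X ⊗[ℂ] Y} (hz : z' ∈ tens (𝒜 0) ⊤) : gmul 𝒜 ℬ z z' = z * z' := by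
  rw [gmul, of_mul_of_right hz, GradedTensorProduct.of_symm_of]

/-- For an inner degree one the Koszul sign is the grading involution of the other inner leg. -/
theorem gmul_of_left_one {z z' : X ⊗[ℂ] Y} (hz : z ∈ tens ⊤ (ℬ 1)) :
    gmul 𝒜 ℬ z z' = z * TensorProduct.map (gradeInvolution 𝒜) LinearMap.id z' := by
  rw [← gmulₗ_apply]
  induction z' with
  | zero => simp [gmul]
  | add x y hx hy => simp only [map_add, mul_add, hx, hy]
  | tmul x y =>
    induction x using grading_induction (𝒜 := 𝒜) with
    | h0 => simp [gmul]
    | hadd x x' hx hx' => simp only [TensorProduct.add_tmul, map_add, mul_add, hx, hx']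
    | h n x hx =>
      rw [gmulₗ_apply, gmul, of_mul_of_of_mem hz (tmul_mem_tens hx Submodule.mem_top),
        TensorProduct.map_tmul, gradeInvolution_of_mem hx, ← TensorProduct.smul_tmul',
        mul_smul_comm, map_smul, one_mul, LinearMap.id_apply, GradedTensorProduct.of_symm_of]

theorem algMap_apply {X' Y' : Type*} [Ring X'] [Algebra ℂ X'] [Ring Y'] [Algebra ℂ Y']
    (f : X →ₐ[ℂ] X') (g : Y →ₐ[ℂ] Y') (z : X ⊗[ℂ] Y) : Algebra.TensorProduct.map f g z =
      TensorProduct.map f.toLinearMap g.toLinearMap z := rfl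

theorem gmul_mem {i j : ℕ} {z z' : X ⊗[ℂ] Y} (hz : z ∈ tens ⊤ (ℬ i)) (hz' : z' ∈ tens ⊤ (ℬ j)) :
    gmul 𝒜 ℬ z z' ∈ tens ⊤ (ℬ (i + j)) := by
  refine map_mem_of_mem_tens (f := (gmulₗ 𝒜 ℬ).flip z') (fun x _ y hy => ?_) hz
  refine map_mem_of_mem_tens (f := gmulₗ 𝒜 ℬ (x ⊗ₜ y)) (fun x' hx₀ y' hy' => ?_) hz'
  clear hx₀
  rw [gmulₗ_apply]
  induction x' using grading_induction (𝒜 := 𝒜) with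
  | h0 => simp [gmul]
  | hadd a b ha hb => rw [TensorProduct.add_tmul, gmul_add_right]; exact add_mem ha hb
  | h n x' hx' =>
    rw [gmul_tmul x hy hx']
    exact Submodule.smul_mem _ _ (tmul_mem_tens Submodule.mem_top (SetLike.mul_mem_graded hy hy'))

/-- The top component of a graded product. -/
theorem compR_gmul {i j : ℕ} {z z' : X ⊗[ℂ] Y} (hz : ∀ k : ℕ, i < k → compR ℬ k z = 0)
    (hz' : ∀ k : ℕ, j < k → compR ℬ k z' = 0) :
    compR ℬ (i + j) (gmul 𝒜 ℬ z z') = gmul 𝒜 ℬ (compR ℬ i z) (compR ℬ j z') ∧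
      ∀ k : ℕ, i + j < k → compR ℬ k (gmul 𝒜 ℬ z z') = 0 := by
  classical
  obtain ⟨s, hs, hs'⟩ := exists_sum_compR (ℬ := ℬ) z
  obtain ⟨t, ht, ht'⟩ := exists_sum_compR (ℬ := ℬ) z'
  have hexp : ∀ k, compR ℬ k (gmul 𝒜 ℬ z z') =
      ∑ a ∈ s, ∑ b ∈ t, compR ℬ k (gmul 𝒜 ℬ (compR ℬ a z) (compR ℬ b z')) := by
    intro k
    have : gmulₗ 𝒜 ℬ z z' = ∑ a ∈ s, ∑ b ∈ t, gmulₗ 𝒜 ℬ (compR ℬ a z) (compR ℬ b z') := by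
      conv_lhs => rw [hs, ht]
      simp only [map_sum, LinearMap.sum_apply]
      rw [Finset.sum_comm]
    simp only [gmulₗ_apply] at this
    rw [this]
    simp only [map_sum]
  have hz0 : ∀ w : X ⊗[ℂ] Y, gmul 𝒜 ℬ 0 w = 0 ∧ gmul 𝒜 ℬ w 0 = 0 := fun w => by simp [gmul]
  constructor
  · rw [hexp, Finset.sum_eq_single i, Finset.sum_eq_single j]
    · exact compR_of_mem (gmul_mem (compR_mem i z) (compR_mem j z'))
    · intro b _ hb
      exact compR_of_mem_ne (by omega) (gmul_mem (compR_mem i z) (compR_mem b z'))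
    · intro hj
      rw [ht' j hj, (hz0 _).2, map_zero]
    · intro a _ ha
      refine Finset.sum_eq_zero fun b _ => ?_
      by_cases h1 : i < a
      · rw [hz a h1, (hz0 _).1, map_zero]
      by_cases h2 : j < b
      · rw [hz' b h2, (hz0 _).2, map_zero]
      exact compR_of_mem_ne (by omega) (gmul_mem (compR_mem a z) (compR_mem b z'))
    · intro hi
      refine Finset.sum_eq_zero fun b _ => ?_
      rw [hs' i hi, (hz0 _).1, map_zero]
  · intro k hk
    rw [hexp]
    refine Finset.sum_eq_zero fun a _ => Finset.sum_eq_zero fun b _ => ?_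
    by_cases h1 : i < a
    · rw [hz a h1, (hz0 _).1, map_zero]
    by_cases h2 : j < b
    · rw [hz' b h2, (hz0 _).2, map_zero]
    exact compR_of_mem_ne (by omega) (gmul_mem (compR_mem a z) (compR_mem b z'))

end Total

end QPB
end

noncomputable section
namespace QPB

namespace BicovariantStarCalculus

universe uA uG

variable {A : Type uA} [Ring A] [StarRing A] [HopfAlgebra ℂ A]
variable {Γ : Type uG} [AddCommGroup Γ] [Module ℂ Γ] [Module A Γ] [Module Aᵐᵒᵖ Γ]
  [IsScalarTower ℂ A Γ] [IsScalarTower ℂ Aᵐᵒᵖ Γ] [SMulCommClass A Aᵐᵒᵖ Γ]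
variable (C : BicovariantStarCalculus A Γ)

/-! ### The coproduct of `Γ^∧` -/

theorem rightTwist_tmul_mul (T : A ⊗[ℂ] A →ₗ[ℂ] C.Envelope) (f g : A →ₗ[ℂ] C.Envelope)
    (hT : ∀ a b, T (a ⊗ₜ b) = f a * g b) (a b : A) :
    TensorProduct.map f LinearMap.id (Coalgebra.comul (R := ℂ) a) *
      TensorProduct.map g LinearMap.id (Coalgebra.comul (R := ℂ) b) =
    TensorProduct.map T LinearMap.id (rightTwist A (a ⊗ₜ b)) := by
  simp only [rightTwist, LinearMap.comp_apply, TensorProduct.map_tmul]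
  induction Coalgebra.comul (R := ℂ) a with
  | zero => simp
  | add x y hx hy => simp only [map_add, add_mul, TensorProduct.add_tmul, hx, hy]
  | tmul a1 a2 =>
    induction Coalgebra.comul (R := ℂ) b with
    | zero => simp
    | add x y hx hy => simp only [map_add, mul_add, TensorProduct.tmul_add, hx, hy]
    | tmul b1 b2 => simp [hT]

/-- The map `a ⊗ b ↦ f(a)g(b)` factors through `a ⊗ b ↦ a db` in `Γ`, so the sum is an image of the
element that vanishes by right covariance. -/
theorem rightTwist_zero (f g : A →ₗ[ℂ] C.Envelope)
    (hfg : ∀ (n : ℕ) (a b : Fin n → A), ∑ i, a i • C.d (b i) = 0 →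
      ∑ i, f (a i) * g (b i) = 0)
    (n : ℕ) (a b : Fin n → A) (h : ∑ i, a i • C.d (b i) = 0) :
    ∑ i, TensorProduct.map f LinearMap.id (Coalgebra.comul (R := ℂ) (a i)) *
      TensorProduct.map g LinearMap.id (Coalgebra.comul (R := ℂ) (b i)) = 0 := by
  set T : A ⊗[ℂ] A →ₗ[ℂ] C.Envelope := LinearMap.mul' ℂ C.Envelope ∘ₗ TensorProduct.map f g
  have hT : ∀ a b, T (a ⊗ₜ b) = f a * g b := fun a b => by simp [T]
  obtain ⟨G, hG⟩ := C.exists_factor T (fun n a b h => by simpa [hT] using hfg n a b h)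
  simp only [C.rightTwist_tmul_mul T f g hT]
  rw [← map_sum, ← map_sum, hG,
    show TensorProduct.map (G ∘ₗ formMap C.d) (LinearMap.id : A →ₗ[ℂ] A) =
      TensorProduct.map G LinearMap.id ∘ₗ TensorProduct.map (formMap C.d) LinearMap.id by
      rw [← TensorProduct.map_comp, LinearMap.id_comp],
    LinearMap.comp_apply, C.right_covariant _ (by simpa [formMap] using h), map_zero]

/-- `a ↦ ∑ a⁽¹⁾ ⊗ a⁽²⁾` in `Γ^∧ ⊗ Γ^∧`. -/
def cop (a : A) : C.Envelope ⊗[ℂ] C.Envelope :=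
  TensorProduct.map C.ofA.toLinearMap C.ofA.toLinearMap (Coalgebra.comul (R := ℂ) a)

/-- `a ↦ ∑ da⁽¹⁾ ⊗ a⁽²⁾`. -/
def copL (a : A) : C.Envelope ⊗[ℂ] C.Envelope :=
  TensorProduct.map C.dA C.ofA.toLinearMap (Coalgebra.comul (R := ℂ) a)

/-- `a ↦ ∑ a⁽¹⁾ ⊗ da⁽²⁾`. -/
def copR (a : A) : C.Envelope ⊗[ℂ] C.Envelope :=
  TensorProduct.map C.ofA.toLinearMap C.dA (Coalgebra.comul (R := ℂ) a)

theorem map_comul_mem {W W' : Submodule ℂ C.Envelope} {f g : A →ₗ[ℂ] C.Envelope}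
    (hf : ∀ a, f a ∈ W) (hg : ∀ a, g a ∈ W') (x : A ⊗[ℂ] A) :
    TensorProduct.map f g x ∈ tens W W' :=
  map_mem_tens (fun a _ => hf a) (fun a _ => hg a) (mem_tens_top x)

theorem cop_mem (a : A) : C.cop a ∈ tens (C.deg 0) (C.deg 0) :=
  C.map_comul_mem C.ofA_mem C.ofA_mem _

theorem copL_mem (a : A) : C.copL a ∈ tens (C.deg 1) (C.deg 0) :=
  C.map_comul_mem C.dA_mem C.ofA_mem _

theorem copR_mem (a : A) : C.copR a ∈ tens (C.deg 0) (C.deg 1) :=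
  C.map_comul_mem C.ofA_mem C.dA_mem _

theorem cop_mul (a b : A) : C.cop (a * b) = C.cop a * C.cop b := by
  rw [cop, Bialgebra.comul_mul]
  exact map_mul (Algebra.TensorProduct.map C.ofA C.ofA) _ _

theorem copL_mul (a b : A) : C.copL (a * b) = C.cop a * C.copL b + C.copL a * C.cop b := by
  simp only [cop, copL, Bialgebra.comul_mul]
  induction Coalgebra.comul (R := ℂ) a with
  | zero => simp
  | add x y hx hy => simp only [add_mul, map_add, hx, hy]; abel
  | tmul a1 a2 =>
    induction Coalgebra.comul (R := ℂ) b with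
    | zero => simp
    | add x y hx hy => simp only [mul_add, map_add, hx, hy]; abel
    | tmul b1 b2 => simp [C.dA_mul, TensorProduct.add_tmul]

theorem copR_mul (a b : A) : C.copR (a * b) = C.cop a * C.copR b + C.copR a * C.cop b := by
  simp only [cop, copR, Bialgebra.comul_mul]
  induction Coalgebra.comul (R := ℂ) a with
  | zero => simp
  | add x y hx hy => simp only [add_mul, map_add, hx, hy]; abel
  | tmul a1 a2 =>
    induction Coalgebra.comul (R := ℂ) b with
    | zero => simp
    | add x y hx hy => simp only [mul_add, map_add, hx, hy]; abel
    | tmul b1 b2 => simp [C.dA_mul, TensorProduct.tmul_add]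

theorem sum_left_zero {f g : A →ₗ[ℂ] C.Envelope}
    (hfg : ∀ (n : ℕ) (a b : Fin n → A), ∑ i, a i • C.d (b i) = 0 → ∑ i, f (a i) * g (b i) = 0)
    {n : ℕ} {a b : Fin n → A} (h : ∑ i, a i • C.d (b i) = 0) :
    ∑ i, TensorProduct.map C.ofA.toLinearMap f (Coalgebra.comul (R := ℂ) (a i)) *
      TensorProduct.map C.ofA.toLinearMap g (Coalgebra.comul (R := ℂ) (b i)) = 0 := by
  have h1 := congrArg (Algebra.TensorProduct.map C.ofA (AlgHom.id ℂ C.Envelope))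
    (C.leftTwist_zero f g hfg n a b h)
  rw [map_sum, map_zero] at h1
  rw [← h1]
  refine Finset.sum_congr rfl fun i _ => ?_
  rw [map_mul, algMap_apply, algMap_apply, map_map, map_map]
  rfl

theorem sum_right_zero {f g : A →ₗ[ℂ] C.Envelope}
    (hfg : ∀ (n : ℕ) (a b : Fin n → A), ∑ i, a i • C.d (b i) = 0 → ∑ i, f (a i) * g (b i) = 0)
    {n : ℕ} {a b : Fin n → A} (h : ∑ i, a i • C.d (b i) = 0) :
    ∑ i, TensorProduct.map f C.ofA.toLinearMap (Coalgebra.comul (R := ℂ) (a i)) *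
      TensorProduct.map g C.ofA.toLinearMap (Coalgebra.comul (R := ℂ) (b i)) = 0 := by
  have h1 := congrArg (Algebra.TensorProduct.map (AlgHom.id ℂ C.Envelope) C.ofA)
    (C.rightTwist_zero f g hfg n a b h)
  rw [map_sum, map_zero] at h1
  rw [← h1]
  refine Finset.sum_congr rfl fun i _ => ?_
  rw [map_mul, algMap_apply, algMap_apply, map_map, map_map]
  rfl

theorem sum_cop_copL {n : ℕ} {a b : Fin n → A} (h : ∑ i, a i • C.d (b i) = 0) :
    ∑ i, C.cop (a i) * C.copL (b i) = 0 :=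
  C.sum_right_zero C.compatible_gen.form h

theorem sum_cop_copR {n : ℕ} {a b : Fin n → A} (h : ∑ i, a i • C.d (b i) = 0) :
    ∑ i, C.cop (a i) * C.copR (b i) = 0 :=
  C.sum_left_zero C.compatible_gen.form h

theorem map_dΓ_left (a b : A) : TensorProduct.map C.dΓ LinearMap.id (C.cop a * C.copR b) =
    C.copL a * C.copR b + C.cop a *
      TensorProduct.map C.dA C.dA (Coalgebra.comul (R := ℂ) b) := by
  simp only [cop, copL, copR]
  induction Coalgebra.comul (R := ℂ) a with
  | zero => simp
  | add x y hx hy => simp only [add_mul, map_add, hx, hy]; abel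
  | tmul a1 a2 =>
    induction Coalgebra.comul (R := ℂ) b with
    | zero => simp
    | add x y hx hy => simp only [mul_add, map_add, hx, hy]; abel
    | tmul b1 b2 =>
      simp [C.dΓ_ofA_mul, C.dΓ_ofA, TensorProduct.add_tmul]

theorem map_dΓ_right (a b : A) : TensorProduct.map LinearMap.id C.dΓ (C.cop a * C.copL b) =
    C.copR a * C.copL b + C.cop a *
      TensorProduct.map C.dA C.dA (Coalgebra.comul (R := ℂ) b) := by
  simp only [cop, copL, copR]
  induction Coalgebra.comul (R := ℂ) a with
  | zero => simp
  | add x y hx hy => simp only [add_mul, map_add, hx, hy]; abel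
  | tmul a1 a2 =>
    induction Coalgebra.comul (R := ℂ) b with
    | zero => simp
    | add x y hx hy => simp only [mul_add, map_add, hx, hy]; abel
    | tmul b1 b2 =>
      simp [C.dΓ_ofA_mul, C.dΓ_ofA, TensorProduct.tmul_add]

/-- The two covariance identities are differentiated, one in the first leg and the other in the
second. Both produce the same sum of terms `a⁽¹⁾ db⁽¹⁾ ⊗ a⁽²⁾ db⁽²⁾`, which cancels in the
difference. -/
theorem sum_copL_copR {n : ℕ} {a b : Fin n → A} (h : ∑ i, a i • C.d (b i) = 0) :
    ∑ i, (C.copL (a i) * C.copR (b i) - C.copR (a i) * C.copL (b i)) = 0 := by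
  have h1 := congrArg (TensorProduct.map C.dΓ LinearMap.id) (C.sum_cop_copR h)
  have h2 := congrArg (TensorProduct.map LinearMap.id C.dΓ) (C.sum_cop_copL h)
  simp only [map_sum, map_dΓ_left, map_dΓ_right, map_zero, Finset.sum_add_distrib] at h1 h2
  rw [Finset.sum_sub_distrib, sub_eq_zero, ← add_left_inj, h1, h2]

/-- In the quadratic relation the two unmixed products vanish by covariance. The Koszul sign turns
the mixed ones into the difference treated by `sum_copL_copR`. -/
theorem compatible_phat : C.Compatible
    (fun a => GradedTensorProduct.of ℂ C.deg C.deg (C.cop a))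
    (fun a => GradedTensorProduct.of ℂ C.deg C.deg (C.copL a + C.copR a)) where
  add a b := by simp [cop]
  scalar c := by
    rw [cop, Bialgebra.comul_algebraMap, Algebra.TensorProduct.algebraMap_apply,
      TensorProduct.map_tmul, Algebra.algebraMap_eq_smul_one, map_smul, ← TensorProduct.smul_tmul',
      map_smul, Algebra.algebraMap_eq_smul_one]
    simp only [AlgHom.toLinearMap_apply, map_one]
    rfl
  mul a b := by
    rw [cop_mul, of_mul_of_left (tens_mono le_top le_rfl (C.cop_mem a))]
  leibniz a b := by
    rw [of_mul_of_left (tens_mono le_top le_rfl (C.cop_mem a)),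
      of_mul_of_right (tens_mono le_rfl le_top (C.cop_mem b)), copL_mul, copR_mul, ← map_add]
    congr 1
    rw [mul_add, add_mul]; abel
  form n a b h := by
    simp only [of_mul_of_left (tens_mono le_top le_rfl (C.cop_mem _)), ← map_sum, mul_add,
      Finset.sum_add_distrib, C.sum_cop_copL h, C.sum_cop_copR h, add_zero, map_zero]
  dform n a b h := by
    have h1 : ∀ a b : A, GradedTensorProduct.of ℂ C.deg C.deg (C.copL a + C.copR a) *
        GradedTensorProduct.of ℂ C.deg C.deg (C.copL b + C.copR b) =
        GradedTensorProduct.of ℂ C.deg C.deg (C.copL a * C.copL b + C.copR a * C.copR b +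
          (C.copL a * C.copR b - C.copR a * C.copL b)) := by
      intro a b
      rw [map_add, map_add, add_mul, mul_add, mul_add,
        of_mul_of_left (tens_mono le_top le_rfl (C.copL_mem a)),
        of_mul_of_left (tens_mono le_top le_rfl (C.copL_mem a)),
        of_mul_of_right (tens_mono le_rfl le_top (C.copR_mem b)),
        of_mul_of_of_mem (tens_mono le_top le_rfl (C.copR_mem a))
          (tens_mono le_rfl le_top (C.copL_mem b))]
      simp only [mul_one, pow_one, neg_smul, one_smul, map_add, map_sub]
      abel
    have h2 : ∑ i, C.copL (a i) * C.copL (b i) = 0 := C.sum_right_zero C.compatible_gen.dform h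
    have h3 : ∑ i, C.copR (a i) * C.copR (b i) = 0 := C.sum_left_zero C.compatible_gen.dform h
    simp only [h1, ← map_sum]
    rw [Finset.sum_add_distrib, Finset.sum_add_distrib, h2, h3, C.sum_copL_copR h]
    simp

/-- The coproduct of `Γ^∧`, as a homomorphism into the graded tensor product. -/
def phatHom : C.Envelope →ₐ[ℂ] C.deg ᵍ⊗[ℂ] C.deg := C.liftHom _ _ C.compatible_phat

/-- The coproduct of `Γ^∧`, with values in the underlying vector space. -/
def phat : C.Envelope →ₗ[ℂ] C.Envelope ⊗[ℂ] C.Envelope :=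
  (GradedTensorProduct.of ℂ C.deg C.deg).symm.toLinearMap ∘ₗ C.phatHom.toLinearMap

theorem phatHom_eq (x : C.Envelope) :
    C.phatHom x = GradedTensorProduct.of ℂ C.deg C.deg (C.phat x) := rfl

theorem phatHom_ofA (a : A) : C.phatHom (C.ofA a) = GradedTensorProduct.of ℂ C.deg C.deg (C.cop a) :=
  C.liftHom_gen _ _ C.compatible_phat (Sum.inl a)

theorem phatHom_dA (a : A) : C.phatHom (C.dA a) =
    GradedTensorProduct.of ℂ C.deg C.deg (C.copL a + C.copR a) :=
  C.liftHom_gen _ _ C.compatible_phat (Sum.inr a)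

theorem phat_one : C.phat 1 = 1 ⊗ₜ 1 := by
  rw [phat, LinearMap.comp_apply, AlgHom.toLinearMap_apply, map_one]; rfl

theorem phat_mul (x y : C.Envelope) :
    C.phat (x * y) = gmul C.deg C.deg (C.phat x) (C.phat y) := by
  rw [gmul, ← phatHom_eq, ← phatHom_eq, ← map_mul]; rfl

theorem phat_ofA (a : A) : C.phat (C.ofA a) = C.cop a :=
  (GradedTensorProduct.of ℂ C.deg C.deg).symm_apply_eq.2 (C.phatHom_ofA a)

theorem phat_dA (a : A) : C.phat (C.dA a) = C.copL a + C.copR a :=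
  (GradedTensorProduct.of ℂ C.deg C.deg).symm_apply_eq.2 (C.phatHom_dA a)

theorem phat_ofA_mul (a : A) (x : C.Envelope) : C.phat (C.ofA a * x) = C.cop a * C.phat x := by
  rw [phat_mul, phat_ofA, gmul_of_left (tens_mono le_top le_rfl (C.cop_mem a))]

theorem phat_dA_mul (a : A) (x : C.Envelope) : C.phat (C.dA a * x) = C.copL a * C.phat x +
    C.copR a * TensorProduct.map (gradeInvolution C.deg) LinearMap.id (C.phat x) := by
  rw [phat_mul, phat_dA, gmul_add_left, gmul_of_left (tens_mono le_top le_rfl (C.copL_mem a)),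
    gmul_of_left_one (tens_mono le_top le_rfl (C.copR_mem a))]

/-- The total differential of `Γ^∧ ⊗ Γ^∧`. -/
abbrev totΓ : C.Envelope ⊗[ℂ] C.Envelope →ₗ[ℂ] C.Envelope ⊗[ℂ] C.Envelope :=
  totD C.deg C.dΓ C.dΓ

theorem totΓ_cop_mul (a : A) (z : C.Envelope ⊗[ℂ] C.Envelope) : C.totΓ (C.cop a * z) =
    C.copL a * z + C.copR a * TensorProduct.map (gradeInvolution C.deg) LinearMap.id z +
      C.cop a * C.totΓ z := by
  simp only [cop, copL, copR]
  induction Coalgebra.comul (R := ℂ) a with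
  | zero => simp
  | add x y hx hy => simp only [add_mul, map_add, hx, hy]; abel
  | tmul a1 a2 =>
    induction z with
    | zero => simp
    | add x y hx hy => simp only [mul_add, map_add, hx, hy]; abel
    | tmul x y =>
      simp only [TensorProduct.map_tmul, AlgHom.toLinearMap_apply, totD_tmul, C.dΓ_ofA_mul,
        Algebra.TensorProduct.tmul_mul_tmul, gradeInvolution_mul, TensorProduct.add_tmul,
        TensorProduct.tmul_add, mul_add, gradeInvolution_of_mem (C.ofA_mem a1), pow_zero,
        one_smul, LinearMap.id_apply]
      abel

theorem phat_dΓ (x : C.Envelope) : C.phat (C.dΓ x) = C.totΓ (C.phat x) := by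
  refine LinearMap.congr_fun (C.env_ext (f := C.phat ∘ₗ C.dΓ) (g := C.totΓ ∘ₗ C.phat) ?_ ?_ ?_) x
  · simp [dΓ_one, phat_one]
  · intro a x hx
    simp only [LinearMap.comp_apply] at hx ⊢
    rw [dΓ_ofA_mul, map_add, phat_dA_mul, phat_ofA_mul, hx, phat_ofA_mul, totΓ_cop_mul]
  · intro x hx
    simp only [LinearMap.comp_apply] at hx ⊢
    rw [dΓ_dΓ, map_zero, hx]
    generalize C.phat x = z
    induction z with
    | zero => simp
    | add x y hx hy => simp only [map_add, ← hx, ← hy, add_zero]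
    | tmul x y =>
      simp only [totD_tmul, map_add, dΓ_dΓ, TensorProduct.zero_tmul, TensorProduct.tmul_zero,
        gradeInvolution_comp_of_mem C.dΓ_mem, TensorProduct.neg_tmul]
      simp

theorem phat_degOp (x : C.Envelope) : C.phat (degOp C.deg x) = totDeg C.deg C.deg (C.phat x) := by
  refine LinearMap.congr_fun (C.env_ext (f := C.phat ∘ₗ degOp C.deg)
    (g := totDeg C.deg C.deg ∘ₗ C.phat) ?_ ?_ ?_) x
  · have h1 : degOp C.deg 1 = 0 := degOp_of_mem_zero (SetLike.one_mem_graded C.deg)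
    simp [phat_one, h1]
  · intro a x hx
    simp only [LinearMap.comp_apply] at hx ⊢
    rw [degOp_mul, degOp_of_mem_zero (C.ofA_mem a), zero_mul, zero_add, phat_ofA_mul, hx,
      phat_ofA_mul, totDeg_mul (C.cop_mem a)]
  · intro x hx
    simp only [LinearMap.comp_apply] at hx ⊢
    rw [degOp_comp_of_mem C.dΓ_mem, map_add, phat_dΓ, phat_dΓ, hx,
      totDeg_totD C.dΓ_mem C.dΓ_mem]

theorem totDeg_phat {n : ℕ} {x : C.Envelope} (hx : x ∈ C.deg n) :
    totDeg C.deg C.deg (C.phat x) = (n : ℂ) • C.phat x := by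
  rw [← phat_degOp, degOp, gradeMap_of_mem hx, map_smul]

/-! ### The coactions -/

theorem leftCoaction_ofA (a : A) : C.leftCoaction (C.ofA a) =
    TensorProduct.map LinearMap.id C.ofA.toLinearMap (Coalgebra.comul (R := ℂ) a) :=
  C.liftHom_gen _ _ _ (Sum.inl a)

theorem leftCoaction_dA (a : A) : C.leftCoaction (C.dA a) =
    TensorProduct.map LinearMap.id C.dA (Coalgebra.comul (R := ℂ) a) :=
  C.liftHom_gen _ _ _ (Sum.inr a)

theorem leftCoaction_dΓ (x : C.Envelope) : C.leftCoaction (C.dΓ x) =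
    TensorProduct.map LinearMap.id C.dΓ (C.leftCoaction x) := by
  refine LinearMap.congr_fun (C.env_ext (f := C.leftCoaction.toLinearMap ∘ₗ C.dΓ)
    (g := TensorProduct.map LinearMap.id C.dΓ ∘ₗ C.leftCoaction.toLinearMap) ?_ ?_ ?_) x
  · simp [dΓ_one, Algebra.TensorProduct.one_def]
  · intro a x hx
    simp only [LinearMap.comp_apply, AlgHom.toLinearMap_apply] at hx ⊢
    rw [dΓ_ofA_mul, map_add, map_mul, map_mul, map_mul, hx, leftCoaction_ofA, leftCoaction_dA]
    induction Coalgebra.comul (R := ℂ) a with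
    | zero => simp
    | add x y hx hy => simp only [add_mul, map_add, ← hx, ← hy]; abel
    | tmul a1 a2 =>
      induction C.leftCoaction x with
      | zero => simp
      | add x y hx hy => simp only [mul_add, map_add, ← hx, ← hy]; abel
      | tmul x y => simp [dΓ_ofA_mul, TensorProduct.tmul_add]
  · intro x hx
    simp only [LinearMap.comp_apply, AlgHom.toLinearMap_apply] at hx ⊢
    rw [dΓ_dΓ, hx, map_zero, map_map]
    have : C.dΓ ∘ₗ C.dΓ = 0 := by ext x; exact C.dΓ_dΓ x
    rw [this, TensorProduct.map_zero_right, LinearMap.zero_apply]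

theorem map_pA_cop_mul (a : A) (z : C.Envelope ⊗[ℂ] C.Envelope) :
    TensorProduct.map C.pA.toLinearMap LinearMap.id (C.cop a * z) =
      TensorProduct.map LinearMap.id C.ofA.toLinearMap (Coalgebra.comul (R := ℂ) a) *
        TensorProduct.map C.pA.toLinearMap LinearMap.id z := by
  rw [cop]
  induction Coalgebra.comul (R := ℂ) a with
  | zero => simp
  | add x y hx hy => simp only [add_mul, map_add, hx, hy]
  | tmul a1 a2 =>
    induction z with
    | zero => simp
    | add x y hx hy => simp only [mul_add, map_add, hx, hy]
    | tmul x y => simp [pA_ofA]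

theorem map_cop_mul_pA (a : A) (z : C.Envelope ⊗[ℂ] C.Envelope) :
    TensorProduct.map LinearMap.id C.pA.toLinearMap (C.cop a * z) =
      TensorProduct.map C.ofA.toLinearMap LinearMap.id (Coalgebra.comul (R := ℂ) a) *
        TensorProduct.map LinearMap.id C.pA.toLinearMap z := by
  rw [cop]
  induction Coalgebra.comul (R := ℂ) a with
  | zero => simp
  | add x y hx hy => simp only [add_mul, map_add, hx, hy]
  | tmul a1 a2 =>
    induction z with
    | zero => simp
    | add x y hx hy => simp only [mul_add, map_add, hx, hy]
    | tmul x y => simp [pA_ofA]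

/-- Through this, coassociativity of `F̂` supplies the left coaction on the second leg of symbols.
-/
theorem map_pA_phat (x : C.Envelope) :
    TensorProduct.map C.pA.toLinearMap LinearMap.id (C.phat x) = C.leftCoaction x := by
  refine LinearMap.congr_fun (C.env_ext (f := TensorProduct.map C.pA.toLinearMap LinearMap.id ∘ₗ
    C.phat) (g := C.leftCoaction.toLinearMap) ?_ ?_ ?_) x
  · simp [phat_one, Algebra.TensorProduct.one_def]
  · intro a x hx
    simp only [LinearMap.comp_apply, AlgHom.toLinearMap_apply] at hx ⊢
    rw [phat_ofA_mul, map_pA_cop_mul, hx, map_mul, leftCoaction_ofA]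
  · intro x hx
    simp only [LinearMap.comp_apply, AlgHom.toLinearMap_apply] at hx ⊢
    rw [phat_dΓ, leftCoaction_dΓ, ← hx]
    generalize C.phat x = z
    induction z with
    | zero => simp
    | add x y hx hy => simp only [map_add, hx, hy]
    | tmul x y => simp [pA_dΓ, pA_gradeInvolution]

/-- The right action `Γ^∧ → Γ^∧ ⊗ A` of the quantum group on `Γ^∧`. -/
def rightCoaction : C.Envelope →ₗ[ℂ] C.Envelope ⊗[ℂ] A :=
  TensorProduct.map LinearMap.id C.pA.toLinearMap ∘ₗ C.phat

theorem rightCoaction_one : C.rightCoaction 1 = 1 ⊗ₜ 1 := by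
  simp [rightCoaction, phat_one]

theorem rightCoaction_ofA_mul (a : A) (x : C.Envelope) : C.rightCoaction (C.ofA a * x) =
    TensorProduct.map C.ofA.toLinearMap LinearMap.id (Coalgebra.comul (R := ℂ) a) *
      C.rightCoaction x := by
  rw [rightCoaction, LinearMap.comp_apply, phat_ofA_mul, map_cop_mul_pA]; rfl

theorem rightCoaction_dΓ (x : C.Envelope) : C.rightCoaction (C.dΓ x) =
    TensorProduct.map C.dΓ LinearMap.id (C.rightCoaction x) := by
  rw [rightCoaction, LinearMap.comp_apply, phat_dΓ, LinearMap.comp_apply]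
  generalize C.phat x = z
  induction z with
  | zero => simp
  | add x y hx hy => simp only [map_add, hx, hy]
  | tmul x y => simp [pA_dΓ]

/-! ### Left-invariant forms -/

theorem mem_inv {x : C.Envelope} : x ∈ C.inv ↔ C.leftCoaction x = 1 ⊗ₜ x := Iff.rfl

theorem one_mem_inv : 1 ∈ C.inv := by
  rw [mem_inv, map_one]; rfl

theorem mul_mem_inv {x y : C.Envelope} (hx : x ∈ C.inv) (hy : y ∈ C.inv) : x * y ∈ C.inv := by
  rw [mem_inv] at *
  rw [map_mul, hx, hy]; simp

theorem dΓ_mem_inv {x : C.Envelope} (hx : x ∈ C.inv) : C.dΓ x ∈ C.inv := by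
  rw [mem_inv] at *
  rw [leftCoaction_dΓ, hx]; simp

theorem π_corep {ι : Type} [Fintype ι] [DecidableEq ι] {U : Matrix ι ι A} (hU : IsCorep U)
    (i j : ι) : C.π (U i j) = ∑ k, C.ofA (HopfAlgebra.antipode ℂ (U i k)) * C.dA (U k j) := by
  simp [π, hU.comul]

/-- The definition of `π` is inverted with `U κ(U) = 1`; in Sweedler form `da = ∑ a⁽¹⁾π(a⁽²⁾)`. -/
theorem dA_corep {ι : Type} [Fintype ι] [DecidableEq ι] {U : Matrix ι ι A} (hU : IsCorep U)
    (i j : ι) : C.dA (U i j) = ∑ k, C.ofA (U i k) * C.π (U k j) := by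
  simp only [C.π_corep hU, Finset.mul_sum, ← mul_assoc, ← map_mul]
  rw [Finset.sum_comm]
  simp only [← Finset.sum_mul, ← map_sum, hU.mul_antipode]
  simp [apply_ite]

theorem π_mem_deg (a : A) : C.π a ∈ C.deg 1 := by
  rw [π, LinearMap.comp_apply, LinearMap.comp_apply]
  refine map_mem_of_mem_tens (f := LinearMap.mul' ℂ C.Envelope ∘ₗ
    TensorProduct.map (C.ofA.toLinearMap ∘ₗ HopfAlgebra.antipode ℂ) C.dA)
    (fun a _ b _ => ?_) (mem_tens_top (Coalgebra.comul (R := ℂ) a))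
  simpa using SetLike.mul_mem_graded (C.ofA_mem _) (C.dA_mem b)

end BicovariantStarCalculus
end QPB
end

noncomputable section
namespace QPB

namespace BicovariantStarCalculus

universe uA uG

variable {A : Type uA} [Ring A] [StarRing A] [HopfAlgebra ℂ A]
variable {Γ : Type uG} [AddCommGroup Γ] [Module ℂ Γ] [Module A Γ] [Module Aᵐᵒᵖ Γ]
  [IsScalarTower ℂ A Γ] [IsScalarTower ℂ Aᵐᵒᵖ Γ] [SMulCommClass A Aᵐᵒᵖ Γ]
variable (C : BicovariantStarCalculus A Γ)

/-! ### One-forms inside `Γ^∧` -/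

/-- The projection of `Γ^∧` onto the square-zero extension `A ⊕ Γ`. -/
def toExt : C.Envelope →ₐ[ℂ] TrivSqZeroExt A Γ :=
  C.liftHom (fun a => TrivSqZeroExt.inl a) (fun b => TrivSqZeroExt.inr (C.d b))
    { add := fun a b => TrivSqZeroExt.inl_add Γ a b
      scalar := fun c => rfl
      mul := fun a b => TrivSqZeroExt.inl_mul Γ a b
      leibniz := fun a b => by
        rw [TrivSqZeroExt.inl_mul_inr, TrivSqZeroExt.inr_mul_inl, ← TrivSqZeroExt.inr_add,
          C.leibniz]
      form := fun n a b h => by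
        simp only [TrivSqZeroExt.inl_mul_inr, ← TrivSqZeroExt.inr_sum, h, TrivSqZeroExt.inr_zero]
      dform := fun n a b h => by simp }

theorem toExt_ofA (a : A) : C.toExt (C.ofA a) = TrivSqZeroExt.inl a :=
  C.liftHom_gen _ _ _ (Sum.inl a)

theorem toExt_dA (a : A) : C.toExt (C.dA a) = TrivSqZeroExt.inr (C.d a) :=
  C.liftHom_gen _ _ _ (Sum.inr a)

/-- The square-zero extension `A ⊕ Γ` satisfies the relations of the envelope, so the envelope
imposes no new relations on one-forms. -/
theorem dA_eq_zero_iff (a : A) : C.dA a = 0 ↔ C.d a = 0 := by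
  constructor
  · intro h
    have := C.toExt_dA a
    rw [h, map_zero] at this
    exact (TrivSqZeroExt.inr_injective (R := A) (this.symm.trans (TrivSqZeroExt.inr_zero A).symm))
  · intro h
    have := C.compatible_gen.form 1 (fun _ => 1) (fun _ => a) (by simp [h])
    rw [Finset.univ_unique, Finset.sum_singleton] at this
    exact (C.gen_inl_one_mul _).symm.trans this

theorem sum_smul_eq_zero {n : ℕ} {a b : Fin n → A} (h : ∑ i, C.ofA (a i) * C.dA (b i) = 0) :
    ∑ i, a i • C.d (b i) = 0 := by
  have h1 := congrArg C.toExt h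
  simp only [map_sum, map_mul, toExt_ofA, toExt_dA, map_zero, TrivSqZeroExt.inl_mul_inr,
    ← TrivSqZeroExt.inr_sum] at h1
  exact TrivSqZeroExt.inr_injective (R := A) (h1.trans (TrivSqZeroExt.inr_zero A).symm)

variable [StarModule ℂ A]

/-! ### Structure of the left-invariant forms -/

theorem leftCoaction_antipode (hA : IsCompactMatrixQuantumGroup A) {ι : Type} [Fintype ι]
    [DecidableEq ι] {U : Matrix ι ι A} (hU : IsCorep U) (i j : ι) :
    C.leftCoaction (C.ofA (HopfAlgebra.antipode ℂ (U i j))) =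
      ∑ k, HopfAlgebra.antipode ℂ (U k j) ⊗ₜ C.ofA (HopfAlgebra.antipode ℂ (U i k)) := by
  simp [leftCoaction_ofA, hU.comul_antipode hA]

theorem π_mem_inv (hA : IsCompactMatrixQuantumGroup A) (a : A) : C.π a ∈ C.inv := by
  refine LinearMap.congr_fun (f := C.leftCoaction.toLinearMap ∘ₗ C.π)
    (g := TensorProduct.mk ℂ A C.Envelope 1 ∘ₗ C.π) (corep_ext hA ?_) a
  intro ι _ _ U hU i j
  replace hU := hU.isCorep
  simp only [LinearMap.comp_apply, AlgHom.toLinearMap_apply, C.π_corep hU, map_sum, map_mul,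
    C.leftCoaction_antipode hA hU, leftCoaction_dA, hU.comul, TensorProduct.map_tmul,
    LinearMap.id_apply, Finset.sum_mul_sum, Algebra.TensorProduct.tmul_mul_tmul,
    TensorProduct.mk_apply]
  rw [Finset.sum_comm]
  refine Finset.sum_congr rfl fun m _ => ?_
  rw [Finset.sum_comm]
  simp only [← TensorProduct.sum_tmul, hU.antipode_mul, TensorProduct.ite_tmul,
    Finset.sum_ite_eq, Finset.mem_univ, if_true]

/-- Compared with `ad_corep`, this says that `π` intertwines the adjoint coaction of `A` with the
right coaction of `Γ^∧`. -/
theorem rightCoaction_π {ι : Type} [Fintype ι] [DecidableEq ι] {U : Matrix ι ι A}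
    (hA : IsCompactMatrixQuantumGroup A) (hU : IsCorep U) (i j : ι) :
    C.rightCoaction (C.π (U i j)) =
      ∑ k, ∑ l, C.π (U k l) ⊗ₜ (HopfAlgebra.antipode ℂ (U i k) * U l j) := by
  have h1 : ∀ i j, C.rightCoaction (C.dA (U i j)) = ∑ l, C.dA (U i l) ⊗ₜ U l j := by
    intro i j
    have := C.rightCoaction_ofA_mul (U i j) 1
    rw [mul_one, rightCoaction_one, ← Algebra.TensorProduct.one_def, mul_one] at this
    rw [← dΓ_ofA, rightCoaction_dΓ, this, hU.comul]
    simp [dΓ_ofA]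
  simp only [C.π_corep hU, map_sum, rightCoaction_ofA_mul, h1, hU.comul_antipode hA,
    TensorProduct.map_tmul, Finset.sum_mul_sum, Algebra.TensorProduct.tmul_mul_tmul,
    LinearMap.id_apply, AlgHom.toLinearMap_apply, TensorProduct.sum_tmul]
  rw [Finset.sum_comm]
  refine Finset.sum_congr rfl fun m _ => ?_
  rw [Finset.sum_comm]

theorem ad_corep {ι : Type} [Fintype ι] [DecidableEq ι] {U : Matrix ι ι A}
    (hU : IsCorep U) (i j : ι) :
    ad A (U i j) = ∑ k, ∑ l, U k l ⊗ₜ (HopfAlgebra.antipode ℂ (U i k) * U l j) := by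
  simp [ad, hU.comul, TensorProduct.tmul_sum]

theorem range_dA_le (hA : IsCompactMatrixQuantumGroup A) : LinearMap.range C.dA ≤
    LinearMap.range C.ofA.toLinearMap * LinearMap.range C.π := by
  rintro _ ⟨a, rfl⟩
  obtain ⟨ι, _, _, U, hU, ha⟩ := exists_mem_coeffs hA a
  have : coeffs U ≤ (LinearMap.range C.ofA.toLinearMap * LinearMap.range C.π).comap C.dA := by
    refine Submodule.span_le.2 ?_
    rintro _ ⟨i, j, rfl⟩
    change C.dA (U i j) ∈ LinearMap.range C.ofA.toLinearMap * LinearMap.range C.π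
    rw [C.dA_corep hU.isCorep]
    exact sum_mem fun k _ => Submodule.mul_mem_mul ⟨_, rfl⟩ ⟨_, rfl⟩
  exact this ha

/-- Every form is a combination of forms `a ϑ` with `ϑ` left-invariant. -/
theorem env_inv_ext (hA : IsCompactMatrixQuantumGroup A) {Y : Type*} [AddCommGroup Y] [Module ℂ Y]
    {f g : C.Envelope →ₗ[ℂ] Y}
    (h : ∀ (ι : Type) [Fintype ι] [DecidableEq ι] (U : Matrix ι ι A), IsCorep U →
      ∀ i j, ∀ ϑ ∈ C.inv, f (C.ofA (U i j) * ϑ) = g (C.ofA (U i j) * ϑ)) : f = g := by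
  have h1 : ∀ x, x ∈ LinearMap.range C.ofA.toLinearMap * C.inv := by
    refine C.env_induction ?_ ?_ ?_
    · rw [← mul_one (1 : C.Envelope)]
      exact Submodule.mul_mem_mul ⟨1, map_one C.ofA⟩ C.one_mem_inv
    · intro a x hx
      rw [← range_ofA_mul, mul_assoc]
      exact Submodule.mul_mem_mul ⟨a, rfl⟩ hx
    · intro x hx
      induction hx using Submodule.mul_induction_on' with
      | add x _ y _ hx hy => rw [map_add]; exact add_mem hx hy
      | mem_mul_mem x hx y hy =>
        obtain ⟨a, rfl⟩ := hx
        rw [AlgHom.toLinearMap_apply, dΓ_ofA_mul]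
        refine add_mem ?_ (Submodule.mul_mem_mul ⟨a, rfl⟩ (C.dΓ_mem_inv hy))
        have h2 : LinearMap.range C.π * C.inv ≤ C.inv := by
          rw [Submodule.mul_le]
          rintro _ ⟨a, rfl⟩ y hy
          exact C.mul_mem_inv (C.π_mem_inv hA a) hy
        have h3 := Submodule.mul_mem_mul (C.range_dA_le hA ⟨a, rfl⟩) hy
        rw [mul_assoc] at h3
        exact mul_le_mul' le_rfl h2 h3
  ext x
  induction h1 x using Submodule.mul_induction_on' with
  | add x _ y _ hx hy => rw [map_add, map_add, hx, hy]
  | mem_mul_mem x hx y hy =>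
    obtain ⟨a, rfl⟩ := hx
    refine LinearMap.congr_fun (f := f ∘ₗ LinearMap.mulRight ℂ y ∘ₗ C.ofA.toLinearMap)
      (g := g ∘ₗ LinearMap.mulRight ℂ y ∘ₗ C.ofA.toLinearMap) (corep_ext hA ?_) a
    intro ι _ _ U hU i j
    exact h ι U hU.isCorep i j y hy

theorem leftCoaction_corep_mul {ι : Type} [Fintype ι] [DecidableEq ι] {U : Matrix ι ι A}
    (hU : IsCorep U) (i j : ι) {ϑ : C.Envelope} (hϑ : ϑ ∈ C.inv) :
    C.leftCoaction (C.ofA (U i j) * ϑ) = ∑ k, U i k ⊗ₜ (C.ofA (U k j) * ϑ) := by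
  rw [map_mul, leftCoaction_ofA, hU.comul, (C.mem_inv).1 hϑ]
  simp [Finset.sum_mul]

theorem counit_leftCoaction (hA : IsCompactMatrixQuantumGroup A) (x : C.Envelope) :
    sliceL Coalgebra.counit (C.leftCoaction x) = x := by
  refine LinearMap.congr_fun (f := sliceL Coalgebra.counit ∘ₗ C.leftCoaction.toLinearMap)
    (g := LinearMap.id) (C.env_inv_ext hA ?_) x
  intro ι _ _ U hU i j ϑ hϑ
  simp only [LinearMap.comp_apply, AlgHom.toLinearMap_apply, C.leftCoaction_corep_mul hU i j hϑ,
    map_sum, sliceL_tmul, hU.counit, ite_smul, one_smul, zero_smul, Finset.sum_ite_eq,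
    Finset.mem_univ, if_true, LinearMap.id_apply]

/-- The projection `γ ↦ ∑ κ(γ⁽⁻¹⁾) γ⁽⁰⁾` onto the left-invariant forms. -/
def invProj : C.Envelope →ₗ[ℂ] C.Envelope :=
  LinearMap.mul' ℂ C.Envelope ∘ₗ
    TensorProduct.map (C.ofA.toLinearMap ∘ₗ HopfAlgebra.antipode ℂ) LinearMap.id ∘ₗ
      C.leftCoaction.toLinearMap

theorem invProj_mul (hA : IsCompactMatrixQuantumGroup A) (a : A) {ϑ : C.Envelope}
    (hϑ : ϑ ∈ C.inv) : C.invProj (C.ofA a * ϑ) = Coalgebra.counit (R := ℂ) a • ϑ := by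
  refine LinearMap.congr_fun (f := C.invProj ∘ₗ LinearMap.mulRight ℂ ϑ ∘ₗ C.ofA.toLinearMap)
    (g := LinearMap.toSpanSingleton ℂ _ ϑ ∘ₗ Coalgebra.counit) (corep_ext hA ?_) a
  intro ι _ _ U hU i j
  replace hU := hU.isCorep
  simp only [LinearMap.comp_apply, LinearMap.mulRight_apply, AlgHom.toLinearMap_apply, invProj,
    C.leftCoaction_corep_mul hU i j hϑ, map_sum, TensorProduct.map_tmul, LinearMap.mul'_apply,
    LinearMap.id_apply, ← mul_assoc, ← map_mul, ← Finset.sum_mul]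
  rw [← map_sum, hU.antipode_mul, LinearMap.toSpanSingleton_apply, hU.counit]
  split_ifs <;> simp

/-- This is the rule `π(a) ∘ b = π(ab) - ε(a)π(b)`, solved for `π(a)b`. It allows elements of `A` to
be moved to the left of elements of `π(A)`. -/
theorem π_mul_ofA {ι κ : Type} [Fintype ι] [DecidableEq ι] [Fintype κ] [DecidableEq κ]
    {U : Matrix ι ι A} {V : Matrix κ κ A} (hU : IsCorep U) (hV : IsCorep V) (i j : ι) (k l : κ) :
    C.π (U i j) * C.ofA (V k l) = ∑ m, C.ofA (V k m) *
      (C.π (U i j * V m l) - Coalgebra.counit (R := ℂ) (U i j) • C.π (V m l)) := by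
  -- The Leibniz rule splits `π(U V)` in two: one half is `π(U) ∘ V`, and in the other `κ(U)U`
  -- collapses to the counit.
  have h1 : ∀ m, C.π (U i j * V m l) - Coalgebra.counit (R := ℂ) (U i j) • C.π (V m l) =
      ∑ n, C.ofA (HopfAlgebra.antipode ℂ (V m n)) * C.π (U i j) * C.ofA (V n l) := by
    intro m
    rw [sub_eq_iff_eq_add, C.π_corep hU, C.π_corep hV, π, LinearMap.comp_apply,
      LinearMap.comp_apply, Bialgebra.comul_mul, hU.comul, hV.comul, Finset.sum_mul_sum]
    simp only [map_sum, Algebra.TensorProduct.tmul_mul_tmul, TensorProduct.map_tmul,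
      LinearMap.comp_apply, HopfAlgebra.antipode_mul_antidistrib, LinearMap.mul'_apply, C.dA_mul,
      AlgHom.toLinearMap_apply, map_mul, mul_add, Finset.sum_add_distrib]
    rw [add_comm]
    congr 1
    · rw [Finset.sum_comm]
      refine Finset.sum_congr rfl fun n _ => ?_
      rw [Finset.mul_sum, Finset.sum_mul]
      exact Finset.sum_congr rfl fun p _ => by simp only [mul_assoc]
    · rw [Finset.sum_comm, Finset.smul_sum]
      refine Finset.sum_congr rfl fun n _ => ?_
      have : ∀ p, C.ofA (HopfAlgebra.antipode ℂ (V m n)) * C.ofA (HopfAlgebra.antipode ℂ (U i p)) *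
          (C.ofA (U p j) * C.dA (V n l)) = C.ofA (HopfAlgebra.antipode ℂ (V m n)) *
            C.ofA (HopfAlgebra.antipode ℂ (U i p) * U p j) * C.dA (V n l) := fun p => by
        simp only [map_mul, mul_assoc]
      simp only [this, ← Finset.sum_mul, ← Finset.mul_sum, ← map_sum, hU.antipode_mul, hU.counit]
      split_ifs <;> simp
  simp only [h1, Finset.mul_sum]
  rw [Finset.sum_comm]
  have h2 : ∀ n, ∑ m, C.ofA (V k m) * (C.ofA (HopfAlgebra.antipode ℂ (V m n)) * C.π (U i j) *
      C.ofA (V n l)) = C.ofA (∑ m, V k m * HopfAlgebra.antipode ℂ (V m n)) * C.π (U i j) *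
      C.ofA (V n l) := fun n => by
    simp only [map_sum, map_mul, Finset.sum_mul, mul_assoc]
  simp only [h2, hV.mul_antipode, apply_ite C.ofA, map_one, map_zero, ite_mul, one_mul, zero_mul,
    Finset.sum_ite_eq, Finset.mem_univ, if_true]

theorem range_π_mul_le (hA : IsCompactMatrixQuantumGroup A) :
    LinearMap.range C.π * LinearMap.range C.ofA.toLinearMap ≤
      LinearMap.range C.ofA.toLinearMap * LinearMap.range C.π := by
  rw [Submodule.mul_le]
  rintro _ ⟨a, rfl⟩ _ ⟨b, rfl⟩
  obtain ⟨ι, _, _, U, hU, ha⟩ := exists_mem_coeffs hA a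
  obtain ⟨κ, _, _, V, hV, hb⟩ := exists_mem_coeffs hA b
  set S := LinearMap.range C.ofA.toLinearMap * LinearMap.range C.π
  have h1 : ∀ i j k l, C.π (U i j) * C.ofA (V k l) ∈ S := by
    intro i j k l
    rw [C.π_mul_ofA hU.isCorep hV.isCorep]
    exact sum_mem fun m _ => Submodule.mul_mem_mul ⟨_, rfl⟩
      (sub_mem ⟨_, rfl⟩ (Submodule.smul_mem _ _ ⟨_, rfl⟩))
  have h2 : ∀ i j, coeffs V ≤ S.comap (LinearMap.mulLeft ℂ (C.π (U i j)) ∘ₗ C.ofA.toLinearMap) := by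
    intro i j
    refine Submodule.span_le.2 ?_
    rintro _ ⟨k, l, rfl⟩
    exact h1 i j k l
  have h3 : coeffs U ≤ S.comap (LinearMap.mulRight ℂ (C.ofA b) ∘ₗ C.π) := by
    refine Submodule.span_le.2 ?_
    rintro _ ⟨i, j, rfl⟩
    exact h2 i j hb
  exact h3 ha

theorem deg_le (hA : IsCompactMatrixQuantumGroup A) (n : ℕ) : C.deg n ≤
    LinearMap.range C.ofA.toLinearMap * LinearMap.range C.π ^ n := by
  have h1 : ∀ n, LinearMap.range C.π ^ n * LinearMap.range C.ofA.toLinearMap ≤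
      LinearMap.range C.ofA.toLinearMap * LinearMap.range C.π ^ n := by
    intro n
    induction n with
    | zero => simp
    | succ n ih =>
      calc _ = LinearMap.range C.π ^ n *
            (LinearMap.range C.π * LinearMap.range C.ofA.toLinearMap) := by rw [pow_succ, mul_assoc]
        _ ≤ LinearMap.range C.π ^ n *
            (LinearMap.range C.ofA.toLinearMap * LinearMap.range C.π) :=
          mul_le_mul' le_rfl (C.range_π_mul_le hA)
        _ = LinearMap.range C.π ^ n * LinearMap.range C.ofA.toLinearMap * LinearMap.range C.π := by
          rw [mul_assoc]
        _ ≤ LinearMap.range C.ofA.toLinearMap * LinearMap.range C.π ^ n * LinearMap.range C.π := by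
          gcongr
        _ = _ := by rw [mul_assoc, pow_succ]
  induction n with
  | zero => simp [deg]
  | succ n ih =>
    calc C.deg (n + 1) = C.deg n * LinearMap.range C.dA := by rw [deg, deg, mul_assoc, pow_succ]
      _ ≤ LinearMap.range C.ofA.toLinearMap * LinearMap.range C.π ^ n *
          (LinearMap.range C.ofA.toLinearMap * LinearMap.range C.π) := by
        gcongr; exact C.range_dA_le hA
      _ = LinearMap.range C.ofA.toLinearMap * (LinearMap.range C.π ^ n *
          LinearMap.range C.ofA.toLinearMap) * LinearMap.range C.π := by simp only [mul_assoc]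
      _ ≤ LinearMap.range C.ofA.toLinearMap * (LinearMap.range C.ofA.toLinearMap *
          LinearMap.range C.π ^ n) * LinearMap.range C.π :=
        mul_le_mul' (mul_le_mul' le_rfl (h1 n)) le_rfl
      _ = LinearMap.range C.ofA.toLinearMap * LinearMap.range C.ofA.toLinearMap *
          (LinearMap.range C.π ^ n * LinearMap.range C.π) := by simp only [mul_assoc]
      _ = _ := by rw [range_ofA_mul, pow_succ]

theorem range_π_pow_le (hA : IsCompactMatrixQuantumGroup A) (n : ℕ) :
    LinearMap.range C.π ^ n ≤ C.invDeg n := by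
  induction n with
  | zero =>
    rw [pow_zero, Submodule.one_le]
    exact ⟨C.one_mem_inv, SetLike.one_mem_graded C.deg⟩
  | succ n ih =>
    rw [pow_succ, Submodule.mul_le]
    rintro x hx _ ⟨a, rfl⟩
    exact ⟨C.mul_mem_inv (ih hx).1 (C.π_mem_inv hA a),
      SetLike.mul_mem_graded (ih hx).2 (C.π_mem_deg a)⟩

/-- Forms of degree `n` lie in `A π(A)ⁿ`, and `invProj` sends `aϑ` to `ε(a)ϑ` while fixing invariant
forms. Products of a connection produce only products from `π(A)`, so this equality is what makes
them sufficient. -/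
theorem invDeg_eq (hA : IsCompactMatrixQuantumGroup A) (n : ℕ) :
    C.invDeg n = LinearMap.range C.π ^ n := by
  refine le_antisymm (fun x hx => ?_) (C.range_π_pow_le hA n)
  have h1 : C.invProj x = x := by
    have := C.invProj_mul hA 1 hx.1
    rwa [map_one, one_mul, Bialgebra.counit_one, one_smul] at this
  have h2 : LinearMap.range C.ofA.toLinearMap * LinearMap.range C.π ^ n ≤
      (LinearMap.range C.π ^ n).comap C.invProj := by
    rw [Submodule.mul_le]
    rintro _ ⟨a, rfl⟩ y hy
    change C.invProj (C.ofA a * y) ∈ LinearMap.range C.π ^ n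
    rw [C.invProj_mul hA a (C.range_π_pow_le hA n hy).1]
    exact Submodule.smul_mem _ _ hy
  rw [← h1]
  exact h2 (C.deg_le hA n hx.2)

theorem circ_corep {ι : Type} [Fintype ι] [DecidableEq ι] {U : Matrix ι ι A}
    (hU : IsCorep U) (i j : ι) (η : C.Envelope) : C.circ (η ⊗ₜ U i j) =
      ∑ k, C.ofA (HopfAlgebra.antipode ℂ (U i k)) * (η * C.ofA (U k j)) := by
  simp [circ, hU.comul, TensorProduct.tmul_sum]

/-- The exchange rule `ηa = ∑ a⁽¹⁾(η ∘ a⁽²⁾)` is what turns the twisted product of `vh(P)` into an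
ordinary one. -/
theorem sum_ofA_mul_circ {ι : Type} [Fintype ι] [DecidableEq ι] {U : Matrix ι ι A}
    (hU : IsCorep U) (i j : ι) (η : C.Envelope) :
    ∑ k, C.ofA (U i k) * C.circ (η ⊗ₜ U k j) = η * C.ofA (U i j) := by
  simp only [C.circ_corep hU, Finset.mul_sum, ← mul_assoc, ← map_mul]
  rw [Finset.sum_comm]
  simp only [← Finset.sum_mul, ← map_sum, hU.mul_antipode, apply_ite C.ofA, map_one, map_zero,
    ite_mul, one_mul, zero_mul, Finset.sum_ite_eq, Finset.mem_univ, if_true]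

/-! ### Null-homotopic functionals -/

/-- Since `ε - e` vanishes on `ker d`, it has the form `f₀ ∘ d`. The homotopy contracts the
degree-one part of the left leg of the coproduct with `f₀`. Because the coproduct is a chain map,
its commutator with `d` contracts that leg with `f₀ ∘ d`, that is, with `ε - e`. -/
theorem exists_homotopy (hA : IsCompactMatrixQuantumGroup A) {e : A →ₗ[ℂ] ℂ}
    (he : ∀ a, C.dA a = 0 → e a = Coalgebra.counit (R := ℂ) a) :
    ∃ K : C.Envelope →ₗ[ℂ] C.Envelope, ∀ x,
      x - sliceL e (C.leftCoaction x) = K (C.dΓ x) + C.dΓ (K x) := by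
  obtain ⟨f₀, hf₀⟩ : Coalgebra.counit - e ∈ LinearMap.range C.dA.dualMap := by
    rw [LinearMap.range_dualMap_eq_dualAnnihilator_ker, Submodule.mem_dualAnnihilator]
    intro a ha
    rw [LinearMap.sub_apply, he a ha, sub_self]
  have hf₀' : ∀ a, f₀ (C.dA a) = Coalgebra.counit (R := ℂ) a - e a := fun a =>
    LinearMap.congr_fun hf₀ a
  refine ⟨sliceL (f₀ ∘ₗ gproj C.deg 1) ∘ₗ C.phat, fun x => ?_⟩
  have h1 : sliceL (Coalgebra.counit - e) (C.leftCoaction x) =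
      x - sliceL e (C.leftCoaction x) := by
    conv_rhs => enter [1]; rw [← C.counit_leftCoaction hA x]
    generalize C.leftCoaction x = z
    induction z with
    | zero => simp
    | add x y hx hy => simp only [map_add, hx, hy]; abel
    | tmul x y => simp [sub_smul]
  rw [← h1, ← map_pA_phat, LinearMap.comp_apply, LinearMap.comp_apply, phat_dΓ]
  generalize C.phat x = z
  induction z with
  | zero => simp
  | add x y hx hy => simp only [map_add, hx, hy]; abel
  | tmul x y =>
    have h2 : f₀ (gproj C.deg 1 (C.dΓ x)) = (Coalgebra.counit - e : A →ₗ[ℂ] ℂ) (C.pA x) := by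
      rw [gproj_succ_comp_of_mem C.dΓ_mem, ← ofA_pA, dΓ_ofA, hf₀']; rfl
    -- This sign cancels the two terms in which `d` acts on the right leg.
    have h3 : gproj C.deg 1 (gradeInvolution C.deg x) = -gproj C.deg 1 x := by
      rw [gradeInvolution_eq, gproj_gradeMap]; simp
    simp only [TensorProduct.map_tmul, sliceL_tmul, totD_tmul, map_add, LinearMap.comp_apply, h2, h3,
      map_neg, neg_smul, map_smul, LinearMap.id_apply, AlgHom.toLinearMap_apply,
      neg_add_cancel_right]

theorem comul_mem_of_dA {a : A} (ha : C.dA a = 0) :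
    Coalgebra.comul (R := ℂ) a ∈ tens ⊤ (LinearMap.ker C.dA) := by
  rw [mem_tens_ker_right, ← leftCoaction_dA, ha, map_zero]

/-- For a projection `p` onto `ker d` take `e(a) = ∑ h(κ(a⁽¹⁾)p(a⁽²⁾))`. On `ker d`, whose coproduct
has right leg in `ker d`, the projection disappears and `κ(a⁽¹⁾)a⁽²⁾ = ε(a)1` remains. In general
`exchange_left` rewrites `∑ a⁽¹⁾e(a⁽²⁾)` by contractions of coproducts of elements of `ker d`. -/
theorem exists_functional (hA : IsCompactMatrixQuantumGroup A) : ∃ e : A →ₗ[ℂ] ℂ,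
    (∀ a, C.dA a = 0 → e a = Coalgebra.counit (R := ℂ) a) ∧
      ∀ a, C.dA (sliceR e (Coalgebra.comul (R := ℂ) a)) = 0 := by
  obtain ⟨h, hh⟩ := exists_haar A hA
  obtain ⟨p, hp, hp'⟩ := exists_proj (LinearMap.ker C.dA)
  refine ⟨h ∘ₗ LinearMap.mul' ℂ A ∘ₗ TensorProduct.map (HopfAlgebra.antipode ℂ) p ∘ₗ
    Coalgebra.comul, fun a ha => ?_, fun a => ?_⟩
  · have h1 : TensorProduct.map (HopfAlgebra.antipode ℂ) p (Coalgebra.comul (R := ℂ) a) =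
        TensorProduct.map (HopfAlgebra.antipode ℂ) LinearMap.id (Coalgebra.comul (R := ℂ) a) :=
      eqOn_tens (fun x _ y hy => by simp [hp' y hy]) (C.comul_mem_of_dA ha)
    have h2 := HopfAlgebra.mul_antipode_rTensor_comul_apply (R := ℂ) a
    rw [LinearMap.rTensor] at h2
    simp only [LinearMap.comp_apply, h1, h2]
    rw [Algebra.algebraMap_eq_smul_one, map_smul, hh.one, smul_eq_mul, mul_one]
  · refine LinearMap.congr_fun (f := C.dA ∘ₗ sliceR _ ∘ₗ Coalgebra.comul) (g := 0)
      (corep_ext hA ?_) a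
    intro ι _ _ U hU i j
    replace hU := hU.isCorep
    have h1 : sliceR (h ∘ₗ LinearMap.mul' ℂ A ∘ₗ TensorProduct.map (HopfAlgebra.antipode ℂ) p ∘ₗ
        Coalgebra.comul) (Coalgebra.comul (R := ℂ) (U i j)) = ∑ m, sliceL (h ∘ₗ
          LinearMap.mulLeft ℂ (HopfAlgebra.antipode ℂ (U i m))) (Coalgebra.comul (p (U m j))) := by
      simp only [hh.exchange_left hA hU, hU.comul, map_sum, sliceR_tmul, LinearMap.comp_apply,
        TensorProduct.map_tmul, LinearMap.mul'_apply, Finset.sum_smul]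
      rw [Finset.sum_comm]
    simp only [LinearMap.comp_apply] at h1 ⊢
    rw [h1, map_sum, LinearMap.zero_apply]
    refine Finset.sum_eq_zero fun m _ => ?_
    exact mem_tens_iff_sliceL.1 (C.comul_mem_of_dA (hp (U m j))) _

end BicovariantStarCalculus
end QPB
end

noncomputable section
namespace QPB

/-! ### Reassociation and contraction of threefold tensors. -/

section

variable {X Y X' Y' Z : Type*} [AddCommGroup X] [Module ℂ X] [AddCommGroup Y] [Module ℂ Y]
  [AddCommGroup X'] [Module ℂ X'] [AddCommGroup Y'] [Module ℂ Y'] [AddCommGroup Z] [Module ℂ Z]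

theorem assoc_map (f : X →ₗ[ℂ] X' ⊗[ℂ] Z) (g : X' →ₗ[ℂ] Y') {Y₂ Z₂ : Type*} [AddCommGroup Y₂]
    [Module ℂ Y₂] [AddCommGroup Z₂] [Module ℂ Z₂] (k : Z →ₗ[ℂ] Z₂) (l : Y →ₗ[ℂ] Y₂)
    (z : X ⊗[ℂ] Y) : TensorProduct.assoc ℂ Y' Z₂ Y₂
      (TensorProduct.map (TensorProduct.map g k ∘ₗ f) l z) =
    TensorProduct.map g (TensorProduct.map k l)
      (TensorProduct.assoc ℂ X' Z Y (TensorProduct.map f LinearMap.id z)) := by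
  induction z with
  | zero => simp
  | add x y hx hy => simp only [map_add, hx, hy]
  | tmul x y =>
    simp only [TensorProduct.map_tmul, LinearMap.comp_apply, LinearMap.id_apply]
    induction f x with
    | zero => simp
    | add a b ha hb => simp only [map_add, TensorProduct.add_tmul, ha, hb]
    | tmul a b => simp

theorem map_sliceR_assoc (f : X →ₗ[ℂ] X' ⊗[ℂ] Z) (l : Y →ₗ[ℂ] ℂ) (z : X ⊗[ℂ] Y) :
    TensorProduct.map LinearMap.id (sliceR l)
      (TensorProduct.assoc ℂ X' Z Y (TensorProduct.map f LinearMap.id z)) = f (sliceR l z) := by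
  induction z with
  | zero => simp
  | add x y hx hy => simp only [map_add, hx, hy]
  | tmul x y =>
    simp only [TensorProduct.map_tmul, LinearMap.id_apply, sliceR_tmul, map_smul]
    induction f x with
    | zero => simp
    | add a b ha hb => simp only [map_add, TensorProduct.add_tmul, ha, hb, smul_add]
    | tmul a b => simp

theorem map_sliceL_assoc (f : X →ₗ[ℂ] X' ⊗[ℂ] Z) (l : Z →ₗ[ℂ] ℂ) (z : X ⊗[ℂ] Y) :
    TensorProduct.map LinearMap.id (sliceL l)
      (TensorProduct.assoc ℂ X' Z Y (TensorProduct.map f LinearMap.id z)) =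
    TensorProduct.map (sliceR l ∘ₗ f) LinearMap.id z := by
  induction z with
  | zero => simp
  | add x y hx hy => simp only [map_add, hx, hy]
  | tmul x y =>
    simp only [TensorProduct.map_tmul, LinearMap.id_apply, LinearMap.comp_apply]
    induction f x with
    | zero => simp
    | add a b ha hb => simp only [map_add, TensorProduct.add_tmul, ha, hb]
    | tmul a b => simp [TensorProduct.smul_tmul]

end

/-! ### Homogeneous components of the left coaction and of the coproduct. -/

namespace BicovariantStarCalculus

universe uA uG

variable {A : Type uA} [Ring A] [StarRing A] [HopfAlgebra ℂ A]
variable {Γ : Type uG} [AddCommGroup Γ] [Module ℂ Γ] [Module A Γ] [Module Aᵐᵒᵖ Γ]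
  [IsScalarTower ℂ A Γ] [IsScalarTower ℂ Aᵐᵒᵖ Γ] [SMulCommClass A Aᵐᵒᵖ Γ]
variable (C : BicovariantStarCalculus A Γ)

theorem map_pA_leftCoaction (x : C.Envelope) :
    TensorProduct.map LinearMap.id C.pA.toLinearMap (C.leftCoaction x) =
      Coalgebra.comul (R := ℂ) (C.pA x) := by
  have : (Algebra.TensorProduct.map (AlgHom.id ℂ A) C.pA).comp C.leftCoaction =
      (Bialgebra.comulAlgHom ℂ A).comp C.pA := by
    apply C.hom_ext
    rintro (a | a)
    · change TensorProduct.map LinearMap.id C.pA.toLinearMap (C.leftCoaction (C.ofA a)) =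
        Coalgebra.comul (R := ℂ) (C.pA (C.ofA a))
      have h : C.pA.toLinearMap ∘ₗ C.ofA.toLinearMap = LinearMap.id :=
        LinearMap.ext fun a => C.pA_ofA a
      rw [leftCoaction_ofA, map_map, pA_ofA, h, LinearMap.id_comp, TensorProduct.map_id]; rfl
    · change TensorProduct.map LinearMap.id C.pA.toLinearMap (C.leftCoaction (C.dA a)) =
        Coalgebra.comul (R := ℂ) (C.pA (C.dA a))
      have h : C.pA.toLinearMap ∘ₗ C.dA = 0 := LinearMap.ext fun a => C.pA_dA a
      rw [leftCoaction_dA, map_map, pA_dA, h, TensorProduct.map_zero_right, map_zero]; rfl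
  exact DFunLike.congr_fun this x

theorem leftCoaction_gproj (n : ℕ) (x : C.Envelope) :
    C.leftCoaction (gproj C.deg n x) = compR C.deg n (C.leftCoaction x) := by
  have h1 : ∀ n, ∀ x ∈ C.deg n, C.leftCoaction x ∈ tens ⊤ (C.deg n) := by
    intro n
    change C.deg n ≤ (tens ⊤ (C.deg n)).comap C.leftCoaction.toLinearMap
    conv_lhs => rw [deg]
    rw [Submodule.mul_le]
    have h0 : ∀ m, ∀ y ∈ LinearMap.range C.dA ^ m, C.leftCoaction y ∈
        tens (⊤ : Submodule ℂ A) (C.deg m) := by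
      intro m
      have hmul : ∀ (i j : ℕ) (u v : A ⊗[ℂ] C.Envelope), u ∈ tens ⊤ (C.deg i) →
          v ∈ tens ⊤ (C.deg j) → u * v ∈ tens (⊤ : Submodule ℂ A) (C.deg (i + j)) := by
        intro i j u v hu hv
        refine map_mem_of_mem_tens (f := LinearMap.mulRight ℂ v) (fun a _ x hx => ?_) hu
        refine map_mem_of_mem_tens (f := LinearMap.mulLeft ℂ (a ⊗ₜ[ℂ] x)) (fun b _ y hy => ?_) hv
        simpa using tmul_mem_tens (U := ⊤) (x := a * b) (y := x * y) Submodule.mem_top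
          (SetLike.mul_mem_graded hx hy)
      induction m with
      | zero =>
        intro y hy
        rw [pow_zero] at hy
        obtain ⟨c, rfl⟩ := Submodule.mem_one.1 hy
        rw [AlgHom.commutes, Algebra.algebraMap_eq_smul_one]
        exact Submodule.smul_mem _ _ (tmul_mem_tens Submodule.mem_top (SetLike.one_mem_graded C.deg))
      | succ m ih =>
        intro y hy
        rw [pow_succ] at hy
        induction hy using Submodule.mul_induction_on' with
        | add x _ y _ hx hy => rw [map_add]; exact add_mem hx hy
        | mem_mul_mem x hx y hy =>
          obtain ⟨a, rfl⟩ := hy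
          rw [map_mul, leftCoaction_dA]
          exact hmul m 1 _ _ (ih x hx) (map_mem_tens (U := ⊤) (W := ⊤)
            (fun _ _ => Submodule.mem_top) (fun b _ => C.dA_mem b) (mem_tens_top _))
    rintro _ ⟨a, rfl⟩ y hy
    change C.leftCoaction (C.ofA a * y) ∈ tens ⊤ (C.deg n)
    rw [map_mul, leftCoaction_ofA]
    refine map_mem_of_mem_tens (f := LinearMap.mulLeft ℂ _) (fun b _ z hz => ?_) (h0 n y hy)
    refine map_mem_of_mem_tens (f := LinearMap.mulRight ℂ (b ⊗ₜ z) ∘ₗ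
      TensorProduct.map LinearMap.id C.ofA.toLinearMap) (fun b' _ c _ => ?_)
        (mem_tens_top (Coalgebra.comul (R := ℂ) a))
    have := SetLike.mul_mem_graded (C.ofA_mem c) hz
    rw [zero_add] at this
    simpa using tmul_mem_tens (U := ⊤) (x := b' * b) Submodule.mem_top this
  induction x using grading_induction (𝒜 := C.deg) with
  | h0 => simp
  | hadd x y hx hy => simp only [map_add, hx, hy]
  | h k x hx =>
    by_cases hk : k = n
    · subst hk
      rw [gproj_of_mem hx, compR_of_mem (h1 k x hx)]
    · rw [gproj_of_mem_ne hx hk, compR_of_mem_ne hk (h1 k x hx), map_zero]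

/-- The top component of the coproduct of a form is its left coaction. -/
theorem compR_phat {k q : ℕ} (hk : k ≤ q) {x : C.Envelope} (hx : x ∈ C.deg k) :
    compR C.deg q (C.phat x) = TensorProduct.map C.ofA.toLinearMap LinearMap.id
      (C.leftCoaction (gproj C.deg q x)) := by
  rcases hk.lt_or_eq with hk | rfl
  · rw [compR_eq_zero_of_totDeg hk (C.totDeg_phat hx), gproj_of_mem_ne hx hk.ne, map_zero, map_zero]
  -- For `k = q` the total degree leaves degree zero for the left leg, where `ofA ∘ pA` is the
  -- identity.
  · have h1 : compR C.deg k (C.phat x) ∈ tens (C.deg 0) (C.deg k) := by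
      refine mem_tens_of_totDeg (compR_mem k _) ?_
      rw [zero_add, ← map_smul, ← C.totDeg_phat hx]
      generalize C.phat x = z
      induction z with
      | zero => simp
      | add x y hx hy => simp only [map_add, hx, hy]
      | tmul x y =>
        have h5 : gproj C.deg k (degOp C.deg y) = degOp C.deg (gproj C.deg k y) := by
          rw [degOp, gproj_gradeMap, gradeMap_of_mem (gproj_mem k y)]
        simp only [compR, TensorProduct.map_tmul, totDeg_tmul, map_add, h5, LinearMap.id_apply]
    have h2 : C.ofA.toLinearMap ∘ₗ C.pA.toLinearMap = gproj C.deg 0 :=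
      LinearMap.ext fun y => C.ofA_pA y
    have h3 : TensorProduct.map C.ofA.toLinearMap LinearMap.id (C.leftCoaction x) =
        TensorProduct.map (gproj C.deg 0) LinearMap.id (C.phat x) := by
      rw [← map_pA_phat, map_map, h2, LinearMap.id_comp]
    have h4 := map_eq_self_of_mem_tens (f := gproj C.deg 0) (g := LinearMap.id)
      (fun _ h => gproj_of_mem h) (fun _ _ => rfl) h1
    rw [C.leftCoaction_gproj, ← h4, compR, map_map, map_map, LinearMap.id_comp, LinearMap.comp_id,
      LinearMap.comp_id, ← map_pA_phat, map_map, h2, LinearMap.comp_id]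

end BicovariantStarCalculus

/-! ### Induction over `Ω(P)`, the pull back and its coassociativity. -/

namespace BundleCalculus

universe uA uG uV uB uW

variable {V : Type uV} {B : Type uB} {A : Type uA}
    [Ring V] [StarRing V] [Algebra ℂ V] [StarModule ℂ V]
    [Ring B] [StarRing B] [Algebra ℂ B] [StarModule ℂ B]
    [Ring A] [StarRing A] [HopfAlgebra ℂ A] [StarModule ℂ A]
    {Γ : Type uG} [AddCommGroup Γ] [Module ℂ Γ] [Module A Γ] [Module Aᵐᵒᵖ Γ]
    [IsScalarTower ℂ A Γ] [IsScalarTower ℂ Aᵐᵒᵖ Γ] [SMulCommClass A Aᵐᵒᵖ Γ]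
    {P : QuantumPrincipalBundle V B A} {C : BicovariantStarCalculus A Γ}
    {Ω : Type uW} [Ring Ω] [Algebra ℂ Ω] {𝒲 : ℕ → Submodule ℂ Ω} [GradedAlgebra 𝒲]
    (S : BundleCalculus P C Ω 𝒲)

theorem j_mem (b : B) : S.j b ∈ 𝒲 0 := by rw [← S.range_j]; exact ⟨b, rfl⟩

theorem d_j_mul (b : B) (w : Ω) : S.d (S.j b * w) = S.d (S.j b) * w + S.j b * S.d w := by
  rw [S.d_mul 0 _ (S.j_mem b), pow_zero, one_smul]

/-- The algebra `Ω(P)` is generated by `1` under multiplication by `B` and the differential. -/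
theorem induction {T : Submodule ℂ Ω} (h1 : 1 ∈ T) (hj : ∀ b, ∀ w ∈ T, S.j b * w ∈ T)
    (hd : ∀ w ∈ T, S.d w ∈ T) (w : Ω) : w ∈ T := by
  have h : ∀ w : Ω, ∀ y ∈ T, w * y ∈ T := by
    intro w
    have hw : w ∈ Algebra.adjoin ℂ (Set.range S.j ∪ Set.range fun b => S.d (S.j b)) := by
      rw [S.generates]; exact Algebra.mem_top
    induction hw using Algebra.adjoin_induction with
    | mem x hx =>
      intro y hy
      rcases hx with ⟨b, rfl⟩ | ⟨b, rfl⟩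
      · exact hj b y hy
      · have : S.d (S.j b) * y = S.d (S.j b * y) - S.j b * S.d y := by
          rw [d_j_mul, add_sub_cancel_right]
        dsimp only
        rw [this]
        exact sub_mem (hd _ (hj b y hy)) (hj b _ (hd y hy))
    | algebraMap c => intro y hy; rw [← Algebra.smul_def]; exact T.smul_mem c hy
    | add x x' _ _ hx hx' => intro y hy; rw [add_mul]; exact add_mem (hx y hy) (hx' y hy)
    | mul x x' _ _ hx hx' => intro y hy; rw [mul_assoc]; exact hx _ (hx' y hy)
  simpa using h w 1 h1

theorem ext {Y : Type*} [AddCommGroup Y] [Module ℂ Y] {f g : Ω →ₗ[ℂ] Y}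
    (h1 : f 1 = g 1) (hj : ∀ b w, f w = g w → f (S.j b * w) = g (S.j b * w))
    (hd : ∀ w, f w = g w → f (S.d w) = g (S.d w)) : f = g :=
  LinearMap.ext fun w => S.induction (T := LinearMap.eqLocus f g) h1 hj hd w

/-! ### The pull back map -/

theorem Fl_one : S.Fl 1 = 1 ⊗ₜ 1 := by
  rw [Fl, LinearMap.comp_apply, AlgHom.toLinearMap_apply, map_one]; rfl

theorem Fl_mul (w w' : Ω) : S.Fl (w * w') = gmul 𝒲 C.deg (S.Fl w) (S.Fl w') := by
  have h : ∀ w, S.Fhat w = GradedTensorProduct.of ℂ 𝒲 C.deg (S.Fl w) := fun w => rfl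
  rw [gmul, ← h, ← h, ← map_mul]; rfl

theorem Fl_j (b : B) : S.Fl (S.j b) =
    TensorProduct.map S.j.toLinearMap C.ofA.toLinearMap (P.F b) :=
  (GradedTensorProduct.of ℂ 𝒲 C.deg).symm_apply_eq.2 (S.Fhat_j b)

theorem Fl_j_mem (b : B) : S.Fl (S.j b) ∈ tens (𝒲 0) (C.deg 0) := by
  rw [Fl_j]
  exact map_mem_tens (fun b _ => S.j_mem b) (fun a _ => C.ofA_mem a) (mem_tens_top _)

theorem Fl_j_mul (b : B) (w : Ω) : S.Fl (S.j b * w) = S.Fl (S.j b) * S.Fl w := by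
  rw [Fl_mul, gmul_of_left (tens_mono le_top le_rfl (S.Fl_j_mem b))]

theorem Fl_d (w : Ω) : S.Fl (S.d w) = totD 𝒲 S.d C.dΓ (S.Fl w) := S.Fhat_d w

theorem Fl_gradeInvolution (w : Ω) : S.Fl (gradeInvolution 𝒲 w) =
    TensorProduct.map (gradeInvolution 𝒲) (gradeInvolution C.deg) (S.Fl w) := by
  refine LinearMap.congr_fun (S.ext (f := S.Fl ∘ₗ gradeInvolution 𝒲)
    (g := TensorProduct.map (gradeInvolution 𝒲) (gradeInvolution C.deg) ∘ₗ S.Fl) ?_ ?_ ?_) w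
  · have h1 : gradeInvolution 𝒲 1 = 1 := by
      rw [gradeInvolution_of_mem (SetLike.one_mem_graded 𝒲)]; simp
    have h2 : gradeInvolution C.deg 1 = 1 := by
      rw [gradeInvolution_of_mem (SetLike.one_mem_graded C.deg)]; simp
    simp [Fl_one, h1, h2]
  · intro b w hw
    simp only [LinearMap.comp_apply] at hw ⊢
    rw [gradeInvolution_mul, gradeInvolution_of_mem (S.j_mem b), pow_zero, one_smul, Fl_j_mul,
      Fl_j_mul, hw]
    refine eqOn_tens (f := LinearMap.mulRight ℂ _) (g := TensorProduct.map _ _ ∘ₗ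
      LinearMap.mulRight ℂ (S.Fl w)) (fun x hx y hy => ?_) (S.Fl_j_mem b)
    simp only [LinearMap.comp_apply, LinearMap.mulRight_apply]
    induction S.Fl w with
    | zero => simp
    | add x y hx hy => simp only [map_add, mul_add, hx, hy]
    | tmul u v => simp [gradeInvolution_mul, gradeInvolution_of_mem hx, gradeInvolution_of_mem hy]
  · intro w hw
    simp only [LinearMap.comp_apply] at hw ⊢
    rw [gradeInvolution_comp_of_mem S.d_mem, map_neg, Fl_d, hw, Fl_d]
    induction S.Fl w with
    | zero => simp
    | add x y hx hy => simp only [map_add, neg_add, hx, hy]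
    | tmul u v =>
      simp only [totD_tmul, TensorProduct.map_tmul, map_add, neg_add,
        gradeInvolution_comp_of_mem S.d_mem, gradeInvolution_comp_of_mem C.dΓ_mem,
        TensorProduct.neg_tmul, TensorProduct.tmul_neg]

theorem Fl_degOp (w : Ω) : S.Fl (degOp 𝒲 w) = totDeg 𝒲 C.deg (S.Fl w) := by
  refine LinearMap.congr_fun (S.ext (f := S.Fl ∘ₗ degOp 𝒲)
    (g := totDeg 𝒲 C.deg ∘ₗ S.Fl) ?_ ?_ ?_) w
  · have h1 : degOp 𝒲 1 = 0 := degOp_of_mem_zero (SetLike.one_mem_graded 𝒲)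
    have h2 : degOp C.deg 1 = 0 := degOp_of_mem_zero (SetLike.one_mem_graded C.deg)
    simp [Fl_one, h1, h2]
  · intro b w hw
    simp only [LinearMap.comp_apply] at hw ⊢
    rw [degOp_mul, degOp_of_mem_zero (S.j_mem b), zero_mul, zero_add, Fl_j_mul, Fl_j_mul, hw,
      totDeg_mul (S.Fl_j_mem b)]
  · intro w hw
    simp only [LinearMap.comp_apply] at hw ⊢
    rw [degOp_comp_of_mem S.d_mem, map_add, Fl_d, hw, Fl_d, totDeg_totD S.d_mem C.dΓ_mem]

theorem totDeg_Fl {n : ℕ} {w : Ω} (hw : w ∈ 𝒲 n) :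
    totDeg 𝒲 C.deg (S.Fl w) = (n : ℂ) • S.Fl w := by
  rw [← Fl_degOp, degOp, gradeMap_of_mem hw, map_smul]

/-- On `B` this is coassociativity of `F`. It extends to `Ω(P)` because both sides respect left
multiplication by `B` and the total differentials. -/
theorem Fl_coassoc (w : Ω) : TensorProduct.assoc ℂ Ω C.Envelope C.Envelope
      (TensorProduct.map S.Fl LinearMap.id (S.Fl w)) =
    TensorProduct.map LinearMap.id C.phat (S.Fl w) := by
  refine LinearMap.congr_fun (S.ext (f := (TensorProduct.assoc ℂ Ω C.Envelope
    C.Envelope).toLinearMap ∘ₗ TensorProduct.map S.Fl LinearMap.id ∘ₗ S.Fl)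
    (g := TensorProduct.map LinearMap.id C.phat ∘ₗ S.Fl) ?_ ?_ ?_) w
  · simp [Fl_one, C.phat_one]
  · intro b w hw
    simp only [LinearMap.comp_apply, LinearEquiv.coe_coe] at hw ⊢
    have h1 : ∀ z, TensorProduct.assoc ℂ Ω C.Envelope C.Envelope
        (TensorProduct.map S.Fl LinearMap.id (S.Fl (S.j b) * z)) =
        TensorProduct.assoc ℂ Ω C.Envelope C.Envelope
          (TensorProduct.map S.Fl LinearMap.id (S.Fl (S.j b))) *
          TensorProduct.assoc ℂ Ω C.Envelope C.Envelope (TensorProduct.map S.Fl LinearMap.id z) := by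
      intro z
      change _ = Algebra.TensorProduct.assoc ℂ ℂ ℂ Ω C.Envelope C.Envelope _ *
        Algebra.TensorProduct.assoc ℂ ℂ ℂ Ω C.Envelope C.Envelope _
      rw [← map_mul]
      change _ = TensorProduct.assoc ℂ Ω C.Envelope C.Envelope _
      congr 1
      rw [Fl_j]
      induction P.F b with
      | zero => simp
      | add x y hx hy => simp only [map_add, add_mul, hx, hy]
      | tmul x y =>
        induction z with
        | zero => simp
        | add x y hx hy => simp only [map_add, mul_add, hx, hy]
        | tmul u v => simp [Fl_j_mul]
    have h2 : ∀ z, TensorProduct.map LinearMap.id C.phat (S.Fl (S.j b) * z) =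
        TensorProduct.map LinearMap.id C.phat (S.Fl (S.j b)) *
          TensorProduct.map LinearMap.id C.phat z := by
      intro z
      rw [Fl_j]
      induction P.F b with
      | zero => simp
      | add x y hx hy => simp only [map_add, add_mul, hx, hy]
      | tmul x y =>
        induction z with
        | zero => simp
        | add x y hx hy => simp only [map_add, mul_add, hx, hy]
        | tmul u v => simp [C.phat_ofA_mul, C.phat_ofA]
    have h3 : TensorProduct.assoc ℂ Ω C.Envelope C.Envelope
          (TensorProduct.map S.Fl LinearMap.id (S.Fl (S.j b))) =
        TensorProduct.map LinearMap.id C.phat (S.Fl (S.j b)) := by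
      have h4 : S.Fl ∘ₗ S.j.toLinearMap = TensorProduct.map S.j.toLinearMap C.ofA.toLinearMap ∘ₗ
          P.F.toAlgHom.toLinearMap := LinearMap.ext fun b => S.Fl_j b
      have h5 : C.phat ∘ₗ C.ofA.toLinearMap =
          TensorProduct.map C.ofA.toLinearMap C.ofA.toLinearMap ∘ₗ Coalgebra.comul :=
        LinearMap.ext fun a => C.phat_ofA a
      rw [Fl_j, map_map, map_map, h4, h5, LinearMap.id_comp, LinearMap.id_comp, assoc_map,
        P.coassoc, map_map, LinearMap.comp_id]
    rw [Fl_j_mul, h1, h2, hw, h3]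
  · intro w hw
    simp only [LinearMap.comp_apply, LinearEquiv.coe_coe] at hw ⊢
    have h1 : ∀ z, TensorProduct.assoc ℂ Ω C.Envelope C.Envelope
        (TensorProduct.map S.Fl LinearMap.id (totD 𝒲 S.d C.dΓ z)) =
        totD 𝒲 S.d C.totΓ (TensorProduct.assoc ℂ Ω C.Envelope C.Envelope
          (TensorProduct.map S.Fl LinearMap.id z)) := by
      intro z
      induction z with
      | zero => simp
      | add x y hx hy => simp only [map_add, hx, hy]
      | tmul x y =>
        simp only [totD_tmul, map_add, TensorProduct.map_tmul, LinearMap.id_apply, Fl_d,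
          Fl_gradeInvolution]
        induction S.Fl x with
        | zero => simp
        | add a b ha hb =>
          simp only [map_add, TensorProduct.add_tmul, ← ha, ← hb]; abel
        | tmul a b => simp [TensorProduct.add_tmul, TensorProduct.tmul_add, add_assoc]
    have h2 : ∀ z, TensorProduct.map LinearMap.id C.phat (totD 𝒲 S.d C.dΓ z) =
        totD 𝒲 S.d C.totΓ (TensorProduct.map LinearMap.id C.phat z) := by
      intro z
      induction z with
      | zero => simp
      | add x y hx hy => simp only [map_add, hx, hy]
      | tmul x y => simp [C.phat_dΓ]
    rw [Fl_d, h1, h2, hw]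

/-! ### The right action -/

theorem FA_one : S.FA 1 = 1 ⊗ₜ 1 := by simp [FA, Fl_one]

theorem FA_j (b : B) : S.FA (S.j b) = TensorProduct.map S.j.toLinearMap LinearMap.id (P.F b) := by
  have h : C.pA.toLinearMap ∘ₗ C.ofA.toLinearMap = LinearMap.id :=
    LinearMap.ext fun a => C.pA_ofA a
  rw [FA, LinearMap.comp_apply, Fl_j, map_map, h, LinearMap.id_comp]

/-- No sign survives: it depends on the vertical degree of the left factor, and `pA` removes
everything of positive vertical degree. -/
theorem FA_mul (w w' : Ω) : S.FA (w * w') = S.FA w * S.FA w' := by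
  simp only [FA, LinearMap.comp_apply, Fl_mul]
  generalize S.Fl w = z, S.Fl w' = z'
  rw [← gmulₗ_apply]
  induction z with
  | zero => simp only [map_zero, zero_mul, LinearMap.zero_apply]
  | add x y hx hy => simp only [map_add, add_mul, LinearMap.add_apply, hx, hy]
  | tmul x y =>
    induction z' with
    | zero => simp only [map_zero, mul_zero]
    | add x y hx hy => simp only [map_add, mul_add, hx, hy]
    | tmul x' y' =>
      induction x' using grading_induction (𝒜 := 𝒲) with
      | h0 => simp only [map_zero, mul_zero, TensorProduct.zero_tmul]
      | hadd x y hx hy => simp only [TensorProduct.add_tmul, map_add, mul_add, hx, hy]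
      | h i x' hx' =>
        induction y using grading_induction (𝒜 := C.deg) with
        | h0 => simp only [map_zero, zero_mul, TensorProduct.tmul_zero, LinearMap.zero_apply]
        | hadd x y hx hy =>
          simp only [TensorProduct.tmul_add, map_add, add_mul, LinearMap.add_apply, hx, hy]
        | h j y hy =>
          rw [gmulₗ_apply, gmul_tmul x hy hx' y']
          rcases eq_or_ne j 0 with rfl | hj
          · simp only [zero_mul, pow_zero, one_smul, TensorProduct.map_tmul, LinearMap.id_apply,
              AlgHom.toLinearMap_apply, map_mul, Algebra.TensorProduct.tmul_mul_tmul]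
          · simp [C.pA_of_mem hj hy]

theorem FA_d (w : Ω) : S.FA (S.d w) = TensorProduct.map S.d LinearMap.id (S.FA w) := by
  rw [FA, LinearMap.comp_apply, LinearMap.comp_apply, Fl_d]
  induction S.Fl w with
  | zero => simp
  | add x y hx hy => simp only [map_add, hx, hy]
  | tmul x y => simp [C.pA_dΓ]

theorem FA_gradeInvolution (w : Ω) : S.FA (gradeInvolution 𝒲 w) =
    TensorProduct.map (gradeInvolution 𝒲) LinearMap.id (S.FA w) := by
  rw [FA, LinearMap.comp_apply, LinearMap.comp_apply, Fl_gradeInvolution]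
  induction S.Fl w with
  | zero => simp
  | add x y hx hy => simp only [map_add, hx, hy]
  | tmul x y => simp [C.pA_gradeInvolution]

theorem FA_assoc_left (w : Ω) : TensorProduct.assoc ℂ Ω A C.Envelope
      (TensorProduct.map S.FA LinearMap.id (S.Fl w)) =
    TensorProduct.map LinearMap.id C.leftCoaction.toLinearMap (S.Fl w) := by
  have h : TensorProduct.map C.pA.toLinearMap LinearMap.id ∘ₗ C.phat =
      C.leftCoaction.toLinearMap := LinearMap.ext fun x => C.map_pA_phat x
  rw [FA, assoc_map, Fl_coassoc, map_map, h, LinearMap.id_comp]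

theorem Fl_assoc_right (w : Ω) : TensorProduct.assoc ℂ Ω C.Envelope A
      (TensorProduct.map S.Fl LinearMap.id (S.FA w)) =
    TensorProduct.map LinearMap.id C.rightCoaction (S.Fl w) := by
  have h := assoc_map S.Fl LinearMap.id LinearMap.id C.pA.toLinearMap (S.Fl w)
  rw [TensorProduct.map_id, LinearMap.id_comp] at h
  rw [FA, LinearMap.comp_apply, map_map, LinearMap.id_comp, LinearMap.comp_id, h, Fl_coassoc,
    map_map, LinearMap.id_comp]
  rfl

theorem isCoaction_FA : IsCoaction S.FA where
  coassoc w := by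
    have h := congrArg (TensorProduct.map LinearMap.id
      (TensorProduct.map LinearMap.id C.pA.toLinearMap)) (S.FA_assoc_left w)
    have h' : TensorProduct.map LinearMap.id C.pA.toLinearMap ∘ₗ C.leftCoaction.toLinearMap =
      Coalgebra.comul ∘ₗ C.pA.toLinearMap := LinearMap.ext fun x => C.map_pA_leftCoaction x
    rw [← assoc_map, map_map, h', TensorProduct.map_id, LinearMap.id_comp] at h
    conv_lhs => enter [2, 2]; rw [FA, LinearMap.comp_apply]
    rw [map_map, LinearMap.id_comp, LinearMap.comp_id, h, FA, LinearMap.comp_apply, map_map,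
      LinearMap.id_comp]
  counit w := by
    have hj : ∀ b, sliceR Coalgebra.counit (S.FA (S.j b)) = S.j b := by
      intro b
      have h := congrArg (TensorProduct.rid ℂ B) (P.counit b)
      rw [TensorProduct.rid_tmul, one_smul] at h
      rw [FA_j, sliceR_map, LinearMap.comp_id]
      exact congrArg S.j h
    have hmul : ∀ z z' : Ω ⊗[ℂ] A, sliceR Coalgebra.counit (z * z') =
        sliceR Coalgebra.counit z * sliceR Coalgebra.counit z' := by
      intro z z'
      induction z with
      | zero => simp
      | add x y hx hy => simp only [map_add, add_mul, hx, hy]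
      | tmul x y =>
        induction z' with
        | zero => simp
        | add x y hx hy => simp only [map_add, mul_add, hx, hy]
        | tmul u v => simp [smul_smul, mul_comm]
    refine LinearMap.congr_fun (S.ext (f := sliceR Coalgebra.counit ∘ₗ S.FA)
      (g := LinearMap.id) ?_ ?_ ?_) w
    · simp [FA_one]
    · intro b w hw
      simp only [LinearMap.comp_apply, LinearMap.id_apply] at hw ⊢
      rw [FA_mul, hmul, hj, hw]
    · intro w hw
      simp only [LinearMap.comp_apply, LinearMap.id_apply] at hw ⊢
      rw [FA_d, sliceR_map, LinearMap.comp_id, hw]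

/-- `F̂` determines `F^∧`, from which the counit recovers the form. -/
theorem Fl_injective : Function.Injective S.Fl := by
  intro w w' h
  rw [← S.isCoaction_FA.counit w, ← S.isCoaction_FA.counit w', FA, LinearMap.comp_apply, h]; rfl

theorem FA_gproj (n : ℕ) (w : Ω) :
    S.FA (gproj 𝒲 n w) = TensorProduct.map (gproj 𝒲 n) LinearMap.id (S.FA w) := by
  have h1 : ∀ k, ∀ x ∈ 𝒲 k, S.FA x ∈ tens (𝒲 k) ⊤ := by
    intro k x hx
    rw [mem_tens_iff_sliceR]
    intro l
    apply mem_of_degOp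
    have h2 : S.FA (degOp 𝒲 x) = TensorProduct.map (degOp 𝒲) LinearMap.id (S.FA x) := by
      rw [FA, LinearMap.comp_apply, LinearMap.comp_apply, Fl_degOp]
      induction S.Fl x with
      | zero => simp
      | add x y hx hy => simp only [map_add, hx, hy]
      | tmul x y =>
        have h3 : C.pA (degOp C.deg y) = 0 := by
          have : C.ofA (C.pA (degOp C.deg y)) = C.ofA 0 := by
            rw [C.ofA_pA, degOp, gproj_gradeMap]; simp
          rw [← C.pA_ofA (C.pA _), this, C.pA_ofA]
        simp [h3]
    rw [degOp, gradeMap_of_mem hx, map_smul] at h2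
    have h4 := sliceR_map l (degOp 𝒲) LinearMap.id (S.FA x)
    rw [← h2, map_smul, LinearMap.comp_id] at h4
    exact h4.symm
  induction w using grading_induction (𝒜 := 𝒲) with
  | h0 => simp
  | hadd x y hx hy => simp only [map_add, hx, hy]
  | h k x hx =>
    by_cases hk : k = n
    · subst hk
      rw [gproj_of_mem hx, map_eq_self_of_mem_tens (fun y hy => gproj_of_mem hy) (fun _ _ => rfl)
        (h1 k x hx)]
    · rw [gproj_of_mem_ne hx hk, map_zero]
      exact (eqOn_tens (f := TensorProduct.map (gproj 𝒲 n) LinearMap.id) (g := 0)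
        (fun x hx y _ => by simp [gproj_of_mem_ne hx hk]) (h1 k x hx)).symm

end BundleCalculus
end QPB
end

noncomputable section
namespace QPB

/-! ### Projection onto invariant forms and Haar averaging on `Γ^∧`. -/

namespace BicovariantStarCalculus

universe uA uG

variable {A : Type uA} [Ring A] [StarRing A] [HopfAlgebra ℂ A] [StarModule ℂ A]
variable {Γ : Type uG} [AddCommGroup Γ] [Module ℂ Γ] [Module A Γ] [Module Aᵐᵒᵖ Γ]
  [IsScalarTower ℂ A Γ] [IsScalarTower ℂ Aᵐᵒᵖ Γ] [SMulCommClass A Aᵐᵒᵖ Γ]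
variable (C : BicovariantStarCalculus A Γ)

theorem invProj_mem_inv (hA : IsCompactMatrixQuantumGroup A) (x : C.Envelope) :
    C.invProj x ∈ C.inv := by
  refine LinearMap.congr_fun (f := C.leftCoaction.toLinearMap ∘ₗ C.invProj)
    (g := TensorProduct.mk ℂ A C.Envelope 1 ∘ₗ C.invProj) (C.env_inv_ext hA ?_) x
  intro ι _ _ U hU i j ϑ hϑ
  simp only [LinearMap.comp_apply, C.invProj_mul hA _ hϑ, AlgHom.toLinearMap_apply, map_smul,
    C.mem_inv.1 hϑ, TensorProduct.mk_apply]

theorem invProj_gproj (n : ℕ) (x : C.Envelope) :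
    C.invProj (gproj C.deg n x) = gproj C.deg n (C.invProj x) := by
  simp only [invProj, LinearMap.comp_apply, AlgHom.toLinearMap_apply, C.leftCoaction_gproj]
  induction C.leftCoaction x with
  | zero => simp only [map_zero]
  | add x y hx hy => simp only [map_add, hx, hy]
  | tmul a y =>
    simp only [compR, TensorProduct.map_tmul, LinearMap.id_apply, LinearMap.comp_apply,
      LinearMap.mul'_apply, AlgHom.toLinearMap_apply, gproj_mul_left (C.ofA_mem _)]

theorem invProj_mem_invDeg (hA : IsCompactMatrixQuantumGroup A) {n : ℕ} {x : C.Envelope}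
    (hx : x ∈ C.deg n) : C.invProj x ∈ C.invDeg n := by
  refine ⟨C.invProj_mem_inv hA x, ?_⟩
  have h := C.invProj_gproj n x
  rw [gproj_of_mem hx] at h
  rw [h]
  exact gproj_mem n _

/-- The map `a ⊗ γ ↦ ∑ h(κ(a) γ⁽⁻¹⁾) γ⁽⁰⁾`. -/
def haarMap (h : A →ₗ[ℂ] ℂ) : A ⊗[ℂ] C.Envelope →ₗ[ℂ] C.Envelope :=
  sliceL (h ∘ₗ LinearMap.mul' ℂ A) ∘ₗ (TensorProduct.assoc ℂ A A C.Envelope).symm.toLinearMap ∘ₗ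
    TensorProduct.map (HopfAlgebra.antipode ℂ) C.leftCoaction.toLinearMap

theorem haarMap_corep_mul (h : A →ₗ[ℂ] ℂ) (a : A) {ι : Type} [Fintype ι] [DecidableEq ι]
    {U : Matrix ι ι A} (hU : IsCorep U) (i j : ι) {ϑ : C.Envelope} (hϑ : ϑ ∈ C.inv) :
    C.haarMap h (a ⊗ₜ (C.ofA (U i j) * ϑ)) =
      ∑ m, h (HopfAlgebra.antipode ℂ a * U i m) • (C.ofA (U m j) * ϑ) := by
  simp [haarMap, C.leftCoaction_corep_mul hU i j hϑ, TensorProduct.tmul_sum]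

/-- On matrix coefficients `κ(U)U = 1` appears inside the functional, and `h(1) = 1`. -/
theorem haarMap_leftCoaction (hA : IsCompactMatrixQuantumGroup A) {h : A →ₗ[ℂ] ℂ} (hh : IsHaar h)
    (x : C.Envelope) : C.haarMap h (C.leftCoaction x) = x := by
  refine LinearMap.congr_fun (f := C.haarMap h ∘ₗ C.leftCoaction.toLinearMap)
    (g := LinearMap.id) (C.env_inv_ext hA ?_) x
  intro ι _ _ U hU i j ϑ hϑ
  simp only [LinearMap.comp_apply, AlgHom.toLinearMap_apply, C.leftCoaction_corep_mul hU i j hϑ,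
    map_sum, C.haarMap_corep_mul h _ hU _ _ hϑ, LinearMap.id_apply]
  rw [Finset.sum_comm]
  simp only [← Finset.sum_smul, ← map_sum, hU.antipode_mul, apply_ite h, hh.one, map_zero, ite_smul,
    one_smul, zero_smul, Finset.sum_ite_eq, Finset.mem_univ, if_true]

theorem haarMap_dΓ (h : A →ₗ[ℂ] ℂ) (z : A ⊗[ℂ] C.Envelope) :
    C.haarMap h (TensorProduct.map LinearMap.id C.dΓ z) = C.dΓ (C.haarMap h z) := by
  induction z with
  | zero => simp
  | add x y hx hy => simp only [map_add, hx, hy]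
  | tmul a x =>
    simp only [haarMap, LinearMap.comp_apply, TensorProduct.map_tmul, LinearMap.id_apply,
      AlgHom.toLinearMap_apply, C.leftCoaction_dΓ]
    induction C.leftCoaction x with
    | zero => simp
    | add x y hx hy => simp only [map_add, TensorProduct.tmul_add, hx, hy]
    | tmul b y => simp

theorem haarMap_gproj (h : A →ₗ[ℂ] ℂ) (n : ℕ) (a : A) (x : C.Envelope) :
    C.haarMap h (a ⊗ₜ gproj C.deg n x) = gproj C.deg n (C.haarMap h (a ⊗ₜ x)) := by
  simp only [haarMap, LinearMap.comp_apply, TensorProduct.map_tmul,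
      AlgHom.toLinearMap_apply, C.leftCoaction_gproj]
  induction C.leftCoaction x with
  | zero => simp only [map_zero, TensorProduct.tmul_zero]
  | add x y hx hy => simp only [map_add, TensorProduct.tmul_add, hx, hy]
  | tmul b y =>
    simp only [compR, TensorProduct.map_tmul, LinearMap.id_apply, LinearEquiv.coe_coe,
      TensorProduct.assoc_symm_tmul, sliceL_tmul, map_smul]

/-- This is `exchange_left` with an invariant form as spectator. It is the equivariance that makes
averages land in cotensor products. -/
theorem leftCoaction_haarMap (hA : IsCompactMatrixQuantumGroup A) {h : A →ₗ[ℂ] ℂ} (hh : IsHaar h)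
    {ι : Type} [Fintype ι] [DecidableEq ι] {U : Matrix ι ι A} (hU : IsCorep U) (n i : ι)
    (x : C.Envelope) : C.leftCoaction (C.haarMap h (U n i ⊗ₜ x)) =
      ∑ l, U n l ⊗ₜ C.haarMap h (U l i ⊗ₜ x) := by
  refine LinearMap.congr_fun
    (f := C.leftCoaction.toLinearMap ∘ₗ C.haarMap h ∘ₗ TensorProduct.mk ℂ _ _ (U n i))
    (g := ∑ l, TensorProduct.mk ℂ A C.Envelope (U n l) ∘ₗ C.haarMap h ∘ₗ
      TensorProduct.mk ℂ _ _ (U l i)) (C.env_inv_ext hA ?_) x |>.trans (by simp)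
  intro κ _ _ V hV k l ϑ hϑ
  have h1 : ∀ r, ∑ m, h (HopfAlgebra.antipode ℂ (U n i) * V k m) • V m r =
      ∑ l, h (HopfAlgebra.antipode ℂ (U l i) * V k r) • U n l := by
    intro r
    have h1 := hh.exchange_left hA hU n i (V k r)
    simpa only [hV.comul, map_sum, sliceL_tmul, LinearMap.comp_apply, LinearMap.mulLeft_apply]
      using h1
  have h2 : C.leftCoaction (C.haarMap h (U n i ⊗ₜ (C.ofA (V k l) * ϑ))) =
      ∑ r, (∑ m, h (HopfAlgebra.antipode ℂ (U n i) * V k m) • V m r) ⊗ₜ (C.ofA (V r l) * ϑ) := by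
    simp only [C.haarMap_corep_mul h _ hV _ _ hϑ, map_sum, map_smul,
      C.leftCoaction_corep_mul hV _ _ hϑ, TensorProduct.sum_tmul, Finset.smul_sum,
      TensorProduct.smul_tmul']
    rw [Finset.sum_comm]
  have h3 : ∑ l', U n l' ⊗ₜ C.haarMap h (U l' i ⊗ₜ (C.ofA (V k l) * ϑ)) =
      ∑ r, (∑ l', h (HopfAlgebra.antipode ℂ (U l' i) * V k r) • U n l') ⊗ₜ[ℂ]
        (C.ofA (V r l) * ϑ) := by
    simp only [C.haarMap_corep_mul h _ hV _ _ hϑ, TensorProduct.sum_tmul, TensorProduct.tmul_sum,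
      TensorProduct.tmul_smul, TensorProduct.smul_tmul']
    rw [Finset.sum_comm]
  simp only [h1, ← h3] at h2
  rw [LinearMap.sum_apply]
  exact h2

theorem lift_ofA_π (hA : IsCompactMatrixQuantumGroup A) : LinearMap.mul' ℂ C.Envelope ∘ₗ
    TensorProduct.map C.ofA.toLinearMap C.π ∘ₗ Coalgebra.comul = C.dA := by
  refine corep_ext hA fun ι _ _ U hU i j => ?_
  rw [C.dA_corep hU.isCorep]
  simp [hU.comul]

theorem π_of_dA {a : A} (ha : C.dA a = 0) : C.π a = 0 := by
  have h1 := eqOn_tens (f := LinearMap.mul' ℂ C.Envelope ∘ₗ TensorProduct.map (C.ofA.toLinearMap ∘ₗ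
    HopfAlgebra.antipode ℂ) C.dA) (g := 0) (fun x _ y hy => by simp [LinearMap.mem_ker.1 hy])
    (C.comul_mem_of_dA ha)
  exact h1

/-- The counterpart of `comul_mem_of_dA` for the other leg, using the right coaction in place of the
left one. -/
theorem comul_mem_of_dA' {a : A} (ha : C.dA a = 0) :
    Coalgebra.comul (R := ℂ) a ∈ tens (LinearMap.ker C.dA) ⊤ := by
  have h2 := C.rightCoaction_ofA_mul a 1
  rw [mul_one, C.rightCoaction_one, ← Algebra.TensorProduct.one_def, mul_one] at h2
  have h3 := C.rightCoaction_dΓ (C.ofA a)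
  have h4 : C.dΓ ∘ₗ C.ofA.toLinearMap = C.dA := LinearMap.ext fun a => C.dΓ_ofA a
  rw [h2, C.dΓ_ofA, ha, map_zero, map_map, h4, LinearMap.comp_id] at h3
  exact mem_tens_ker_left.2 h3.symm

end BicovariantStarCalculus

namespace BundleCalculus

universe uA uG uV uB uW

variable {V : Type uV} {B : Type uB} {A : Type uA}
    [Ring V] [StarRing V] [Algebra ℂ V] [StarModule ℂ V]
    [Ring B] [StarRing B] [Algebra ℂ B] [StarModule ℂ B]
    [Ring A] [StarRing A] [HopfAlgebra ℂ A] [StarModule ℂ A]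
    {Γ : Type uG} [AddCommGroup Γ] [Module ℂ Γ] [Module A Γ] [Module Aᵐᵒᵖ Γ]
    [IsScalarTower ℂ A Γ] [IsScalarTower ℂ Aᵐᵒᵖ Γ] [SMulCommClass A Aᵐᵒᵖ Γ]
    {P : QuantumPrincipalBundle V B A} {C : BicovariantStarCalculus A Γ}
    {Ω : Type uW} [Ring Ω] [Algebra ℂ Ω] {𝒲 : ℕ → Submodule ℂ Ω} [GradedAlgebra 𝒲]
    (S : BundleCalculus P C Ω 𝒲)

/-! ### The filtration and symbols -/

/-- The component of `F̂(w)` of vertical degree `q`. -/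
def symb (q : ℕ) : Ω →ₗ[ℂ] Ω ⊗[ℂ] C.Envelope := compR C.deg q ∘ₗ S.Fl

theorem mem_fil {k : ℤ} {w : Ω} : w ∈ S.fil k ↔ ∀ j : ℕ, k < j → S.symb j w = 0 :=
  mem_tens_iSup_iff

theorem hor_eq_fil : S.hor = S.fil 0 := by
  have : (⨆ (i : ℕ) (_ : (i : ℤ) ≤ 0), C.deg i) = LinearMap.range C.ofA.toLinearMap := by
    rw [← C.deg_zero]
    refine le_antisymm (iSup₂_le fun i hi => ?_) (le_iSup₂_of_le 0 le_rfl le_rfl)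
    obtain rfl : i = 0 := by omega
    exact le_rfl
  rw [hor, fil, this]

theorem fil_mono {k l : ℤ} (h : k ≤ l) : S.fil k ≤ S.fil l := fun w hw => by
  rw [mem_fil] at *
  exact fun j hj => hw j (h.trans_lt hj)

theorem symb_zero_d (w : Ω) : S.symb 0 (S.d w) =
    TensorProduct.map S.d LinearMap.id (S.symb 0 w) := by
  simp only [symb, LinearMap.comp_apply, Fl_d]
  induction S.Fl w with
  | zero => simp only [map_zero]
  | add x y hx hy => simp only [map_add, hx, hy]
  | tmul x y =>
    simp only [compR, totD_tmul, map_add, TensorProduct.map_tmul, LinearMap.id_apply,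
      gproj_zero_comp_of_mem C.dΓ_mem, TensorProduct.tmul_zero, add_zero]

theorem symb_succ_d (j : ℕ) (w : Ω) : S.symb (j + 1) (S.d w) =
    TensorProduct.map S.d LinearMap.id (S.symb (j + 1) w) +
      TensorProduct.map (gradeInvolution 𝒲) C.dΓ (S.symb j w) := by
  simp only [symb, LinearMap.comp_apply, Fl_d]
  induction S.Fl w with
  | zero => simp only [map_zero, add_zero]
  | add x y hx hy => simp only [map_add, hx, hy]; abel
  | tmul x y =>
    simp only [compR, totD_tmul, map_add, TensorProduct.map_tmul, LinearMap.id_apply,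
      gproj_succ_comp_of_mem C.dΓ_mem]

theorem d_mem_fil {k : ℤ} {w : Ω} (hw : w ∈ S.fil k) : S.d w ∈ S.fil (k + 1) := by
  rw [mem_fil] at *
  rintro (_ | j) hj
  · rw [symb_zero_d, hw 0 (by push_cast at *; omega), map_zero]
  · rw [symb_succ_d, hw (j + 1) (by push_cast at *; omega), hw j (by push_cast at *; omega),
      map_zero, map_zero, add_zero]

/-- Differentiation of the first leg does not raise the vertical degree, so only `d` on the second
leg contributes to the next symbol. This is the differential of the associated graded algebra. -/
theorem symb_succ_d_of_mem {q : ℕ} {w : Ω} (hw : w ∈ S.fil q) : S.symb (q + 1) (S.d w) =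
      TensorProduct.map (gradeInvolution 𝒲) C.dΓ (S.symb q w) := by
  rw [symb_succ_d, S.mem_fil.1 hw (q + 1) (by push_cast; omega), map_zero, zero_add]

/-- Taking symbols is therefore injective on the associated graded space. -/
theorem mem_fil_sub_one {q : ℕ} {w : Ω} (hw : w ∈ S.fil q) :
    w ∈ S.fil (q - 1) ↔ S.symb q w = 0 := by
  constructor
  · exact fun h => S.mem_fil.1 h q (by omega)
  · intro h
    rw [mem_fil] at *
    intro j hj
    rcases eq_or_ne j q with rfl | hne
    · exact h
    · exact hw j (by omega)

theorem fil_of_neg {k : ℤ} (hk : k < 0) {w : Ω} (hw : w ∈ S.fil k) : w = 0 := by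
  apply S.Fl_injective
  obtain ⟨s, hs, _⟩ := exists_sum_compR (ℬ := C.deg) (S.Fl w)
  rw [map_zero, hs]
  exact Finset.sum_eq_zero fun j _ => S.mem_fil.1 hw j (by omega)

theorem symb_of_lt {n k : ℕ} (h : n < k) {w : Ω} (hw : w ∈ 𝒲 n) : S.symb k w = 0 :=
  compR_eq_zero_of_totDeg h (S.totDeg_Fl hw)

theorem mem_fil_of_mem {n : ℕ} {w : Ω} (hw : w ∈ 𝒲 n) : w ∈ S.fil n :=
  S.mem_fil.2 fun _ hj => S.symb_of_lt (by omega) hw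

theorem symb_mem {p q : ℕ} {w : Ω} (hw : w ∈ 𝒲 (p + q)) :
    S.symb q w ∈ tens (𝒲 p) (C.deg q) := by
  refine mem_tens_of_totDeg (compR_mem q _) ?_
  rw [symb, LinearMap.comp_apply, ← map_smul, ← S.totDeg_Fl hw]
  generalize S.Fl w = z
  induction z with
  | zero => simp only [map_zero]
  | add x y hx hy => simp only [map_add, hx, hy]
  | tmul x y =>
    have h5 : gproj C.deg q (degOp C.deg y) = degOp C.deg (gproj C.deg q y) := by
      rw [degOp, gproj_gradeMap, gradeMap_of_mem (gproj_mem q y)]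
    simp only [compR, TensorProduct.map_tmul, totDeg_tmul, map_add, h5, LinearMap.id_apply]

/-- `F̂` preserves total degree, so the first leg has degree `n - j`. The case distinction keeps the
truncated subtraction harmless. -/
theorem symb_gproj (j n : ℕ) (w : Ω) : S.symb j (gproj 𝒲 n w) =
    if j ≤ n then TensorProduct.map (gproj 𝒲 (n - j)) LinearMap.id (S.symb j w) else 0 := by
  induction w using grading_induction (𝒜 := 𝒲) with
  | h0 => simp only [map_zero, ite_self]
  | hadd x y hx hy =>
    simp only [map_add, hx, hy]
    split_ifs <;> simp only [add_zero]
  | h m w hw =>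
    rcases lt_or_ge m j with hm | hm
    · have h1 : S.symb j (gproj 𝒲 n w) = 0 := by
        rcases eq_or_ne m n with rfl | hmn
        · rw [gproj_of_mem hw, S.symb_of_lt hm hw]
        · rw [gproj_of_mem_ne hw hmn, map_zero]
      rw [h1, S.symb_of_lt hm hw, map_zero, ite_self]
    · obtain ⟨p, rfl⟩ := Nat.exists_eq_add_of_le' hm
      have h1 := S.symb_mem hw
      rcases eq_or_ne (p + j) n with rfl | hmn
      · rw [if_pos hm, gproj_of_mem hw, Nat.add_sub_cancel,
          map_eq_self_of_mem_tens (fun _ h => gproj_of_mem h) (fun _ _ => rfl) h1]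
      · rw [gproj_of_mem_ne hw hmn, map_zero]
        split_ifs with hj
        · exact (eqOn_tens (f := TensorProduct.map (gproj 𝒲 (n - j)) LinearMap.id) (g := 0)
            (fun x hx y _ => by
              simp [gproj_of_mem_ne hx (m := n - j) (by omega)]) h1).symm
        · rfl

theorem gproj_mem_fil {k : ℤ} (n : ℕ) {w : Ω} (hw : w ∈ S.fil k) : gproj 𝒲 n w ∈ S.fil k := by
  rw [mem_fil] at *
  intro j hj
  rw [symb_gproj, hw j hj, map_zero, ite_self]

theorem symb_mul {q q' : ℕ} {w w' : Ω} (hw : w ∈ S.fil q) (hw' : w' ∈ S.fil q') :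
    S.symb (q + q') (w * w') = gmul 𝒲 C.deg (S.symb q w) (S.symb q' w') ∧
      w * w' ∈ S.fil ((q + q' : ℕ) : ℤ) := by
  have h := compR_gmul (𝒜 := 𝒲) (ℬ := C.deg) (z := S.Fl w) (z' := S.Fl w') (i := q) (j := q')
    (fun k hk => S.mem_fil.1 hw k (by omega)) (fun k hk => S.mem_fil.1 hw' k (by omega))
  rw [← Fl_mul] at h
  exact ⟨h.1, S.mem_fil.2 fun j hj => h.2 j (by omega)⟩

theorem Fl_of_mem_hor {w : Ω} (hw : w ∈ S.hor) :
    S.Fl w = TensorProduct.map LinearMap.id C.ofA.toLinearMap (S.FA w) := by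
  rw [FA, LinearMap.comp_apply, map_map, LinearMap.id_comp]
  refine (map_eq_self_of_mem_tens (fun _ _ => rfl) ?_ hw).symm
  rintro _ ⟨a, rfl⟩
  simp [C.pA_ofA]

theorem mem_hor_of_Fl {w : Ω} {x : Ω ⊗[ℂ] A}
    (h : S.Fl w = TensorProduct.map LinearMap.id C.ofA.toLinearMap x) : w ∈ S.hor := by
  change S.Fl w ∈ tens ⊤ (LinearMap.range C.ofA.toLinearMap)
  rw [h]
  exact map_mem_tens (U := ⊤) (W := ⊤) (fun _ _ => Submodule.mem_top)
    (fun a _ => LinearMap.mem_range_self C.ofA.toLinearMap a) (mem_tens_top x)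

theorem symb_zero_of_mem_hor {w : Ω} (hw : w ∈ S.hor) :
    S.symb 0 w = TensorProduct.map LinearMap.id C.ofA.toLinearMap (S.FA w) := by
  rw [← S.Fl_of_mem_hor hw]
  refine compR_of_mem ?_
  rw [C.deg_zero]
  exact hw

/-- Coassociativity moves `F̂` on the first leg to the coproduct on the second, and by `compR_phat`
the component of top degree sees only the left coaction. -/
theorem symb_Fl {q : ℕ} {w : Ω} (hw : w ∈ S.fil q) :
    TensorProduct.assoc ℂ Ω C.Envelope C.Envelope
      (TensorProduct.map S.Fl LinearMap.id (S.symb q w)) =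
    TensorProduct.map LinearMap.id (TensorProduct.map C.ofA.toLinearMap LinearMap.id ∘ₗ
      C.leftCoaction.toLinearMap) (S.symb q w) := by
  have h1 := assoc_map S.Fl LinearMap.id LinearMap.id (gproj C.deg q) (S.Fl w)
  rw [TensorProduct.map_id, LinearMap.id_comp, Fl_coassoc, map_map, LinearMap.id_comp] at h1
  rw [symb, LinearMap.comp_apply, map_map, map_map, LinearMap.id_comp, LinearMap.comp_id, h1]
  refine eqOn_tens (fun x _ y hy => ?_) hw
  simp only [TensorProduct.map_tmul, LinearMap.id_apply]
  congr 1
  have h2 : (⨆ (i : ℕ) (_ : (i : ℤ) ≤ q), C.deg i) ≤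
      LinearMap.eqLocus (TensorProduct.map LinearMap.id (gproj C.deg q) ∘ₗ C.phat)
        ((TensorProduct.map C.ofA.toLinearMap LinearMap.id ∘ₗ C.leftCoaction.toLinearMap) ∘ₗ
          gproj C.deg q) :=
    iSup₂_le fun i hi x hx => C.compR_phat (by omega) hx
  exact h2 hy

theorem symb_FA {q : ℕ} {w : Ω} (hw : w ∈ S.fil q) :
    TensorProduct.assoc ℂ Ω A C.Envelope (TensorProduct.map S.FA LinearMap.id (S.symb q w)) =
    TensorProduct.map LinearMap.id C.leftCoaction.toLinearMap (S.symb q w) := by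
  have h : C.pA.toLinearMap ∘ₗ C.ofA.toLinearMap = LinearMap.id :=
    LinearMap.ext fun a => C.pA_ofA a
  rw [FA, assoc_map, S.symb_Fl hw, map_map, LinearMap.id_comp, ← LinearMap.comp_assoc,
    ← TensorProduct.map_comp, h, LinearMap.id_comp, TensorProduct.map_id, LinearMap.id_comp]

/-- By `symb_Fl`, `F̂` of a contraction of the symbol has its second leg in `A`. -/
theorem symb_mem_hor {q : ℕ} {w : Ω} (hw : w ∈ S.fil q) : S.symb q w ∈ tens S.hor ⊤ := by
  rw [mem_tens_iff_sliceR]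
  intro l
  have h1 := map_sliceR_assoc S.Fl l (S.symb q w)
  rw [S.symb_Fl hw, map_map, LinearMap.id_comp] at h1
  refine S.mem_hor_of_Fl (x := TensorProduct.map LinearMap.id
    (sliceR l ∘ₗ C.leftCoaction.toLinearMap) (S.symb q w)) ?_
  rw [← h1, map_map, LinearMap.id_comp]
  congr 2
  ext x
  simp only [LinearMap.comp_apply, sliceR_map, LinearMap.comp_id]

/-! ### Stable subspaces -/

/-- Stability under the right action. -/
def Stable (W : Submodule ℂ Ω) : Prop := ∀ w ∈ W, S.FA w ∈ tens W ⊤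

theorem stable_top : S.Stable ⊤ := fun _ _ => mem_tens_top _

theorem stable_grade (p : ℕ) : S.Stable (𝒲 p) := fun w hw => by
  rw [← gproj_of_mem hw, FA_gproj]
  exact map_mem_tens (U := ⊤) (W := ⊤) (fun x _ => gproj_mem p x) (fun _ _ => Submodule.mem_top)
    (mem_tens_top _)

theorem Stable.inf {S : BundleCalculus P C Ω 𝒲} {W W' : Submodule ℂ Ω} (h : S.Stable W)
    (h' : S.Stable W') : S.Stable (W ⊓ W') := fun w hw => by
  simpa using mem_tens_inf (h w hw.1) (h' w hw.2)

theorem stable_hor : S.Stable S.hor := fun w hw => by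
  rw [mem_tens_iff_sliceR]
  intro l
  have h1 := map_sliceR_assoc S.Fl l (S.FA w)
  rw [Fl_assoc_right, map_map, LinearMap.id_comp, S.Fl_of_mem_hor hw, map_map,
    LinearMap.id_comp] at h1
  refine S.mem_hor_of_Fl (x := TensorProduct.map LinearMap.id
    (sliceR l ∘ₗ Coalgebra.comul) (S.FA w)) ?_
  rw [← h1, map_map, LinearMap.id_comp]
  congr 2
  ext a
  have h2 := C.rightCoaction_ofA_mul a 1
  rw [mul_one, C.rightCoaction_one, ← Algebra.TensorProduct.one_def, mul_one] at h2
  simp only [LinearMap.comp_apply, AlgHom.toLinearMap_apply, h2, sliceR_map, LinearMap.comp_id]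

theorem stable_horDeg (p : ℕ) : S.Stable (S.horDeg p) := S.stable_hor.inf (S.stable_grade p)

/-- For a single `a`, the equation `π(a) = 0` is weaker than `da = 0`. Here coassociativity yields
the vanishing of `φ⁽⁰⁾ ⊗ φ⁽¹⁾ ⊗ π(φ⁽²⁾)`, and multiplying the last two legs gives `φ⁽⁰⁾ ⊗ dφ⁽¹⁾ =
0`, since `da = ∑ a⁽¹⁾π(a⁽²⁾)`. -/
theorem FA_of_mem_hM (hA : IsCompactMatrixQuantumGroup A) {w : Ω} (hw : w ∈ S.hM) : S.FA w ∈ tens ⊤ (LinearMap.ker C.dA) := by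
  rw [mem_tens_ker_right]
  have h1 : TensorProduct.map LinearMap.id C.π (S.FA w) = 0 := hw.2
  have h2 := assoc_map S.FA LinearMap.id LinearMap.id C.π (S.FA w)
  rw [TensorProduct.map_id, LinearMap.id_comp, S.isCoaction_FA.coassoc, map_map,
    LinearMap.id_comp] at h2
  have h3 : TensorProduct.map S.FA C.π (S.FA w) = 0 := by
    have := map_map S.FA LinearMap.id LinearMap.id C.π (S.FA w)
    rw [h1, map_zero, LinearMap.comp_id, LinearMap.id_comp] at this
    exact this.symm
  rw [h3, map_zero] at h2
  have h4 := congrArg (TensorProduct.map LinearMap.id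
    (LinearMap.mul' ℂ C.Envelope ∘ₗ TensorProduct.map C.ofA.toLinearMap LinearMap.id)) h2
  rw [map_zero, map_map, LinearMap.id_comp, ← C.lift_ofA_π hA] at *
  rw [h4]
  congr 2
  ext a
  simp [map_map]

theorem mem_hM (hA : IsCompactMatrixQuantumGroup A) {w : Ω} :
    w ∈ S.hM ↔ w ∈ S.hor ∧ S.FA w ∈ tens ⊤ (LinearMap.ker C.dA) := by
  refine ⟨fun h => ⟨h.1, S.FA_of_mem_hM hA h⟩, fun h => ⟨h.1, ?_⟩⟩
  exact eqOn_tens (f := TensorProduct.map LinearMap.id C.π) (g := 0)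
    (fun x _ y hy => by simp [C.π_of_dA hy]) h.2

theorem stable_hM (hA : IsCompactMatrixQuantumGroup A) : S.Stable S.hM := fun w hw => by
  rw [mem_tens_iff_sliceR]
  intro l
  rw [S.mem_hM hA] at *
  refine ⟨mem_tens_iff_sliceR.1 (S.stable_hor w hw.1) l, ?_⟩
  rw [← map_sliceR_assoc, S.isCoaction_FA.coassoc, map_map, LinearMap.id_comp]
  refine map_mem_tens (fun _ _ => Submodule.mem_top) (fun a ha => ?_) hw.2
  exact mem_tens_iff_sliceR.1 (C.comul_mem_of_dA' ha) l

theorem gproj_mem_hor (n : ℕ) {w : Ω} (hw : w ∈ S.hor) : gproj 𝒲 n w ∈ S.hor := by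
  rw [hor_eq_fil] at *
  exact S.gproj_mem_fil n hw

theorem gproj_mem_hM (hA : IsCompactMatrixQuantumGroup A) (n : ℕ) {w : Ω} (hw : w ∈ S.hM) :
    gproj 𝒲 n w ∈ S.hM := by
  rw [S.mem_hM hA] at *
  refine ⟨S.gproj_mem_hor n hw.1, ?_⟩
  rw [FA_gproj]
  exact map_mem_tens (fun _ _ => Submodule.mem_top) (fun _ h => h) hw.2

theorem d_mem_hM (hA : IsCompactMatrixQuantumGroup A) {w : Ω} (hw : w ∈ S.hM) : S.d w ∈ S.hM := by
  rw [S.mem_hM hA] at *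
  constructor
  · have h1 := S.hor_eq_fil ▸ hw.1
    rw [hor_eq_fil, mem_fil]
    rintro (_ | _ | j) hj
    · omega
    -- The component of vertical degree one is `φ⁽⁰⁾ ⊗ dφ⁽¹⁾` up to sign. It is the only obstruction
    -- to horizontality of `dφ`.
    · rw [S.symb_succ_d, S.mem_fil.1 h1 _ hj, map_zero, zero_add, S.symb_zero_of_mem_hor hw.1,
        map_map]
      exact eqOn_tens (g := 0) (fun x _ y hy => by
        simp [C.dΓ_ofA, LinearMap.mem_ker.1 hy]) hw.2
    · rw [S.symb_succ_d, S.mem_fil.1 h1 _ hj, S.mem_fil.1 h1 _ (by omega), map_zero, map_zero,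
        zero_add]
  · rw [FA_d]
    exact map_mem_tens (fun _ _ => Submodule.mem_top) (fun _ h => h) hw.2

end BundleCalculus
end QPB
end

noncomputable section
namespace QPB

/-! ### Frames in `Ω(P)` and the cotensor description of `vh(P)`. -/

namespace BundleCalculus

universe uA uG uV uB uW

variable {V : Type uV} {B : Type uB} {A : Type uA}
    [Ring V] [StarRing V] [Algebra ℂ V] [StarModule ℂ V]
    [Ring B] [StarRing B] [Algebra ℂ B] [StarModule ℂ B]
    [Ring A] [StarRing A] [HopfAlgebra ℂ A] [StarModule ℂ A]
    {Γ : Type uG} [AddCommGroup Γ] [Module ℂ Γ] [Module A Γ] [Module Aᵐᵒᵖ Γ]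
    [IsScalarTower ℂ A Γ] [IsScalarTower ℂ Aᵐᵒᵖ Γ] [SMulCommClass A Aᵐᵒᵖ Γ]
    {P : QuantumPrincipalBundle V B A} {C : BicovariantStarCalculus A Γ}
    {Ω : Type uW} [Ring Ω] [Algebra ℂ Ω] {𝒲 : ℕ → Submodule ℂ Ω} [GradedAlgebra 𝒲]
    (S : BundleCalculus P C Ω 𝒲)

theorem Stable.ext {S : BundleCalculus P C Ω 𝒲} {W : Submodule ℂ Ω} (hW : S.Stable W)
    {T : Submodule ℂ C.Envelope} {Y : Type*} [AddCommGroup Y] [Module ℂ Y]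
    {f g : Ω ⊗[ℂ] C.Envelope →ₗ[ℂ] Y}
    (h : ∀ (n : ℕ) (e : Fin n → Ω) (U : Matrix (Fin n) (Fin n) A), IsFrame S.FA e U →
      (∀ i, e i ∈ W) → ∀ i, ∀ γ ∈ T, f (e i ⊗ₜ γ) = g (e i ⊗ₜ γ))
    {z : Ω ⊗[ℂ] C.Envelope} (hz : z ∈ tens W T) : f z = g z := by
  refine eqOn_tens (fun φ hφ γ hγ => ?_) hz
  exact S.isCoaction_FA.ext hW (f := f ∘ₗ (TensorProduct.mk ℂ _ _).flip γ)
    (g := g ∘ₗ (TensorProduct.mk ℂ _ _).flip γ) (fun n e U he hm i => h n e U he hm i γ hγ) hφ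

theorem frame_ext {Y : Type*} [AddCommGroup Y] [Module ℂ Y]
    {f g : Ω ⊗[ℂ] C.Envelope →ₗ[ℂ] Y}
    (h : ∀ (n : ℕ) (e : Fin n → Ω) (U : Matrix (Fin n) (Fin n) A), IsFrame S.FA e U →
      ∀ i γ, f (e i ⊗ₜ γ) = g (e i ⊗ₜ γ)) : f = g :=
  LinearMap.ext fun z => S.stable_top.ext (T := ⊤) (fun n e U he _ i γ _ => h n e U he i γ)
    (mem_tens_top z)

theorem frame_gradeInvolution {n : ℕ} {e : Fin n → Ω} {U : Matrix (Fin n) (Fin n) A}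
    (he : IsFrame S.FA e U) : IsFrame S.FA (fun i => gradeInvolution 𝒲 (e i)) U where
  corep := he.corep
  apply i := by rw [FA_gradeInvolution, he.apply]; simp

/-! ### The isomorphism with cotensors -/

/-- The map `φ ⊗ γ ↦ ∑ φ⁽⁰⁾ ⊗ T(φ⁽¹⁾ ⊗ γ)`. -/
def act (T : A ⊗[ℂ] C.Envelope →ₗ[ℂ] C.Envelope) :
    Ω ⊗[ℂ] C.Envelope →ₗ[ℂ] Ω ⊗[ℂ] C.Envelope :=
  TensorProduct.map LinearMap.id T ∘ₗ (TensorProduct.assoc ℂ Ω A C.Envelope).toLinearMap ∘ₗ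
    TensorProduct.map S.FA LinearMap.id

theorem act_frame (T : A ⊗[ℂ] C.Envelope →ₗ[ℂ] C.Envelope) {n : ℕ} {e : Fin n → Ω}
    {U : Matrix (Fin n) (Fin n) A} (he : IsFrame S.FA e U) (i : Fin n) (γ : C.Envelope) :
    S.act T (e i ⊗ₜ γ) = ∑ j, e j ⊗ₜ T (U j i ⊗ₜ γ) := by
  simp [act, he.apply, TensorProduct.sum_tmul]

theorem act_mem {T : A ⊗[ℂ] C.Envelope →ₗ[ℂ] C.Envelope} {W : Submodule ℂ Ω} (hW : S.Stable W)
    {Y Y' : Submodule ℂ C.Envelope} (hT : ∀ a, ∀ γ ∈ Y, T (a ⊗ₜ γ) ∈ Y')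
    {z : Ω ⊗[ℂ] C.Envelope} (hz : z ∈ tens W Y) : S.act T z ∈ tens W Y' := by
  refine map_mem_of_mem_tens (fun φ hφ γ hγ => ?_) hz
  refine map_mem_of_mem_tens (f := TensorProduct.map LinearMap.id T ∘ₗ
    (TensorProduct.assoc ℂ Ω A C.Envelope).toLinearMap ∘ₗ (TensorProduct.mk ℂ _ _).flip γ)
    (fun ψ hψ a _ => ?_) (hW φ hφ)
  exact tmul_mem_tens hψ (hT a γ hγ)

/-- The map `φ ⊗ γ ↦ ∑ φ⁽⁰⁾ ⊗ φ⁽¹⁾ γ`. -/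
def iota : Ω ⊗[ℂ] C.Envelope →ₗ[ℂ] Ω ⊗[ℂ] C.Envelope :=
  S.act (LinearMap.mul' ℂ C.Envelope ∘ₗ TensorProduct.map C.ofA.toLinearMap LinearMap.id)

/-- The map `φ ⊗ γ ↦ ∑ φ⁽⁰⁾ ⊗ κ(φ⁽¹⁾) γ`. -/
def iotaInv : Ω ⊗[ℂ] C.Envelope →ₗ[ℂ] Ω ⊗[ℂ] C.Envelope :=
  S.act (LinearMap.mul' ℂ C.Envelope ∘ₗ
    TensorProduct.map (C.ofA.toLinearMap ∘ₗ HopfAlgebra.antipode ℂ) LinearMap.id)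

theorem iota_frame {n : ℕ} {e : Fin n → Ω} {U : Matrix (Fin n) (Fin n) A} (he : IsFrame S.FA e U)
    (i : Fin n) (γ : C.Envelope) : S.iota (e i ⊗ₜ γ) = ∑ j, e j ⊗ₜ (C.ofA (U j i) * γ) := by
  simp [iota, S.act_frame _ he]

theorem iotaInv_frame {n : ℕ} {e : Fin n → Ω} {U : Matrix (Fin n) (Fin n) A}
    (he : IsFrame S.FA e U) (i : Fin n) (γ : C.Envelope) : S.iotaInv (e i ⊗ₜ γ) =
      ∑ j, e j ⊗ₜ (C.ofA (HopfAlgebra.antipode ℂ (U j i)) * γ) := by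
  simp [iotaInv, S.act_frame _ he]

theorem iota_tmul (φ : Ω) (γ : C.Envelope) : S.iota (φ ⊗ₜ γ) =
    TensorProduct.map LinearMap.id C.ofA.toLinearMap (S.FA φ) * (1 ⊗ₜ γ) := by
  rw [iota, act, LinearMap.comp_apply, LinearMap.comp_apply, TensorProduct.map_tmul]
  induction S.FA φ with
  | zero => simp
  | add x y hx hy =>
    simp only [map_add, TensorProduct.add_tmul, add_mul, LinearMap.id_apply] at hx hy ⊢
    rw [hx, hy]
  | tmul x a => simp

theorem iota_iotaInv (z : Ω ⊗[ℂ] C.Envelope) : S.iota (S.iotaInv z) = z := by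
  refine LinearMap.congr_fun (S.frame_ext (f := S.iota ∘ₗ S.iotaInv) (g := LinearMap.id) ?_) z
  intro n e U he i γ
  simp only [LinearMap.comp_apply, S.iotaInv_frame he, S.iota_frame he, map_sum, ← mul_assoc,
    ← map_mul, LinearMap.id_apply]
  rw [Finset.sum_comm]
  simp only [← TensorProduct.tmul_sum, ← Finset.sum_mul, ← map_sum, he.corep.mul_antipode,
    apply_ite C.ofA, map_one, map_zero, ite_mul, one_mul, zero_mul, TensorProduct.tmul_ite,
    Finset.sum_ite_eq', Finset.mem_univ, if_true]

theorem iotaInv_iota (z : Ω ⊗[ℂ] C.Envelope) : S.iotaInv (S.iota z) = z := by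
  refine LinearMap.congr_fun (S.frame_ext (f := S.iotaInv ∘ₗ S.iota) (g := LinearMap.id) ?_) z
  intro n e U he i γ
  simp only [LinearMap.comp_apply, S.iotaInv_frame he, S.iota_frame he, map_sum, ← mul_assoc,
    ← map_mul, LinearMap.id_apply]
  rw [Finset.sum_comm]
  simp only [← TensorProduct.tmul_sum, ← Finset.sum_mul, ← map_sum, he.corep.antipode_mul,
    apply_ite C.ofA, map_one, map_zero, ite_mul, one_mul, zero_mul, TensorProduct.tmul_ite,
    Finset.sum_ite_eq', Finset.mem_univ, if_true]

theorem iota_injective : Function.Injective S.iota := fun x y h => by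
  rw [← S.iotaInv_iota x, h, S.iotaInv_iota]

theorem dvh_frame {n : ℕ} {e : Fin n → Ω} {U : Matrix (Fin n) (Fin n) A} (he : IsFrame S.FA e U)
    (i : Fin n) (γ : C.Envelope) : S.dvh (e i ⊗ₜ γ) =
      ∑ j, gradeInvolution 𝒲 (e j) ⊗ₜ (C.π (U j i) * γ) + gradeInvolution 𝒲 (e i) ⊗ₜ C.dΓ γ := by
  simp [dvh, he.apply, TensorProduct.sum_tmul]

/-- The term `φ⁽¹⁾π(φ⁽²⁾)γ` produced by `d_vh` is `d(φ⁽¹⁾)γ`, so the two terms of `d_vh` form the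
Leibniz rule for `d(φ⁽¹⁾γ)`. -/
theorem iota_dvh (z : Ω ⊗[ℂ] C.Envelope) : S.iota (S.dvh z) =
    TensorProduct.map (gradeInvolution 𝒲) C.dΓ (S.iota z) := by
  refine LinearMap.congr_fun (S.frame_ext (f := S.iota ∘ₗ S.dvh)
    (g := TensorProduct.map (gradeInvolution 𝒲) C.dΓ ∘ₗ S.iota) ?_) z
  intro n e U he i γ
  simp only [LinearMap.comp_apply, S.dvh_frame he, map_add, map_sum,
    S.iota_frame (S.frame_gradeInvolution he), S.iota_frame he, TensorProduct.map_tmul,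
    C.dΓ_ofA_mul, TensorProduct.tmul_add, Finset.sum_add_distrib]
  congr 1
  rw [Finset.sum_comm]
  refine Finset.sum_congr rfl fun k _ => ?_
  simp only [← TensorProduct.tmul_sum, ← mul_assoc, ← Finset.sum_mul, ← C.dA_corep he.corep]

/-- The factors `φ⁽¹⁾(η ∘ φ⁽²⁾)` recombine to `ηφ⁽¹⁾` by `sum_ofA_mul_circ`. The product on the
right is the tensor product algebra without signs; the Koszul sign is added later. -/
theorem iota_vhMul (z z' : Ω ⊗[ℂ] C.Envelope) :
    S.iota (S.vhMul (z ⊗ₜ z')) = S.iota z * S.iota z' := by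
  refine LinearMap.congr_fun (S.frame_ext (f := S.iota ∘ₗ S.vhMul ∘ₗ TensorProduct.mk ℂ _ _ z)
    (g := LinearMap.mulLeft ℂ (S.iota z) ∘ₗ S.iota) ?_) z'
  intro m f V hf j ϑ
  refine LinearMap.congr_fun (S.frame_ext (f := S.iota ∘ₗ S.vhMul ∘ₗ
    (TensorProduct.mk ℂ _ _).flip (f j ⊗ₜ ϑ))
    (g := LinearMap.mulRight ℂ (S.iota (f j ⊗ₜ ϑ)) ∘ₗ S.iota) ?_) z
  intro n e U he i η
  have h1 : S.vhMul ((e i ⊗ₜ η) ⊗ₜ (f j ⊗ₜ ϑ)) =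
      ∑ l, (e i * f l) ⊗ₜ (C.circ (η ⊗ₜ V l j) * ϑ) := by
    simp [vhMul, hf.apply, TensorProduct.sum_tmul, TensorProduct.tmul_sum]
  have h2 : ∀ l γ, S.iota ((e i * f l) ⊗ₜ γ) =
      ∑ k, ∑ m, (e k * f m) ⊗ₜ (C.ofA (U k i) * C.ofA (V m l) * γ) := by
    intro l γ
    rw [iota_tmul, FA_mul, he.apply, hf.apply, Finset.sum_mul_sum]
    simp [Finset.sum_mul]
  have h3 : ∀ k m, ∑ l, C.ofA (U k i) * C.ofA (V m l) * (C.circ (η ⊗ₜ V l j) * ϑ) =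
      C.ofA (U k i) * η * (C.ofA (V m j) * ϑ) := by
    intro k m
    have h4 := C.sum_ofA_mul_circ hf.corep m j η
    calc _ = C.ofA (U k i) * (∑ l, C.ofA (V m l) * C.circ (η ⊗ₜ V l j)) * ϑ := by
          simp only [Finset.mul_sum, Finset.sum_mul, mul_assoc]
      _ = _ := by rw [h4]; simp only [mul_assoc]
  have h5 : S.iota (e i ⊗ₜ η) * S.iota (f j ⊗ₜ ϑ) =
      ∑ k, ∑ m, (e k * f m) ⊗ₜ (C.ofA (U k i) * η * (C.ofA (V m j) * ϑ)) := by
    rw [S.iota_frame he, S.iota_frame hf, Finset.sum_mul_sum]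
    simp only [Algebra.TensorProduct.tmul_mul_tmul]
  change S.iota (S.vhMul ((e i ⊗ₜ η) ⊗ₜ (f j ⊗ₜ ϑ))) = S.iota (e i ⊗ₜ η) * S.iota (f j ⊗ₜ ϑ)
  rw [h1, h5, map_sum]
  simp only [h2]
  rw [Finset.sum_comm]
  refine Finset.sum_congr rfl fun k _ => ?_
  rw [Finset.sum_comm]
  refine Finset.sum_congr rfl fun m _ => ?_
  rw [← TensorProduct.tmul_sum, h3]

/-! ### Cotensors -/

/-- The cotensor product of a subspace of `Ω(P)` and `Γ^∧`. -/
def cot (W : Submodule ℂ Ω) : Submodule ℂ (Ω ⊗[ℂ] C.Envelope) :=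
  tens W ⊤ ⊓ LinearMap.eqLocus ((TensorProduct.assoc ℂ Ω A C.Envelope).toLinearMap ∘ₗ
    TensorProduct.map S.FA LinearMap.id) (TensorProduct.map LinearMap.id C.leftCoaction.toLinearMap)

theorem act_of_mem_cot {W : Submodule ℂ Ω} {z : Ω ⊗[ℂ] C.Envelope} (hz : z ∈ S.cot W)
    (T : A ⊗[ℂ] C.Envelope →ₗ[ℂ] C.Envelope) :
    S.act T z = TensorProduct.map LinearMap.id (T ∘ₗ C.leftCoaction.toLinearMap) z := by
  have h : TensorProduct.assoc ℂ Ω A C.Envelope (TensorProduct.map S.FA LinearMap.id z) =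
    TensorProduct.map LinearMap.id C.leftCoaction.toLinearMap z := hz.2
  rw [act, LinearMap.comp_apply, LinearMap.comp_apply, LinearEquiv.coe_coe, h, map_map,
    LinearMap.id_comp]

theorem symb_mem_cot {q : ℕ} {w : Ω} (hw : w ∈ S.fil q) : S.symb q w ∈ S.cot S.hor :=
  ⟨S.symb_mem_hor hw, S.symb_FA hw⟩

theorem iota_mem_tens {W : Submodule ℂ Ω} (hW : S.Stable W) {q : ℕ} {z : Ω ⊗[ℂ] C.Envelope}
    (hz : z ∈ tens W (C.deg q)) : S.iota z ∈ tens W (C.deg q) := by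
  refine S.act_mem hW (fun a γ hγ => ?_) hz
  have := SetLike.mul_mem_graded (C.ofA_mem a) hγ
  rw [zero_add] at this
  exact this

theorem iota_mem_cot {W : Submodule ℂ Ω} (hW : S.Stable W) {z : Ω ⊗[ℂ] C.Envelope}
    (hz : z ∈ tens W C.inv) : S.iota z ∈ S.cot W := by
  refine ⟨S.act_mem hW (fun _ _ _ => Submodule.mem_top) hz, ?_⟩
  refine hW.ext (f := ((TensorProduct.assoc ℂ Ω A C.Envelope).toLinearMap ∘ₗ
    TensorProduct.map S.FA LinearMap.id) ∘ₗ S.iota)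
    (g := TensorProduct.map LinearMap.id C.leftCoaction.toLinearMap ∘ₗ S.iota) ?_ hz
  intro n e U he _ i γ hγ
  simp only [LinearMap.comp_apply, S.iota_frame he, map_sum, TensorProduct.map_tmul,
    LinearMap.id_apply, he.apply, TensorProduct.sum_tmul, LinearEquiv.coe_coe,
    TensorProduct.assoc_tmul, AlgHom.toLinearMap_apply, C.leftCoaction_corep_mul he.corep _ _ hγ,
    TensorProduct.tmul_sum]
  rw [Finset.sum_comm]

/-- On a cotensor, `κ` of the coaction leg can be taken from the second factor, where the operation
becomes `invProj`. -/
theorem iotaInv_mem (hA : IsCompactMatrixQuantumGroup A) {W : Submodule ℂ Ω}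
    {z : Ω ⊗[ℂ] C.Envelope} (hz : z ∈ S.cot W) : S.iotaInv z ∈ tens W C.inv := by
  rw [iotaInv, S.act_of_mem_cot hz]
  exact map_mem_tens (fun _ h => h) (fun x _ => C.invProj_mem_inv hA x) hz.1

theorem iotaInv_mem_deg (hA : IsCompactMatrixQuantumGroup A) {W W' : Submodule ℂ Ω} {q : ℕ}
    {z : Ω ⊗[ℂ] C.Envelope} (hz : z ∈ S.cot W) (hz' : z ∈ tens W' (C.deg q)) :
    S.iotaInv z ∈ tens W' (C.invDeg q) := by
  rw [iotaInv, S.act_of_mem_cot hz]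
  exact map_mem_tens (fun _ h => h) (fun x hx => C.invProj_mem_invDeg hA hx) hz'

/-! ### Averaging -/

/-- The averaging map `φ ⊗ γ ↦ ∑ h(κ(φ⁽¹⁾) γ⁽⁻¹⁾) φ⁽⁰⁾ ⊗ γ⁽⁰⁾`. -/
def avg (h : A →ₗ[ℂ] ℂ) : Ω ⊗[ℂ] C.Envelope →ₗ[ℂ] Ω ⊗[ℂ] C.Envelope := S.act (C.haarMap h)

theorem avg_of_mem_cot (hA : IsCompactMatrixQuantumGroup A) {h : A →ₗ[ℂ] ℂ} (hh : IsHaar h)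
    {W : Submodule ℂ Ω} {z : Ω ⊗[ℂ] C.Envelope} (hz : z ∈ S.cot W) : S.avg h z = z := by
  rw [avg, S.act_of_mem_cot hz]
  have : C.haarMap h ∘ₗ C.leftCoaction.toLinearMap = LinearMap.id :=
    LinearMap.ext (C.haarMap_leftCoaction hA hh)
  rw [this, TensorProduct.map_id]; rfl

/-- On frames both coactions produce the same double sum, by the equivariance of `haarMap`. -/
theorem avg_mem_cot (hA : IsCompactMatrixQuantumGroup A) {h : A →ₗ[ℂ] ℂ} (hh : IsHaar h)
    {W : Submodule ℂ Ω} (hW : S.Stable W) {z : Ω ⊗[ℂ] C.Envelope} (hz : z ∈ tens W ⊤) :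
    S.avg h z ∈ S.cot W := by
  refine ⟨S.act_mem hW (fun _ _ _ => Submodule.mem_top) hz, ?_⟩
  refine LinearMap.congr_fun (S.frame_ext (f := ((TensorProduct.assoc ℂ Ω A
    C.Envelope).toLinearMap ∘ₗ TensorProduct.map S.FA LinearMap.id) ∘ₗ S.avg h)
    (g := TensorProduct.map LinearMap.id C.leftCoaction.toLinearMap ∘ₗ S.avg h) ?_) z
  intro n e U he i γ
  simp only [LinearMap.comp_apply, avg, S.act_frame _ he, map_sum, TensorProduct.map_tmul,
    LinearMap.id_apply, he.apply, TensorProduct.sum_tmul, LinearEquiv.coe_coe,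
    TensorProduct.assoc_tmul, AlgHom.toLinearMap_apply, C.leftCoaction_haarMap hA hh he.corep,
    TensorProduct.tmul_sum]
  rw [Finset.sum_comm]

theorem avg_map_dΓ (h : A →ₗ[ℂ] ℂ) (z : Ω ⊗[ℂ] C.Envelope) :
    S.avg h (TensorProduct.map LinearMap.id C.dΓ z) =
      TensorProduct.map LinearMap.id C.dΓ (S.avg h z) := by
  refine LinearMap.congr_fun (S.frame_ext (f := S.avg h ∘ₗ TensorProduct.map LinearMap.id C.dΓ)
    (g := TensorProduct.map LinearMap.id C.dΓ ∘ₗ S.avg h) ?_) z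
  intro n e U he i γ
  have h1 : ∀ a, C.haarMap h (a ⊗ₜ C.dΓ γ) = C.dΓ (C.haarMap h (a ⊗ₜ γ)) := fun a =>
    C.haarMap_dΓ h (a ⊗ₜ γ)
  simp only [LinearMap.comp_apply, avg, S.act_frame _ he, map_sum, TensorProduct.map_tmul,
    LinearMap.id_apply, h1]

theorem avg_mem_deg (h : A →ₗ[ℂ] ℂ) {W : Submodule ℂ Ω} (hW : S.Stable W) {q : ℕ}
    {z : Ω ⊗[ℂ] C.Envelope} (hz : z ∈ tens W (C.deg q)) : S.avg h z ∈ tens W (C.deg q) := by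
  refine S.act_mem hW (fun a γ hγ => ?_) hz
  rw [← gproj_of_mem hγ, C.haarMap_gproj]
  exact gproj_mem q _

/-- Exactness of cotensors: boundaries in a cotensor product are boundaries of cotensors. -/
theorem exists_mem_cot (hA : IsCompactMatrixQuantumGroup A) {W : Submodule ℂ Ω} (hW : S.Stable W)
    {z y : Ω ⊗[ℂ] C.Envelope} (hz : z ∈ S.cot W) (hy : z = TensorProduct.map LinearMap.id C.dΓ y) :
    ∃ y' ∈ S.cot W, z = TensorProduct.map LinearMap.id C.dΓ y' := by
  obtain ⟨h, hh⟩ := exists_haar A hA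
  -- The primitive `y` is arbitrary. Projecting its first leg to `W` and then averaging makes it a
  -- cotensor; both operations commute with `id ⊗ d` and fix `z`.
  obtain ⟨p, hp, hp'⟩ := exists_proj W
  have h1 : TensorProduct.map p LinearMap.id z = z :=
    map_eq_self_of_mem_tens hp' (fun _ _ => rfl) hz.1
  refine ⟨S.avg h (TensorProduct.map p LinearMap.id y), S.avg_mem_cot hA hh hW
    (map_mem_tens (U := ⊤) (W := ⊤) (fun x _ => hp x) (fun _ _ => Submodule.mem_top)
      (mem_tens_top y)), ?_⟩
  rw [← S.avg_map_dΓ, map_map, LinearMap.id_comp, LinearMap.comp_id]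
  conv_lhs => rw [← S.avg_of_mem_cot hA hh hz, ← h1, hy, map_map, LinearMap.id_comp,
    LinearMap.comp_id]

end BundleCalculus
end QPB
end

noncomputable section
namespace QPB

theorem exists_factor_of_ker_le {X Y Z : Type*} [AddCommGroup X] [Module ℂ X] [AddCommGroup Y]
    [Module ℂ Y] [AddCommGroup Z] [Module ℂ Z] {f : X →ₗ[ℂ] Y} {g : X →ₗ[ℂ] Z}
    (h : ∀ x, f x = 0 → g x = 0) :
    ∃ k : LinearMap.range f →ₗ[ℂ] Z, ∀ x, k (f.rangeRestrict x) = g x := by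
  obtain ⟨s, hs⟩ := f.rangeRestrict.exists_rightInverse_of_surjective f.range_rangeRestrict
  refine ⟨g ∘ₗ s, fun x => ?_⟩
  have h1 : f (s (f.rangeRestrict x)) = f x :=
    congrArg Subtype.val (LinearMap.congr_fun hs (f.rangeRestrict x))
  have h2 := h (s (f.rangeRestrict x) - x) (by rw [map_sub, h1, sub_self])
  rw [map_sub, sub_eq_zero] at h2
  exact h2

theorem map_smulRight {X Y Z : Type*} [AddCommGroup X] [Module ℂ X] [AddCommGroup Y]
    [Module ℂ Y] [AddCommGroup Z] [Module ℂ Z] (l : Y →ₗ[ℂ] ℂ) (a : Z) (z : X ⊗[ℂ] Y) :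
    TensorProduct.map LinearMap.id (l.smulRight a) z = sliceR l z ⊗ₜ a := by
  induction z with
  | zero => simp
  | add x y hx hy => simp only [map_add, hx, hy, TensorProduct.add_tmul]
  | tmul x y => simp [TensorProduct.smul_tmul]

theorem map_id_sum {X Y Z ι : Type*} [AddCommGroup X] [Module ℂ X] [AddCommGroup Y]
    [Module ℂ Y] [AddCommGroup Z] [Module ℂ Z] [Fintype ι] (f : ι → Y →ₗ[ℂ] Z) (z : X ⊗[ℂ] Y) :
    TensorProduct.map LinearMap.id (∑ i, f i) z = ∑ i, TensorProduct.map LinearMap.id (f i) z := by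
  induction z with
  | zero => simp
  | add x y hx hy => simp only [map_add, hx, hy, Finset.sum_add_distrib]
  | tmul x y => simp [TensorProduct.tmul_sum]

/-! ### The adjoint corepresentation and the involution `a ↦ κ(a)*`. -/

section

variable {A : Type*} [Ring A] [StarRing A] [HopfAlgebra ℂ A] [StarModule ℂ A]

/-- The matrix of the adjoint action on the coefficients of a corepresentation. -/
def adMatrix {ι : Type} (U : Matrix ι ι A) : Matrix (ι × ι) (ι × ι) A :=
  Matrix.of fun p q => HopfAlgebra.antipode ℂ (U q.1 p.1) * U p.2 q.2

/-- This is the tensor product of the contragredient of `U` with `U`; the antipode reverses the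
coproduct, which restores the order of indices. -/
theorem IsCorep.adMatrix (hA : IsCompactMatrixQuantumGroup A) {ι : Type} [Fintype ι]
    [DecidableEq ι] {U : Matrix ι ι A} (hU : IsCorep U) : IsCorep (adMatrix U) where
  comul p q := by
    simp only [QPB.adMatrix, Matrix.of_apply, Bialgebra.comul_mul, hU.comul_antipode hA, hU.comul,
      Finset.sum_mul_sum, Algebra.TensorProduct.tmul_mul_tmul, Fintype.sum_prod_type]
  counit p q := by
    have h1 : Coalgebra.counit (R := ℂ) (HopfAlgebra.antipode ℂ (U q.1 p.1)) =
        Coalgebra.counit (R := ℂ) (U q.1 p.1) := HopfAlgebra.counit_antipode _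
    simp only [QPB.adMatrix, Matrix.of_apply, Bialgebra.counit_mul, h1, hU.counit]
    by_cases h : p = q
    · subst h; simp
    · rw [if_neg h]
      split_ifs with h2 h3
      · exact absurd (Prod.ext h2.symm h3) h
      all_goals simp

theorem ad_eq_sum {ι : Type} [Fintype ι] [DecidableEq ι] {U : Matrix ι ι A}
    (hU : IsCorep U) (q : ι × ι) : BicovariantStarCalculus.ad A (U q.1 q.2) =
      ∑ p : ι × ι, U p.1 p.2 ⊗ₜ adMatrix U p q := by
  rw [BicovariantStarCalculus.ad_corep hU, Fintype.sum_prod_type]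
  rfl

variable (A) in
/-- The `*`-operation as a semilinear map. -/
def starMap : A →ₛₗ[starRingEnd ℂ] A := (starLinearEquiv ℂ : A ≃ₗ⋆[ℂ] A).toLinearMap

@[simp] theorem starMap_apply (a : A) : starMap A a = star a := rfl

theorem antilinear_corep_ext (hA : IsCompactMatrixQuantumGroup A) {X : Type*} [AddCommGroup X]
    [Module ℂ X] {f g : A →ₛₗ[starRingEnd ℂ] X}
    (h : ∀ (ι : Type) [Fintype ι] [DecidableEq ι] (U : Matrix ι ι A), IsUnitaryCorep U →
      ∀ i j, f (U i j) = g (U i j)) : f = g := by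
  ext a
  obtain ⟨ι, _, _, U, hU, ha⟩ := exists_mem_coeffs hA a
  have : coeffs U ≤ LinearMap.eqLocus f g := by
    refine Submodule.span_le.2 ?_
    rintro _ ⟨i, j, rfl⟩
    exact h ι U hU i j
  exact this ha

/-- On unitary coefficients `a ↦ κ(a)*` transposes the matrix indices. -/
theorem star_antipode_star_antipode (hA : IsCompactMatrixQuantumGroup A) (a : A) :
    star (HopfAlgebra.antipode ℂ (star (HopfAlgebra.antipode ℂ a))) = a := by
  refine LinearMap.congr_fun (f := (starMap A ∘ₛₗ HopfAlgebra.antipode ℂ) ∘ₛₗ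
    (starMap A ∘ₛₗ HopfAlgebra.antipode ℂ)) (g := LinearMap.id) (corep_ext hA ?_) a
  intro ι _ _ U hU i j
  simp [hU.antipode_eq]

end

/-! ### The star structure on left-invariant one-forms. -/

namespace BicovariantStarCalculus

universe uA uG

variable {A : Type uA} [Ring A] [StarRing A] [HopfAlgebra ℂ A] [StarModule ℂ A]
variable {Γ : Type uG} [AddCommGroup Γ] [Module ℂ Γ] [Module A Γ] [Module Aᵐᵒᵖ Γ]
  [IsScalarTower ℂ A Γ] [IsScalarTower ℂ Aᵐᵒᵖ Γ] [SMulCommClass A Aᵐᵒᵖ Γ]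
variable (C : BicovariantStarCalculus A Γ)

/-- `a ⊗ b ↦ a db` in `Γ^∧`. -/
def oneForm : A ⊗[ℂ] A →ₗ[ℂ] C.Envelope :=
  LinearMap.mul' ℂ C.Envelope ∘ₗ TensorProduct.map C.ofA.toLinearMap C.dA

/-- `a ⊗ b ↦ d(b*) a*` in `Γ^∧`. -/
def starOneForm : A ⊗[ℂ] A →ₛₗ[starRingEnd ℂ] C.Envelope :=
  (LinearMap.mul' ℂ C.Envelope ∘ₗ (TensorProduct.comm ℂ _ _).toLinearMap) ∘ₛₗ
    TensorProduct.map (C.ofA.toLinearMap ∘ₛₗ starMap A) (C.dA ∘ₛₗ starMap A)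

@[simp] theorem oneForm_tmul (a b : A) : C.oneForm (a ⊗ₜ b) = C.ofA a * C.dA b := by
  simp [oneForm]

@[simp] theorem starOneForm_tmul (a b : A) :
    C.starOneForm (a ⊗ₜ b) = C.dA (star b) * C.ofA (star a) := by
  simp [starOneForm]

theorem exists_sum_tmul (x : A ⊗[ℂ] A) :
    ∃ (n : ℕ) (a b : Fin n → A), x = ∑ i, a i ⊗ₜ[ℂ] b i := by
  induction x with
  | zero => exact ⟨0, 0, 0, by simp⟩
  | tmul a b => exact ⟨1, fun _ => a, fun _ => b, by simp⟩
  | add x y hx hy =>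
    obtain ⟨n, a, b, rfl⟩ := hx
    obtain ⟨m, a', b', rfl⟩ := hy
    exact ⟨n + m, Fin.append a a', Fin.append b b', by simp [Fin.sum_univ_add]⟩

/-- A relation in the envelope is a relation in `Γ`, where star covariance applies. The resulting
right multiples are transported back through the Leibniz rule. -/
theorem starOneForm_eq_zero {x : A ⊗[ℂ] A} (hx : C.oneForm x = 0) : C.starOneForm x = 0 := by
  obtain ⟨g, hg⟩ := C.exists_factor C.oneForm (fun n a b h => by
    simp only [oneForm_tmul]
    exact C.compatible_gen.form n a b h)
  have hg' : ∀ a b, g (a • C.d b) = C.ofA a * C.dA b := fun a b => by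
    have := LinearMap.congr_fun hg (a ⊗ₜ b)
    simpa [formMap] using this.symm
  have hg₁ : ∀ b, g (C.d b) = C.dA b := fun b => by simpa using hg' 1 b
  have hop : ∀ a b, g (MulOpposite.op a • C.d b) = C.dA b * C.ofA a := fun a b => by
    have h1 : MulOpposite.op a • C.d b = C.d (b * a) - b • C.d a := by
      rw [C.leibniz, add_sub_cancel_left]
    rw [h1, map_sub, hg', hg₁, C.dA_mul, add_sub_cancel_left]
  obtain ⟨n, a, b, rfl⟩ := exists_sum_tmul x
  simp only [map_sum, oneForm_tmul] at hx
  have h2 := congrArg g (C.star_covariant n a b (C.sum_smul_eq_zero hx))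
  simpa only [map_sum, starOneForm_tmul, hop, map_zero] using h2

theorem oneForm_π (a : A) : C.oneForm (TensorProduct.map (HopfAlgebra.antipode ℂ) LinearMap.id
    (Coalgebra.comul a)) = C.π a := by
  rw [oneForm, LinearMap.comp_apply, map_map, LinearMap.comp_id]
  rfl

/-- On a unitary corepresentation the two sides differ by the differential of an entry of `U* U =
1`. -/
theorem starOneForm_π (hA : IsCompactMatrixQuantumGroup A) (a : A) :
    C.starOneForm (TensorProduct.map (HopfAlgebra.antipode ℂ) LinearMap.id (Coalgebra.comul a)) =
      -C.π (star (HopfAlgebra.antipode ℂ a)) := by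
  refine LinearMap.congr_fun (f := C.starOneForm ∘ₛₗ (TensorProduct.map (HopfAlgebra.antipode ℂ)
    LinearMap.id ∘ₗ Coalgebra.comul)) (g := (-C.π) ∘ₛₗ (starMap A ∘ₛₗ HopfAlgebra.antipode ℂ))
    (antilinear_corep_ext hA ?_) a
  intro ι _ _ U hU i j
  simp only [LinearMap.comp_apply, hU.comul, map_sum, TensorProduct.map_tmul, LinearMap.id_apply,
    starOneForm_tmul, starMap_apply, hU.antipode_eq, star_star, LinearMap.neg_apply,
    C.π_corep hU.isCorep]
  rw [eq_neg_iff_add_eq_zero, ← Finset.sum_add_distrib]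
  have h1 : ∀ k, C.dA (star (U k j)) * C.ofA (U k i) + C.ofA (star (U k j)) * C.dA (U k i) =
      C.dA (star (U k j) * U k i) := fun k => by rw [C.dA_mul, add_comm]
  simp only [h1, ← map_sum, hU.sum_star_mul]
  split_ifs
  · rw [← C.dΓ_ofA, map_one, C.dΓ_one]
  · exact map_zero _

/-- This makes the rule `π(a)* = -π(κ(a)*)` well defined on `π(A)`. -/
theorem π_star_antipode (hA : IsCompactMatrixQuantumGroup A) {a : A} (ha : C.π a = 0) :
    C.π (star (HopfAlgebra.antipode ℂ a)) = 0 := by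
  rw [← C.oneForm_π] at ha
  have := C.starOneForm_eq_zero ha
  rwa [C.starOneForm_π hA, neg_eq_zero] at this

end BicovariantStarCalculus

namespace BundleCalculus

universe uA uG uV uB uW

variable {V : Type uV} {B : Type uB} {A : Type uA}
    [Ring V] [StarRing V] [Algebra ℂ V] [StarModule ℂ V]
    [Ring B] [StarRing B] [Algebra ℂ B] [StarModule ℂ B]
    [Ring A] [StarRing A] [HopfAlgebra ℂ A] [StarModule ℂ A]
    {Γ : Type uG} [AddCommGroup Γ] [Module ℂ Γ] [Module A Γ] [Module Aᵐᵒᵖ Γ]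
    [IsScalarTower ℂ A Γ] [IsScalarTower ℂ Aᵐᵒᵖ Γ] [SMulCommClass A Aᵐᵒᵖ Γ]
    {P : QuantumPrincipalBundle V B A} {C : BicovariantStarCalculus A Γ}
    {Ω : Type uW} [Ring Ω] [Algebra ℂ Ω] {𝒲 : ℕ → Submodule ℂ Ω} [GradedAlgebra 𝒲]
    (S : BundleCalculus P C Ω 𝒲)

/-! ### Symbols of one-forms -/

theorem j_mem_fil (b : B) : S.j b ∈ S.fil (0 : ℕ) := S.mem_fil_of_mem (S.j_mem b)

theorem symb_zero_j (b : B) : S.symb 0 (S.j b) = S.Fl (S.j b) :=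
  compR_of_mem (tens_mono le_top le_rfl (S.Fl_j_mem b))

theorem symb_one_d_j (b : B) : S.symb 1 (S.d (S.j b)) =
    TensorProduct.map S.j.toLinearMap C.dA (P.F b) := by
  rw [S.symb_succ_d_of_mem (S.j_mem_fil b), symb_zero_j, Fl_j, map_map]
  congr 2
  · ext b; simp [gradeInvolution_of_mem (S.j_mem b)]
  · ext a; simp [C.dΓ_ofA]

theorem d_j_mem (b : B) : S.d (S.j b) ∈ 𝒲 1 := S.d_mem 0 _ (S.j_mem b)

theorem symb_one_j_mul (b : B) {w : Ω} (hw : w ∈ 𝒲 1) :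
    S.symb 1 (S.j b * w) = S.Fl (S.j b) * S.symb 1 w := by
  have h := (S.symb_mul (S.j_mem_fil b) (S.mem_fil_of_mem hw)).1
  rw [zero_add] at h
  rw [h, symb_zero_j, gmul_of_left (tens_mono le_top le_rfl (S.Fl_j_mem b))]

theorem symb_one_mul_j (b : B) {w : Ω} (hw : w ∈ 𝒲 1) :
    S.symb 1 (w * S.j b) = S.symb 1 w * S.Fl (S.j b) := by
  have h := (S.symb_mul (S.mem_fil_of_mem hw) (S.j_mem_fil b)).1
  rw [add_zero] at h
  rw [h, symb_zero_j, gmul_of_right (tens_mono le_rfl le_top (S.Fl_j_mem b))]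

theorem Fl_of_mem_one {w : Ω} (hw : w ∈ 𝒲 1) : S.Fl w =
    TensorProduct.map LinearMap.id C.ofA.toLinearMap (S.FA w) + S.symb 1 w := by
  have h0 : S.symb 0 w = TensorProduct.map LinearMap.id C.ofA.toLinearMap (S.FA w) := by
    have : C.ofA.toLinearMap ∘ₗ C.pA.toLinearMap = gproj C.deg 0 :=
      LinearMap.ext fun y => C.ofA_pA y
    rw [FA, LinearMap.comp_apply, map_map, this, LinearMap.id_comp]
    rfl
  obtain ⟨s, hs, hs'⟩ := exists_sum_compR (ℬ := C.deg) (S.Fl w)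
  have h2 : ∀ k ∉ ({0, 1} : Finset ℕ), compR C.deg k (S.Fl w) = 0 := fun k hk =>
    S.symb_of_lt (by simp at hk; omega) hw
  have h3 : S.Fl w = ∑ k ∈ ({0, 1} : Finset ℕ), compR C.deg k (S.Fl w) := by
    conv_lhs => rw [hs]
    rw [Finset.sum_subset (Finset.subset_union_left (s₂ := {0, 1})) fun k _ hk => hs' k hk,
      Finset.sum_subset (Finset.subset_union_right (s₁ := s)) fun k _ hk => h2 k hk]
  rw [← h0]
  simpa [symb] using h3

/-- Conjugation of one-forms can therefore be checked on products `b db'`, where it is explicit. -/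
theorem mem_span_j_mul {w : Ω} (hw : w ∈ 𝒲 1) :
    w ∈ Submodule.span ℂ {x | ∃ b b', S.j b * S.d (S.j b') = x} := by
  rw [← gproj_of_mem hw]
  refine S.induction (T := (Submodule.span ℂ {x | ∃ b b', S.j b * S.d (S.j b') = x}).comap
    (gproj 𝒲 1)) ?_ ?_ ?_ w
  · rw [Submodule.mem_comap, gproj_of_mem_ne (SetLike.one_mem_graded 𝒲) zero_ne_one]
    exact zero_mem _
  · intro b w hw
    rw [Submodule.mem_comap] at *
    rw [gproj_mul_left (S.j_mem b)]
    generalize gproj 𝒲 1 w = y at hw ⊢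
    induction hw using Submodule.span_induction with
    | mem x hx =>
      obtain ⟨b₁, b₂, rfl⟩ := hx
      exact Submodule.subset_span ⟨b * b₁, b₂, by rw [map_mul, mul_assoc]⟩
    | zero => rw [mul_zero]; exact zero_mem _
    | add x y _ _ hx hy => rw [mul_add]; exact add_mem hx hy
    | smul c x _ hx => rw [mul_smul_comm]; exact Submodule.smul_mem _ _ hx
  · intro w _
    rw [Submodule.mem_comap, gproj_succ_comp_of_mem S.d_mem]
    have h1 : gproj 𝒲 0 w ∈ LinearMap.range S.j.toLinearMap := by
      rw [S.range_j]; exact gproj_mem 0 w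
    obtain ⟨b, hb⟩ := h1
    rw [← hb]
    exact Submodule.subset_span ⟨1, b, by simp⟩

/-- Freeness of the action: every left-invariant one-form is a symbol. -/
theorem exists_symb_one (a : A) :
    ∃ w ∈ 𝒲 1, S.symb 1 w = 1 ⊗ₜ C.π a := by
  -- `T` consists of the `x` for which `(j ⊗ π)(x)`, transported by `iota`, is the symbol of a
  -- one-form. It contains `(q ⊗ 1)F(b)`, with witness `q db`; freeness then provides `1 ⊗ a`.
  let T : Submodule ℂ (B ⊗[ℂ] A) := ((𝒲 1).map (S.symb 1)).comap
    (S.iota ∘ₗ TensorProduct.map S.j.toLinearMap C.π)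
  have h1 : Submodule.span ℂ {y | ∃ q b : B, y = (q ⊗ₜ[ℂ] (1 : A)) * P.F b} ≤ T := by
    refine Submodule.span_le.2 ?_
    rintro _ ⟨q, b, rfl⟩
    refine ⟨S.j q * S.d (S.j b), ?_, ?_⟩
    · have := SetLike.mul_mem_graded (S.j_mem q) (S.d_j_mem b)
      rwa [zero_add] at this
    · have h2 : ∀ y, S.iota (TensorProduct.map S.j.toLinearMap C.π ((q ⊗ₜ[ℂ] (1 : A)) * y)) =
          S.Fl (S.j q) * S.iota (TensorProduct.map S.j.toLinearMap C.π y) := by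
        intro y
        induction y with
        | zero => simp
        | add x y hx hy => simp only [mul_add, map_add, hx, hy]
        | tmul x c =>
          have h3 : S.Fl (S.j q) = TensorProduct.map LinearMap.id C.ofA.toLinearMap
              (S.FA (S.j q)) := by rw [Fl_j, FA_j, map_map]; rfl
          have h7 : TensorProduct.map LinearMap.id C.ofA.toLinearMap
              (S.FA (S.j q) * S.FA (S.j x)) = TensorProduct.map LinearMap.id C.ofA.toLinearMap
                (S.FA (S.j q)) * TensorProduct.map LinearMap.id C.ofA.toLinearMap (S.FA (S.j x)) :=
            map_mul (Algebra.TensorProduct.map (AlgHom.id ℂ Ω) C.ofA) _ _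
          rw [Algebra.TensorProduct.tmul_mul_tmul, one_mul, TensorProduct.map_tmul,
            TensorProduct.map_tmul, iota_tmul, iota_tmul, h3, ← mul_assoc, AlgHom.toLinearMap_apply,
            map_mul, FA_mul, h7]
          rfl
      have h4 : S.symb 1 (S.d (S.j b)) =
          S.iota (TensorProduct.map S.j.toLinearMap C.π (P.F b)) := by
        have h5 : S.symb 0 (S.j b) = S.iota (S.j b ⊗ₜ 1) := by
          rw [iota_tmul, ← Algebra.TensorProduct.one_def, mul_one, symb_zero_j, Fl_j, FA_j, map_map]
          rfl
        have h6 : S.dvh (S.j b ⊗ₜ 1) = TensorProduct.map S.j.toLinearMap C.π (P.F b) := by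
          simp only [dvh, LinearMap.comp_apply, LinearMap.add_apply, TensorProduct.map_tmul,
            C.dΓ_one, TensorProduct.tmul_zero, add_zero, FA_j]
          induction P.F b with
          | zero => simp
          | add x y hx hy =>
            simp only [map_add, TensorProduct.add_tmul, LinearMap.id_apply, LinearEquiv.coe_coe]
              at hx hy ⊢
            rw [hx, hy]
          | tmul x c => simp [gradeInvolution_of_mem (S.j_mem x)]
        rw [S.symb_succ_d_of_mem (S.j_mem_fil b), h5, ← iota_dvh, h6]
      rw [S.symb_one_j_mul q (S.d_j_mem b), h4]
      exact (h2 _).symm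
  obtain ⟨w, hw, h⟩ := h1 (P.free (1 ⊗ₜ a))
  refine ⟨w, hw, h.trans ?_⟩
  simp [iota_tmul, FA_one]

/-! ### Averaging of one-forms -/

/-- Lifts are chosen on a basis of `π(A)` rather than of `A`, so that the resulting map is linear
and vanishes where `π` does. -/
theorem exists_section : ∃ η : A →ₗ[ℂ] Ω,
    (∀ a, C.π a = 0 → η a = 0) ∧ (∀ a, η a ∈ 𝒲 1) ∧ ∀ a, S.symb 1 (η a) = 1 ⊗ₜ C.π a := by
  let b := Module.Basis.ofVectorSpace ℂ (LinearMap.range C.π)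
  have h1 : ∀ ϑ : LinearMap.range C.π, ∃ w : 𝒲 1, S.symb 1 w = 1 ⊗ₜ[ℂ] (ϑ : C.Envelope) := by
    rintro ⟨_, a, rfl⟩
    obtain ⟨w, hw, h⟩ := S.exists_symb_one a
    exact ⟨⟨w, hw⟩, h⟩
  choose f hf using h1
  let g : LinearMap.range C.π →ₗ[ℂ] 𝒲 1 := b.constr ℂ fun i => f (b i)
  have hg : S.symb 1 ∘ₗ (𝒲 1).subtype ∘ₗ g =
      TensorProduct.mk ℂ Ω C.Envelope 1 ∘ₗ (LinearMap.range C.π).subtype := by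
    refine b.ext fun i => ?_
    simp only [LinearMap.comp_apply, g, Module.Basis.constr_basis]
    exact hf (b i)
  refine ⟨(𝒲 1).subtype ∘ₗ g ∘ₗ C.π.rangeRestrict, fun a ha => ?_, fun a => (g _).2, fun a =>
    LinearMap.congr_fun hg (C.π.rangeRestrict a)⟩
  have : C.π.rangeRestrict a = 0 := Subtype.ext ha
  rw [LinearMap.comp_apply, LinearMap.comp_apply, this, map_zero, map_zero]

/-- The average of a map `A → Ω(P)` with respect to the adjoint action on `A`. -/
def adAvg (h : A →ₗ[ℂ] ℂ) (η : A →ₗ[ℂ] Ω) : A →ₗ[ℂ] Ω :=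
  sliceR (h ∘ₗ LinearMap.mul' ℂ A ∘ₗ TensorProduct.map LinearMap.id (HopfAlgebra.antipode ℂ)) ∘ₗ
    (TensorProduct.assoc ℂ Ω A A).toLinearMap ∘ₗ
      TensorProduct.map (S.FA ∘ₗ η) LinearMap.id ∘ₗ BicovariantStarCalculus.ad A

theorem adAvg_corep (h : A →ₗ[ℂ] ℂ) (η : A →ₗ[ℂ] Ω) {ι : Type} [Fintype ι] [DecidableEq ι]
    {U : Matrix ι ι A} (hU : IsCorep U) (q : ι × ι) : S.adAvg h η (U q.1 q.2) =
      ∑ p : ι × ι, sliceR (h ∘ₗ LinearMap.mulRight ℂ (HopfAlgebra.antipode ℂ (adMatrix U p q)))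
        (S.FA (η (U p.1 p.2))) := by
  simp only [adAvg, LinearMap.comp_apply, ad_eq_sum hU, map_sum, TensorProduct.map_tmul,
    LinearMap.id_apply]
  refine Finset.sum_congr rfl fun p _ => ?_
  induction S.FA (η (U p.1 p.2)) with
  | zero => simp
  | add x y hx hy => simp only [map_add, TensorProduct.add_tmul, hx, hy]
  | tmul x a => simp

/-- `exchange_right` for the adjoint matrix turns the coaction on the contracted forms into the
adjoint coaction on the argument. -/
theorem FA_adAvg (hA : IsCompactMatrixQuantumGroup A) {h : A →ₗ[ℂ] ℂ} (hh : IsHaar h)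
    (η : A →ₗ[ℂ] Ω) (a : A) : S.FA (S.adAvg h η a) =
      TensorProduct.map (S.adAvg h η) LinearMap.id (BicovariantStarCalculus.ad A a) := by
  refine LinearMap.congr_fun (f := S.FA ∘ₗ S.adAvg h η) (g := TensorProduct.map (S.adAvg h η)
    LinearMap.id ∘ₗ BicovariantStarCalculus.ad A) (corep_ext hA ?_) a
  intro ι _ _ U hU i j
  have hW := hU.isCorep.adMatrix hA
  have h1 : ∀ p q : ι × ι, sliceR (h ∘ₗ LinearMap.mulRight ℂ (HopfAlgebra.antipode ℂ
      (adMatrix U p q))) ∘ₗ Coalgebra.comul = ∑ l, (h ∘ₗ LinearMap.mulRight ℂ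
        (HopfAlgebra.antipode ℂ (adMatrix U p l))).smulRight (adMatrix U l q) := by
    intro p q
    ext w
    rw [LinearMap.comp_apply, hh.exchange_right hA hW]
    simp
  have h2 : ∀ (l : A →ₗ[ℂ] ℂ) (w : Ω), S.FA (sliceR l (S.FA w)) =
      TensorProduct.map LinearMap.id (sliceR l ∘ₗ Coalgebra.comul) (S.FA w) := by
    intro l w
    rw [← map_sliceR_assoc, S.isCoaction_FA.coassoc, map_map, LinearMap.id_comp]
  simp only [LinearMap.comp_apply, S.adAvg_corep h η hU.isCorep (i, j), map_sum, h2, h1,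
    map_id_sum, map_smulRight, ad_eq_sum hU.isCorep (i, j),
    TensorProduct.map_tmul, S.adAvg_corep h η hU.isCorep, LinearMap.id_apply,
    TensorProduct.sum_tmul]
  rw [Finset.sum_comm]

/-- The symbol `1 ⊗ π(a)` is already covariant, so averaging reproduces it: `W κ(W) = 1` for the
adjoint matrix `W`, and `h(1) = 1`. -/
theorem symb_adAvg (hA : IsCompactMatrixQuantumGroup A) {h : A →ₗ[ℂ] ℂ} (hh : IsHaar h)
    {η : A →ₗ[ℂ] Ω} (hη : ∀ a, η a ∈ 𝒲 1) (hη' : ∀ a, S.symb 1 (η a) = 1 ⊗ₜ C.π a) (a : A) :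
    S.symb 1 (S.adAvg h η a) = 1 ⊗ₜ C.π a := by
  refine LinearMap.congr_fun (f := S.symb 1 ∘ₗ S.adAvg h η)
    (g := TensorProduct.mk ℂ Ω C.Envelope 1 ∘ₗ C.π) (corep_ext hA ?_) a
  intro ι _ _ U hU i j
  have hW := hU.isCorep.adMatrix hA
  have h1 : ∀ q : ι × ι, C.rightCoaction (C.π (U q.1 q.2)) =
      ∑ p : ι × ι, C.π (U p.1 p.2) ⊗ₜ adMatrix U p q := by
    intro q
    rw [C.rightCoaction_π hA hU.isCorep, Fintype.sum_prod_type]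
    rfl
  have h2 : ∀ (l : A →ₗ[ℂ] ℂ) (p : ι × ι), S.symb 1 (sliceR l (S.FA (η (U p.1 p.2)))) =
      ∑ m : ι × ι, l (adMatrix U m p) • ((1 : Ω) ⊗ₜ C.π (U m.1 m.2)) := by
    intro l p
    -- The horizontal part of the one-form has no component of vertical degree one after the right
    -- coaction, so only the known symbol contributes.
    have h3 : gproj C.deg 1 ∘ₗ (sliceR l ∘ₗ C.rightCoaction) ∘ₗ C.ofA.toLinearMap = 0 := by
      ext c
      have h4 := C.rightCoaction_ofA_mul c 1
      rw [mul_one, C.rightCoaction_one, ← Algebra.TensorProduct.one_def, mul_one] at h4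
      simp only [LinearMap.comp_apply, AlgHom.toLinearMap_apply, h4, sliceR_map, LinearMap.comp_id]
      exact gproj_of_mem_ne (C.ofA_mem _) zero_ne_one
    have h5 := map_sliceR_assoc S.Fl l (S.FA (η (U p.1 p.2)))
    rw [Fl_assoc_right, map_map, LinearMap.id_comp] at h5
    rw [symb, LinearMap.comp_apply, ← h5, map_map, LinearMap.id_comp, S.Fl_of_mem_one (hη _),
      hη', map_add, map_map, LinearMap.id_comp, LinearMap.comp_assoc, h3,
      TensorProduct.map_zero_right, LinearMap.zero_apply, zero_add, TensorProduct.map_tmul,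
      LinearMap.comp_apply, LinearMap.comp_apply, h1]
    simp only [map_sum, sliceR_tmul, map_smul, gproj_of_mem (C.π_mem_deg _), LinearMap.id_apply,
      TensorProduct.tmul_sum, TensorProduct.tmul_smul]
  simp only [LinearMap.comp_apply, S.adAvg_corep h η hU.isCorep (i, j), map_sum, h2]
  rw [Finset.sum_comm]
  simp only [← Finset.sum_smul, LinearMap.mulRight_apply, ← map_sum, hW.mul_antipode, apply_ite h,
    hh.one, map_zero, ite_smul, one_smul, zero_smul, Finset.sum_ite_eq', Finset.mem_univ, if_true]
  rfl

theorem adAvg_mem {h : A →ₗ[ℂ] ℂ} {η : A →ₗ[ℂ] Ω} (hA : IsCompactMatrixQuantumGroup A)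
    (hη : ∀ a, η a ∈ 𝒲 1) (a : A) : S.adAvg h η a ∈ 𝒲 1 := by
  obtain ⟨ι, _, _, U, hU, ha⟩ := exists_mem_coeffs hA a
  have : coeffs U ≤ (𝒲 1).comap (S.adAvg h η) := by
    refine Submodule.span_le.2 ?_
    rintro _ ⟨i, j, rfl⟩
    change S.adAvg h η (U i j) ∈ 𝒲 1
    rw [S.adAvg_corep h η hU.isCorep (i, j)]
    exact sum_mem fun p _ => mem_tens_iff_sliceR.1 (S.stable_grade 1 _ (hη _)) _
  exact this ha

/-- The map `η` factors through `π`, and `(π ⊗ id) ad` vanishes on `ker π` because it equals the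
right coaction composed with `π`. -/
theorem adAvg_eq_zero (hA : IsCompactMatrixQuantumGroup A) {h : A →ₗ[ℂ] ℂ} {η : A →ₗ[ℂ] Ω}
    (hη : ∀ a, C.π a = 0 → η a = 0) {a : A} (ha : C.π a = 0) : S.adAvg h η a = 0 := by
  obtain ⟨k, hk⟩ := exists_factor_of_ker_le hη
  obtain ⟨g, hg⟩ := LinearMap.exists_extend k
  have h1 : η = g ∘ₗ C.π := LinearMap.ext fun a =>
    (hk a).symm.trans (LinearMap.congr_fun hg (C.π.rangeRestrict a)).symm
  have h2 : TensorProduct.map C.π LinearMap.id (BicovariantStarCalculus.ad A a) = 0 := by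
    have h3 : TensorProduct.map C.π LinearMap.id ∘ₗ BicovariantStarCalculus.ad A =
        C.rightCoaction ∘ₗ C.π := corep_ext hA fun ι _ _ U hU i j => by
      simp [C.rightCoaction_π hA hU.isCorep, BicovariantStarCalculus.ad_corep hU.isCorep]
    have h4 := LinearMap.congr_fun h3 a
    rw [LinearMap.comp_apply, LinearMap.comp_apply, ha, map_zero] at h4
    exact h4
  have h5 := map_map (S.FA ∘ₗ g) LinearMap.id C.π LinearMap.id (BicovariantStarCalculus.ad A a)
  rw [h2, map_zero, LinearMap.comp_assoc, ← h1, LinearMap.comp_id] at h5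
  rw [adAvg, LinearMap.comp_apply, LinearMap.comp_apply, LinearMap.comp_apply, ← h5, map_zero,
    map_zero]

/-! ### Hermitian connections -/

theorem conj_j_mul_d_j (b b' : B) :
    S.conj (S.j b * S.d (S.j b')) = S.d (S.j (star b')) * S.j (star b) := by
  rw [S.conj_mul 0 1 _ (S.j_mem b) _ (S.d_j_mem b'), S.conj_d, S.conj_j, S.conj_j]
  simp

theorem F_star (b : B) : P.F (star b) = star (P.F b) := map_star P.F b

theorem FA_conj {w : Ω} (hw : w ∈ 𝒲 1) :
    S.FA (S.conj w) = TensorProduct.map S.conj (starMap A) (S.FA w) := by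
  have h : Submodule.span ℂ {x | ∃ b b', S.j b * S.d (S.j b') = x} ≤
      LinearMap.eqLocus (S.FA ∘ₛₗ S.conj) (TensorProduct.map S.conj (starMap A) ∘ₛₗ S.FA) := by
    refine Submodule.span_le.2 ?_
    rintro _ ⟨b, b', rfl⟩
    change S.FA (S.conj _) = TensorProduct.map S.conj (starMap A) (S.FA _)
    rw [conj_j_mul_d_j, FA_mul, FA_mul, FA_d, FA_d, FA_j, FA_j, FA_j, FA_j, F_star, F_star]
    generalize P.F b = y, P.F b' = y'
    induction y with
    | zero => simp
    | add x y hx hy => simp only [star_add, map_add, add_mul, mul_add, hx, hy]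
    | tmul x a =>
      induction y' with
      | zero => simp
      | add x y hx hy => simp only [star_add, map_add, add_mul, mul_add, hx, hy]
      | tmul x' a' => simp [conj_j_mul_d_j]
  exact h (S.mem_span_j_mul hw)

/-- No star operation is set up on `Γ^∧`. The symbol is therefore lifted to `Ω(P) ⊗ (A ⊗ A)`, where
conjugating `b db'` is explicit. -/
theorem exists_symb_conj {w : Ω} (hw : w ∈ 𝒲 1) : ∃ X : Ω ⊗[ℂ] (A ⊗[ℂ] A),
    S.symb 1 w = TensorProduct.map LinearMap.id C.oneForm X ∧
      S.symb 1 (S.conj w) = TensorProduct.map S.conj C.starOneForm X := by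
  replace hw := S.mem_span_j_mul hw
  induction hw using Submodule.span_induction with
  | zero => exact ⟨0, by simp⟩
  | add x y _ _ hx hy =>
    obtain ⟨X, hX, hX'⟩ := hx
    obtain ⟨Y, hY, hY'⟩ := hy
    exact ⟨X + Y, by simp only [map_add, hX, hY], by simp only [map_add, hX', hY']⟩
  | smul c x _ hx =>
    obtain ⟨X, hX, hX'⟩ := hx
    exact ⟨c • X, by simp only [map_smul, hX], by simp only [map_smulₛₗ, RingHom.id_apply, hX']⟩
  | mem x hx =>
    obtain ⟨b, b', rfl⟩ := hx
    refine ⟨TensorProduct.map (LinearMap.mul' ℂ Ω ∘ₗ TensorProduct.map S.j.toLinearMap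
      S.j.toLinearMap) LinearMap.id (TensorProduct.tensorTensorTensorComm ℂ B A B A
        (P.F b ⊗ₜ P.F b')), ?_, ?_⟩
    · rw [S.symb_one_j_mul b (S.d_j_mem b'), symb_one_d_j, Fl_j]
      induction P.F b with
      | zero => simp
      | add x y hx hy => simp only [map_add, add_mul, TensorProduct.add_tmul, hx, hy]
      | tmul x a =>
        induction P.F b' with
        | zero => simp
        | add x y hx hy => simp only [map_add, mul_add, TensorProduct.tmul_add, hx, hy]
        | tmul x' a' => simp
    · have hj : ∀ b b', S.conj (S.j b * S.j b') = S.j (star b') * S.j (star b) := fun b b' => by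
        rw [← map_mul, S.conj_j, star_mul, map_mul]
      rw [conj_j_mul_d_j, S.symb_one_mul_j _ (S.d_j_mem _), symb_one_d_j, Fl_j, F_star, F_star]
      generalize P.F b = y, P.F b' = y'
      induction y with
      | zero => simp
      | add x y hx hy => simp only [star_add, map_add, mul_add, TensorProduct.add_tmul, hx, hy]
      | tmul x a =>
        induction y' with
        | zero => simp
        | add x y hx hy => simp only [star_add, map_add, add_mul, TensorProduct.tmul_add, hx, hy]
        | tmul x' a' => simp [hj]

theorem conj_one : S.conj 1 = 1 := by
  have := S.conj_j 1
  rwa [star_one, map_one] at this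

/-- The lift from `exists_symb_conj` and the obvious lift of `1 ⊗ π(a)` differ by an element killed
by `oneForm` in the second leg, hence by `starOneForm`. -/
theorem symb_conj (hA : IsCompactMatrixQuantumGroup A) {w : Ω} (hw : w ∈ 𝒲 1) {a : A}
    (h : S.symb 1 w = 1 ⊗ₜ C.π a) :
    S.symb 1 (S.conj w) = -(1 ⊗ₜ C.π (star (HopfAlgebra.antipode ℂ a))) := by
  obtain ⟨X, hX, hX'⟩ := S.exists_symb_conj hw
  set u : A ⊗[ℂ] A := TensorProduct.map (HopfAlgebra.antipode ℂ) LinearMap.id (Coalgebra.comul a)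
  have h1 : X - 1 ⊗ₜ u ∈ tens ⊤ (LinearMap.ker C.oneForm) := by
    rw [mem_tens_ker_right, map_sub, ← hX, h, TensorProduct.map_tmul, C.oneForm_π]
    simp
  have h2 : ∀ Y ∈ tens ⊤ (LinearMap.ker C.oneForm),
      TensorProduct.map S.conj C.starOneForm Y = 0 := by
    rintro _ ⟨t, rfl⟩
    induction t with
    | zero => simp
    | add x y hx hy => simp only [map_add, hx, hy, add_zero]
    | tmul x y => simp [C.starOneForm_eq_zero y.2]
  have h3 := h2 _ h1
  rw [map_sub, ← hX', sub_eq_zero, TensorProduct.map_tmul, conj_one, C.starOneForm_π hA] at h3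
  rw [h3, TensorProduct.tmul_neg]

/-- A one-form is determined under `F̂` by its horizontal coaction and its symbol. Averaging
prescribes the first, freeness the second, and passing to the hermitian part keeps both. -/
theorem exists_isConnection (hA : IsCompactMatrixQuantumGroup A) : ∃ ω, S.IsConnection ω := by
  obtain ⟨h, hh⟩ := exists_haar A hA
  obtain ⟨η₀, h0, h0m, h0s⟩ := S.exists_section
  set η := S.adAvg h η₀
  have hη : ∀ a, C.π a = 0 → η a = 0 := fun a => S.adAvg_eq_zero hA h0
  have hηm : ∀ a, η a ∈ 𝒲 1 := S.adAvg_mem hA h0m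
  have hηs : ∀ a, S.symb 1 (η a) = 1 ⊗ₜ C.π a := S.symb_adAvg hA hh h0m h0s
  have hηA := S.FA_adAvg hA hh η₀
  -- `η'` is the conjugate of `η` for the star `π(a)* = -π(κ(a)*)`. As `a ↦ κ(a)*` is an involution,
  -- `η + η'` is hermitian. Both summands have symbol `1 ⊗ π(a)`, which explains the factor `2⁻¹`.
  let η' : A →ₗ[ℂ] Ω := -(S.conj ∘ₛₗ (η ∘ₛₗ (starMap A ∘ₛₗ HopfAlgebra.antipode ℂ)))
  have hη' : ∀ a, η' a = -S.conj (η (star (HopfAlgebra.antipode ℂ a))) := fun a => rfl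
  have hη'A : ∀ a, S.FA (η' a) = TensorProduct.map η' LinearMap.id
      (BicovariantStarCalculus.ad A a) := by
    refine LinearMap.congr_fun (f := S.FA ∘ₗ η') (g := TensorProduct.map η' LinearMap.id ∘ₗ
      BicovariantStarCalculus.ad A) (corep_ext hA ?_)
    intro ι _ _ U hU i j
    have h1 : ∀ i j, star (HopfAlgebra.antipode ℂ (U i j)) = U j i := fun i j => by
      rw [hU.antipode_eq, star_star]
    simp only [LinearMap.comp_apply, hη', map_neg, h1, S.FA_conj (hηm _), η, hηA,
      BicovariantStarCalculus.ad_corep hU.isCorep, map_sum, TensorProduct.map_tmul,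
      LinearMap.id_apply, starMap_apply, star_mul, TensorProduct.neg_tmul,
      Finset.sum_neg_distrib]
    rw [Finset.sum_comm]
    simp only [hU.antipode_eq]
  obtain ⟨ω, hω⟩ := exists_factor_of_ker_le (f := C.π) (g := (2⁻¹ : ℂ) • (η + η')) (fun a ha => by
    simp [hη a ha, hη' a, hη _ (C.π_star_antipode hA ha)])
  have hm : ∀ a, ω (C.π.rangeRestrict a) ∈ 𝒲 1 := fun a => by
    rw [hω]
    exact Submodule.smul_mem _ _ (add_mem (hηm a) (neg_mem (S.conj_mem 1 _ (hηm _))))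
  refine ⟨ω, ?_, ?_, ?_⟩
  · rintro ⟨_, a, rfl⟩
    exact hm a
  · intro a
    simp only [hω, LinearMap.smul_apply, LinearMap.add_apply, hη', map_smulₛₗ, map_add, map_neg,
      S.conj_conj, star_antipode_star_antipode hA]
    simp only [map_inv₀, map_ofNat, ← smul_neg]
    congr 1
    abel
  · intro a
    have h1 : ω ∘ₗ C.π.rangeRestrict = (2⁻¹ : ℂ) • (η + η') := LinearMap.ext hω
    have h2 : S.FA (ω (C.π.rangeRestrict a)) = TensorProduct.map (ω ∘ₗ C.π.rangeRestrict)
        LinearMap.id (BicovariantStarCalculus.ad A a) := by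
      rw [h1, hω, TensorProduct.map_smul_left, TensorProduct.map_add_left]
      simp only [LinearMap.smul_apply, LinearMap.add_apply, map_smul, map_add, hη'A, η, hηA]
    have h3 : S.symb 1 (ω (C.π.rangeRestrict a)) = 1 ⊗ₜ C.π a := by
      rw [hω, LinearMap.smul_apply, LinearMap.add_apply, map_smul, map_add, hηs, hη', map_neg,
        S.symb_conj hA (hηm _) (hηs _), star_antipode_star_antipode hA, neg_neg, ← two_smul ℂ,
        smul_smul]
      norm_num
    rw [S.Fl_of_mem_one (hm a), h2, h3, map_map, LinearMap.id_comp, LinearMap.comp_id]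

end BundleCalculus
end QPB
end

noncomputable section
namespace QPB

namespace BundleCalculus

universe uA uG uV uB uW

variable {V : Type uV} {B : Type uB} {A : Type uA}
    [Ring V] [StarRing V] [Algebra ℂ V] [StarModule ℂ V]
    [Ring B] [StarRing B] [Algebra ℂ B] [StarModule ℂ B]
    [Ring A] [StarRing A] [HopfAlgebra ℂ A] [StarModule ℂ A]
    {Γ : Type uG} [AddCommGroup Γ] [Module ℂ Γ] [Module A Γ] [Module Aᵐᵒᵖ Γ]
    [IsScalarTower ℂ A Γ] [IsScalarTower ℂ Aᵐᵒᵖ Γ] [SMulCommClass A Aᵐᵒᵖ Γ]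
    {P : QuantumPrincipalBundle V B A} {C : BicovariantStarCalculus A Γ}
    {Ω : Type uW} [Ring Ω] [Algebra ℂ Ω] {𝒲 : ℕ → Submodule ℂ Ω} [GradedAlgebra 𝒲]
    (S : BundleCalculus P C Ω 𝒲)

/-! ### Symbols as elements of `vh(P)` -/

/-- The symbol of a form, as an element of `vh(P)`. -/
def vhSymb (q : ℕ) : Ω →ₗ[ℂ] Ω ⊗[ℂ] C.Envelope := S.iotaInv ∘ₗ S.symb q

theorem iota_vhSymb (q : ℕ) (w : Ω) : S.iota (S.vhSymb q w) = S.symb q w := S.iota_iotaInv _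

theorem eq_vhSymb {q : ℕ} {w : Ω} {x : Ω ⊗[ℂ] C.Envelope} :
    x = S.vhSymb q w ↔ S.symb q w = S.iota x := by
  rw [← S.iota_vhSymb, S.iota_injective.eq_iff, eq_comm]

theorem vhSymb_mem (hA : IsCompactMatrixQuantumGroup A) {p q : ℕ} {w : Ω} (hw : w ∈ 𝒲 (p + q))
    (hw' : w ∈ S.fil q) : S.vhSymb q w ∈ S.vhDeg p q := by
  refine S.iotaInv_mem_deg hA (S.symb_mem_cot hw') ?_
  simpa [horDeg] using mem_tens_inf (S.symb_mem_hor hw') (S.symb_mem hw)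

theorem vhSymb_d {q : ℕ} {w : Ω} (hw : w ∈ S.fil q) :
    S.vhSymb (q + 1) (S.d w) = S.dvh (S.vhSymb q w) := by
  rw [eq_comm, eq_vhSymb, iota_dvh, iota_vhSymb, S.symb_succ_d_of_mem hw]

/-! ### Products with a connection -/

section connection

variable {S} {ω : LinearMap.range C.π →ₗ[ℂ] Ω}

theorem IsConnection.symb_one (hω : S.IsConnection ω) (a : A) : S.symb 1 (ω (C.π.rangeRestrict a)) = 1 ⊗ₜ C.π a := by
  rw [symb, LinearMap.comp_apply, hω.pullback, map_add,
    compR_of_mem (tmul_mem_tens Submodule.mem_top (C.π_mem_deg a)),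
    compR_of_mem_ne zero_ne_one (map_mem_tens (U := ⊤) (W := ⊤) (fun _ _ => Submodule.mem_top)
      (fun a _ => C.ofA_mem a) (mem_tens_top _)), zero_add]

theorem IsConnection.mem_fil (hω : S.IsConnection ω) (ϑ : LinearMap.range C.π) : ω ϑ ∈ S.fil (1 : ℕ) :=
  S.mem_fil_of_mem (hω.mem ϑ)

theorem IsConnection.mul_mem (hω : S.IsConnection ω) {p q : ℕ} {w : Ω} (hw : w ∈ 𝒲 (p + q) ⊓ S.fil q) (a : A) :
    w * ω (C.π.rangeRestrict a) ∈ 𝒲 (p + (q + 1)) ⊓ S.fil ((q + 1 : ℕ) : ℤ) :=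
  ⟨by
    rw [← add_assoc]
    exact SetLike.mul_mem_graded hw.1 (hω.mem _), (S.symb_mul hw.2 (hω.mem_fil _)).2⟩

theorem IsConnection.symb_mul (hω : S.IsConnection ω) {q : ℕ} {w φ : Ω} {θ : C.Envelope} (hw : w ∈ S.fil q)
    (h : S.symb q w = S.iota (φ ⊗ₜ θ)) (a : A) :
    S.symb (q + 1) (w * ω (C.π.rangeRestrict a)) = S.iota (φ ⊗ₜ (θ * C.π a)) := by
  rw [(S.symb_mul hw (hω.mem_fil _)).1, h, hω.symb_one,
    gmul_of_right (tmul_mem_tens (SetLike.one_mem_graded 𝒲) Submodule.mem_top), iota_tmul,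
    iota_tmul, mul_assoc, Algebra.TensorProduct.tmul_mul_tmul, one_mul]

theorem IsConnection.list_prod (hω : S.IsConnection ω) {p : ℕ} {φ : Ω} (hφ : φ ∈ S.horDeg p) (q : ℕ) (a : Fin q → A) :
    φ * (List.ofFn fun i => ω (C.π.rangeRestrict (a i))).prod ∈ 𝒲 (p + q) ⊓ S.fil q ∧
      S.symb q (φ * (List.ofFn fun i => ω (C.π.rangeRestrict (a i))).prod) =
        S.iota (φ ⊗ₜ (List.ofFn fun i => C.π (a i)).prod) := by
  induction q with
  | zero =>
    simp only [List.ofFn_zero, List.prod_nil, mul_one]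
    refine ⟨⟨hφ.2, ?_⟩, ?_⟩
    · have h := hφ.1
      rw [hor_eq_fil] at h
      exact h
    · rw [S.symb_zero_of_mem_hor hφ.1, iota_tmul, ← Algebra.TensorProduct.one_def, mul_one]
  | succ q ih =>
    obtain ⟨h1, h2⟩ := ih fun i => a i.castSucc
    simp only [List.ofFn_succ', List.prod_concat, ← mul_assoc]
    exact ⟨hω.mul_mem h1 _, hω.symb_mul h1.2 h2 _⟩

/-- By `invDeg_eq` the second leg may be taken as a product from `π(A)`, and right multiplication by
`ω` appends one such factor to a symbol. -/
theorem IsConnection.exists_symb (hω : S.IsConnection ω) (hA : IsCompactMatrixQuantumGroup A) {p q : ℕ}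
    {x : Ω ⊗[ℂ] C.Envelope} (hx : x ∈ S.vhDeg p q) :
    ∃ w ∈ 𝒲 (p + q) ⊓ S.fil q, S.symb q w = S.iota x := by
  refine map_mem_of_mem_tens (S := ((𝒲 (p + q) ⊓ S.fil q).map (S.symb q)))
    (f := S.iota) (fun φ hφ θ hθ => ?_) hx
  rw [C.invDeg_eq hA] at hθ
  have h : LinearMap.range C.π ^ q ≤ (((𝒲 (p + q) ⊓ S.fil q).map (S.symb q)).comap
      (S.iota ∘ₗ TensorProduct.mk ℂ Ω C.Envelope φ)) := by
    clear hθ θ x hx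
    induction q with
    | zero =>
      rw [pow_zero, Submodule.one_le]
      exact ⟨_, (hω.list_prod hφ 0 Fin.elim0).1, by simpa using (hω.list_prod hφ 0 Fin.elim0).2⟩
    | succ q ih =>
      rw [pow_succ, Submodule.mul_le]
      rintro θ hθ _ ⟨a, rfl⟩
      obtain ⟨w, hw, h⟩ := ih hθ
      exact ⟨_, hω.mul_mem hw a, hω.symb_mul hw.2 h a⟩
  exact h hθ

end connection

theorem exists_symb_eq (hA : IsCompactMatrixQuantumGroup A) {p q : ℕ}
    {x : Ω ⊗[ℂ] C.Envelope} (hx : x ∈ S.vhDeg p q) :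
    ∃ w ∈ 𝒲 (p + q) ⊓ S.fil q, S.symb q w = S.iota x := by
  obtain ⟨ω, hω⟩ := S.exists_isConnection hA
  exact hω.exists_symb hA hx

/-! ### The associated graded algebra -/

/-- The isomorphism is characterized by symbols, so it does not depend on a connection; the formula
for each particular `ω` then follows from the symbol of its products. -/
theorem exists_grEquiv (hA : IsCompactMatrixQuantumGroup A) (p q : ℕ) :
    ∃ Θ : ↥(S.vhDeg p q) ≃ₗ[ℂ] S.gr p q, ∀ (x : S.vhDeg p q) (w : ↥(𝒲 (p + q) ⊓ S.fil q)),
      Θ x = Gr.mk 𝒲 S.fil q (p + q) w ↔ S.symb q w = S.iota x := by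
  have hg : ∀ w : ↥(𝒲 (p + q) ⊓ S.fil q), (S.vhSymb q ∘ₗ Submodule.subtype _) w ∈ S.vhDeg p q :=
    fun w => S.vhSymb_mem hA w.2.1 w.2.2
  obtain ⟨e, he⟩ := exists_equiv_of_ker_eq (f := Gr.mk 𝒲 S.fil q (p + q))
    (g := (S.vhSymb q ∘ₗ Submodule.subtype _).codRestrict (S.vhDeg p q) hg)
    (Submodule.mkQ_surjective _) (fun x => by
      obtain ⟨w, hw, h⟩ := S.exists_symb_eq hA x.2
      exact ⟨⟨w, hw⟩, Subtype.ext (S.eq_vhSymb.2 h).symm⟩) (fun w => by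
      rw [Submodule.mkQ_apply, Submodule.Quotient.mk_eq_zero, Submodule.submoduleOf,
        Submodule.mem_comap, Submodule.subtype_apply, S.mem_fil_sub_one w.2.2, Subtype.ext_iff]
      change _ ↔ S.vhSymb q w = 0
      rw [eq_comm (a := S.vhSymb q w), eq_vhSymb, map_zero])
  refine ⟨e.symm, fun x w => ?_⟩
  rw [LinearEquiv.symm_apply_eq, he, Subtype.ext_iff]
  exact S.eq_vhSymb

/-- The inner legs have degrees `q` and `p'`, which is where the Koszul sign of the product of
`vh(P)` comes from. -/
theorem symb_mul_eq {p p' q q' : ℕ} {x x' : Ω ⊗[ℂ] C.Envelope} (hx : x ∈ S.vhDeg p q)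
    (hx' : x' ∈ S.vhDeg p' q') {w w' : Ω} (hw : w ∈ S.fil q) (hw' : w' ∈ S.fil q')
    (h : S.symb q w = S.iota x) (h' : S.symb q' w' = S.iota x') :
    S.symb (q + q') (w * w') = S.iota (((-1 : ℂ) ^ (q * p')) • S.vhMul (x ⊗ₜ x')) := by
  have h1 := S.iota_mem_tens (S.stable_horDeg p) (tens_mono le_rfl inf_le_right hx)
  have h2 := S.iota_mem_tens (S.stable_horDeg p') (tens_mono le_rfl inf_le_right hx')
  rw [(S.symb_mul hw hw').1, h, h', gmul, of_mul_of_of_mem (tens_mono le_top le_rfl h1)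
    (tens_mono inf_le_right le_top h2), map_smul, map_smul, iota_vhMul]
  rfl

end BundleCalculus
end QPB
end

noncomputable section
namespace QPB

/-! ### Lifting tensors along a map of one leg, and vanishing of classes. -/

section

variable {X Y Y' : Type*} [AddCommGroup X] [Module ℂ X] [AddCommGroup Y] [Module ℂ Y]
  [AddCommGroup Y'] [Module ℂ Y']

theorem exists_of_mem_tens_map_right {U : Submodule ℂ X} {W : Submodule ℂ Y} {f : Y →ₗ[ℂ] Y'}
    {z : X ⊗[ℂ] Y'} (hz : z ∈ tens U (W.map f)) :
    ∃ z' ∈ tens U W, TensorProduct.map LinearMap.id f z' = z := by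
  refine map_mem_of_mem_tens (S := (tens U W).map (TensorProduct.map LinearMap.id f))
    (f := LinearMap.id) ?_ hz
  rintro x hx _ ⟨y, hy, rfl⟩
  exact ⟨x ⊗ₜ y, tmul_mem_tens hx hy, rfl⟩

theorem exists_of_mem_tens_map_left {U : Submodule ℂ Y} {W : Submodule ℂ X} {f : Y →ₗ[ℂ] Y'}
    {z : Y' ⊗[ℂ] X} (hz : z ∈ tens (U.map f) W) :
    ∃ z' ∈ tens U W, TensorProduct.map f LinearMap.id z' = z := by
  refine map_mem_of_mem_tens (S := (tens U W).map (TensorProduct.map f LinearMap.id))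
    (f := LinearMap.id) ?_ hz
  rintro _ ⟨y, hy, rfl⟩ x hx
  exact ⟨y ⊗ₜ x, tmul_mem_tens hy hx, rfl⟩

end

theorem map_gradeInvolution_left {X Y Y' : Type*} [Ring X] [Algebra ℂ X] [AddCommGroup Y]
    [Module ℂ Y] [AddCommGroup Y'] [Module ℂ Y'] {𝒜 : ℕ → Submodule ℂ X} [GradedAlgebra 𝒜] {p : ℕ}
    {z : X ⊗[ℂ] Y} (hz : z ∈ tens (𝒜 p) ⊤) (f : Y →ₗ[ℂ] Y') :
    TensorProduct.map (gradeInvolution 𝒜) f z =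
      ((-1 : ℂ) ^ p) • TensorProduct.map LinearMap.id f z :=
  eqOn_tens (f := TensorProduct.map (gradeInvolution 𝒜) f)
    (g := ((-1 : ℂ) ^ p) • TensorProduct.map LinearMap.id f) (fun x hx y _ => by
      simp [gradeInvolution_of_mem hx, TensorProduct.smul_tmul']) hz

theorem Coh.mk_eq_zero {X : Type*} [AddCommGroup X] [Module ℂ X] {d : X →ₗ[ℂ] X}
    {K L : Submodule ℂ X} {x : ↥(L ⊓ LinearMap.ker d)} :
    Coh.mk d K L x = 0 ↔ (x : X) ∈ K.map d := by
  rw [Submodule.mkQ_apply, Submodule.Quotient.mk_eq_zero]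
  rfl

theorem Er.mk_eq_zero {X : Type*} [AddCommGroup X] [Module ℂ X] {d : X →ₗ[ℂ] X}
    {𝒲 : ℕ → Submodule ℂ X} {Fil : ℤ → Submodule ℂ X} {r k : ℤ} {n : ℕ}
    {x : ↥(Zr d 𝒲 Fil r k n)} :
    Er.mk d 𝒲 Fil r k n x = 0 ↔ (x : X) ∈ Br d 𝒲 Fil r k n := by
  rw [Submodule.mkQ_apply, Submodule.Quotient.mk_eq_zero]
  rfl

theorem smul_neg_one_pow_mem {X : Type*} [AddCommGroup X] [Module ℂ X] {U : Submodule ℂ X} (p : ℕ)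
    {x : X} : ((-1 : ℂ) ^ p) • x ∈ U ↔ x ∈ U :=
  U.smul_mem_iff (pow_ne_zero _ (by norm_num))

namespace BundleCalculus

universe uA uG uV uB uW

variable {V : Type uV} {B : Type uB} {A : Type uA}
    [Ring V] [StarRing V] [Algebra ℂ V] [StarModule ℂ V]
    [Ring B] [StarRing B] [Algebra ℂ B] [StarModule ℂ B]
    [Ring A] [StarRing A] [HopfAlgebra ℂ A] [StarModule ℂ A]
    {Γ : Type uG} [AddCommGroup Γ] [Module ℂ Γ] [Module A Γ] [Module Aᵐᵒᵖ Γ]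
    [IsScalarTower ℂ A Γ] [IsScalarTower ℂ Aᵐᵒᵖ Γ] [SMulCommClass A Aᵐᵒᵖ Γ]
    {P : QuantumPrincipalBundle V B A} {C : BicovariantStarCalculus A Γ}
    {Ω : Type uW} [Ring Ω] [Algebra ℂ Ω] {𝒲 : ℕ → Submodule ℂ Ω} [GradedAlgebra 𝒲]
    (S : BundleCalculus P C Ω 𝒲)

/-! ### Vertical boundaries -/

/-- The image of `id ⊗ d` in `Ω(P) ⊗ Γ^∧`. -/
def bnd (_ : BundleCalculus P C Ω 𝒲) : Submodule ℂ (Ω ⊗[ℂ] C.Envelope) :=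
  LinearMap.range (TensorProduct.map LinearMap.id C.dΓ)

theorem map_mem_bnd (f : Ω →ₗ[ℂ] Ω) (z : Ω ⊗[ℂ] C.Envelope) :
    TensorProduct.map f C.dΓ z ∈ S.bnd :=
  ⟨TensorProduct.map f LinearMap.id z, by rw [map_map, LinearMap.id_comp, LinearMap.comp_id]⟩

theorem iota_dvh_mem_bnd (x : Ω ⊗[ℂ] C.Envelope) : S.iota (S.dvh x) ∈ S.bnd := by
  rw [iota_dvh]
  exact S.map_mem_bnd _ _

theorem iota_dvh_of_mem {p : ℕ} {x : Ω ⊗[ℂ] C.Envelope} (hx : x ∈ tens (𝒲 p) ⊤) :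
    S.iota (S.dvh x) = ((-1 : ℂ) ^ p) • TensorProduct.map LinearMap.id C.dΓ (S.iota x) := by
  rw [iota_dvh, map_gradeInvolution_left]
  exact S.act_mem (S.stable_grade p) (fun _ _ _ => Submodule.mem_top) hx

/-- Membership in `bnd` allows any primitive in `Ω(P) ⊗ Γ^∧`. By `exists_mem_cot` one can be found
among cotensors, and `iotaInv` carries it back to `vh(P)`. -/
theorem mem_map_dvh_iff (hA : IsCompactMatrixQuantumGroup A) {p : ℕ} {x : Ω ⊗[ℂ] C.Envelope}
    (hx : x ∈ tens (S.horDeg p) C.inv) : x ∈ S.vh.map S.dvh ↔ S.iota x ∈ S.bnd := by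
  constructor
  · rintro ⟨u, _, rfl⟩
    exact S.iota_dvh_mem_bnd u
  · rintro ⟨y, hy⟩
    obtain ⟨y', hy', h⟩ := S.exists_mem_cot hA (S.stable_horDeg p)
      (S.iota_mem_cot (S.stable_horDeg p) hx) hy.symm
    have h1 := S.iotaInv_mem hA hy'
    have h2 : x = ((-1 : ℂ) ^ p) • S.dvh (S.iotaInv y') := by
      apply S.iota_injective
      rw [map_smul, S.iota_dvh_of_mem (tens_mono inf_le_right le_top h1), iota_iotaInv, ← h,
        smul_smul, ← mul_pow]
      norm_num
    rw [h2, smul_neg_one_pow_mem]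
    exact ⟨_, tens_mono inf_le_left le_rfl h1, rfl⟩

theorem eq_zero_of_mem_bnd {z : Ω ⊗[ℂ] C.Envelope} (hz : z ∈ tens ⊤ (C.deg 0)) (h : z ∈ S.bnd) :
    z = 0 := by
  obtain ⟨y, rfl⟩ := h
  have h1 : gproj C.deg 0 ∘ₗ C.dΓ = 0 := LinearMap.ext (gproj_zero_comp_of_mem C.dΓ_mem)
  rw [← map_eq_self_of_mem_tens (f := LinearMap.id) (g := gproj C.deg 0) (fun _ _ => rfl)
    (fun _ h => gproj_of_mem h) hz, map_map, h1, TensorProduct.map_zero_right, LinearMap.zero_apply]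

theorem exists_dvh_eq (hA : IsCompactMatrixQuantumGroup A) {p q : ℕ} {x : Ω ⊗[ℂ] C.Envelope}
    (hx : x ∈ S.vhDeg p (q + 1)) (h : S.iota x ∈ S.bnd) : ∃ u ∈ S.vhDeg p q, S.dvh u = x := by
  have hx' : x ∈ tens (S.horDeg p) C.inv := tens_mono le_rfl inf_le_left hx
  obtain ⟨y, hy⟩ := h
  have hW := S.stable_horDeg p
  have hz := S.iota_mem_cot hW hx'
  obtain ⟨y', hy', hxy⟩ := S.exists_mem_cot hA hW hz hy.symm
  obtain ⟨h, hh⟩ := exists_haar A hA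
  -- Only the component of degree `q` of the primitive matters. The average is taken afterwards to
  -- stay among cotensors, and it preserves this degree.
  set y'' := S.avg h (TensorProduct.map LinearMap.id (gproj C.deg q) y') with hy''
  have h1 : TensorProduct.map LinearMap.id (gproj C.deg q) y' ∈ tens (S.horDeg p) (C.deg q) :=
    map_mem_tens (fun _ h => h) (fun x _ => gproj_mem q x) hy'.1
  have h2 : S.iota x = TensorProduct.map LinearMap.id C.dΓ y'' := by
    have h3 : C.dΓ ∘ₗ gproj C.deg q = gproj C.deg (q + 1) ∘ₗ C.dΓ :=
      LinearMap.ext fun x => (gproj_succ_comp_of_mem C.dΓ_mem q x).symm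
    rw [hy'', ← avg_map_dΓ, map_map, h3, LinearMap.id_comp,
      ← LinearMap.id_comp (LinearMap.id : Ω →ₗ[ℂ] Ω), ← map_map, ← hxy,
      map_eq_self_of_mem_tens (fun _ _ => rfl) (fun _ h => gproj_of_mem h)
        (S.iota_mem_tens hW (tens_mono le_rfl inf_le_right hx)), S.avg_of_mem_cot hA hh hz]
  have h4 := S.iotaInv_mem_deg hA (S.avg_mem_cot hA hh hW (tens_mono le_rfl le_top h1))
    (S.avg_mem_deg h hW h1)
  refine ⟨((-1 : ℂ) ^ p) • S.iotaInv y'', Submodule.smul_mem _ _ h4, S.iota_injective ?_⟩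
  rw [map_smul, map_smul, S.iota_dvh_of_mem (tens_mono inf_le_right le_top h4), iota_iotaInv, ← h2,
    smul_smul, ← mul_pow]
  norm_num

/-! ### The terms `Z_r` and `B_r` for small `r` -/

theorem mem_Zr_one {k : ℤ} {n : ℕ} {w : Ω} : w ∈ Zr S.d 𝒲 S.fil (1 : ℕ) k n ↔
    w ∈ 𝒲 n ∧ w ∈ S.fil k ∧ S.d w ∈ S.fil k := by
  rw [Zr, show k + 1 - ((1 : ℕ) : ℤ) = k by simp, Submodule.mem_inf, Submodule.mem_inf, and_assoc]
  rfl

theorem mem_Zr_two {k : ℤ} {n : ℕ} {w : Ω} : w ∈ Zr S.d 𝒲 S.fil (2 : ℕ) k n ↔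
    w ∈ 𝒲 n ∧ w ∈ S.fil k ∧ S.d w ∈ S.fil (k - 1) := by
  rw [Zr, show k + 1 - ((2 : ℕ) : ℤ) = k - 1 by push_cast; ring, Submodule.mem_inf,
    Submodule.mem_inf, and_assoc]
  rfl

/-- The remaining conditions in `B₁` are automatic, since `d` raises the vertical order by at most
one. -/
theorem mem_Br_one {k : ℤ} {n : ℕ} {w : Ω} : w ∈ Br S.d 𝒲 S.fil (1 : ℕ) k n ↔
    ∃ a u, a ∈ 𝒲 n ∧ a ∈ S.fil (k - 1) ∧ u ∈ S.fil (k - 1) ∧ S.d u ∈ 𝒲 n ∧ w = a + S.d u := by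
  rw [Br, Zr, show k - 1 + 1 - (((1 : ℕ) : ℤ) - 1) = k by simp,
    show k + ((1 : ℕ) : ℤ) - 2 = k - 1 by push_cast; ring, Submodule.mem_sup]
  constructor
  · rintro ⟨a, ⟨⟨h1, h2⟩, _⟩, _, ⟨⟨h3, _⟩, u, hu, rfl⟩, rfl⟩
    exact ⟨a, u, h1, h2, hu, h3, rfl⟩
  · rintro ⟨a, u, h1, h2, h3, h4, rfl⟩
    have h5 : ∀ {x}, x ∈ S.fil (k - 1) → S.d x ∈ S.fil k := fun h => by
      simpa using S.d_mem_fil h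
    exact ⟨a, ⟨⟨h1, h2⟩, h5 h2⟩, S.d u, ⟨⟨h4, h5 h3⟩, u, h3, rfl⟩, rfl⟩

theorem mem_Br_two {k : ℤ} {n : ℕ} {w : Ω} : w ∈ Br S.d 𝒲 S.fil (2 : ℕ) k n ↔
    ∃ a u, a ∈ 𝒲 n ∧ a ∈ S.fil (k - 1) ∧ S.d a ∈ S.fil (k - 1) ∧ u ∈ S.fil k ∧ S.d u ∈ 𝒲 n ∧
      S.d u ∈ S.fil k ∧ w = a + S.d u := by
  rw [Br, Zr, show k - 1 + 1 - (((2 : ℕ) : ℤ) - 1) = k - 1 by push_cast; ring,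
    show k + ((2 : ℕ) : ℤ) - 2 = k by simp, Submodule.mem_sup]
  constructor
  · rintro ⟨a, ⟨⟨h1, h2⟩, h2'⟩, _, ⟨⟨h3, h4⟩, u, hu, rfl⟩, rfl⟩
    exact ⟨a, u, h1, h2, h2', hu, h3, h4, rfl⟩
  · rintro ⟨a, u, h1, h2, h2', h3, h4, h5, rfl⟩
    exact ⟨a, ⟨⟨h1, h2⟩, h2'⟩, S.d u, ⟨⟨h4, h5⟩, u, h3, rfl⟩, rfl⟩

/-- `B_r` does not require homogeneous primitives. Projection to the preceding degree supplies one,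
except in degree zero, where the exact form vanishes. -/
theorem exists_homogeneous {k : ℤ} {n : ℕ} {u : Ω} (hu : u ∈ S.fil k) (hd : S.d u ∈ 𝒲 n) :
    (n = 0 ∧ S.d u = 0) ∨ ∃ m v, n = m + 1 ∧ v ∈ 𝒲 m ∧ v ∈ S.fil k ∧ S.d v = S.d u := by
  obtain _ | m := n
  · exact Or.inl ⟨rfl, by rw [← gproj_of_mem hd, gproj_zero_comp_of_mem S.d_mem]⟩
  · exact Or.inr ⟨m, gproj 𝒲 m u, rfl, gproj_mem m u, S.gproj_mem_fil m hu, by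
      rw [← gproj_succ_comp_of_mem S.d_mem, gproj_of_mem hd]⟩

theorem symb_eq_zero_of_mem {q : ℕ} {w : Ω} (hw : w ∈ S.fil (q - 1)) : S.symb q w = 0 :=
  S.mem_fil.1 hw q (by omega)

theorem symb_d_mem_bnd {q : ℕ} {u : Ω} (hu : u ∈ S.fil (q - 1)) : S.symb q (S.d u) ∈ S.bnd := by
  obtain _ | q := q
  · rw [S.fil_of_neg (by simp) hu, map_zero, map_zero]
    exact zero_mem _
  · rw [S.symb_succ_d_of_mem (by simpa using hu)]
    exact S.map_mem_bnd _ _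

/-- If the symbol of `w` lies in `bnd`, it is the symbol of some `du` with `u` of lower vertical
order, and `w - du` drops one step in the filtration. -/
theorem mem_Br_one_iff (hA : IsCompactMatrixQuantumGroup A) {p q : ℕ} {w : Ω}
    (hw : w ∈ 𝒲 (p + q)) (hw' : w ∈ S.fil q) :
    w ∈ Br S.d 𝒲 S.fil (1 : ℕ) q (p + q) ↔ S.symb q w ∈ S.bnd := by
  rw [mem_Br_one]
  constructor
  · rintro ⟨a, u, _, h2, h3, _, rfl⟩
    rw [map_add, S.symb_eq_zero_of_mem h2, zero_add]
    exact S.symb_d_mem_bnd h3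
  · intro h
    obtain _ | q := q
    -- In vertical degree zero there are no boundaries, so the symbol itself vanishes and no
    -- correction is needed.
    · have h0 := S.eq_zero_of_mem_bnd (tens_mono le_top le_rfl (S.symb_mem hw)) h
      exact ⟨w, 0, hw, (S.mem_fil_sub_one hw').2 h0, zero_mem _, by simp, by simp⟩
    · rw [← iota_vhSymb] at h
      obtain ⟨x, hx, hxw⟩ := S.exists_dvh_eq hA (S.vhSymb_mem hA hw hw') h
      obtain ⟨u, hu, hux⟩ := S.exists_symb_eq hA hx
      have h1 : S.d u ∈ 𝒲 (p + (q + 1)) := S.d_mem _ u hu.1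
      refine ⟨w - S.d u, u, sub_mem hw h1, ?_, by simpa using hu.2, h1, by simp⟩
      have h2 : S.d u ∈ S.fil ((q + 1 : ℕ) : ℤ) := by simpa using S.d_mem_fil hu.2
      rw [S.mem_fil_sub_one (sub_mem hw' h2), map_sub, ← S.iota_vhSymb _ w, ← S.iota_vhSymb _ (S.d u),
        S.vhSymb_d hu.2, ← hxw, ← S.eq_vhSymb.2 hux, sub_self]

theorem mem_Zr_one_of_symb {p q : ℕ} {x : Ω ⊗[ℂ] C.Envelope} (hd : S.dvh x = 0) {w : Ω}
    (hw : w ∈ 𝒲 (p + q) ⊓ S.fil q) (h : S.symb q w = S.iota x) :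
    w ∈ Zr S.d 𝒲 S.fil (1 : ℕ) q (p + q) := by
  have h1 : S.d w ∈ S.fil ((q + 1 : ℕ) : ℤ) := by simpa using S.d_mem_fil hw.2
  have h2 := (S.mem_fil_sub_one h1).2 (by
    rw [← iota_vhSymb, S.vhSymb_d hw.2, ← S.eq_vhSymb.2 h, hd, map_zero])
  exact S.mem_Zr_one.2 ⟨hw.1, hw.2, by simpa using h2⟩

theorem exists_Zr_one_symb (hA : IsCompactMatrixQuantumGroup A) {p q : ℕ}
    {x : Ω ⊗[ℂ] C.Envelope} (hx : x ∈ S.vhDeg p q) (hd : S.dvh x = 0) :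
    ∃ w ∈ Zr S.d 𝒲 S.fil (1 : ℕ) q (p + q), S.symb q w = S.iota x := by
  obtain ⟨w, hw, h⟩ := S.exists_symb_eq hA hx
  exact ⟨w, S.mem_Zr_one_of_symb hd hw h, h⟩

/-- Symbols are compared only modulo `bnd`: the representatives that occur for `d₁` and for `E₂`
match only in this weaker sense. -/
theorem exists_E₁Equiv (hA : IsCompactMatrixQuantumGroup A) (p q : ℕ) :
    ∃ e₁ : S.Hvh p q ≃ₗ[ℂ] S.E 1 p q,
      ∀ (x : ↥(S.vhDeg p q ⊓ LinearMap.ker S.dvh)) (w : Ω)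
        (hw : w ∈ Zr S.d 𝒲 S.fil (1 : ℕ) q (p + q)),
        S.symb q w - S.iota x ∈ S.bnd →
        e₁ (Coh.mk S.dvh S.vh (S.vhDeg p q) x) = Er.mk S.d 𝒲 S.fil (1 : ℕ) q (p + q) ⟨w, hw⟩ := by
  have hg : ∀ w : ↥(Zr S.d 𝒲 S.fil (1 : ℕ) q (p + q)), (S.vhSymb q ∘ₗ Submodule.subtype _) w ∈
      S.vhDeg p q ⊓ LinearMap.ker S.dvh := fun w => by
    obtain ⟨h1, h2, h3⟩ := S.mem_Zr_one.1 w.2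
    refine ⟨S.vhSymb_mem hA h1 h2, ?_⟩
    change S.dvh (S.vhSymb q w) = 0
    rw [← S.vhSymb_d h2, vhSymb, LinearMap.comp_apply,
      S.symb_eq_zero_of_mem (q := q + 1) (by simpa using h3), map_zero]
  have key : ∀ x ∈ S.vhDeg p q, x ∈ S.vh.map S.dvh ↔ S.iota x ∈ S.bnd := fun x hx =>
    S.mem_map_dvh_iff hA (tens_mono le_rfl inf_le_left hx)
  set g := (S.vhSymb q ∘ₗ Submodule.subtype _).codRestrict _ hg
  have hg' : ∀ w, (g w : Ω ⊗[ℂ] C.Envelope) = S.vhSymb q w := fun _ => rfl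
  obtain ⟨e, he⟩ := exists_equiv_of_ker_eq (f := Er.mk S.d 𝒲 S.fil (1 : ℕ) q (p + q))
    (g := Coh.mk S.dvh S.vh (S.vhDeg p q) ∘ₗ g)
    (Submodule.mkQ_surjective _) (fun c => by
      obtain ⟨x, rfl⟩ := Submodule.mkQ_surjective _ c
      obtain ⟨w, hw, h⟩ := S.exists_Zr_one_symb hA x.2.1 x.2.2
      have h3 : g ⟨w, hw⟩ = x := Subtype.ext (S.eq_vhSymb.2 h).symm
      exact ⟨_, by rw [LinearMap.comp_apply, h3]⟩) (fun w => by
      obtain ⟨h1, h2, h3⟩ := S.mem_Zr_one.1 w.2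
      rw [Er.mk_eq_zero, LinearMap.comp_apply, Coh.mk_eq_zero, S.mem_Br_one_iff hA h1 h2,
        key _ (g w).2.1, hg', iota_vhSymb])
  refine ⟨e.symm, fun x w hw h => ?_⟩
  rw [LinearEquiv.symm_apply_eq, he, LinearMap.comp_apply, eq_comm, ← sub_eq_zero, ← map_sub,
    Coh.mk_eq_zero, key _ (g _ - x).2.1]
  rwa [Submodule.coe_sub, hg', map_sub, iota_vhSymb]

end BundleCalculus
end QPB
end

noncomputable section
namespace QPB

/-! ### Tensor products of subquotients. -/

theorem exists_extend_mkQ {Z : Type*} [AddCommGroup Z] [Module ℂ Z] (U B : Submodule ℂ Z) :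
    ∃ k : Z →ₗ[ℂ] U ⧸ B.submoduleOf U, k ∘ₗ U.subtype = (B.submoduleOf U).mkQ ∧
      ∀ x ∈ U ⊓ B, k x = 0 := by
  obtain ⟨k, hk⟩ := LinearMap.exists_extend (B.submoduleOf U).mkQ
  refine ⟨k, hk, fun x hx => ?_⟩
  refine (LinearMap.congr_fun hk ⟨x, hx.1⟩).trans ?_
  rw [Submodule.mkQ_apply, Submodule.Quotient.mk_eq_zero]
  exact hx.2

theorem map_mkQ_eq_zero_iff {X Y : Type*} [AddCommGroup X] [Module ℂ X] [AddCommGroup Y]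
    [Module ℂ Y] {U B : Submodule ℂ X} {W D : Submodule ℂ Y} (t : U ⊗[ℂ] W) :
    TensorProduct.map (B.submoduleOf U).mkQ (D.submoduleOf W).mkQ t = 0 ↔
      ∃ t₁ ∈ tens (U ⊓ B) W, ∃ t₂ ∈ tens U (W ⊓ D),
        TensorProduct.map U.subtype W.subtype t = t₁ + t₂ := by
  constructor
  · intro h
    -- The part of `t` with second leg in `D` is split off by `r`. The rest no longer sees the
    -- quotient by `D`, so its first leg must lie in `B`.
    obtain ⟨r, hr, hr'⟩ := exists_proj (D.submoduleOf W)
    set t₁ := TensorProduct.map LinearMap.id (LinearMap.id - r) t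
    set t₂ := TensorProduct.map LinearMap.id r t
    have ht : t = t₁ + t₂ := by
      simp only [t₁, t₂]
      rw [← LinearMap.add_apply, ← TensorProduct.map_add_right, sub_add_cancel,
        TensorProduct.map_id, LinearMap.id_apply]
    have h1 : TensorProduct.map (B.submoduleOf U).mkQ LinearMap.id t₁ = 0 := by
      have h2 : TensorProduct.map (B.submoduleOf U).mkQ LinearMap.id t ∈
          tens ⊤ (D.submoduleOf W) := by
        rw [← Submodule.ker_mkQ (D.submoduleOf W), mem_tens_ker_right, map_map, LinearMap.id_comp,
          LinearMap.comp_id]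
        exact h
      have h3 := eqOn_tens (f := TensorProduct.map LinearMap.id (LinearMap.id - r)) (g := 0)
        (fun x _ y hy => by simp [hr' y hy]) h2
      simpa only [t₁, map_map, LinearMap.id_comp, LinearMap.comp_id, LinearMap.zero_apply] using h3
    rw [← mem_tens_ker_left, Submodule.ker_mkQ] at h1
    refine ⟨_, map_mem_tens (U' := U ⊓ B) (W' := W) (f := U.subtype)
      (g := W.subtype) (fun x hx => ⟨x.2, hx⟩)
      (fun y _ => y.2) h1, TensorProduct.map U.subtype W.subtype t₂, ?_, ?_⟩
    · simp only [t₂, map_map]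
      exact map_mem_tens (U := ⊤) (W := ⊤) (U' := U) (W' := W ⊓ D) (fun x _ => x.2)
        (fun y _ => ⟨(r y).2, hr y⟩)
        (mem_tens_top _)
    · rw [← map_add, ← ht]
  · rintro ⟨t₁, h₁, t₂, h₂, h⟩
    obtain ⟨k, hk, hk'⟩ := exists_extend_mkQ U B
    obtain ⟨l, hl, hl'⟩ := exists_extend_mkQ W D
    rw [← hk, ← hl, ← map_map, h, map_add]
    rw [eqOn_tens (f := TensorProduct.map k l) (g := 0) (fun x hx y _ => by simp [hk' x hx]) h₁,
      eqOn_tens (f := TensorProduct.map k l) (g := 0) (fun x _ y hy => by simp [hl' y hy]) h₂]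
    simp

namespace BundleCalculus

universe uA uG uV uB uW

variable {V : Type uV} {B : Type uB} {A : Type uA}
    [Ring V] [StarRing V] [Algebra ℂ V] [StarModule ℂ V]
    [Ring B] [StarRing B] [Algebra ℂ B] [StarModule ℂ B]
    [Ring A] [StarRing A] [HopfAlgebra ℂ A] [StarModule ℂ A]
    {Γ : Type uG} [AddCommGroup Γ] [Module ℂ Γ] [Module A Γ] [Module Aᵐᵒᵖ Γ]
    [IsScalarTower ℂ A Γ] [IsScalarTower ℂ Aᵐᵒᵖ Γ] [SMulCommClass A Aᵐᵒᵖ Γ]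
    {P : QuantumPrincipalBundle V B A} {C : BicovariantStarCalculus A Γ}
    {Ω : Type uW} [Ring Ω] [Algebra ℂ Ω] {𝒲 : ℕ → Submodule ℂ Ω} [GradedAlgebra 𝒲]
    (S : BundleCalculus P C Ω 𝒲)

/-! ### The cohomology of `vh(P)` -/

/-- Elements of `𝔥_M` have coefficients in `ker d`, and for these `d(aϑ) = a dϑ`. -/
theorem iota_map_dΓ (hA : IsCompactMatrixQuantumGroup A) {x : Ω ⊗[ℂ] C.Envelope}
    (hx : x ∈ tens S.hM ⊤) : S.iota (TensorProduct.map LinearMap.id C.dΓ x) =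
      TensorProduct.map LinearMap.id C.dΓ (S.iota x) := by
  refine eqOn_tens (f := S.iota ∘ₗ TensorProduct.map LinearMap.id C.dΓ)
    (g := TensorProduct.map LinearMap.id C.dΓ ∘ₗ S.iota) (fun φ hφ ϑ _ => ?_) hx
  simp only [LinearMap.comp_apply, TensorProduct.map_tmul, LinearMap.id_apply, iota_tmul]
  refine eqOn_tens (f := LinearMap.mulRight ℂ (1 ⊗ₜ C.dΓ ϑ) ∘ₗ
    TensorProduct.map LinearMap.id C.ofA.toLinearMap) (g := TensorProduct.map LinearMap.id C.dΓ ∘ₗ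
      LinearMap.mulRight ℂ (1 ⊗ₜ ϑ) ∘ₗ TensorProduct.map LinearMap.id C.ofA.toLinearMap)
    (fun ψ _ a ha => ?_) (S.FA_of_mem_hM hA hφ)
  simp [C.dΓ_ofA_mul, LinearMap.mem_ker.1 ha]

theorem iota_map_d (x : Ω ⊗[ℂ] C.Envelope) : S.iota (TensorProduct.map S.d LinearMap.id x) =
    TensorProduct.map S.d LinearMap.id (S.iota x) := by
  induction x with
  | zero => simp
  | add x y hx hy => simp only [map_add, hx, hy]
  | tmul φ ϑ =>
    rw [TensorProduct.map_tmul, iota_tmul, iota_tmul, FA_d]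
    induction S.FA φ with
    | zero => simp
    | add x y hx hy => simp only [map_add, add_mul, hx, hy]
    | tmul x a => simp

/-- The vertical part of `d` contributes only to `bnd`, so modulo `bnd` the differential acts on
symbols by `d ⊗ id`. This is the source of the formula for `d₁`. -/
theorem symb_d_sub_mem_bnd {q : ℕ} {w : Ω} {x : Ω ⊗[ℂ] C.Envelope}
    (h : S.symb q w - S.iota x ∈ S.bnd) :
    S.symb q (S.d w) - S.iota (TensorProduct.map S.d LinearMap.id x) ∈ S.bnd := by
  have h1 : TensorProduct.map S.d LinearMap.id (S.symb q w - S.iota x) ∈ S.bnd := by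
    obtain ⟨y, hy⟩ := h
    rw [← hy, map_map, LinearMap.id_comp, LinearMap.comp_id]
    exact S.map_mem_bnd _ _
  rw [map_sub, ← iota_map_d] at h1
  obtain _ | q := q
  · rwa [symb_zero_d]
  · rw [symb_succ_d, add_sub_right_comm]
    exact add_mem h1 (S.map_mem_bnd _ _)

/-- On `𝔥_M ⊗ Γ^∧_inv` the map `iota` commutes with `id ⊗ d`, so a cotensor primitive gives
exactness in the second leg. -/
theorem iota_mem_bnd_iff (hA : IsCompactMatrixQuantumGroup A) {x : Ω ⊗[ℂ] C.Envelope}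
    (hx : x ∈ tens S.hM C.inv) : S.iota x ∈ S.bnd ↔ x ∈ tens S.hM (C.inv.map C.dΓ) := by
  constructor
  · rintro ⟨y, hy⟩
    obtain ⟨y', hy', h⟩ := S.exists_mem_cot hA (S.stable_hM hA)
      (S.iota_mem_cot (S.stable_hM hA) hx) hy.symm
    have h1 := S.iotaInv_mem hA hy'
    have h2 : x = TensorProduct.map LinearMap.id C.dΓ (S.iotaInv y') := by
      apply S.iota_injective
      rw [S.iota_map_dΓ hA (tens_mono le_rfl le_top h1), iota_iotaInv, h]
    rw [h2]
    exact map_mem_tens (fun _ h => h) (fun x hx => Submodule.mem_map_of_mem hx) h1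
  · intro h
    obtain ⟨x', hx', rfl⟩ := exists_of_mem_tens_map_right h
    rw [S.iota_map_dΓ hA (tens_mono le_rfl le_top hx')]
    exact S.map_mem_bnd _ _

theorem dvh_of_mem (hA : IsCompactMatrixQuantumGroup A) {p : ℕ} {x : Ω ⊗[ℂ] C.Envelope}
    (hx : x ∈ tens (S.hMDeg p) ⊤) :
    S.dvh x = ((-1 : ℂ) ^ p) • TensorProduct.map LinearMap.id C.dΓ x := by
  apply S.iota_injective
  rw [S.iota_dvh_of_mem (tens_mono inf_le_right le_rfl hx), map_smul,
    S.iota_map_dΓ hA (tens_mono inf_le_left le_rfl hx)]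

theorem stable_hMDeg (hA : IsCompactMatrixQuantumGroup A) (p : ℕ) : S.Stable (S.hMDeg p) :=
  (S.stable_hM hA).inf (S.stable_grade p)

theorem hMDeg_le_horDeg (p : ℕ) : S.hMDeg p ≤ S.horDeg p := inf_le_inf_right _ inf_le_left

/-- The homotopy for `e` replaces the cocycle by its contraction with `e` on the second leg. By the
cotensor property this equals a contraction on the first leg, and that one maps `hor(P)` into `𝔥_M`.
-/
theorem exists_hM_rep (hA : IsCompactMatrixQuantumGroup A) {p q : ℕ} {x : Ω ⊗[ℂ] C.Envelope}
    (hx : x ∈ S.vhDeg p q) (hd : S.dvh x = 0) :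
    ∃ t ∈ tens (S.hMDeg p) (C.invDeg q ⊓ LinearMap.ker C.dΓ), S.iota x - S.iota t ∈ S.bnd := by
  have hW := S.stable_horDeg p
  have hz := S.iota_mem_cot hW (tens_mono le_rfl inf_le_left hx)
  have hzq := S.iota_mem_tens hW (tens_mono le_rfl inf_le_right hx)
  have hzd : TensorProduct.map LinearMap.id C.dΓ (S.iota x) = 0 := by
    have := S.iota_dvh_of_mem (tens_mono inf_le_right le_top hx)
    rw [hd, map_zero, eq_comm, smul_eq_zero] at this
    exact this.resolve_left (pow_ne_zero _ (by norm_num))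
  obtain ⟨e, he, he'⟩ := C.exists_functional hA
  obtain ⟨K, hK⟩ := C.exists_homotopy hA he
  obtain ⟨h, hh⟩ := exists_haar A hA
  set E : Ω →ₗ[ℂ] Ω := sliceR e ∘ₗ S.FA
  have hE : ∀ w ∈ S.horDeg p, E w ∈ S.hMDeg p := by
    intro w hw
    have h1 := mem_tens_iff_sliceR.1 (hW w hw) e
    refine ⟨(S.mem_hM hA).2 ⟨h1.1, ?_⟩, h1.2⟩
    change S.FA (sliceR e (S.FA w)) ∈ _
    -- By coassociativity the coefficients of the contracted form are of the shape `∑ a⁽¹⁾e(a⁽²⁾)`,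
    -- which lie in `ker d` by the choice of `e`.
    rw [← map_sliceR_assoc, S.isCoaction_FA.coassoc, map_map, LinearMap.id_comp]
    exact map_mem_tens (U := ⊤) (W := ⊤) (fun _ h => h) (fun a _ => he' a) (mem_tens_top _)
  set z₁ := TensorProduct.map E LinearMap.id (S.iota x) with hz₁
  have h1 : z₁ ∈ tens (S.hMDeg p) (C.deg q) := map_mem_tens hE (fun _ h => h) hzq
  have h2 : S.iota x - z₁ =
      TensorProduct.map LinearMap.id C.dΓ (TensorProduct.map LinearMap.id K (S.iota x)) := by
    have h3 := map_sliceL_assoc S.FA e (S.iota x)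
    have h4 : TensorProduct.assoc ℂ Ω A C.Envelope
      (TensorProduct.map S.FA LinearMap.id (S.iota x)) =
        TensorProduct.map LinearMap.id C.leftCoaction.toLinearMap (S.iota x) := hz.2
    rw [h4, map_map, LinearMap.id_comp] at h3
    have h5 : LinearMap.id = K ∘ₗ C.dΓ + C.dΓ ∘ₗ K + sliceL e ∘ₗ C.leftCoaction.toLinearMap :=
      LinearMap.ext fun y => sub_eq_iff_eq_add.1 (hK y)
    have h6 := LinearMap.congr_fun (congrArg (TensorProduct.map (LinearMap.id : Ω →ₗ[ℂ] Ω)) h5)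
      (S.iota x)
    have h7 := map_map LinearMap.id K LinearMap.id C.dΓ (S.iota x)
    rw [hzd, map_zero, LinearMap.id_comp] at h7
    rw [TensorProduct.map_id, TensorProduct.map_add_right, TensorProduct.map_add_right,
      LinearMap.add_apply, LinearMap.add_apply, ← h7, zero_add, LinearMap.id_apply, h3] at h6
    rw [sub_eq_iff_eq_add, map_map, LinearMap.id_comp]
    exact h6
  have hW' := S.stable_hMDeg hA p
  -- Being a cotensor is not known for `z₁`. Averaging restores it, fixes `iota x` and preserves the
  -- boundary relating the two.
  have h3 := S.avg_mem_cot hA hh hW' (tens_mono le_rfl le_top h1)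
  have h4 := S.avg_mem_deg h hW' h1
  have h5 : S.iota x - S.avg h z₁ ∈ S.bnd := by
    rw [← S.avg_of_mem_cot hA hh hz, ← map_sub, h2, avg_map_dΓ]
    exact S.map_mem_bnd _ _
  have h6 := S.iotaInv_mem_deg hA h3 h4
  refine ⟨S.iotaInv (S.avg h z₁), ?_, by rwa [iota_iotaInv]⟩
  have h7 : TensorProduct.map LinearMap.id C.dΓ (S.iotaInv (S.avg h z₁)) = 0 := by
    apply S.iota_injective
    rw [S.iota_map_dΓ hA (tens_mono inf_le_left le_top h6), iota_iotaInv, map_zero]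
    obtain ⟨y, hy⟩ := h5
    have h8 := congrArg (TensorProduct.map LinearMap.id C.dΓ) hy
    have h9 : C.dΓ ∘ₗ C.dΓ = 0 := LinearMap.ext C.dΓ_dΓ
    rw [map_map, h9, TensorProduct.map_zero_right, LinearMap.zero_apply, map_sub, hzd, zero_sub,
      eq_comm, neg_eq_zero] at h8
    exact h8
  simpa using mem_tens_inf h6 (mem_tens_ker_right.2 h7)

theorem dvh_of_closed (hA : IsCompactMatrixQuantumGroup A) {p : ℕ} {x : Ω ⊗[ℂ] C.Envelope}
    (hx : x ∈ tens (S.hMDeg p) (LinearMap.ker C.dΓ)) : S.dvh x = 0 := by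
  rw [S.dvh_of_mem hA (tens_mono le_rfl le_top hx),
    mem_tens_ker_right.1 (tens_mono le_top le_rfl hx), smul_zero]

theorem tens_hMDeg_le (hA : IsCompactMatrixQuantumGroup A) (p q : ℕ) :
    tens (S.hMDeg p) (C.invDeg q ⊓ LinearMap.ker C.dΓ) ≤ S.vhDeg p q ⊓ LinearMap.ker S.dvh :=
  fun _ hx => ⟨tens_mono (S.hMDeg_le_horDeg p) inf_le_left hx,
    S.dvh_of_closed hA (tens_mono le_rfl inf_le_right hx)⟩

/-- Surjectivity is `exists_hM_rep`; the kernel is controlled by `iota_mem_bnd_iff`. -/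
theorem exists_κ (hA : IsCompactMatrixQuantumGroup A) (p q : ℕ) :
    ∃ κ : (↥(S.hMDeg p) ⊗[ℂ] Hinv C q) ≃ₗ[ℂ] S.Hvh p q,
      ∀ (t : ↥(S.hMDeg p) ⊗[ℂ] ↥(C.invDeg q ⊓ LinearMap.ker C.dΓ))
        (hx : TensorProduct.map (Submodule.subtype _) (Submodule.subtype _) t ∈
          S.vhDeg p q ⊓ LinearMap.ker S.dvh),
        κ (TensorProduct.map LinearMap.id (Coh.mk C.dΓ C.inv (C.invDeg q)) t) =
          Coh.mk S.dvh S.vh (S.vhDeg p q) ⟨_, hx⟩ := by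
  set j := TensorProduct.map (S.hMDeg p).subtype (C.invDeg q ⊓ LinearMap.ker C.dΓ).subtype
  have hj : ∀ t, j t ∈ tens (S.hMDeg p) (C.invDeg q ⊓ LinearMap.ker C.dΓ) := fun t => ⟨t, rfl⟩
  have key : ∀ x ∈ S.vhDeg p q, x ∈ S.vh.map S.dvh ↔ S.iota x ∈ S.bnd := fun x hx =>
    S.mem_map_dvh_iff hA (tens_mono le_rfl inf_le_left hx)
  set g : ↥(S.hMDeg p) ⊗[ℂ] ↥(C.invDeg q ⊓ LinearMap.ker C.dΓ) →ₗ[ℂ]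
      ↥(S.vhDeg p q ⊓ LinearMap.ker S.dvh) :=
    LinearMap.codRestrict _ j fun t => S.tens_hMDeg_le hA p q (hj t)
  set f : ↥(S.hMDeg p) ⊗[ℂ] ↥(C.invDeg q ⊓ LinearMap.ker C.dΓ) →ₗ[ℂ]
      ↥(S.hMDeg p) ⊗[ℂ] Hinv C q :=
    TensorProduct.map LinearMap.id (Coh.mk C.dΓ C.inv (C.invDeg q)) with hf
  set G : ↥(S.hMDeg p) ⊗[ℂ] ↥(C.invDeg q ⊓ LinearMap.ker C.dΓ) →ₗ[ℂ] S.Hvh p q :=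
    LinearMap.comp (Coh.mk S.dvh S.vh (S.vhDeg p q)) g
  have hG : ∀ t, G t = Coh.mk S.dvh S.vh (S.vhDeg p q) (g t) := fun _ => rfl
  have h1 : Function.Surjective f :=
    TensorProduct.map_surjective Function.surjective_id (Submodule.mkQ_surjective _)
  have h2 : Function.Surjective G := fun c => by
    obtain ⟨x, rfl⟩ := Submodule.mkQ_surjective _ c
    obtain ⟨_, ⟨t, rfl⟩, h⟩ := S.exists_hM_rep hA x.2.1 x.2.2
    have h0 : Coh.mk S.dvh S.vh (S.vhDeg p q) (x - g t) = 0 := by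
      rw [Coh.mk_eq_zero, key _ (x - g t).2.1, Submodule.coe_sub, map_sub]
      exact h
    rw [map_sub, sub_eq_zero] at h0
    exact ⟨t, h0.symm⟩
  have h3 : ∀ t, f t = 0 ↔ G t = 0 := fun t => by
    have hi := S.iota_mem_bnd_iff hA (tens_mono inf_le_left
      (inf_le_left.trans inf_le_left) (hj t))
    rw [hG, Coh.mk_eq_zero, key _ (g t).2.1, LinearMap.codRestrict_apply, hi, hf,
      ← mem_tens_ker_right, Submodule.ker_mkQ]
    constructor
    · intro h
      exact map_mem_tens (fun x _ => x.2.1) (fun y hy => hy) h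
    · intro h
      rw [mem_tens_iff_sliceL]
      intro l
      -- Functionals on the subspace extend to `Ω(P)`, which compares tensors over the subspaces
      -- with their images in `Ω(P) ⊗ Γ^∧`.
      obtain ⟨l', rfl⟩ := LinearMap.exists_extend l
      have h1 := mem_tens_iff_sliceL.1 (tens_mono le_top le_rfl h) l'
      rw [sliceL_map] at h1
      exact h1
  obtain ⟨κ, hκ⟩ := exists_equiv_of_ker_eq
    (X := ↥(S.hMDeg p) ⊗[ℂ] ↥(C.invDeg q ⊓ LinearMap.ker C.dΓ)) (Y := ↥(S.hMDeg p) ⊗[ℂ] Hinv C q)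
    (Y' := S.Hvh p q) (f := f) (g := G) h1 h2 h3
  exact ⟨κ, fun t hx => hκ t⟩

end BundleCalculus
end QPB
end

noncomputable section
namespace QPB

/-! ### Isomorphisms of quotients from correspondences of representatives. -/

theorem exists_equiv_of_rel {X X' Y Y' Z : Type*} [AddCommGroup X] [Module ℂ X] [AddCommGroup X']
    [Module ℂ X'] [AddCommGroup Y] [Module ℂ Y] [AddCommGroup Y'] [Module ℂ Y'] [AddCommGroup Z]
    [Module ℂ Z] {m : X →ₗ[ℂ] Y} {m' : X' →ₗ[ℂ] Y'} (hm : Function.Surjective m)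
    (hm' : Function.Surjective m') (a : X →ₗ[ℂ] Z) (a' : X' →ₗ[ℂ] Z) (R : Submodule ℂ Z)
    (h₁ : ∀ x, ∃ x', a' x' - a x ∈ R) (h₂ : ∀ x', ∃ x, a' x' - a x ∈ R)
    (h : ∀ x x', a' x' - a x ∈ R → (m x = 0 ↔ m' x' = 0)) :
    ∃ e : Y ≃ₗ[ℂ] Y', ∀ x x', a' x' - a x ∈ R → e (m x) = m' x' := by
  -- Representatives correspond only modulo `R`, so a linear relation takes the place of a map; both
  -- quotients are quotients of `T`.
  let T : Submodule ℂ (X × X') :=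
    R.comap (a' ∘ₗ LinearMap.snd ℂ X X' - a ∘ₗ LinearMap.fst ℂ X X')
  obtain ⟨e, he⟩ := exists_equiv_of_ker_eq (f := m ∘ₗ LinearMap.fst ℂ X X' ∘ₗ T.subtype)
    (g := m' ∘ₗ LinearMap.snd ℂ X X' ∘ₗ T.subtype)
    (fun y => by
      obtain ⟨x, rfl⟩ := hm y
      obtain ⟨x', hx'⟩ := h₁ x
      exact ⟨⟨(x, x'), hx'⟩, rfl⟩)
    (fun y => by
      obtain ⟨x', rfl⟩ := hm' y
      obtain ⟨x, hx⟩ := h₂ x'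
      exact ⟨⟨(x, x'), hx⟩, rfl⟩)
    (fun x => h _ _ x.2)
  exact ⟨e, fun x x' hx => he ⟨(x, x'), hx⟩⟩

theorem exists_quotient_equiv {X Y X' Z : Type*} [AddCommGroup X] [Module ℂ X] [AddCommGroup Y]
    [Module ℂ Y] [AddCommGroup X'] [Module ℂ X'] [AddCommGroup Z] [Module ℂ Z]
    {U B : Submodule ℂ X} {W D : Submodule ℂ Y} {U' B' : Submodule ℂ X'} (a : X ⊗[ℂ] Y →ₗ[ℂ] Z)
    (a' : X' →ₗ[ℂ] Z) (R : Submodule ℂ Z)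
    (h₁ : ∀ x ∈ tens U W, ∃ x' ∈ U', a' x' - a x ∈ R)
    (h₂ : ∀ x' ∈ U', ∃ x ∈ tens U W, a' x' - a x ∈ R)
    (h : ∀ x ∈ tens U W, ∀ x' ∈ U', a' x' - a x ∈ R →
      (x' ∈ B' ↔ ∃ x₁ ∈ tens (U ⊓ B) W, ∃ x₂ ∈ tens U (W ⊓ D), x = x₁ + x₂)) :
    ∃ e : ((U ⧸ B.submoduleOf U) ⊗[ℂ] (W ⧸ D.submoduleOf W)) ≃ₗ[ℂ] (U' ⧸ B'.submoduleOf U'),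
      ∀ (x : U) (y : W) (x' : X') (hx' : x' ∈ U'), a' x' - a ((x : X) ⊗ₜ (y : Y)) ∈ R →
        e ((B.submoduleOf U).mkQ x ⊗ₜ (D.submoduleOf W).mkQ y) =
          (B'.submoduleOf U').mkQ ⟨x', hx'⟩ := by
  have hj : ∀ t, TensorProduct.map U.subtype W.subtype t ∈ tens U W := fun t => ⟨t, rfl⟩
  obtain ⟨e, he⟩ := exists_equiv_of_rel
    (m := TensorProduct.map (B.submoduleOf U).mkQ (D.submoduleOf W).mkQ)
    (m' := (B'.submoduleOf U').mkQ)
    (TensorProduct.map_surjective (Submodule.mkQ_surjective _) (Submodule.mkQ_surjective _))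
    (Submodule.mkQ_surjective _) (a ∘ₗ TensorProduct.map U.subtype W.subtype) (a' ∘ₗ U'.subtype) R
    (fun t => by
      obtain ⟨w, hw, h⟩ := h₁ _ (hj t)
      exact ⟨⟨w, hw⟩, h⟩)
    (fun w => by
      obtain ⟨_, ⟨t, rfl⟩, h⟩ := h₂ w w.2
      exact ⟨t, h⟩)
    (fun t w hw => by
      rw [map_mkQ_eq_zero_iff, ← h _ (hj t) w w.2 hw, Submodule.mkQ_apply,
        Submodule.Quotient.mk_eq_zero]
      rfl)
  exact ⟨e, fun x y x' hx' h => he (x ⊗ₜ y) ⟨x', hx'⟩ h⟩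

namespace BundleCalculus

universe uA uG uV uB uW

variable {V : Type uV} {B : Type uB} {A : Type uA}
    [Ring V] [StarRing V] [Algebra ℂ V] [StarModule ℂ V]
    [Ring B] [StarRing B] [Algebra ℂ B] [StarModule ℂ B]
    [Ring A] [StarRing A] [HopfAlgebra ℂ A] [StarModule ℂ A]
    {Γ : Type uG} [AddCommGroup Γ] [Module ℂ Γ] [Module A Γ] [Module Aᵐᵒᵖ Γ]
    [IsScalarTower ℂ A Γ] [IsScalarTower ℂ Aᵐᵒᵖ Γ] [SMulCommClass A Aᵐᵒᵖ Γ]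
    {P : QuantumPrincipalBundle V B A} {C : BicovariantStarCalculus A Γ}
    {Ω : Type uW} [Ring Ω] [Algebra ℂ Ω] {𝒲 : ℕ → Submodule ℂ Ω} [GradedAlgebra 𝒲]
    (S : BundleCalculus P C Ω 𝒲)

/-! ### The second term of the spectral sequence -/

theorem d_mem_hMDeg (hA : IsCompactMatrixQuantumGroup A) {p : ℕ} {φ : Ω} (hφ : φ ∈ S.hMDeg p) :
    S.d φ ∈ S.hMDeg (p + 1) :=
  ⟨S.d_mem_hM hA hφ.1, S.d_mem p φ hφ.2⟩

theorem mem_Zr_one_of_mem_two {k : ℤ} {n : ℕ} {w : Ω} (hw : w ∈ Zr S.d 𝒲 S.fil (2 : ℕ) k n) :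
    w ∈ Zr S.d 𝒲 S.fil (1 : ℕ) k n := by
  obtain ⟨h1, h2, h3⟩ := S.mem_Zr_two.1 hw
  exact S.mem_Zr_one.2 ⟨h1, h2, S.fil_mono (by omega) h3⟩

theorem map_d_eq_zero {p : ℕ} {I : Submodule ℂ C.Envelope} {x : Ω ⊗[ℂ] C.Envelope}
    (hx : x ∈ tens (S.hMDeg p ⊓ LinearMap.ker S.d) I) :
    TensorProduct.map S.d LinearMap.id x = 0 :=
  mem_tens_ker_left.1 (tens_mono inf_le_right le_top hx)

/-- A lift `w` of a closed `x` has `dw` with symbol in `bnd`, so `dw` is in `B₁`. Subtracting the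
form of lower order found there puts `w` into `Z₂` without changing its symbol. -/
theorem exists_Zr_two (hA : IsCompactMatrixQuantumGroup A) {p q : ℕ} {x : Ω ⊗[ℂ] C.Envelope}
    (hx : x ∈ tens (S.hMDeg p ⊓ LinearMap.ker S.d) (C.invDeg q ⊓ LinearMap.ker C.dΓ)) :
    ∃ w ∈ Zr S.d 𝒲 S.fil (2 : ℕ) q (p + q), S.symb q w - S.iota x ∈ S.bnd := by
  obtain ⟨hx1, hx2⟩ := S.tens_hMDeg_le hA p q (tens_mono inf_le_left le_rfl hx)
  obtain ⟨w, hw, h⟩ := S.exists_Zr_one_symb hA hx1 hx2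
  have h0 : S.symb q w - S.iota x ∈ S.bnd := by rw [h, sub_self]; exact zero_mem _
  obtain ⟨h1, h2, h3⟩ := S.mem_Zr_one.1 hw
  have h4 := S.symb_d_sub_mem_bnd h0
  rw [S.map_d_eq_zero hx, map_zero, sub_zero] at h4
  have h5 : S.d w ∈ 𝒲 (p + 1 + q) := by
    rw [add_right_comm]
    exact S.d_mem _ _ h1
  obtain ⟨a, u, _, ha, hu, hdu, hau⟩ := S.mem_Br_one.1 ((S.mem_Br_one_iff hA h5 h3).2 h4)
  obtain ⟨hn, _⟩ | ⟨m, v, hm, hv, hv', hvd⟩ := S.exists_homogeneous hu hdu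
  · omega
  obtain rfl : m = p + q := by omega
  refine ⟨w - v, S.mem_Zr_two.2 ⟨sub_mem h1 hv, sub_mem h2 (S.fil_mono (by omega) hv'), ?_⟩, ?_⟩
  · rwa [map_sub, hvd, hau, add_sub_cancel_right]
  · rwa [map_sub, S.symb_eq_zero_of_mem hv', sub_zero]

theorem exists_hM_rep_of_Zr_one (hA : IsCompactMatrixQuantumGroup A) {p q : ℕ} {w : Ω}
    (hw : w ∈ Zr S.d 𝒲 S.fil (1 : ℕ) q (p + q)) :
    ∃ t ∈ tens (S.hMDeg p) (C.invDeg q ⊓ LinearMap.ker C.dΓ), S.symb q w - S.iota t ∈ S.bnd := by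
  obtain ⟨h1, h2, h3⟩ := S.mem_Zr_one.1 hw
  have h4 : S.dvh (S.vhSymb q w) = 0 := by
    rw [← S.vhSymb_d h2, vhSymb, LinearMap.comp_apply,
      S.symb_eq_zero_of_mem (q := q + 1) (by simpa using h3), map_zero]
  obtain ⟨t, ht, h⟩ := S.exists_hM_rep hA (S.vhSymb_mem hA h1 h2) h4
  exact ⟨t, ht, by rwa [iota_vhSymb] at h⟩

theorem map_dΓ_inv_le : C.inv.map C.dΓ ≤ C.inv ⊓ LinearMap.ker C.dΓ := by
  rintro _ ⟨x, hx, rfl⟩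
  exact ⟨C.dΓ_mem_inv hx, C.dΓ_dΓ x⟩

/-- If `w ∈ Z₂` is represented by `t`, then `(d ⊗ id)t` has its second leg exact. Removing the exact
part from the second leg of `t` makes the first leg closed and changes `iota t` only by an element
of `bnd`. -/
theorem exists_closed_rep (hA : IsCompactMatrixQuantumGroup A) {p q : ℕ} {w : Ω}
    (hw : w ∈ Zr S.d 𝒲 S.fil (2 : ℕ) q (p + q)) :
    ∃ x ∈ tens (S.hMDeg p ⊓ LinearMap.ker S.d) (C.invDeg q ⊓ LinearMap.ker C.dΓ),
      S.symb q w - S.iota x ∈ S.bnd := by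
  obtain ⟨t, ht, h⟩ := S.exists_hM_rep_of_Zr_one hA (S.mem_Zr_one_of_mem_two hw)
  have h1 := S.symb_d_sub_mem_bnd h
  rw [S.symb_eq_zero_of_mem (S.mem_Zr_two.1 hw).2.2, zero_sub, neg_mem_iff] at h1
  have h2 : TensorProduct.map S.d LinearMap.id t ∈
      tens (S.hMDeg (p + 1)) (C.invDeg q ⊓ LinearMap.ker C.dΓ) :=
    map_mem_tens (fun φ hφ => S.d_mem_hMDeg hA hφ) (fun _ h => h) ht
  have h3 := (S.iota_mem_bnd_iff hA (tens_mono inf_le_left (inf_le_left.trans inf_le_left) h2)).1 h1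
  set D := C.inv.map C.dΓ ⊓ (C.invDeg q ⊓ LinearMap.ker C.dΓ)
  have h4 : TensorProduct.map S.d LinearMap.id t ∈ tens ⊤ D :=
    tens_mono le_top le_rfl (mem_tens_inf h3 h2)
  obtain ⟨r, hr, hr'⟩ := exists_proj D
  have hs : t = TensorProduct.map LinearMap.id (LinearMap.id - r) t +
      TensorProduct.map LinearMap.id r t := by
    rw [← LinearMap.add_apply, ← TensorProduct.map_add_right, sub_add_cancel,
      TensorProduct.map_id, LinearMap.id_apply]
  refine ⟨TensorProduct.map LinearMap.id (LinearMap.id - r) t, ?_, ?_⟩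
  · have h5 : TensorProduct.map LinearMap.id (LinearMap.id - r) t ∈
        tens (S.hMDeg p) (C.invDeg q ⊓ LinearMap.ker C.dΓ) :=
      map_mem_tens (fun _ h => h) (fun y hy => sub_mem hy (hr y).2) ht
    have h6 : TensorProduct.map S.d LinearMap.id
        (TensorProduct.map LinearMap.id (LinearMap.id - r) t) = 0 := by
      have h7 := eqOn_tens (f := TensorProduct.map LinearMap.id (LinearMap.id - r)) (g := 0)
        (fun x _ y hy => by simp [hr' y hy]) h4
      simpa only [map_map, LinearMap.id_comp, LinearMap.comp_id, LinearMap.zero_apply] using h7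
    simpa using mem_tens_inf h5 (mem_tens_ker_left.2 h6)
  · have h8 : TensorProduct.map LinearMap.id r t ∈ tens S.hM (C.inv.map C.dΓ) :=
      map_mem_tens (U := S.hMDeg p) (U' := S.hM) (fun _ h => h.1) (fun y _ => (hr y).1) ht
    have h9 := (S.iota_mem_bnd_iff hA
      (tens_mono le_rfl ((map_dΓ_inv_le (C := C)).trans inf_le_left) h8)).2 h8
    have h10 := add_mem h h9
    have h11 := congrArg S.iota hs
    rw [map_add] at h11
    rwa [h11, sub_add_eq_sub_sub, sub_add_cancel] at h10

theorem exists_of_exact_rep (hA : IsCompactMatrixQuantumGroup A) {p q : ℕ}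
    {x : Ω ⊗[ℂ] C.Envelope}
    (hx : x ∈ tens (S.hMDeg p ⊓ LinearMap.ker S.d ⊓ S.hM.map S.d)
      (C.invDeg q ⊓ LinearMap.ker C.dΓ)) :
    ∃ v ∈ S.fil q, S.d v ∈ S.fil q ∧ S.d v ∈ 𝒲 (p + q) ∧ S.symb q (S.d v) - S.iota x ∈ S.bnd := by
  obtain _ | p := p
  -- There are no nonzero exact forms of degree zero.
  · have h1 : S.hMDeg 0 ⊓ LinearMap.ker S.d ⊓ S.hM.map S.d ≤ LinearMap.ker LinearMap.id := by
      rintro _ ⟨⟨⟨_, h2⟩, _⟩, ψ, _, rfl⟩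
      change S.d ψ = 0
      rw [← gproj_of_mem h2, gproj_zero_comp_of_mem S.d_mem]
    have h2 := mem_tens_ker_left.1 (tens_mono h1 le_top hx)
    rw [TensorProduct.map_id, LinearMap.id_apply] at h2
    exact ⟨0, zero_mem _, by simp, by simp, by simp [h2]⟩
  · have h1 : S.hMDeg (p + 1) ⊓ LinearMap.ker S.d ⊓ S.hM.map S.d ≤ (S.hMDeg p).map S.d := by
      rintro _ ⟨⟨⟨_, h2⟩, _⟩, ψ, hψ, rfl⟩
      refine ⟨gproj 𝒲 p ψ, ⟨S.gproj_mem_hM hA p hψ, gproj_mem p ψ⟩, ?_⟩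
      rw [← gproj_succ_comp_of_mem S.d_mem, gproj_of_mem h2]
    obtain ⟨s, hs, rfl⟩ := exists_of_mem_tens_map_left (tens_mono h1 le_rfl hx)
    obtain ⟨hs1, hs2⟩ := S.tens_hMDeg_le hA p q hs
    obtain ⟨v, hv, h⟩ := S.exists_Zr_one_symb hA hs1 hs2
    obtain ⟨h3, h4, h5⟩ := S.mem_Zr_one.1 hv
    refine ⟨v, h4, h5, ?_, S.symb_d_sub_mem_bnd (by rw [h, sub_self]; exact zero_mem _)⟩
    rw [add_right_comm]
    exact S.d_mem _ _ h3

theorem exists_exact_rep (hA : IsCompactMatrixQuantumGroup A) {p q : ℕ} {v : Ω}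
    (hv : v ∈ S.fil q) (hd : S.d v ∈ S.fil q) (hd' : S.d v ∈ 𝒲 (p + q)) :
    ∃ x ∈ tens (S.hMDeg p ⊓ LinearMap.ker S.d ⊓ S.hM.map S.d) (C.invDeg q ⊓ LinearMap.ker C.dΓ),
      S.symb q (S.d v) - S.iota x ∈ S.bnd := by
  obtain ⟨_, h0⟩ | ⟨m, u, hm, hu, hu', hud⟩ := S.exists_homogeneous hv hd'
  · exact ⟨0, zero_mem _, by simp [h0]⟩
  rw [← hud] at hd ⊢
  obtain _ | p := p
  -- Here the primitive has total degree `q - 1`, hence vertical order below `q`.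
  · refine ⟨0, zero_mem _, ?_⟩
    rw [map_zero, sub_zero]
    refine S.symb_d_mem_bnd ((S.mem_fil_sub_one hu').2 ?_)
    rw [← gproj_of_mem hu, symb_gproj, if_neg (by omega)]
  · obtain rfl : m = p + q := by omega
    obtain ⟨t, ht, h⟩ := S.exists_hM_rep_of_Zr_one hA (S.mem_Zr_one.2 ⟨hu, hu', hd⟩)
    refine ⟨_, map_mem_tens (fun φ hφ => ?_) (fun _ h => h) ht, S.symb_d_sub_mem_bnd h⟩
    exact ⟨⟨S.d_mem_hMDeg hA hφ, S.d_d φ⟩, φ, hφ.1, rfl⟩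

/-- An element of `B₂` is a form of lower order plus some `dv`. The `dv` accounts for the
coboundaries of `𝔥_M`, and what is left of the symbol lies in `bnd`, which accounts for those of
`Γ^∧_inv`. -/
theorem mem_Br_two_iff (hA : IsCompactMatrixQuantumGroup A) {p q : ℕ} {w : Ω}
    (hw : w ∈ Zr S.d 𝒲 S.fil (2 : ℕ) q (p + q)) {x : Ω ⊗[ℂ] C.Envelope}
    (hx : x ∈ tens (S.hMDeg p ⊓ LinearMap.ker S.d) (C.invDeg q ⊓ LinearMap.ker C.dΓ))
    (h : S.symb q w - S.iota x ∈ S.bnd) : w ∈ Br S.d 𝒲 S.fil (2 : ℕ) q (p + q) ↔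
      ∃ x₁ ∈ tens (S.hMDeg p ⊓ LinearMap.ker S.d ⊓ S.hM.map S.d)
          (C.invDeg q ⊓ LinearMap.ker C.dΓ),
        ∃ x₂ ∈ tens (S.hMDeg p ⊓ LinearMap.ker S.d)
          (C.invDeg q ⊓ LinearMap.ker C.dΓ ⊓ C.inv.map C.dΓ), x = x₁ + x₂ := by
  obtain ⟨hw1, hw2, hw3⟩ := S.mem_Zr_two.1 hw
  have key : ∀ x₂ ∈ tens (S.hMDeg p ⊓ LinearMap.ker S.d) (C.invDeg q ⊓ LinearMap.ker C.dΓ),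
      S.iota x₂ ∈ S.bnd ↔ x₂ ∈ tens S.hM (C.inv.map C.dΓ) := fun x₂ h₂ =>
    S.iota_mem_bnd_iff hA (tens_mono (inf_le_left.trans inf_le_left)
      (inf_le_left.trans inf_le_left) h₂)
  rw [mem_Br_two]
  constructor
  · rintro ⟨a, u, _, h2, _, h4, h5, h6, rfl⟩
    obtain ⟨x₁, hx₁, h7⟩ := S.exists_exact_rep hA h4 h6 h5
    have h8 := sub_mem h7 h
    rw [map_add, S.symb_eq_zero_of_mem h2, zero_add, sub_sub_sub_cancel_left, ← map_sub] at h8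
    have h9 := sub_mem hx (tens_mono inf_le_left le_rfl hx₁)
    refine ⟨x₁, hx₁, x - x₁, ?_, by abel⟩
    have h10 := mem_tens_inf h9 ((key _ h9).1 h8)
    exact tens_mono inf_le_left le_rfl h10
  · rintro ⟨x₁, hx₁, x₂, hx₂, rfl⟩
    obtain ⟨v, hv, hdv, hdv', h7⟩ := S.exists_of_exact_rep hA hx₁
    have h8 := (key _ (tens_mono le_rfl inf_le_left hx₂)).2
      (tens_mono (inf_le_left.trans inf_le_left) inf_le_right hx₂)
    have h9 : S.symb q (w - S.d v) ∈ S.bnd := by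
      have := add_mem (sub_mem h h7) h8
      rw [map_add, sub_sub_sub_eq] at this
      rw [map_sub]
      convert this using 1
      abel
    obtain ⟨a, u, ha, ha', hu, hdu, hau⟩ := S.mem_Br_one.1
      ((S.mem_Br_one_iff hA (sub_mem hw1 hdv') (sub_mem hw2 hdv)).2 h9)
    refine ⟨a, u + v, ha, ha', ?_, add_mem (S.fil_mono (by omega) hu) hv, ?_, ?_, ?_⟩
    -- Applying `d` removes the exact terms and leaves `da = dw`, so the extra condition in `B₂` is
    -- inherited from `w ∈ Z₂`.
    · have := congrArg S.d hau
      rw [map_sub, map_add, S.d_d, S.d_d, sub_zero, add_zero] at this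
      rwa [← this]
    · rw [map_add]
      exact add_mem hdu hdv'
    · rw [map_add]
      refine add_mem ?_ hdv
      simpa using S.d_mem_fil hu
    · rw [map_add, ← add_assoc, ← hau, sub_add_cancel]

theorem exists_E₂Equiv (hA : IsCompactMatrixQuantumGroup A) (p q : ℕ) :
    ∃ e₂ : (S.HhM p ⊗[ℂ] Hinv C q) ≃ₗ[ℂ] S.E 2 p q,
      ∀ (φ : ↥(S.hMDeg p ⊓ LinearMap.ker S.d)) (ϑ : ↥(C.invDeg q ⊓ LinearMap.ker C.dΓ)) (w : Ω)
        (hw : w ∈ Zr S.d 𝒲 S.fil (2 : ℕ) q (p + q)),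
        S.symb q w - S.iota ((φ : Ω) ⊗ₜ (ϑ : C.Envelope)) ∈ S.bnd →
        e₂ (Coh.mk S.d S.hM (S.hMDeg p) φ ⊗ₜ Coh.mk C.dΓ C.inv (C.invDeg q) ϑ) =
          Er.mk S.d 𝒲 S.fil (2 : ℕ) q (p + q) ⟨w, hw⟩ := by
  exact exists_quotient_equiv S.iota (S.symb q) S.bnd (fun x hx => S.exists_Zr_two hA hx)
    (fun w hw => S.exists_closed_rep hA hw) (fun x hx w hw h => S.mem_Br_two_iff hA hw hx h)

end BundleCalculus
end QPB
end

noncomputable section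
namespace QPB

/-! ### Connected quantum groups -/

theorem exists_coh_equiv_of_eq {X : Type*} [AddCommGroup X] [Module ℂ X] {d : X →ₗ[ℂ] X}
    {K K' L L' : Submodule ℂ X} (hK : K = K') (hL : L = L') :
    ∃ e : Coh d K L ≃ₗ[ℂ] Coh d K' L', ∀ (x : ↥(L ⊓ LinearMap.ker d))
      (x' : ↥(L' ⊓ LinearMap.ker d)), (x : X) = x' → e (Coh.mk d K L x) = Coh.mk d K' L' x' := by
  subst hK hL
  refine ⟨LinearEquiv.refl ℂ _, fun x x' h => ?_⟩
  rw [Subtype.ext h]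
  rfl

namespace BicovariantStarCalculus

universe uA uG

variable {A : Type uA} [Ring A] [StarRing A] [HopfAlgebra ℂ A] [StarModule ℂ A]
variable {Γ : Type uG} [AddCommGroup Γ] [Module ℂ Γ] [Module A Γ] [Module Aᵐᵒᵖ Γ]
  [IsScalarTower ℂ A Γ] [IsScalarTower ℂ Aᵐᵒᵖ Γ] [SMulCommClass A Aᵐᵒᵖ Γ]
variable (C : BicovariantStarCalculus A Γ)

theorem leftCoaction_coassoc (hA : IsCompactMatrixQuantumGroup A) (x : C.Envelope) :
    TensorProduct.map LinearMap.id C.leftCoaction.toLinearMap (C.leftCoaction x) =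
      TensorProduct.assoc ℂ A A C.Envelope
        (TensorProduct.map Coalgebra.comul LinearMap.id (C.leftCoaction x)) := by
  refine LinearMap.congr_fun (f := TensorProduct.map LinearMap.id C.leftCoaction.toLinearMap ∘ₗ
    C.leftCoaction.toLinearMap) (g := (TensorProduct.assoc ℂ A A C.Envelope).toLinearMap ∘ₗ
      TensorProduct.map Coalgebra.comul LinearMap.id ∘ₗ C.leftCoaction.toLinearMap)
    (C.env_inv_ext hA ?_) x
  intro ι _ _ U hU i j ϑ hϑ
  simp only [LinearMap.comp_apply, AlgHom.toLinearMap_apply, C.leftCoaction_corep_mul hU _ _ hϑ,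
    map_sum, TensorProduct.map_tmul, LinearMap.id_apply, hU.comul, TensorProduct.tmul_sum,
    TensorProduct.sum_tmul, LinearEquiv.coe_coe, TensorProduct.assoc_tmul]
  rw [Finset.sum_comm]

/-- Averaging of forms over the quantum group. -/
def haarProj (h : A →ₗ[ℂ] ℂ) : C.Envelope →ₗ[ℂ] C.Envelope :=
  sliceL h ∘ₗ C.leftCoaction.toLinearMap

theorem haarProj_mem_inv (hA : IsCompactMatrixQuantumGroup A) {h : A →ₗ[ℂ] ℂ} (hh : IsHaar h)
    (x : C.Envelope) : C.haarProj h x ∈ C.inv := by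
  have h1 : C.leftCoaction (C.haarProj h x) = sliceL h
      (TensorProduct.map LinearMap.id C.leftCoaction.toLinearMap (C.leftCoaction x)) := by
    rw [sliceL_map]; rfl
  rw [mem_inv, h1, C.leftCoaction_coassoc hA, haarProj, LinearMap.comp_apply,
    AlgHom.toLinearMap_apply]
  generalize C.leftCoaction x = z
  induction z with
  | zero => simp
  | add x y hx hy => simp only [map_add, TensorProduct.tmul_add, hx, hy]
  | tmul a y =>
    have h2 : ∀ w : A ⊗[ℂ] A, sliceL h (TensorProduct.assoc ℂ A A C.Envelope (w ⊗ₜ y)) =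
        sliceL h w ⊗ₜ y := fun w => by
      induction w with
      | zero => simp
      | add x y hx hy => simp only [map_add, TensorProduct.add_tmul, hx, hy]
      | tmul b c => simp [TensorProduct.smul_tmul']
    simp [h2, hh.left, TensorProduct.smul_tmul]

theorem haarProj_of_mem_inv {h : A →ₗ[ℂ] ℂ} (hh : IsHaar h) {x : C.Envelope} (hx : x ∈ C.inv) :
    C.haarProj h x = x := by
  rw [haarProj, LinearMap.comp_apply, AlgHom.toLinearMap_apply, C.mem_inv.1 hx, sliceL_tmul, hh.one,
    one_smul]

theorem haarProj_dΓ (h : A →ₗ[ℂ] ℂ) (x : C.Envelope) :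
    C.haarProj h (C.dΓ x) = C.dΓ (C.haarProj h x) := by
  rw [haarProj, LinearMap.comp_apply, AlgHom.toLinearMap_apply, leftCoaction_dΓ, sliceL_map]
  rfl

theorem haarProj_mem {h : A →ₗ[ℂ] ℂ} {n : ℕ} {x : C.Envelope} (hx : x ∈ C.deg n) :
    C.haarProj h x ∈ C.deg n := by
  refine mem_tens_iff_sliceL.1 ?_ h
  rw [AlgHom.toLinearMap_apply, ← gproj_of_mem hx, leftCoaction_gproj]
  exact compR_mem _ _

/-- When `ker d = ℂ1`, the Haar functional agrees with the counit on `ker d`. Averaging over the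
group is then homotopic to the identity on `Γ^∧`, maps onto `Γ^∧_inv` and is the identity there. -/
theorem exists_Hinv_equiv (hA : IsCompactMatrixQuantumGroup A)
    (hG : ∀ a : A, C.d a = 0 → a ∈ Set.range (algebraMap ℂ A)) (q : ℕ) :
    ∃ g : Hinv C q ≃ₗ[ℂ] HG C q, ∀ ϑ : ↥(C.invDeg q ⊓ LinearMap.ker C.dΓ),
      ∃ hϑ : (ϑ : C.Envelope) ∈ C.deg q ⊓ LinearMap.ker C.dΓ,
        g (Coh.mk C.dΓ C.inv (C.invDeg q) ϑ) = Coh.mk C.dΓ ⊤ (C.deg q) ⟨ϑ, hϑ⟩ := by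
  obtain ⟨h, hh⟩ := exists_haar A hA
  obtain ⟨K, hK⟩ := C.exists_homotopy hA (e := h) (fun a ha => by
    obtain ⟨c, rfl⟩ := hG a ((C.dA_eq_zero_iff a).1 ha)
    rw [Algebra.algebraMap_eq_smul_one, map_smul, map_smul, hh.one, Bialgebra.counit_one])
  have hle : C.invDeg q ⊓ LinearMap.ker C.dΓ ≤ C.deg q ⊓ LinearMap.ker C.dΓ :=
    inf_le_inf_right _ inf_le_right
  obtain ⟨g, hg⟩ := exists_equiv_of_ker_eq (f := Coh.mk C.dΓ C.inv (C.invDeg q))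
    (g := LinearMap.comp (Coh.mk C.dΓ ⊤ (C.deg q)) (Submodule.inclusion hle))
    (Submodule.mkQ_surjective _) (fun c => by
      obtain ⟨x, rfl⟩ := Submodule.mkQ_surjective _ c
      have h1 : C.dΓ x = 0 := x.2.2
      have h2 : C.haarProj h x ∈ C.invDeg q ⊓ LinearMap.ker C.dΓ :=
        ⟨⟨C.haarProj_mem_inv hA hh x, C.haarProj_mem x.2.1⟩, by
          exact (C.haarProj_dΓ h x).symm.trans (by rw [h1, map_zero])⟩
      have h3 : Coh.mk C.dΓ ⊤ (C.deg q) (x - Submodule.inclusion hle ⟨_, h2⟩) = 0 := by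
        rw [Coh.mk_eq_zero]
        have h4 := hK x
        rw [h1, map_zero, zero_add] at h4
        exact ⟨K x, Submodule.mem_top, h4.symm⟩
      rw [map_sub, sub_eq_zero] at h3
      exact ⟨_, h3.symm⟩) (fun x => by
      rw [LinearMap.comp_apply, Coh.mk_eq_zero, Coh.mk_eq_zero, Submodule.coe_inclusion]
      constructor
      · rintro ⟨y, _, hy⟩
        exact ⟨y, Submodule.mem_top, hy⟩
      · rintro ⟨y, _, hy⟩
        refine ⟨C.haarProj h y, C.haarProj_mem_inv hA hh y, ?_⟩
        rw [← haarProj_dΓ, hy, C.haarProj_of_mem_inv hh x.2.1.1])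
  exact ⟨g, fun ϑ => ⟨hle ϑ.2, hg ϑ⟩⟩

end BicovariantStarCalculus

namespace BundleCalculus

universe uA uG uV uB uW

variable {V : Type uV} {B : Type uB} {A : Type uA}
    [Ring V] [StarRing V] [Algebra ℂ V] [StarModule ℂ V]
    [Ring B] [StarRing B] [Algebra ℂ B] [StarModule ℂ B]
    [Ring A] [StarRing A] [HopfAlgebra ℂ A] [StarModule ℂ A]
    {Γ : Type uG} [AddCommGroup Γ] [Module ℂ Γ] [Module A Γ] [Module Aᵐᵒᵖ Γ]
    [IsScalarTower ℂ A Γ] [IsScalarTower ℂ Aᵐᵒᵖ Γ] [SMulCommClass A Aᵐᵒᵖ Γ]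
    {P : QuantumPrincipalBundle V B A} {C : BicovariantStarCalculus A Γ}
    {Ω : Type uW} [Ring Ω] [Algebra ℂ Ω] {𝒲 : ℕ → Submodule ℂ Ω} [GradedAlgebra 𝒲]
    (S : BundleCalculus P C Ω 𝒲)

/-- For a connected group `FA w` has scalar coefficients, and the counit law identifies it with `w ⊗
1`. -/
theorem hM_eq_base (hA : IsCompactMatrixQuantumGroup A)
    (hG : ∀ a : A, C.d a = 0 → a ∈ Set.range (algebraMap ℂ A)) : S.hM = S.base := by
  ext w
  rw [S.mem_hM hA]
  constructor
  · rintro ⟨h1, h2⟩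
    have h3 := eqOn_tens (f := LinearMap.id) (g := (TensorProduct.mk ℂ Ω A).flip 1 ∘ₗ
      sliceR (Coalgebra.counit (R := ℂ))) (fun x _ a ha => by
        obtain ⟨c, rfl⟩ := hG a ((C.dA_eq_zero_iff a).1 ha)
        simp [Algebra.algebraMap_eq_smul_one, TensorProduct.smul_tmul']) h2
    rw [LinearMap.id_apply, LinearMap.comp_apply, S.isCoaction_FA.counit] at h3
    change S.Fl w = w ⊗ₜ 1
    rw [S.Fl_of_mem_hor h1, h3]
    simp
  · intro h
    have h1 : S.Fl w = w ⊗ₜ 1 := h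
    have h2 : S.FA w = w ⊗ₜ 1 := by
      rw [FA, LinearMap.comp_apply, h1]
      simp
    refine ⟨S.mem_hor_of_Fl (x := w ⊗ₜ 1) (by rw [h1]; simp), ?_⟩
    rw [h2]
    refine tmul_mem_tens Submodule.mem_top ?_
    rw [LinearMap.mem_ker, ← C.dΓ_ofA, map_one, C.dΓ_one]

theorem exists_connected_equiv (hA : IsCompactMatrixQuantumGroup A)
    (hG : ∀ a : A, C.d a = 0 → a ∈ Set.range (algebraMap ℂ A)) {p q : ℕ}
    (e₂ : (S.HhM p ⊗[ℂ] Hinv C q) ≃ₗ[ℂ] S.E 2 p q) (g : Hinv C q ≃ₗ[ℂ] HG C q) :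
    ∃ f : (S.HM p ⊗[ℂ] HG C q) ≃ₗ[ℂ] S.E 2 p q,
      ∀ (φ : ↥(S.baseDeg p ⊓ LinearMap.ker S.d)) (φ' : ↥(S.hMDeg p ⊓ LinearMap.ker S.d))
        (c : Hinv C q), (φ : Ω) = φ' →
        f (Coh.mk S.d S.base (S.baseDeg p) φ ⊗ₜ[ℂ] g c) =
          e₂ (Coh.mk S.d S.hM (S.hMDeg p) φ' ⊗ₜ[ℂ] c) := by
  have h := S.hM_eq_base hA hG
  obtain ⟨e, he⟩ := exists_coh_equiv_of_eq (d := S.d) h.symm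
    (show S.baseDeg p = S.hMDeg p by rw [baseDeg, hMDeg, h])
  exact ⟨TensorProduct.congr e g.symm ≪≫ₗ e₂, fun φ φ' c hφ => by
    rw [LinearEquiv.trans_apply, TensorProduct.congr_tmul, he φ φ' hφ, LinearEquiv.symm_apply_apply]⟩

theorem d₁_mk {p q : ℕ} {w : Ω} (hw : w ∈ Zr S.d 𝒲 S.fil (1 : ℕ) q (p + q))
    (hw' : S.d w ∈ Zr S.d 𝒲 S.fil (1 : ℕ) q (p + 1 + q)) :
    S.d₁ p q (Er.mk S.d 𝒲 S.fil (1 : ℕ) q (p + q) ⟨w, hw⟩) =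
      Er.mk S.d 𝒲 S.fil (1 : ℕ) q (p + 1 + q) ⟨S.d w, hw'⟩ := rfl

theorem d_mem_Zr_one {p q : ℕ} {w : Ω} (hw : w ∈ Zr S.d 𝒲 S.fil (1 : ℕ) q (p + q)) :
    S.d w ∈ Zr S.d 𝒲 S.fil (1 : ℕ) q (p + 1 + q) := by
  obtain ⟨h1, _, h3⟩ := S.mem_Zr_one.1 hw
  refine S.mem_Zr_one.2 ⟨?_, h3, by rw [S.d_d]; exact zero_mem _⟩
  rw [add_right_comm]
  exact S.d_mem _ _ h1

end BundleCalculus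
end QPB
end

/-! ### Assembly of the identifications. -/

theorem mainTheorem7 {V B A Γ Ω : Type*}
    [Ring V] [StarRing V] [Algebra ℂ V] [StarModule ℂ V]
    [Ring B] [StarRing B] [Algebra ℂ B] [StarModule ℂ B]
    [Ring A] [StarRing A] [HopfAlgebra ℂ A] [StarModule ℂ A]
    [AddCommGroup Γ] [Module ℂ Γ] [Module A Γ] [Module Aᵐᵒᵖ Γ]
    [IsScalarTower ℂ A Γ] [IsScalarTower ℂ Aᵐᵒᵖ Γ] [SMulCommClass A Aᵐᵒᵖ Γ]
    [Ring Ω] [Algebra ℂ Ω] (𝒲 : ℕ → Submodule ℂ Ω) [GradedAlgebra 𝒲]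
    (hA : QPB.IsCompactMatrixQuantumGroup A)
    (C : QPB.BicovariantStarCalculus A Γ)
    (P : QPB.QuantumPrincipalBundle V B A)
    (S : QPB.BundleCalculus P C Ω 𝒲) :
    -- connections exist, and `𝔥_M` is a subcomplex
    (∃ ω, S.IsConnection ω) ∧
    (∀ p, ∀ φ ∈ S.hMDeg p, S.d φ ∈ S.hMDeg (p + 1)) ∧
    ∃ (Θ : ∀ p q, ↥(S.vhDeg p q) ≃ₗ[ℂ] S.gr p q)
      (e₁ : ∀ p q, S.Hvh p q ≃ₗ[ℂ] S.E 1 p q)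
      (κ : ∀ p q, (↥(S.hMDeg p) ⊗[ℂ] QPB.Hinv C q) ≃ₗ[ℂ] S.Hvh p q)
      (e₂ : ∀ p q, (S.HhM p ⊗[ℂ] QPB.Hinv C q) ≃ₗ[ℂ] S.E 2 p q),
      -- `Θ` is the identification of `vh(P)` with the associated graded algebra:
      -- `φ ⊗ ϑ₁⋯ϑ_q ↔ [φ ω(ϑ₁)⋯ω(ϑ_q)]` for every connection `ω`
      (∀ ω, S.IsConnection ω → ∀ (p q : ℕ) (φ : ↥(S.horDeg p)) (a : Fin q → A),
        ∃ (hx : (φ : Ω) ⊗ₜ[ℂ] (List.ofFn fun i => C.π (a i)).prod ∈ S.vhDeg p q)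
          (hw : (φ : Ω) * (List.ofFn fun i => ω (C.π.rangeRestrict (a i))).prod ∈
            𝒲 (p + q) ⊓ S.fil q),
          Θ p q ⟨_, hx⟩ = QPB.Gr.mk 𝒲 S.fil q (p + q) ⟨_, hw⟩) ∧
      -- it transports the product of `Ω(P)` to that of `vh(P)`
      (∀ (p q p' q' : ℕ) (x : ↥(S.vhDeg p q)) (x' : ↥(S.vhDeg p' q'))
        (w : ↥(𝒲 (p + q) ⊓ S.fil q)) (w' : ↥(𝒲 (p' + q') ⊓ S.fil q')),
        Θ p q x = QPB.Gr.mk 𝒲 S.fil q (p + q) w →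
        Θ p' q' x' = QPB.Gr.mk 𝒲 S.fil q' (p' + q') w' →
        ∃ (hx : ((-1 : ℂ) ^ (q * p')) • S.vhMul ((x : Ω ⊗[ℂ] C.Envelope) ⊗ₜ[ℂ] x') ∈
            S.vhDeg (p + p') (q + q'))
          (hw : (w : Ω) * w' ∈ 𝒲 (p + p' + (q + q')) ⊓ S.fil ((q + q' : ℕ) : ℤ)),
          Θ (p + p') (q + q') ⟨_, hx⟩ =
            QPB.Gr.mk 𝒲 S.fil ((q + q' : ℕ) : ℤ) (p + p' + (q + q')) ⟨_, hw⟩) ∧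
      -- and the differential of `Ω(P)` to `d_vh`
      (∀ (p q : ℕ) (x : ↥(S.vhDeg p q)) (w : ↥(𝒲 (p + q) ⊓ S.fil q)),
        Θ p q x = QPB.Gr.mk 𝒲 S.fil q (p + q) w →
        ∃ (hx : S.dvh x ∈ S.vhDeg p (q + 1))
          (hw : S.d w ∈ 𝒲 (p + (q + 1)) ⊓ S.fil ((q + 1 : ℕ) : ℤ)),
          Θ p (q + 1) ⟨_, hx⟩ =
            QPB.Gr.mk 𝒲 S.fil ((q + 1 : ℕ) : ℤ) (p + (q + 1)) ⟨_, hw⟩) ∧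
      -- `E₁(P) = H_vh(P)`
      (∀ (p q : ℕ) (x : ↥(S.vhDeg p q ⊓ LinearMap.ker S.dvh)) (w : ↥(𝒲 (p + q) ⊓ S.fil q)),
        Θ p q ⟨x, x.2.1⟩ = QPB.Gr.mk 𝒲 S.fil q (p + q) w →
        ∃ hw : (w : Ω) ∈ QPB.Zr S.d 𝒲 S.fil (1 : ℕ) q (p + q),
          e₁ p q (QPB.Coh.mk S.dvh S.vh (S.vhDeg p q) x) =
            QPB.Er.mk S.d 𝒲 S.fil (1 : ℕ) q (p + q) ⟨w, hw⟩) ∧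
      -- `H_vh(P) = 𝔥_M ⊗ H(Γ^∧_inv)`
      (∀ (p q : ℕ) (φ : ↥(S.hMDeg p)) (ϑ : ↥(C.invDeg q ⊓ LinearMap.ker C.dΓ)),
        ∃ hx : (φ : Ω) ⊗ₜ[ℂ] (ϑ : C.Envelope) ∈ S.vhDeg p q ⊓ LinearMap.ker S.dvh,
          κ p q (φ ⊗ₜ[ℂ] QPB.Coh.mk C.dΓ C.inv (C.invDeg q) ϑ) =
            QPB.Coh.mk S.dvh S.vh (S.vhDeg p q) ⟨_, hx⟩) ∧
      -- `d₁(φ ⊗ c) = dφ ⊗ c`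
      (∀ (p q : ℕ) (φ : ↥(S.hMDeg p)) (φ' : ↥(S.hMDeg (p + 1))) (c : QPB.Hinv C q),
        (φ' : Ω) = S.d φ →
        S.d₁ p q (e₁ p q (κ p q (φ ⊗ₜ[ℂ] c))) = e₁ (p + 1) q (κ (p + 1) q (φ' ⊗ₜ[ℂ] c))) ∧
      -- `E₂(P) = H(𝔥_M) ⊗ H(Γ^∧_inv)`
      (∀ (p q : ℕ) (φ : ↥(S.hMDeg p ⊓ LinearMap.ker S.d)) (c : QPB.Hinv C q),
        ∃ (w : Ω) (h₁ : w ∈ QPB.Zr S.d 𝒲 S.fil (1 : ℕ) q (p + q))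
          (h₂ : w ∈ QPB.Zr S.d 𝒲 S.fil (2 : ℕ) q (p + q)),
          e₁ p q (κ p q (⟨φ, φ.2.1⟩ ⊗ₜ[ℂ] c)) =
            QPB.Er.mk S.d 𝒲 S.fil (1 : ℕ) q (p + q) ⟨w, h₁⟩ ∧
          e₂ p q (QPB.Coh.mk S.d S.hM (S.hMDeg p) φ ⊗ₜ[ℂ] c) =
            QPB.Er.mk S.d 𝒲 S.fil (2 : ℕ) q (p + q) ⟨w, h₂⟩) ∧
      -- if `G` is connected, then `𝔥_M = Ω(M)` and `E₂(P) = H(M) ⊗ H(G)`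
      ((∀ a : A, C.d a = 0 → a ∈ Set.range (algebraMap ℂ A)) →
        S.hM = S.base ∧
        ∃ (g : ∀ q, QPB.Hinv C q ≃ₗ[ℂ] QPB.HG C q)
          (f : ∀ p q, (S.HM p ⊗[ℂ] QPB.HG C q) ≃ₗ[ℂ] S.E 2 p q),
          (∀ (q : ℕ) (ϑ : ↥(C.invDeg q ⊓ LinearMap.ker C.dΓ)),
            ∃ hϑ : (ϑ : C.Envelope) ∈ C.deg q ⊓ LinearMap.ker C.dΓ,
              g q (QPB.Coh.mk C.dΓ C.inv (C.invDeg q) ϑ) =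
                QPB.Coh.mk C.dΓ ⊤ (C.deg q) ⟨ϑ, hϑ⟩) ∧
          (∀ (p q : ℕ) (φ : ↥(S.baseDeg p ⊓ LinearMap.ker S.d))
            (φ' : ↥(S.hMDeg p ⊓ LinearMap.ker S.d)) (c : QPB.Hinv C q), (φ : Ω) = φ' →
            f p q (QPB.Coh.mk S.d S.base (S.baseDeg p) φ ⊗ₜ[ℂ] g q c) =
              e₂ p q (QPB.Coh.mk S.d S.hM (S.hMDeg p) φ' ⊗ₜ[ℂ] c))) := by
  refine ⟨S.exists_isConnection hA, fun p φ hφ => S.d_mem_hMDeg hA hφ, ?_⟩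
  choose Θ hΘ using S.exists_grEquiv hA
  choose e₁ he₁ using S.exists_E₁Equiv hA
  choose κ hκ using S.exists_κ hA
  choose e₂ he₂ using S.exists_E₂Equiv hA
  have hκ' : ∀ (p q : ℕ) (φ : ↥(S.hMDeg p)) (ϑ : ↥(C.invDeg q ⊓ LinearMap.ker C.dΓ)),
      ∃ hx : (φ : Ω) ⊗ₜ[ℂ] (ϑ : C.Envelope) ∈ S.vhDeg p q ⊓ LinearMap.ker S.dvh,
        κ p q (φ ⊗ₜ[ℂ] QPB.Coh.mk C.dΓ C.inv (C.invDeg q) ϑ) =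
          QPB.Coh.mk S.dvh S.vh (S.vhDeg p q) ⟨_, hx⟩ := fun p q φ ϑ =>
    have hx := S.tens_hMDeg_le hA p q (QPB.tmul_mem_tens φ.2 ϑ.2)
    ⟨hx, hκ p q (φ ⊗ₜ ϑ) hx⟩
  have heκ : ∀ (p q : ℕ) (φ : ↥(S.hMDeg p)) (ϑ : ↥(C.invDeg q ⊓ LinearMap.ker C.dΓ)) (w : Ω)
      (hw : w ∈ QPB.Zr S.d 𝒲 S.fil (1 : ℕ) q (p + q)),
      S.symb q w - S.iota ((φ : Ω) ⊗ₜ (ϑ : C.Envelope)) ∈ S.bnd →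
      e₁ p q (κ p q (φ ⊗ₜ[ℂ] QPB.Coh.mk C.dΓ C.inv (C.invDeg q) ϑ)) =
        QPB.Er.mk S.d 𝒲 S.fil (1 : ℕ) q (p + q) ⟨w, hw⟩ := fun p q φ ϑ w hw h => by
    obtain ⟨hx, hκx⟩ := hκ' p q φ ϑ
    rw [hκx]
    exact he₁ p q ⟨_, hx⟩ w hw h
  refine ⟨Θ, e₁, κ, e₂, ?_, ?_, ?_, ?_, hκ', ?_, ?_, ?_⟩
  · intro ω hω p q φ a
    obtain ⟨hw, h⟩ := hω.list_prod φ.2 q a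
    have hx : (φ : Ω) ⊗ₜ[ℂ] (List.ofFn fun i => C.π (a i)).prod ∈ S.vhDeg p q := by
      rw [S.eq_vhSymb.2 h]
      -- The tensor is the inverse image under `iota` of the symbol of an honest form, which shows
      -- that it lies in `vh(P)` in the right bidegree.
      exact S.vhSymb_mem hA hw.1 hw.2
    exact ⟨hx, hw, (hΘ p q _ _).2 h⟩
  · intro p q p' q' x x' w w' hxw hxw'
    have h := S.symb_mul_eq x.2 x'.2 w.2.2 w'.2.2 ((hΘ _ _ _ _).1 hxw) ((hΘ _ _ _ _).1 hxw')
    have hw : (w : Ω) * w' ∈ 𝒲 (p + p' + (q + q')) ⊓ S.fil ((q + q' : ℕ) : ℤ) := by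
      refine ⟨?_, (S.symb_mul w.2.2 w'.2.2).2⟩
      rw [add_add_add_comm]
      exact SetLike.mul_mem_graded w.2.1 w'.2.1
    have hx := S.vhSymb_mem hA hw.1 hw.2
    rw [← S.eq_vhSymb.2 h] at hx
    exact ⟨hx, hw, (hΘ _ _ _ _).2 h⟩
  · intro p q x w hxw
    have h := S.eq_vhSymb.2 ((hΘ _ _ _ _).1 hxw)
    have hw : S.d w ∈ 𝒲 (p + (q + 1)) ⊓ S.fil ((q + 1 : ℕ) : ℤ) :=
      ⟨S.d_mem _ _ w.2.1, by simpa using S.d_mem_fil w.2.2⟩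
    have hx := S.vhSymb_mem hA hw.1 hw.2
    have h' := S.vhSymb_d w.2.2
    rw [h', ← h] at hx
    refine ⟨hx, hw, (hΘ _ _ _ _).2 (S.eq_vhSymb.1 ?_)⟩
    rw [h', ← h]
  · intro p q x w hxw
    have h := (hΘ _ _ _ _).1 hxw
    refine ⟨S.mem_Zr_one_of_symb x.2.2 w.2 h, he₁ p q x w _ ?_⟩
    rw [h, sub_self]
    exact zero_mem _
  · intro p q φ φ' c hφ
    obtain ⟨ϑ, rfl⟩ := Submodule.mkQ_surjective _ c
    obtain ⟨hx1, hx2⟩ := S.tens_hMDeg_le hA p q (QPB.tmul_mem_tens φ.2 ϑ.2)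
    obtain ⟨w, hw, h⟩ := S.exists_Zr_one_symb hA hx1 hx2
    have h0 : S.symb q w - S.iota ((φ : Ω) ⊗ₜ (ϑ : C.Envelope)) ∈ S.bnd := by
      rw [h, sub_self]
      exact zero_mem _
    have h1 := S.symb_d_sub_mem_bnd h0
    rw [TensorProduct.map_tmul, ← hφ] at h1
    rw [heκ p q φ ϑ w hw h0, S.d₁_mk hw (S.d_mem_Zr_one hw)]
    -- The form `dw` represents `dφ ⊗ ϑ` only modulo `bnd`, which `heκ` permits.
    exact (heκ (p + 1) q φ' ϑ _ (S.d_mem_Zr_one hw) h1).symm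
  · intro p q φ c
    obtain ⟨ϑ, rfl⟩ := Submodule.mkQ_surjective _ c
    obtain ⟨w, hw, h⟩ := S.exists_Zr_two hA (QPB.tmul_mem_tens φ.2 ϑ.2)
    exact ⟨w, S.mem_Zr_one_of_mem_two hw, hw, heκ p q ⟨φ, φ.2.1⟩ ϑ w _ h, he₂ p q φ ϑ w hw h⟩
  · intro hG
    choose g hg using C.exists_Hinv_equiv hA hG
    choose f hf using fun p q => S.exists_connected_equiv hA hG (e₂ p q) (g q)
    exact ⟨S.hM_eq_base hA hG, g, f, hg, hf⟩
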